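/- **Definitions.** *XC-tangles.* An XC-tangle diagram is a finite directed graph with vertices of valence 1, 2 or 4 such that: each tetravalent vertex carries a sign $\pm$ and a cyclic order of its half-edges, with two adjacent ones incoming and the other two outgoing; every bivalent vertex has one incoming and one outgoing half-edge; every edge carries a rotation number in $\{-1,0,1\}$; every maximal directed path going straight at the tetravalent vertices (a strand) starts and finishes at univalent vertices; the sets $V_{out}$ and $V_{in}$ of univalent vertices where edges start, respectively end, are totally ordered. Strands are ordered by their starting points in $V_{out}$. Name the half-edges at a tetravalent vertex in-left, in-right, out-right, out-left in counterclockwise order; at a positive (negative) vertex the overpass is the path entering on the left (right). An XC-tangle is an isomorphism class of diagrams modulo the XC-Reidemeister moves, each of which replaces a subgraph by another one. Describe a strand by what it meets, in order: $o_c,u_c$ is the over-, underpass at a vertex $c$ and $[r]$ is a rotation number (zeros are omitted). Let $p$ be a positive and $m$ a negative vertex. The moves are: * $\widehat\Omega 0r$: consecutive edges $[i],[j]$ separated by a bivalent vertex $\leftrightarrow$ one edge $[i+j]$ (for $i,j,i+j\in\{-1,0,1\}$); * $\widehat\Omega 0a,b$: a vertex $c$ of either sign $\leftrightarrow$ the same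 vertex with $[1]$ on both incoming and $[-1]$ on both outgoing edges; * $\widehat\Omega 1f$: $(o_p,[-1],u_p)\leftrightarrow(u_p,[1],o_p)$; * $\widehat\Omega 2a$, $\widehat\Omega 2b$: two vertex-free strands with rotation number $0$ $\leftrightarrow$ $(o_m,o_p),(u_m,u_p)$, respectively $\leftrightarrow (o_p,o_m),(u_p,u_m)$; * $\widehat\Omega 2c$: $(\ ),([1])\leftrightarrow(o_m,o_p),(u_p,[1],u_m)$; * $\widehat\Omega 2d$: $([-1]),(\ )\leftrightarrow(o_p,[-1],o_m),(u_m,u_p)$; * $\widehat\Omega 3$: for positive vertices $a,b,c$, $(o_b,o_a),(o_c,u_a),(u_c,u_b)\leftrightarrow(o_a,o_b),(u_a,o_c),(u_b,u_c)$. The category $\mathcal T^{\mathrm{XC}}$ has objects $n\ge 0$ and only endomorphisms; $\mathrm{End}(n)$ is the set of XC-tangles with $n$ strands, $T_2\circ T_1$ glues $V_{in}(T_1)$ to $V_{out}(T_2)$ in order, $\otimes$ is ordered disjoint union, and the symmetry $P_{n,m}$ consists of $n+m$ trivial strands, the $i$-th one going to the $(i+m)$-th incoming vertex (mod $n+m$).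 *XC-algebras.* Let $\mathcal C$ be a symmetric monoidal category. An XC-algebra object in $\mathcal C$ is an algebra object $(A,\mu,\eta)$ with multiplicatively invertible $R:\mathbf 1\to A\otimes A$ and $\kappa:\mathbf 1\to A$ such that, with $\mu_k$ the iterated multiplication and $R_{ij}^{\pm1},\kappa_i^{\pm1}$ denoting insertion of the legs at the indicated positions and of $\eta$ elsewhere, $$R^{\pm1}=(\kappa\otimes\kappa)R^{\pm1}(\kappa^{-1}\otimes\kappa^{-1}),\quad \mu_3(R_{31}\kappa_2)=\mu_3(R_{13}\kappa_2^{-1}),\quad \eta\otimes\kappa^{-1}=(\mu\otimes\mu_3)(R_{15}R_{23}^{-1}\kappa_4^{-1}),$$ $$\kappa\otimes \eta=(\mu_3\otimes\mu)(R_{15}^{-1}R_{34}\kappa_2),\quad R_{12}R_{13}R_{23}=R_{23}R_{13}R_{12}.$$ $\mathsf{XC}$ is the PROP generated by $\mu,\eta,R^{\pm1},\kappa^{\pm1}$ subject to these equations; an XC-algebra object $A$ is viewed as a symmetric monoidal functor $A:\mathsf{XC}\to\mathcal C$. *Virtual category of elements.* $v\mathcal E(A)$ has objects $n\ge0$, only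 endomorphisms, $\mathrm{End}(n)=A(\mathrm{Hom}_{\mathsf{XC}}(0,n))\times\mathfrak S_n$, composition $(u,\sigma)\circ(v,\tau)=(P_{\tau^{-1},A}(u)\cdot v,\sigma\tau)$ (where $P_{\tau,A}$ is the symmetry of $A^{\otimes n}$ moving the $i$-th factor to position $\tau(i)$, and $\cdot$ is the componentwise product), identity $(\eta^{\otimes n},\mathrm{Id})$, tensor product $(u\otimes v,\sigma\oplus\xi)$ and symmetry $(\eta^{\otimes(n+m)},\,i\mapsto i+m \bmod n+m)$. Write $v\mathcal E(\mathsf{XC})$ when $A$ is the identity functor of $\mathsf{XC}$, i.e. the XC-algebra object $1$ in $\mathsf{XC}$. *The functor $Z_A$.* Let $X^{\pm}$ be a single crossing of sign $\pm$ (whose vertices are ordered from left to right) and $C^{\pm}$ a single edge with rotation number $\pm1$. $Z_A:\mathcal T^{\mathrm{XC}}\to v\mathcal E(A)$ is the symmetric monoidal functor that is the identity on objects, takes the values $$Z_A(X)=(R,(12)),\quad Z_A(X^-)=(R_{21}^{-1},(12)),\quad Z_A(C)=(\kappa^{-1},\mathrm{Id}),\quad Z_A(C^-)=(\kappa,\mathrm{Id}),$$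 and is compatible with the following operations on tangles and on elements: (i) renumbering the strands, so that the $i$-th strand becomes the $\tau(i)$-th, which on elements is $(u,\sigma)\mapsto(P_{\tau,A}(u),\sigma\tau^{-1})$; (ii) merging the last two strands by glueing the end of the last strand to the start of the one before it, which on elements applies $\mathrm{Id}\otimes\mu$ to $u$ and in $\sigma$ removes the two glued endpoints and shifts the remaining indices; (iii) inserting an edge with rotation number $0$ as last strand, which on elements is $(u,\sigma)\mapsto(u\otimes\eta,\sigma\oplus\mathrm{Id}_1)$. For $A$ the identity functor of $\mathsf{XC}$, write $Z$ for $Z_A$. **Theorem.** $\mathcal T^{\mathrm{XC}}$ and $v\mathcal E(\mathsf{XC})$ are strict symmetric monoidal categories, there is exactly one functor $Z:\mathcal T^{\mathrm{XC}}\to v\mathcal E(\mathsf{XC})$ as above, and it is an isomorphism of symmetric monoidal categories. Moreover, for any symmetric monoidal category $\mathcal C$ and any XC-algebra object $A$ in $\mathcal C$, $v\mathcal E(A)$ is a strict symmetric monoidal category, there is exactly one functor $Z_A:\mathcal T^{\mathrm{XC}}\to v\mathcal E(A)$ as above, and it factors as $$Z_A:\ \mathcal T^{\mathrm{XC}}\xrightarrow{\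 Z\ }v\mathcal E(\mathsf{XC})\longrightarrow v\mathcal E(A),$$ where the second arrow is the canonical symmetric monoidal functor $(f,\sigma)\mapsto(A(f),\sigma)$. -/

import Mathlib

open CategoryTheory MonoidalCategory

universe w v u

/-! ## Strict symmetric monoidal categories with objects `0, 1, 2, …` and only endomorphisms -/

/-- The data of a strict symmetric monoidal category whose monoid of objects is `(ℕ, +)` and in
which every arrow is an endomorphism: `Hom n` is the set of endomorphisms of `n`,
`comp f g` is `f ∘ g` (first `g`, then `f`), and `braid n m` is the symmetry
`n ⊗ m ⟶ m ⊗ n`, an endomorphism of the object `n + m = m + n`. -/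
structure EndoCat where
  Hom : ℕ → Type w
  one : ∀ n, Hom n
  comp : ∀ {n}, Hom n → Hom n → Hom n
  tensor : ∀ {n m}, Hom n → Hom m → Hom (n + m)
  braid : ∀ n m, Hom (n + m)

namespace EndoCat

/-- Transport of an endomorphism along an equality of objects. -/
def tr (M : EndoCat.{w}) {n m : ℕ} (h : n = m) (f : M.Hom n) : M.Hom m := h ▸ f

/-- The axioms of a strict symmetric monoidal category. -/
structure IsStrictSymmetricMonoidal (M : EndoCat.{w}) : Prop where
  one_comp : ∀ {n} (f : M.Hom n), M.comp (M.one n) f = f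
  comp_one : ∀ {n} (f : M.Hom n), M.comp f (M.one n) = f
  comp_assoc : ∀ {n} (f g h : M.Hom n), M.comp (M.comp f g) h = M.comp f (M.comp g h)
  tensor_one : ∀ n m, M.tensor (M.one n) (M.one m) = M.one (n + m)
  tensor_comp : ∀ {n m} (f f' : M.Hom n) (g g' : M.Hom m),
    M.tensor (M.comp f f') (M.comp g g') = M.comp (M.tensor f g) (M.tensor f' g')
  tensor_assoc : ∀ {n m k} (f : M.Hom n) (g : M.Hom m) (h : M.Hom k),
    M.tr (Nat.add_assoc n m k) (M.tensor (M.tensor f g) h) = M.tensor f (M.tensor g h)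
  unit_tensor : ∀ {n} (f : M.Hom n), M.tr (Nat.zero_add n) (M.tensor (M.one 0) f) = f
  tensor_unit : ∀ {n} (f : M.Hom n), M.tr (Nat.add_zero n) (M.tensor f (M.one 0)) = f
  braid_natural : ∀ {n m} (f : M.Hom n) (g : M.Hom m),
    M.comp (M.braid n m) (M.tensor f g)
      = M.comp (M.tr (Nat.add_comm m n) (M.tensor g f)) (M.braid n m)
  braid_braid : ∀ n m,
    M.comp (M.tr (Nat.add_comm m n) (M.braid m n)) (M.braid n m) = M.one (n + m)
  hexagon : ∀ n m k,
    M.tr (Nat.add_assoc n m k).symm (M.braid n (m + k))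
      = M.comp (M.tr (by omega) (M.tensor (M.one m) (M.braid n k)))
          (M.tensor (M.braid n m) (M.one k))

/-- Symmetric monoidal functors that are the identity on objects. -/
structure Functor (M : EndoCat.{w}) (N : EndoCat.{v}) where
  map : ∀ {n}, M.Hom n → N.Hom n
  map_one : ∀ n, map (M.one n) = N.one n
  map_comp : ∀ {n} (f g : M.Hom n), map (M.comp f g) = N.comp (map f) (map g)
  map_tensor : ∀ {n m} (f : M.Hom n) (g : M.Hom m),
    map (M.tensor f g) = N.tensor (map f) (map g)
  map_braid : ∀ n m, map (M.braid n m) = N.braid n m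

/-- The functor has a two-sided inverse which is again a symmetric monoidal functor. -/
def Functor.IsIso {M : EndoCat.{w}} {N : EndoCat.{v}} (F : Functor M N) : Prop :=
  ∃ G : Functor N M, (∀ {n} (f : M.Hom n), G.map (F.map f) = f) ∧
    ∀ {n} (g : N.Hom n), F.map (G.map g) = g

end EndoCat

/-- The permutation of `n + m` points that maps `i` to `i + m` modulo `n + m`. -/
def blockSwap (n m : ℕ) : Equiv.Perm (Fin (n + m)) :=
  finAddFlip.trans (finCongr (Nat.add_comm m n))

/-- The block product of permutations. -/
def blockSum {n m : ℕ} (σ : Equiv.Perm (Fin n)) (τ : Equiv.Perm (Fin m)) :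
    Equiv.Perm (Fin (n + m)) :=
  (finSumFinEquiv.symm.trans (Equiv.sumCongr σ τ)).trans finSumFinEquiv

/-! ## XC-tangle diagrams -/

/-- A finite directed graph with vertices of valence 1, 2 or 4, decorated as in an XC-tangle
diagram; `O` is the set of univalent vertices with an outgoing half-edge, `I` the set of univalent
vertices with an incoming half-edge, `B` the set of bivalent vertices (one half-edge incoming, one
outgoing), `X` the set of tetravalent vertices.

At a tetravalent vertex the cyclic order of the four half-edges, two adjacent ones incoming and the
other two outgoing, is recorded by calling them
`in-left, in-right, out-right, out-left` in this (counterclockwise) cyclic order; `false` stands for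
left and `true` for right. So a path that goes straight enters at the left and leaves at the right,
or enters at the right and leaves at the left.

`src` sends an edge to the outgoing half-edge where it starts and `tgt` sends an edge to the
incoming half-edge where it ends; both are bijections. -/
structure XCGraph (O I : Type) : Type 1 where
  E : Type
  B : Type
  X : Type
  finite_edges : Finite E
  /-- the sign of a tetravalent vertex, `true` for `+` -/
  pos : X → Bool
  /-- the rotation number of an edge, one of `-1, 0, 1` -/
  rot : E → SignType
  src : E ≃ O ⊕ B ⊕ X × Bool
  tgt : E ≃ I ⊕ B ⊕ X × Bool

namespace XCGraph

variable {O I O' I' O'' I'' : Type}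

/-- The edge `f` follows the edge `e` on a path going straight at the tetravalent vertices. -/
def Next (D : XCGraph O I) (e f : D.E) : Prop :=
  (∃ b, D.tgt e = Sum.inr (Sum.inl b) ∧ D.src f = Sum.inr (Sum.inl b)) ∨
  (∃ x s, D.tgt e = Sum.inr (Sum.inr (x, s)) ∧ D.src f = Sum.inr (Sum.inr (x, !s)))

/-- Every maximal directed path going straight starts and finishes at univalent vertices; as the
graph is finite, this says that no such path closes up. -/
def IsOpen (D : XCGraph O I) : Prop := ∀ e, ¬ Relation.TransGen D.Next e e

/-- The strand that starts at the univalent vertex `o` finishes at the univalent vertex `i`. -/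
def StrandEndsAt (D : XCGraph O I) (o : O) (i : I) : Prop :=
  ∃ e f, D.src e = Sum.inl o ∧ Relation.ReflTransGen D.Next e f ∧ D.tgt f = Sum.inl i

/-- Isomorphisms of decorated graphs that fix the univalent vertices. -/
structure Iso (D D' : XCGraph O I) where
  e : D.E ≃ D'.E
  b : D.B ≃ D'.B
  x : D.X ≃ D'.X
  pos_eq : ∀ y, D'.pos (x y) = D.pos y
  rot_eq : ∀ y, D'.rot (e y) = D.rot y
  src_eq : ∀ y, D'.src (e y) = Sum.map id (Sum.map b (Prod.map x id)) (D.src y)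
  tgt_eq : ∀ y, D'.tgt (e y) = Sum.map id (Sum.map b (Prod.map x id)) (D.tgt y)

/-- Renaming the univalent vertices. -/
def relabel (D : XCGraph O I) (o : O ≃ O') (i : I ≃ I') : XCGraph O' I' where
  E := D.E
  B := D.B
  X := D.X
  finite_edges := D.finite_edges
  pos := D.pos
  rot := D.rot
  src := D.src.trans (Equiv.sumCongr o (Equiv.refl _))
  tgt := D.tgt.trans (Equiv.sumCongr i (Equiv.refl _))

/-- Bookkeeping for the half-edges of a disjoint union. -/
def unionPorts (U B X U' B' X' : Type) :
    (U ⊕ B ⊕ X × Bool) ⊕ (U' ⊕ B' ⊕ X' × Bool) ≃ (U ⊕ U') ⊕ (B ⊕ B') ⊕ (X ⊕ X') × Bool where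
  toFun
    | .inl (.inl a) => .inl (.inl a)
    | .inl (.inr (.inl b)) => .inr (.inl (.inl b))
    | .inl (.inr (.inr (x, s))) => .inr (.inr (.inl x, s))
    | .inr (.inl a) => .inl (.inr a)
    | .inr (.inr (.inl b)) => .inr (.inl (.inr b))
    | .inr (.inr (.inr (x, s))) => .inr (.inr (.inr x, s))
  invFun
    | .inl (.inl a) => .inl (.inl a)
    | .inr (.inl (.inl b)) => .inl (.inr (.inl b))
    | .inr (.inr (.inl x, s)) => .inl (.inr (.inr (x, s)))
    | .inl (.inr a) => .inr (.inl a)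
    | .inr (.inl (.inr b)) => .inr (.inr (.inl b))
    | .inr (.inr (.inr x, s)) => .inr (.inr (.inr (x, s)))
  left_inv := by rintro ((a | b | ⟨x, s⟩) | (a | b | ⟨x, s⟩)) <;> rfl
  right_inv := by rintro ((a | a) | (b | b) | ⟨x | x, s⟩) <;> rfl

/-- Disjoint union. -/
def union (D : XCGraph O I) (D' : XCGraph O' I') : XCGraph (O ⊕ O') (I ⊕ I') where
  E := D.E ⊕ D'.E
  B := D.B ⊕ D'.B
  X := D.X ⊕ D'.X
  finite_edges := by
    have := D.finite_edges
    have := D'.finite_edges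
    infer_instance
  pos := Sum.elim D.pos D'.pos
  rot := Sum.elim D.rot D'.rot
  src := (Equiv.sumCongr D.src D'.src).trans (unionPorts _ _ _ _ _ _)
  tgt := (Equiv.sumCongr D.tgt D'.tgt).trans (unionPorts _ _ _ _ _ _)

/-- Bookkeeping for the half-edges when univalent vertices become bivalent. -/
def gluePorts (U K B Y : Type) : (U ⊕ K) ⊕ B ⊕ Y ≃ U ⊕ (B ⊕ K) ⊕ Y where
  toFun
    | .inl (.inl a) => .inl a
    | .inl (.inr k) => .inr (.inl (.inr k))
    | .inr (.inl b) => .inr (.inl (.inl b))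
    | .inr (.inr y) => .inr (.inr y)
  invFun
    | .inl a => .inl (.inl a)
    | .inr (.inl (.inr k)) => .inl (.inr k)
    | .inr (.inl (.inl b)) => .inr (.inl b)
    | .inr (.inr y) => .inr (.inr y)
  left_inv := by rintro ((a | k) | b | y) <;> rfl
  right_inv := by rintro (a | (b | k) | y) <;> rfl

/-- Glueing the incoming univalent vertices in `K` to the outgoing univalent vertices in `K`: each
such pair becomes one bivalent vertex. -/
def glue {K : Type} (D : XCGraph (O ⊕ K) (I ⊕ K)) : XCGraph O I where
  E := D.E
  B := D.B ⊕ K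
  X := D.X
  finite_edges := D.finite_edges
  pos := D.pos
  rot := D.rot
  src := D.src.trans (gluePorts _ _ _ _)
  tgt := D.tgt.trans (gluePorts _ _ _ _)

/-- Bookkeeping for the new edge and the new bivalent vertex of a subdivision. -/
def newPort (U B Y : Type) : Option (U ⊕ B ⊕ Y) ≃ U ⊕ Option B ⊕ Y where
  toFun
    | some (.inl a) => .inl a
    | some (.inr (.inl b)) => .inr (.inl (some b))
    | some (.inr (.inr y)) => .inr (.inr y)
    | none => .inr (.inl none)
  invFun
    | .inl a => some (.inl a)
    | .inr (.inl (some b)) => some (.inr (.inl b))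
    | .inr (.inr y) => some (.inr (.inr y))
    | .inr (.inl none) => none
  left_inv := by rintro (_ | a | b | y) <;> rfl
  right_inv := by rintro (a | (_ | b) | y) <;> rfl

open Classical in
/-- The edge `e` is replaced by two edges with rotation numbers `i` (the first one, still called
`e`) and `j` (the second one), separated by a new bivalent vertex. -/
noncomputable def subdivide (D : XCGraph O I) (e : D.E) (i j : SignType) : XCGraph O I where
  E := Option D.E
  B := Option D.B
  X := D.X
  finite_edges := by
    have := D.finite_edges
    infer_instance
  pos := D.pos
  rot
    | none => j
    | some f => if f = e then i else D.rot f
  src := (Equiv.optionCongr D.src).trans (newPort _ _ _)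
  tgt := ((Equiv.swap none (some e)).trans (Equiv.optionCongr D.tgt)).trans (newPort _ _ _)

open Classical in
theorem subdivide_tgt_none (D : XCGraph O I) (e : D.E) (i j : SignType) :
    (D.subdivide e i j).tgt none = newPort _ _ _ (some (D.tgt e)) :=
  congrArg (fun y => newPort _ _ _ (Option.map D.tgt y)) (Equiv.swap_apply_left (none : Option D.E) (some e))

open Classical in
theorem subdivide_tgt_self (D : XCGraph O I) (e : D.E) (i j : SignType) :
    (D.subdivide e i j).tgt (some e) = Sum.inr (Sum.inl none) :=
  congrArg (fun y => newPort _ _ _ (Option.map D.tgt y)) (Equiv.swap_apply_right (none : Option D.E) (some e))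

open Classical in
theorem subdivide_tgt_ne (D : XCGraph O I) {e f : D.E} (h : f ≠ e) (i j : SignType) :
    (D.subdivide e i j).tgt (some f) = newPort _ _ _ (some (D.tgt f)) :=
  congrArg (fun y => newPort _ _ _ (Option.map D.tgt y))
    (Equiv.swap_apply_of_ne_of_ne (by simp) (by simpa using h))

theorem subdivide_rot_self (D : XCGraph O I) (e : D.E) (i j : SignType) :
    (D.subdivide e i j).rot (some e) = i := by
  simp [subdivide]

theorem subdivide_rot_ne (D : XCGraph O I) {e f : D.E} (h : f ≠ e) (i j : SignType) :
    (D.subdivide e i j).rot (some f) = D.rot f := by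
  simp [subdivide, h]

/-- `l` with `k` strands is placed in the surrounding graph `c`: the univalent vertices of the
disjoint union that are matched with elements of `K` are glued, the others remain. -/
def plug {k : ℕ} {Oc Ic K : Type} (l : XCGraph (Fin k) (Fin k)) (c : XCGraph Oc Ic)
    (o : Fin k ⊕ Oc ≃ O ⊕ K) (i : Fin k ⊕ Ic ≃ I ⊕ K) : XCGraph O I :=
  ((l.union c).relabel o i).glue

/-! ### Small graphs, given by their edges -/

/-- The half-edges, all incoming or all outgoing, of a graph with `k` strands, `c` tetravalent
vertices and no bivalent vertices. -/
abbrev Port (k c : ℕ) : Type := Fin k ⊕ Fin 0 ⊕ Fin c × Bool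

/-- The half-edge at the `i`-th univalent vertex. -/
abbrev vtx {k c : ℕ} (i : Fin k) : Port k c := Sum.inl i

/-- The left half-edge at the tetravalent vertex `x`. -/
abbrev hl {k c : ℕ} (x : Fin c) : Port k c := Sum.inr (Sum.inr (x, false))

/-- The right half-edge at the tetravalent vertex `x`. -/
abbrev hr {k c : ℕ} (x : Fin c) : Port k c := Sum.inr (Sum.inr (x, true))

/-- The graph with the given signs of tetravalent vertices and the given edges, each of them written
as (outgoing half-edge where it starts, rotation number, incoming half-edge where it ends). -/
noncomputable def ofEdges {k c e : ℕ} (pos : Fin c → Bool)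
    (edge : Fin e → Port k c × SignType × Port k c)
    (hs : Function.Bijective fun i => (edge i).1)
    (ht : Function.Bijective fun i => (edge i).2.2) : XCGraph (Fin k) (Fin k) where
  E := Fin e
  B := Fin 0
  X := Fin c
  finite_edges := inferInstance
  pos := pos
  rot i := (edge i).2.1
  src := Equiv.ofBijective _ hs
  tgt := Equiv.ofBijective _ ht

/-- `n` strands without vertices in their interior, with the given rotation numbers; the `i`-th
strand goes from the `i`-th outgoing vertex to the `σ i`-th incoming vertex. -/
def strands {n : ℕ} (σ : Equiv.Perm (Fin n)) (r : Fin n → SignType) : XCGraph (Fin n) (Fin n) where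
  E := Fin n
  B := Fin 0
  X := Fin 0
  finite_edges := inferInstance
  pos := fun x => x.elim0
  rot := r
  src := (Equiv.sumEmpty _ _).symm
  tgt := σ.trans (Equiv.sumEmpty _ _).symm

/-- One crossing of the given sign, with rotation numbers `a` on the two incoming edges and `b` on
the two outgoing edges; both strands go straight, the left incoming one towards the right. -/
noncomputable def crossing (s : Bool) (a b : SignType) : XCGraph (Fin 2) (Fin 2) :=
  ofEdges ![s]
    ![(vtx 0, a, hl 0), (vtx 1, a, hr 0), (hl 0, b, vtx 0), (hr 0, b, vtx 1)]
    (by decide +revert) (by decide +revert)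

/-- A positive kink: the overpass is traversed first, then an edge with rotation number `-1`. -/
noncomputable def kinkOverFirst : XCGraph (Fin 1) (Fin 1) :=
  ofEdges ![true]
    ![(vtx 0, 0, hl 0), (hr 0, -1, hr 0), (hl 0, 0, vtx 0)]
    (by decide) (by decide)

/-- A positive kink: the underpass is traversed first, then an edge with rotation number `1`. -/
noncomputable def kinkUnderFirst : XCGraph (Fin 1) (Fin 1) :=
  ofEdges ![true]
    ![(vtx 0, 0, hr 0), (hl 0, 1, hl 0), (hr 0, 0, vtx 0)]
    (by decide) (by decide)

/-- Two parallel strands, a negative crossing (vertex 1) followed by a positive one (vertex 0). -/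
noncomputable def parallelNegPos : XCGraph (Fin 2) (Fin 2) :=
  ofEdges ![true, false]
    ![(vtx 0, 0, hr 1), (hl 1, 0, hl 0), (hr 0, 0, vtx 0),
      (vtx 1, 0, hl 1), (hr 1, 0, hr 0), (hl 0, 0, vtx 1)]
    (by decide) (by decide)

/-- Two parallel strands, a positive crossing (vertex 0) followed by a negative one (vertex 1). -/
noncomputable def parallelPosNeg : XCGraph (Fin 2) (Fin 2) :=
  ofEdges ![true, false]
    ![(vtx 0, 0, hl 0), (hr 0, 0, hr 1), (hl 1, 0, vtx 0),
      (vtx 1, 0, hr 0), (hl 0, 0, hl 1), (hr 1, 0, vtx 1)]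
    (by decide) (by decide)

/-- Two antiparallel strands: the over strand meets the negative crossing (vertex 1) first, the
under strand meets the positive crossing (vertex 0) first and makes a positive rotation. -/
noncomputable def antiparallelC : XCGraph (Fin 2) (Fin 2) :=
  ofEdges ![true, false]
    ![(vtx 0, 0, hr 1), (hl 1, 0, hl 0), (hr 0, 0, vtx 0),
      (vtx 1, 0, hr 0), (hl 0, 1, hl 1), (hr 1, 0, vtx 1)]
    (by decide) (by decide)

/-- Two antiparallel strands: the over strand meets the positive crossing (vertex 0) first and makes
a negative rotation, the under strand meets the negative crossing (vertex 1) first. -/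
noncomputable def antiparallelD : XCGraph (Fin 2) (Fin 2) :=
  ofEdges ![true, false]
    ![(vtx 0, 0, hl 0), (hr 0, -1, hr 1), (hl 1, 0, vtx 0),
      (vtx 1, 0, hl 1), (hr 1, 0, hr 0), (hl 0, 0, vtx 1)]
    (by decide) (by decide)

/-- Three positive crossings: vertex 0 between strands 1 and 2, vertex 1 between strands 1 and 3,
vertex 2 between strands 2 and 3, traversed in the order 2, 1, 0. -/
noncomputable def tripleLeft : XCGraph (Fin 3) (Fin 3) :=
  ofEdges ![true, true, true]
    ![(vtx 0, 0, hl 1), (hr 1, 0, hl 0), (hr 0, 0, vtx 0),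
      (vtx 1, 0, hl 2), (hr 2, 0, hr 0), (hl 0, 0, vtx 1),
      (vtx 2, 0, hr 2), (hl 2, 0, hr 1), (hl 1, 0, vtx 2)]
    (by decide) (by decide)

/-- The same three positive crossings, traversed in the order 0, 1, 2. -/
noncomputable def tripleRight : XCGraph (Fin 3) (Fin 3) :=
  ofEdges ![true, true, true]
    ![(vtx 0, 0, hl 0), (hr 0, 0, hl 1), (hr 1, 0, vtx 0),
      (vtx 1, 0, hr 0), (hl 0, 0, hl 2), (hr 2, 0, vtx 1),
      (vtx 2, 0, hr 1), (hl 1, 0, hr 2), (hl 2, 0, vtx 2)]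
    (by decide) (by decide)

/-- The XC-Reidemeister moves between small subgraphs: `Ω0a`, `Ω0b`, `Ω1f`, `Ω2a`, `Ω2b`, `Ω2c`,
`Ω2d`, `Ω3`. -/
inductive Move : ∀ {k : ℕ}, XCGraph (Fin k) (Fin k) → XCGraph (Fin k) (Fin k) → Prop
  | zeroA : Move (crossing true 0 0) (crossing true 1 (-1))
  | zeroB : Move (crossing false 0 0) (crossing false 1 (-1))
  | oneF : Move kinkOverFirst kinkUnderFirst
  | twoA : Move (strands 1 ![0, 0]) parallelNegPos
  | twoB : Move (strands 1 ![0, 0]) parallelPosNeg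
  | twoC : Move (strands 1 ![0, 1]) antiparallelC
  | twoD : Move (strands 1 ![-1, 0]) antiparallelD
  | three : Move tripleLeft tripleRight

/-- Two graphs are related if they are isomorphic, if the second one is obtained from the first one
by replacing an edge `[i + j]` by consecutive edges `[i]`, `[j]` (the move `Ω0r`), or if they are
identical except in a subgraph, where they differ by one of the remaining moves. -/
inductive Step : XCGraph O I → XCGraph O I → Prop
  | iso {D D' : XCGraph O I} : D.Iso D' → Step D D'
  | zeroR {D D' : XCGraph O I} (e : D.E) (i j : SignType)
      (h : (D.rot e : ℤ) = (i : ℤ) + (j : ℤ)) : (D.subdivide e i j).Iso D' → Step D D'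
  | move {k : ℕ} {l r : XCGraph (Fin k) (Fin k)} (m : Move l r) {Oc Ic K : Type}
      (c : XCGraph Oc Ic) (o : Fin k ⊕ Oc ≃ O ⊕ K) (i : Fin k ⊕ Ic ≃ I ⊕ K)
      {D D' : XCGraph O I} : (plug l c o i).Iso D → (plug r c o i).Iso D' → Step D D'

/-! ### The operations respect the moves -/

namespace Iso

/-- Identity isomorphism. -/
def refl (D : XCGraph O I) : D.Iso D where
  e := Equiv.refl _
  b := Equiv.refl _
  x := Equiv.refl _
  pos_eq _ := rfl
  rot_eq _ := rfl
  src_eq y := by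
    show D.src y = _
    rcases D.src y with a | b | ⟨x, s⟩ <;> rfl
  tgt_eq y := by
    show D.tgt y = _
    rcases D.tgt y with a | b | ⟨x, s⟩ <;> rfl

/-- Composition of isomorphisms. -/
def trans {D D' D'' : XCGraph O I} (f : D.Iso D') (g : D'.Iso D'') : D.Iso D'' where
  e := f.e.trans g.e
  b := f.b.trans g.b
  x := f.x.trans g.x
  pos_eq y := (g.pos_eq _).trans (f.pos_eq y)
  rot_eq y := (g.rot_eq _).trans (f.rot_eq y)
  src_eq y := by
    show D''.src (g.e (f.e y)) = _
    rw [g.src_eq, f.src_eq]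
    rcases D.src y with a | b | ⟨x, s⟩ <;> rfl
  tgt_eq y := by
    show D''.tgt (g.e (f.e y)) = _
    rw [g.tgt_eq, f.tgt_eq]
    rcases D.tgt y with a | b | ⟨x, s⟩ <;> rfl

/-- Isomorphic graphs stay isomorphic after renaming. -/
def relabel {D D' : XCGraph O I} (f : D.Iso D') (o : O ≃ O') (i : I ≃ I') :
    (D.relabel o i).Iso (D'.relabel o i) where
  e := f.e
  b := f.b
  x := f.x
  pos_eq := f.pos_eq
  rot_eq := f.rot_eq
  src_eq := fun (y : D.E) => by
    show Sum.map o id (D'.src (f.e y)) = Sum.map _ _ (Sum.map o id (D.src y))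
    rw [f.src_eq]
    rcases D.src y with a | b | ⟨x, s⟩ <;> rfl
  tgt_eq := fun (y : D.E) => by
    show Sum.map i id (D'.tgt (f.e y)) = Sum.map _ _ (Sum.map i id (D.tgt y))
    rw [f.tgt_eq]
    rcases D.tgt y with a | b | ⟨x, s⟩ <;> rfl

/-- Isomorphic graphs stay isomorphic after glueing. -/
def glue {K : Type} {D D' : XCGraph (O ⊕ K) (I ⊕ K)} (f : D.Iso D') : D.glue.Iso D'.glue where
  e := f.e
  b := Equiv.sumCongr f.b (Equiv.refl _)
  x := f.x
  pos_eq := f.pos_eq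
  rot_eq := f.rot_eq
  src_eq := fun (y : D.E) => by
    show gluePorts _ _ _ _ (D'.src (f.e y)) = Sum.map _ _ (gluePorts _ _ _ _ (D.src y))
    rw [f.src_eq]
    rcases D.src y with (a | k) | b | ⟨x, s⟩ <;> rfl
  tgt_eq := fun (y : D.E) => by
    show gluePorts _ _ _ _ (D'.tgt (f.e y)) = Sum.map _ _ (gluePorts _ _ _ _ (D.tgt y))
    rw [f.tgt_eq]
    rcases D.tgt y with (a | k) | b | ⟨x, s⟩ <;> rfl

/-- Disjoint unions of isomorphic graphs are isomorphic. -/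
def union {D D' : XCGraph O I} (f : D.Iso D') {T T' : XCGraph O' I'} (g : T.Iso T') :
    (D.union T).Iso (D'.union T') where
  e := Equiv.sumCongr f.e g.e
  b := Equiv.sumCongr f.b g.b
  x := Equiv.sumCongr f.x g.x
  pos_eq := by rintro (y | y); exacts [f.pos_eq y, g.pos_eq y]
  rot_eq := by rintro (y | y); exacts [f.rot_eq y, g.rot_eq y]
  src_eq := by
    rintro (y | y)
    · show unionPorts _ _ _ _ _ _ (.inl (D'.src (f.e y)))
        = Sum.map _ _ (unionPorts _ _ _ _ _ _ (.inl (D.src y)))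
      rw [f.src_eq]
      rcases D.src y with a | b | ⟨x, s⟩ <;> rfl
    · show unionPorts _ _ _ _ _ _ (.inr (T'.src (g.e y)))
        = Sum.map _ _ (unionPorts _ _ _ _ _ _ (.inr (T.src y)))
      rw [g.src_eq]
      rcases T.src y with a | b | ⟨x, s⟩ <;> rfl
  tgt_eq := by
    rintro (y | y)
    · show unionPorts _ _ _ _ _ _ (.inl (D'.tgt (f.e y)))
        = Sum.map _ _ (unionPorts _ _ _ _ _ _ (.inl (D.tgt y)))
      rw [f.tgt_eq]
      rcases D.tgt y with a | b | ⟨x, s⟩ <;> rfl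
    · show unionPorts _ _ _ _ _ _ (.inr (T'.tgt (g.e y)))
        = Sum.map _ _ (unionPorts _ _ _ _ _ _ (.inr (T.tgt y)))
      rw [g.tgt_eq]
      rcases T.tgt y with a | b | ⟨x, s⟩ <;> rfl

end Iso

/-- Disjoint union is commutative up to renaming. -/
def unionComm (D : XCGraph O I) (T : XCGraph O' I') :
    ((D.union T).relabel (Equiv.sumComm _ _) (Equiv.sumComm _ _)).Iso (T.union D) where
  e := Equiv.sumComm _ _
  b := Equiv.sumComm _ _
  x := Equiv.sumComm _ _
  pos_eq := by rintro (y | y) <;> rfl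
  rot_eq := by rintro (y | y) <;> rfl
  src_eq := by
    rintro (y | y)
    · show unionPorts _ _ _ _ _ _ (.inr (D.src y))
        = Sum.map _ _ (Sum.map _ _ (unionPorts _ _ _ _ _ _ (.inl (D.src y))))
      rcases D.src y with a | b | ⟨x, s⟩ <;> rfl
    · show unionPorts _ _ _ _ _ _ (.inl (T.src y))
        = Sum.map _ _ (Sum.map _ _ (unionPorts _ _ _ _ _ _ (.inr (T.src y))))
      rcases T.src y with a | b | ⟨x, s⟩ <;> rfl
  tgt_eq := by
    rintro (y | y)
    · show unionPorts _ _ _ _ _ _ (.inr (D.tgt y))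
        = Sum.map _ _ (Sum.map _ _ (unionPorts _ _ _ _ _ _ (.inl (D.tgt y))))
      rcases D.tgt y with a | b | ⟨x, s⟩ <;> rfl
    · show unionPorts _ _ _ _ _ _ (.inl (T.tgt y))
        = Sum.map _ _ (Sum.map _ _ (unionPorts _ _ _ _ _ _ (.inr (T.tgt y))))
      rcases T.tgt y with a | b | ⟨x, s⟩ <;> rfl

/-- Renaming after plugging is plugging. -/
def plugRelabel {k : ℕ} {Oc Ic K : Type} (l : XCGraph (Fin k) (Fin k)) (c : XCGraph Oc Ic)
    (o : Fin k ⊕ Oc ≃ O ⊕ K) (i : Fin k ⊕ Ic ≃ I ⊕ K) (o' : O ≃ O') (i' : I ≃ I') :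
    (plug l c (o.trans (Equiv.sumCongr o' (Equiv.refl _)))
      (i.trans (Equiv.sumCongr i' (Equiv.refl _)))).Iso ((plug l c o i).relabel o' i') where
  e := Equiv.refl _
  b := Equiv.refl _
  x := Equiv.refl _
  pos_eq _ := rfl
  rot_eq _ := rfl
  src_eq y := by
    show Sum.map o' id (gluePorts _ _ _ _ (Sum.map o id ((l.union c).src y)))
      = Sum.map _ _ (gluePorts _ _ _ _ (Sum.map (Sum.map o' id ∘ o) id ((l.union c).src y)))
    rcases (l.union c).src y with a | b | ⟨x, s⟩
    · simp only [Sum.map_inl, Function.comp]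
      rcases o a with a | a <;> rfl
    all_goals rfl
  tgt_eq y := by
    show Sum.map i' id (gluePorts _ _ _ _ (Sum.map i id ((l.union c).tgt y)))
      = Sum.map _ _ (gluePorts _ _ _ _ (Sum.map (Sum.map i' id ∘ i) id ((l.union c).tgt y)))
    rcases (l.union c).tgt y with a | b | ⟨x, s⟩
    · simp only [Sum.map_inl, Function.comp]
      rcases i a with a | a <;> rfl
    all_goals rfl

/-- Glueing after plugging is plugging. -/
def plugGlue {k : ℕ} {Oc Ic K K' : Type} (l : XCGraph (Fin k) (Fin k)) (c : XCGraph Oc Ic)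
    (o : Fin k ⊕ Oc ≃ (O ⊕ K') ⊕ K) (i : Fin k ⊕ Ic ≃ (I ⊕ K') ⊕ K) :
    (plug l c (o.trans (Equiv.sumAssoc _ _ _)) (i.trans (Equiv.sumAssoc _ _ _))).Iso
      (plug l c o i).glue where
  e := Equiv.refl _
  b := (Equiv.sumCongr (Equiv.refl _) (Equiv.sumComm _ _)).trans (Equiv.sumAssoc _ _ _).symm
  x := Equiv.refl _
  pos_eq _ := rfl
  rot_eq _ := rfl
  src_eq y := by
    show gluePorts _ _ _ _ (gluePorts _ _ _ _ (Sum.map o id ((l.union c).src y)))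
      = Sum.map _ _ (gluePorts _ _ _ _ (Sum.map (Equiv.sumAssoc _ _ _ ∘ o) id
          ((l.union c).src y)))
    rcases (l.union c).src y with a | b | ⟨x, s⟩
    · simp only [Sum.map_inl, Function.comp]
      rcases o a with (a | a) | a <;> rfl
    all_goals rfl
  tgt_eq y := by
    show gluePorts _ _ _ _ (gluePorts _ _ _ _ (Sum.map i id ((l.union c).tgt y)))
      = Sum.map _ _ (gluePorts _ _ _ _ (Sum.map (Equiv.sumAssoc _ _ _ ∘ i) id
          ((l.union c).tgt y)))
    rcases (l.union c).tgt y with a | b | ⟨x, s⟩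
    · simp only [Sum.map_inl, Function.comp]
      rcases i a with (a | a) | a <;> rfl
    all_goals rfl

/-- Bookkeeping for univalent vertices. -/
def plugUnionEquiv {k : ℕ} {A U U' K : Type} (o : Fin k ⊕ A ≃ U ⊕ K) :
    Fin k ⊕ (A ⊕ U') ≃ (U ⊕ U') ⊕ K :=
  (Equiv.sumAssoc _ _ _).symm.trans ((Equiv.sumCongr o (Equiv.refl _)).trans
    ((Equiv.sumAssoc _ _ _).trans ((Equiv.sumCongr (Equiv.refl _) (Equiv.sumComm _ _)).trans
      (Equiv.sumAssoc _ _ _).symm)))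

/-- Disjoint union after plugging is plugging. -/
def plugUnion {k : ℕ} {Oc Ic K : Type} (l : XCGraph (Fin k) (Fin k)) (c : XCGraph Oc Ic)
    (o : Fin k ⊕ Oc ≃ O ⊕ K) (i : Fin k ⊕ Ic ≃ I ⊕ K) (T : XCGraph O' I') :
    (plug l (c.union T) (plugUnionEquiv o) (plugUnionEquiv i)).Iso ((plug l c o i).union T) where
  e := (Equiv.sumAssoc _ _ _).symm
  b := (((Equiv.sumCongr (Equiv.sumAssoc _ _ _).symm (Equiv.refl _)).trans
    (Equiv.sumAssoc _ _ _)).trans (Equiv.sumCongr (Equiv.refl _) (Equiv.sumComm _ _))).trans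
      (Equiv.sumAssoc _ _ _).symm
  x := (Equiv.sumAssoc _ _ _).symm
  pos_eq := by rintro (y | y | y) <;> rfl
  rot_eq := by rintro (y | y | y) <;> rfl
  src_eq := by
    rintro (y | y | y)
    · show unionPorts _ _ _ _ _ _ (.inl (gluePorts _ _ _ _ (Sum.map o id
          (unionPorts _ _ _ _ _ _ (.inl (l.src y)))))) = Sum.map _ _ (gluePorts _ _ _ _
          (Sum.map (plugUnionEquiv o) id (unionPorts _ _ _ _ _ _ (.inl (l.src y)))))
      rcases l.src y with a | b | ⟨x, s⟩
      · simp only [unionPorts, Equiv.coe_fn_mk, Sum.map_inl, plugUnionEquiv, Equiv.trans_apply,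
          Equiv.sumAssoc_symm_apply_inl, Equiv.sumCongr_apply]
        rcases o (.inl a) with a | a <;> rfl
      all_goals rfl
    · show unionPorts _ _ _ _ _ _ (.inl (gluePorts _ _ _ _ (Sum.map o id
          (unionPorts _ _ _ _ _ _ (.inr (c.src y)))))) = Sum.map _ _ (gluePorts _ _ _ _
          (Sum.map (plugUnionEquiv o) id (unionPorts _ _ _ _ _ _ (.inr
            (unionPorts _ _ _ _ _ _ (.inl (c.src y)))))))
      rcases c.src y with a | b | ⟨x, s⟩
      · simp only [unionPorts, Equiv.coe_fn_mk, Sum.map_inl, plugUnionEquiv, Equiv.trans_apply,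
          Equiv.sumAssoc_symm_apply_inr_inl, Equiv.sumCongr_apply]
        rcases o (.inr a) with a | a <;> rfl
      all_goals rfl
    · show unionPorts _ _ _ _ _ _ (.inr (T.src y)) = Sum.map _ _ (gluePorts _ _ _ _
          (Sum.map (plugUnionEquiv o) id (unionPorts _ _ _ _ _ _ (.inr
            (unionPorts _ _ _ _ _ _ (.inr (T.src y)))))))
      rcases T.src y with a | b | ⟨x, s⟩ <;> rfl
  tgt_eq := by
    rintro (y | y | y)
    · show unionPorts _ _ _ _ _ _ (.inl (gluePorts _ _ _ _ (Sum.map i id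
          (unionPorts _ _ _ _ _ _ (.inl (l.tgt y)))))) = Sum.map _ _ (gluePorts _ _ _ _
          (Sum.map (plugUnionEquiv i) id (unionPorts _ _ _ _ _ _ (.inl (l.tgt y)))))
      rcases l.tgt y with a | b | ⟨x, s⟩
      · simp only [unionPorts, Equiv.coe_fn_mk, Sum.map_inl, plugUnionEquiv, Equiv.trans_apply,
          Equiv.sumAssoc_symm_apply_inl, Equiv.sumCongr_apply]
        rcases i (.inl a) with a | a <;> rfl
      all_goals rfl
    · show unionPorts _ _ _ _ _ _ (.inl (gluePorts _ _ _ _ (Sum.map i id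
          (unionPorts _ _ _ _ _ _ (.inr (c.tgt y)))))) = Sum.map _ _ (gluePorts _ _ _ _
          (Sum.map (plugUnionEquiv i) id (unionPorts _ _ _ _ _ _ (.inr
            (unionPorts _ _ _ _ _ _ (.inl (c.tgt y)))))))
      rcases c.tgt y with a | b | ⟨x, s⟩
      · simp only [unionPorts, Equiv.coe_fn_mk, Sum.map_inl, plugUnionEquiv, Equiv.trans_apply,
          Equiv.sumAssoc_symm_apply_inr_inl, Equiv.sumCongr_apply]
        rcases i (.inr a) with a | a <;> rfl
      all_goals rfl
    · show unionPorts _ _ _ _ _ _ (.inr (T.tgt y)) = Sum.map _ _ (gluePorts _ _ _ _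
          (Sum.map (plugUnionEquiv i) id (unionPorts _ _ _ _ _ _ (.inr
            (unionPorts _ _ _ _ _ _ (.inr (T.tgt y)))))))
      rcases T.tgt y with a | b | ⟨x, s⟩ <;> rfl

open Classical in
/-- Renaming commutes with subdivision. -/
noncomputable def subdivideRelabel (D : XCGraph O I) (e : D.E) (a b : SignType)
    (o : O ≃ O') (i : I ≃ I') :
    ((D.relabel o i).subdivide e a b).Iso ((D.subdivide e a b).relabel o i) where
  e := Equiv.refl _
  b := Equiv.refl _
  x := Equiv.refl _
  pos_eq _ := rfl
  rot_eq := by rintro (_ | f) <;> rfl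
  src_eq := by
    rintro (_ | f)
    · rfl
    · show Sum.map o id (newPort _ _ _ (some (D.src f)))
        = Sum.map _ _ (newPort _ _ _ (some (Sum.map o id (D.src f))))
      rcases D.src f with a | b | ⟨x, s⟩ <;> rfl
  tgt_eq y := by
    show Sum.map i id (newPort _ _ _ (Option.map D.tgt (Equiv.swap none (some e) y)))
      = Sum.map _ _ (newPort _ _ _ (Option.map (Sum.map i id ∘ D.tgt)
          (Equiv.swap none (some e) y)))
    rcases Equiv.swap none (some e) y with _ | f
    · rfl
    · simp only [Option.map, Function.comp]
      rcases D.tgt f with a | b | ⟨x, s⟩ <;> rfl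

open Classical in
/-- Glueing commutes with subdivision. -/
noncomputable def subdivideGlue {K : Type} (D : XCGraph (O ⊕ K) (I ⊕ K)) (e : D.E)
    (a b : SignType) : (D.glue.subdivide e a b).Iso (D.subdivide e a b).glue where
  e := Equiv.refl _
  b :=
    { toFun := fun
        | none => .inl none
        | some (.inl b) => .inl (some b)
        | some (.inr k) => .inr k
      invFun := fun
        | .inl none => none
        | .inl (some b) => some (.inl b)
        | .inr k => some (.inr k)
      left_inv := by rintro (_ | b | k) <;> rfl
      right_inv := by rintro ((_ | b) | k) <;> rfl }
  x := Equiv.refl _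
  pos_eq _ := rfl
  rot_eq := by rintro (_ | f) <;> rfl
  src_eq := by
    rintro (_ | f)
    · rfl
    · show gluePorts _ _ _ _ (newPort _ _ _ (some (D.src f)))
        = Sum.map _ _ (newPort _ _ _ (some (gluePorts _ _ _ _ (D.src f))))
      rcases D.src f with (a | k) | b | ⟨x, s⟩ <;> rfl
  tgt_eq y := by
    show gluePorts _ _ _ _ (newPort _ _ _ (Option.map D.tgt (Equiv.swap none (some e) y)))
      = Sum.map _ _ (newPort _ _ _ (Option.map (gluePorts _ _ _ _ ∘ D.tgt)
          (Equiv.swap none (some e) y)))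
    rcases Equiv.swap none (some e) y with _ | f
    · rfl
    · simp only [Option.map, Function.comp]
      rcases D.tgt f with (a | k) | b | ⟨x, s⟩ <;> rfl

/-- Bookkeeping for subdivisions in disjoint unions. -/
def optionSum (α β : Type) : Option (α ⊕ β) ≃ Option α ⊕ β where
  toFun
    | none => .inl none
    | some (.inl b) => .inl (some b)
    | some (.inr k) => .inr k
  invFun
    | .inl none => none
    | .inl (some b) => some (.inl b)
    | .inr k => some (.inr k)
  left_inv := by rintro (_ | b | k) <;> rfl
  right_inv := by rintro ((_ | b) | k) <;> rfl

open Classical in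
/-- Disjoint union commutes with subdivision. -/
noncomputable def subdivideUnion (D : XCGraph O I) (T : XCGraph O' I') (e : D.E) (a b : SignType) :
    ((D.union T).subdivide (Sum.inl e) a b).Iso ((D.subdivide e a b).union T) where
  e := optionSum _ _
  b := optionSum _ _
  x := Equiv.refl _
  pos_eq := by rintro (y | y) <;> rfl
  rot_eq := by
    rintro (_ | f | f)
    · rfl
    · by_cases h : f = e
      · subst h
        exact (subdivide_rot_self D f a b).trans
          (subdivide_rot_self (D.union T) (Sum.inl f) a b).symm
      · exact (subdivide_rot_ne D h a b).trans
          (subdivide_rot_ne (D.union T) (Sum.inl_injective.ne h) a b).symm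
    · exact (subdivide_rot_ne (D.union T) (f := Sum.inr f) (e := Sum.inl e) Sum.inr_ne_inl a b).symm
  src_eq := by
    rintro (_ | f | f)
    · rfl
    · show unionPorts _ _ _ _ _ _ (.inl (newPort _ _ _ (some (D.src f))))
        = Sum.map _ _ (newPort _ _ _ (some (unionPorts _ _ _ _ _ _ (.inl (D.src f)))))
      rcases D.src f with a | b | ⟨x, s⟩ <;> rfl
    · show unionPorts _ _ _ _ _ _ (.inr (T.src f))
        = Sum.map _ _ (newPort _ _ _ (some (unionPorts _ _ _ _ _ _ (.inr (T.src f)))))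
      rcases T.src f with a | b | ⟨x, s⟩ <;> rfl
  tgt_eq := by
    have hl : ∀ p : I ⊕ D.B ⊕ D.X × Bool,
        unionPorts I _ _ I' T.B T.X (.inl (newPort _ _ _ (some p)))
          = Sum.map id (Sum.map (optionSum _ _) (Prod.map (Equiv.refl _) id))
            (newPort _ _ _ (some (unionPorts _ _ _ _ _ _ (.inl p)))) := by
      rintro (a | b | ⟨x, s⟩) <;> rfl
    have hr : ∀ p : I' ⊕ T.B ⊕ T.X × Bool,
        unionPorts I (Option D.B) D.X I' T.B T.X (.inr p)
          = Sum.map id (Sum.map (optionSum _ _) (Prod.map (Equiv.refl _) id))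
            (newPort _ _ _ (some (unionPorts _ _ _ _ _ _ (.inr p)))) := by
      rintro (a | b | ⟨x, s⟩) <;> rfl
    have fin : ∀ {y p p' q}, ((D.union T).subdivide (Sum.inl e) a b).tgt y = p →
        p' = Sum.map id (Sum.map (optionSum _ _) (Prod.map (Equiv.refl _) id)) p →
        ((D.subdivide e a b).union T).tgt q = p' → ((D.subdivide e a b).union T).tgt q
          = Sum.map id (Sum.map (optionSum _ _) (Prod.map (Equiv.refl _) id))
            (((D.union T).subdivide (Sum.inl e) a b).tgt y) := by
      rintro y p p' q rfl h2 h3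
      exact h3.trans h2
    have inl : ∀ {y p}, (D.subdivide e a b).tgt y = p →
        ((D.subdivide e a b).union T).tgt (Sum.inl y) = unionPorts _ _ _ _ _ _ (.inl p) := by
      rintro y p rfl
      rfl
    rintro (_ | f | f)
    · exact fin (subdivide_tgt_none (D.union T) (Sum.inl e) a b) (hl (D.tgt e))
        (inl (subdivide_tgt_none D e a b))
    · by_cases h : f = e
      · subst h
        exact fin (subdivide_tgt_self (D.union T) (Sum.inl f) a b) rfl
          (inl (subdivide_tgt_self D f a b))
      · exact fin (subdivide_tgt_ne (D.union T) (Sum.inl_injective.ne h) a b) (hl (D.tgt f))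
          (inl (subdivide_tgt_ne D h a b))
    · exact fin (subdivide_tgt_ne (D.union T) (f := Sum.inr f) (e := Sum.inl e) Sum.inr_ne_inl a b)
        (hr (T.tgt f)) rfl

/-- The inverse of an isomorphism. -/
def Iso.symm {D D' : XCGraph O I} (f : D.Iso D') : D'.Iso D where
  e := f.e.symm
  b := f.b.symm
  x := f.x.symm
  pos_eq y := by simpa using (f.pos_eq (f.x.symm y)).symm
  rot_eq y := by simpa using (f.rot_eq (f.e.symm y)).symm
  src_eq y := by
    have h := f.src_eq (f.e.symm y)
    rw [Equiv.apply_symm_apply] at h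
    rw [h]
    rcases D.src (f.e.symm y) with a | b | ⟨x, s⟩ <;> simp
  tgt_eq y := by
    have h := f.tgt_eq (f.e.symm y)
    rw [Equiv.apply_symm_apply] at h
    rw [h]
    rcases D.tgt (f.e.symm y) with a | b | ⟨x, s⟩ <;> simp

theorem Step.relabel {D D' : XCGraph O I} (h : Step D D') (o : O ≃ O') (i : I ≃ I') :
    Step (D.relabel o i) (D'.relabel o i) := by
  cases h with
  | iso f => exact .iso (f.relabel o i)
  | zeroR e a b h f =>
    exact .zeroR (D := D.relabel o i) e a b h
      ((subdivideRelabel D e a b o i).trans (f.relabel o i))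
  | move m c o' i' f g =>
    exact .move m c _ _ ((plugRelabel _ c o' i' o i).trans (f.relabel o i))
      ((plugRelabel _ c o' i' o i).trans (g.relabel o i))

theorem Step.glue {K : Type} {D D' : XCGraph (O ⊕ K) (I ⊕ K)} (h : Step D D') :
    Step D.glue D'.glue := by
  cases h with
  | iso f => exact .iso f.glue
  | zeroR e a b h f =>
    exact .zeroR (D := D.glue) e a b h ((subdivideGlue D e a b).trans f.glue)
  | move m c o' i' f g =>
    exact .move m c _ _ ((plugGlue _ c o' i').trans f.glue) ((plugGlue _ c o' i').trans g.glue)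

theorem Step.union_right {D D' : XCGraph O I} (h : Step D D') (T : XCGraph O' I') :
    Step (D.union T) (D'.union T) := by
  cases h with
  | iso f => exact .iso (f.union (Iso.refl T))
  | zeroR e a b h f =>
    exact .zeroR (D := D.union T) (Sum.inl e) a b h
      ((subdivideUnion D T e a b).trans (f.union (Iso.refl T)))
  | move m c o' i' f g =>
    exact .move m _ _ _ ((plugUnion _ c o' i' T).trans (f.union (Iso.refl T)))
      ((plugUnion _ c o' i' T).trans (g.union (Iso.refl T)))

/-! ### Openness -/

theorem Iso.next {D D' : XCGraph O I} (f : D.Iso D') {y z : D.E} (h : D.Next y z) :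
    D'.Next (f.e y) (f.e z) := by
  rcases h with ⟨b, h1, h2⟩ | ⟨x, s, h1, h2⟩
  · exact Or.inl ⟨f.b b, by rw [f.tgt_eq, h1]; rfl, by rw [f.src_eq, h2]; rfl⟩
  · exact Or.inr ⟨f.x x, s, by rw [f.tgt_eq, h1]; rfl, by rw [f.src_eq, h2]; rfl⟩

/-- If the edges can be numbered increasingly along the strands, no strand closes up. -/
theorem isOpen_of_rank {D : XCGraph O I} (r : D.E → ℕ) (h : ∀ y z, D.Next y z → r y < r z) :
    D.IsOpen := by
  intro y hy
  have : ∀ z, Relation.TransGen D.Next y z → r y < r z := by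
    intro z hz
    induction hz with
    | single h1 => exact h _ _ h1
    | tail _ h1 ih => exact ih.trans (h _ _ h1)
  exact lt_irrefl _ (this y hy)

theorem strands_isOpen {n : ℕ} (σ : Equiv.Perm (Fin n)) (r : Fin n → SignType) :
    (strands σ r).IsOpen :=
  isOpen_of_rank (fun _ => 0) (by rintro y z (⟨b, _⟩ | ⟨x, _⟩); exacts [b.elim0, x.elim0])

theorem crossing_isOpen (s : Bool) (a b : SignType) : (crossing s a b).IsOpen := by
  let edge : Fin 4 → Port 2 1 × SignType × Port 2 1 :=
    ![(vtx 0, a, hl 0), (vtx 1, a, hr 0), (hl 0, b, vtx 0), (hr 0, b, vtx 1)]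
  let r : Fin 4 → ℕ := ![0, 0, 1, 1]
  have key : ∀ y z : Fin 4, ∀ x : Fin 1, ∀ t : Bool,
      (edge y).2.2 = Sum.inr (Sum.inr (x, t)) → (edge z).1 = Sum.inr (Sum.inr (x, !t)) →
        r y < r z := by
    intro y z x t h1 h2
    fin_cases y <;> fin_cases z <;> simp_all [edge, r]
  refine isOpen_of_rank (D := crossing s a b) r ?_
  rintro y z (⟨c, _⟩ | ⟨x, t, h1, h2⟩)
  · exact c.elim0
  · exact key y z x t h1 h2

theorem union_isOpen {D : XCGraph O I} {T : XCGraph O' I'} (hD : D.IsOpen) (hT : T.IsOpen) :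
    (D.union T).IsOpen := by
  have ll : ∀ y z : D.E, (D.union T).Next (Sum.inl y) (Sum.inl z) → D.Next y z := by
    intro y z h
    have h : (∃ b, unionPorts _ _ _ I' T.B T.X (.inl (D.tgt y)) = .inr (.inl b) ∧
        unionPorts _ _ _ O' T.B T.X (.inl (D.src z)) = .inr (.inl b)) ∨
        ∃ x s, unionPorts _ _ _ I' T.B T.X (.inl (D.tgt y)) = .inr (.inr (x, s)) ∧
        unionPorts _ _ _ O' T.B T.X (.inl (D.src z)) = .inr (.inr (x, !s)) := h
    unfold Next
    generalize D.tgt y = p at h ⊢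
    generalize D.src z = q at h ⊢
    rcases p with p | p | ⟨p, t⟩ <;> rcases q with q | q | ⟨q, u⟩ <;>
      simp_all [unionPorts]
  have rr : ∀ y z : T.E, (D.union T).Next (Sum.inr y) (Sum.inr z) → T.Next y z := by
    intro y z h
    have h : (∃ b, unionPorts I D.B D.X _ _ _ (.inr (T.tgt y)) = .inr (.inl b) ∧
        unionPorts O D.B D.X _ _ _ (.inr (T.src z)) = .inr (.inl b)) ∨
        ∃ x s, unionPorts I D.B D.X _ _ _ (.inr (T.tgt y)) = .inr (.inr (x, s)) ∧
        unionPorts O D.B D.X _ _ _ (.inr (T.src z)) = .inr (.inr (x, !s)) := h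
    unfold Next
    generalize T.tgt y = p at h ⊢
    generalize T.src z = q at h ⊢
    rcases p with p | p | ⟨p, t⟩ <;> rcases q with q | q | ⟨q, u⟩ <;>
      simp_all [unionPorts]
  have lr : ∀ (y : D.E) (z : T.E), ¬ (D.union T).Next (Sum.inl y) (Sum.inr z) := by
    intro y z h
    have h : (∃ b, unionPorts _ _ _ I' T.B T.X (.inl (D.tgt y)) = .inr (.inl b) ∧
        unionPorts O D.B D.X _ _ _ (.inr (T.src z)) = .inr (.inl b)) ∨
        ∃ x s, unionPorts _ _ _ I' T.B T.X (.inl (D.tgt y)) = .inr (.inr (x, s)) ∧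
        unionPorts O D.B D.X _ _ _ (.inr (T.src z)) = .inr (.inr (x, !s)) := h
    generalize D.tgt y = p at h
    generalize T.src z = q at h
    rcases p with p | p | ⟨p, t⟩ <;> rcases q with q | q | ⟨q, u⟩ <;>
      simp_all [unionPorts]
  have rl : ∀ (y : T.E) (z : D.E), ¬ (D.union T).Next (Sum.inr y) (Sum.inl z) := by
    intro y z h
    have h : (∃ b, unionPorts I D.B D.X _ _ _ (.inr (T.tgt y)) = .inr (.inl b) ∧
        unionPorts _ _ _ O' T.B T.X (.inl (D.src z)) = .inr (.inl b)) ∨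
        ∃ x s, unionPorts I D.B D.X _ _ _ (.inr (T.tgt y)) = .inr (.inr (x, s)) ∧
        unionPorts _ _ _ O' T.B T.X (.inl (D.src z)) = .inr (.inr (x, !s)) := h
    generalize T.tgt y = p at h
    generalize D.src z = q at h
    rcases p with p | p | ⟨p, t⟩ <;> rcases q with q | q | ⟨q, u⟩ <;>
      simp_all [unionPorts]
  have key : ∀ y z : D.E ⊕ T.E, Relation.TransGen (D.union T).Next y z →
      Sum.LiftRel (Relation.TransGen D.Next) (Relation.TransGen T.Next) y z := by
    intro y z h
    induction h with
    | @single b h =>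
      rcases y with y | y <;> rcases b with b | b
      exacts [.inl (.single (ll _ _ h)), (lr _ _ h).elim, (rl _ _ h).elim, .inr (.single (rr _ _ h))]
    | @tail b c _ h ih =>
      rcases ih with @⟨y, b, ih⟩ | @⟨y, b, ih⟩ <;> rcases c with c | c
      exacts [.inl (ih.tail (ll _ _ h)), (lr _ _ h).elim, (rl _ _ h).elim, .inr (ih.tail (rr _ _ h))]
  rintro (y | y) h
  · rcases key _ _ h with ⟨h⟩
    exact hD _ h
  · rcases key _ _ h with ⟨_⟩ | ⟨h⟩
    exact hT _ h

theorem relabel_isOpen {D : XCGraph O I} (hD : D.IsOpen) (o : O ≃ O') (i : I ≃ I') :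
    (D.relabel o i).IsOpen := by
  have key : ∀ y z : D.E, (D.relabel o i).Next y z → D.Next y z := by
    intro y z h
    have h : (∃ b, Sum.map i id (D.tgt y) = .inr (.inl b) ∧
        Sum.map o id (D.src z) = .inr (.inl b)) ∨
        ∃ x s, Sum.map i id (D.tgt y) = .inr (.inr (x, s)) ∧
        Sum.map o id (D.src z) = .inr (.inr (x, !s)) := h
    unfold Next
    generalize D.tgt y = p at h ⊢
    generalize D.src z = q at h ⊢
    rcases p with p | p | ⟨p, t⟩ <;> rcases q with q | q | ⟨q, u⟩ <;>
      simp_all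
  intro y h
  exact hD y (Relation.TransGen.mono key _ _ h)

/-- Glueing the incoming univalent vertices of `D` to the outgoing ones of `T`. -/
def stack {K : Type} (D : XCGraph O K) (T : XCGraph K I) : XCGraph O I :=
  ((D.union T).relabel (Equiv.refl _) (Equiv.sumComm _ _)).glue

theorem stack_isOpen {K : Type} {D : XCGraph O K} {T : XCGraph K I} (hD : D.IsOpen)
    (hT : T.IsOpen) : (D.stack T).IsOpen := by
  let pt (p : (K ⊕ D.B ⊕ D.X × Bool) ⊕ (I ⊕ T.B ⊕ T.X × Bool)) :
      I ⊕ ((D.B ⊕ T.B) ⊕ K) ⊕ (D.X ⊕ T.X) × Bool :=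
    gluePorts _ _ _ _ (Sum.map (Equiv.sumComm _ _) id (unionPorts _ _ _ _ _ _ p))
  let ps (p : (O ⊕ D.B ⊕ D.X × Bool) ⊕ (K ⊕ T.B ⊕ T.X × Bool)) :
      O ⊕ ((D.B ⊕ T.B) ⊕ K) ⊕ (D.X ⊕ T.X) × Bool :=
    gluePorts _ _ _ _ (Sum.map (Equiv.refl _) id (unionPorts _ _ _ _ _ _ p))
  have t1 : ∀ k, pt (.inl (.inl k)) = .inr (.inl (.inr k)) := fun _ => rfl
  have t2 : ∀ k, pt (.inl (.inr (.inl k))) = .inr (.inl (.inl (.inl k))) := fun _ => rfl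
  have t3 : ∀ x s, pt (.inl (.inr (.inr (x, s)))) = .inr (.inr (.inl x, s)) := fun _ _ => rfl
  have t4 : ∀ k, pt (.inr (.inl k)) = .inl k := fun _ => rfl
  have t5 : ∀ k, pt (.inr (.inr (.inl k))) = .inr (.inl (.inl (.inr k))) := fun _ => rfl
  have t6 : ∀ x s, pt (.inr (.inr (.inr (x, s)))) = .inr (.inr (.inr x, s)) := fun _ _ => rfl
  have s1 : ∀ k, ps (.inl (.inl k)) = .inl k := fun _ => rfl
  have s2 : ∀ k, ps (.inl (.inr (.inl k))) = .inr (.inl (.inl (.inl k))) := fun _ => rfl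
  have s3 : ∀ x s, ps (.inl (.inr (.inr (x, s)))) = .inr (.inr (.inl x, s)) := fun _ _ => rfl
  have s4 : ∀ k, ps (.inr (.inl k)) = .inr (.inl (.inr k)) := fun _ => rfl
  have s5 : ∀ k, ps (.inr (.inr (.inl k))) = .inr (.inl (.inl (.inr k))) := fun _ => rfl
  have s6 : ∀ x s, ps (.inr (.inr (.inr (x, s)))) = .inr (.inr (.inr x, s)) := fun _ _ => rfl
  have ll : ∀ y z : D.E, (D.stack T).Next (Sum.inl y) (Sum.inl z) → D.Next y z := by
    intro y z h0
    have h : (∃ b, pt (.inl (D.tgt y)) = .inr (.inl b) ∧ ps (.inl (D.src z)) = .inr (.inl b)) ∨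
        ∃ x s, pt (.inl (D.tgt y)) = .inr (.inr (x, s)) ∧
          ps (.inl (D.src z)) = .inr (.inr (x, !s)) := h0
    clear h0 hD hT
    clear_value pt ps
    unfold Next
    generalize D.tgt y = p at h ⊢
    generalize D.src z = q at h ⊢
    rcases p with p | p | ⟨p, t⟩ <;> rcases q with q | q | ⟨q, u⟩ <;>
      simp [t1, t2, t3, t4, t5, t6, s1, s2, s3, s4, s5, s6] at h ⊢ <;> exact h
  have rr : ∀ y z : T.E, (D.stack T).Next (Sum.inr y) (Sum.inr z) → T.Next y z := by
    intro y z h0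
    have h : (∃ b, pt (.inr (T.tgt y)) = .inr (.inl b) ∧ ps (.inr (T.src z)) = .inr (.inl b)) ∨
        ∃ x s, pt (.inr (T.tgt y)) = .inr (.inr (x, s)) ∧
          ps (.inr (T.src z)) = .inr (.inr (x, !s)) := h0
    clear ll h0 hD hT
    clear_value pt ps
    unfold Next
    generalize T.tgt y = p at h ⊢
    generalize T.src z = q at h ⊢
    rcases p with p | p | ⟨p, t⟩ <;> rcases q with q | q | ⟨q, u⟩ <;>
      simp [t1, t2, t3, t4, t5, t6, s1, s2, s3, s4, s5, s6] at h ⊢ <;> exact h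
  have rl : ∀ (y : T.E) (z : D.E), ¬ (D.stack T).Next (Sum.inr y) (Sum.inl z) := by
    intro y z h0
    have h : (∃ b, pt (.inr (T.tgt y)) = .inr (.inl b) ∧ ps (.inl (D.src z)) = .inr (.inl b)) ∨
        ∃ x s, pt (.inr (T.tgt y)) = .inr (.inr (x, s)) ∧
          ps (.inl (D.src z)) = .inr (.inr (x, !s)) := h0
    clear ll rr h0 hD hT
    clear_value pt ps
    generalize T.tgt y = p at h
    generalize D.src z = q at h
    rcases p with p | p | ⟨p, t⟩ <;> rcases q with q | q | ⟨q, u⟩ <;>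
      simp [t1, t2, t3, t4, t5, t6, s1, s2, s3, s4, s5, s6] at h ⊢ <;> exact h
  have key : ∀ y z : D.E ⊕ T.E, Relation.TransGen (D.stack T).Next y z →
      Sum.Lex (Relation.TransGen D.Next) (Relation.TransGen T.Next) y z := by
    intro y z h
    induction h with
    | @single b h =>
      rcases y with y | y <;> rcases b with b | b
      exacts [.inl (.single (ll _ _ h)), .sep _ _, (rl _ _ h).elim, .inr (.single (rr _ _ h))]
    | @tail b c _ h ih =>
      rcases ih with @⟨y, b, ih⟩ | @⟨y, b, ih⟩ | ⟨y, b⟩ <;> rcases c with c | c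
      exacts [.inl (ih.tail (ll _ _ h)), .sep _ _, (rl _ _ h).elim, .inr (ih.tail (rr _ _ h)),
        (rl _ _ h).elim, .sep _ _]
  rintro (y | y) h
  · exact hD _ (Sum.lex_inl_inl.1 (key _ _ h))
  · exact hT _ (Sum.lex_inr_inr.1 (key _ _ h))

theorem Iso.isOpen {D D' : XCGraph O I} (f : D.Iso D') (h : D.IsOpen) : D'.IsOpen := by
  intro y hy
  have key : ∀ y z, Relation.TransGen D'.Next y z →
      Relation.TransGen D.Next (f.symm.e y) (f.symm.e z) := fun y z h =>
    Relation.TransGen.lift (p := D.Next) f.symm.e (fun _ _ => f.symm.next) _ _ h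
  exact h _ (key y y hy)

end XCGraph

/-! ## The category of XC-tangles -/

/-- XC-tangle diagrams with `n` strands. The total orders on the sets of outgoing and incoming
univalent vertices are given by numbering each of them with `0, …, n - 1`. -/
structure XCDiagram (n : ℕ) where
  graph : XCGraph (Fin n) (Fin n)
  isOpen : graph.IsOpen

/-- XC-tangles: XC-tangle diagrams up to the equivalence relation generated by isomorphism and the
XC-Reidemeister moves. -/
def XCTangle (n : ℕ) : Type 1 :=
  Quot fun D D' : XCDiagram n => D.graph.Step D'.graph

namespace XCTangle

/-- The XC-tangle of a diagram. -/
def mk {n : ℕ} (D : XCDiagram n) : XCTangle n := Quot.mk _ D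

theorem sound_iso {n : ℕ} {D D' : XCDiagram n} (f : D.graph.Iso D'.graph) : mk D = mk D' :=
  Quot.sound (XCGraph.Step.iso f)

theorem sound_conj {n : ℕ} {D D' : XCDiagram n} {G G' : XCGraph (Fin n) (Fin n)}
    (f : D.graph.Iso G) (h : G.Step G') (f' : G'.Iso D'.graph) : mk D = mk D' :=
  (sound_iso (D' := ⟨G, f.isOpen D.isOpen⟩) f).trans
    ((show mk _ = mk _ from Quot.sound h).trans (sound_iso (D := ⟨G', f'.symm.isOpen D'.isOpen⟩) f'))

/-- The tangle `T₂ ∘ T₁` on diagrams: the incoming univalent vertices of `T₁` are glued to the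
outgoing univalent vertices of `T₂`. -/
def compDiagram {n : ℕ} (T₂ T₁ : XCDiagram n) : XCDiagram n :=
  ⟨T₁.graph.stack T₂.graph, XCGraph.stack_isOpen T₁.isOpen T₂.isOpen⟩

/-- The disjoint union of diagrams, with the ordinal sum of the orders. -/
def tensorDiagram {n m : ℕ} (T : XCDiagram n) (T' : XCDiagram m) : XCDiagram (n + m) :=
  ⟨(T.graph.union T'.graph).relabel finSumFinEquiv finSumFinEquiv,
    XCGraph.relabel_isOpen (XCGraph.union_isOpen T.isOpen T'.isOpen) _ _⟩

/-- Composition of XC-tangles. -/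
def comp {n : ℕ} : XCTangle n → XCTangle n → XCTangle n :=
  Quot.lift₂ (fun T₂ T₁ => mk (compDiagram T₂ T₁))
    (fun T₂ _ _ h => Quot.sound ((h.union_right T₂.graph).relabel _ _).glue)
    (fun D D' T₁ h => sound_conj
      (((XCGraph.unionComm D.graph T₁.graph).symm.relabel _ _).glue)
      (((h.union_right T₁.graph).relabel _ _).relabel _ _).glue
      (((XCGraph.unionComm D'.graph T₁.graph).relabel _ _).glue))

/-- Disjoint union of XC-tangles. -/
def tensor {n m : ℕ} : XCTangle n → XCTangle m → XCTangle (n + m) :=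
  Quot.lift₂ (fun T T' => mk (tensorDiagram T T'))
    (fun T D D' h => sound_conj
      (((XCGraph.unionComm D.graph T.graph).symm).relabel finSumFinEquiv finSumFinEquiv)
      (((h.union_right T.graph).relabel _ _).relabel _ _)
      ((XCGraph.unionComm D'.graph T.graph).relabel finSumFinEquiv finSumFinEquiv))
    (fun D D' T h => Quot.sound ((h.union_right T.graph).relabel _ _))

/-- The strands without vertices in their interior and with rotation number `0`, where the `i`-th
strand goes from the `i`-th outgoing vertex to the `σ i`-th incoming vertex. -/
def ofPerm {n : ℕ} (σ : Equiv.Perm (Fin n)) : XCTangle n :=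
  mk ⟨XCGraph.strands σ fun _ => 0, XCGraph.strands_isOpen _ _⟩

end XCTangle

/-- The category of XC-tangles. -/
def txc : EndoCat.{1} where
  Hom := XCTangle
  one _ := XCTangle.ofPerm 1
  comp := XCTangle.comp
  tensor := XCTangle.tensor
  braid n m := XCTangle.ofPerm (blockSwap n m)

namespace XCTangle

/-- The generators `X` (for the sign `true`) and `X⁻` (for the sign `false`). -/
noncomputable def X (s : Bool) : XCTangle 2 :=
  mk ⟨XCGraph.crossing s 0 0, XCGraph.crossing_isOpen _ _ _⟩

/-- A strand with one edge, of rotation number `r`; the generators `C` and `C⁻` are the cases `1`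
and `-1`. -/
def C (r : SignType) : XCTangle 1 :=
  mk ⟨XCGraph.strands 1 fun _ => r, XCGraph.strands_isOpen _ _⟩

/-! The external algebra action on XC-tangles, for the arrows `P_τ`, `Id_n ⊗ μ` and `Id_n ⊗ η`,
which generate the PROP for algebras. -/

/-- The strands are reordered by `τ`: the strand with number `i` gets the number `τ i`. -/
def reorder {n : ℕ} (τ : Equiv.Perm (Fin n)) : XCTangle n → XCTangle n :=
  Quot.map (fun D => ⟨D.graph.relabel τ (Equiv.refl _), XCGraph.relabel_isOpen D.isOpen _ _⟩)
    (fun _ _ h => h.relabel _ _)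

/-- The number `p` is removed and the remaining ones are shifted accordingly. -/
def removeIndex {n : ℕ} (p : Fin (n + 1)) : Fin (n + 1) ≃ Fin n ⊕ Unit :=
  (finSuccEquiv' p).trans (Equiv.optionEquivSumPUnit _)

/-- `D'` is obtained from `D` by merging the last two strands: the incoming univalent vertex where
the last strand finishes is glued to the outgoing univalent vertex where the strand before it
starts (this is the order in which the strands of `T₂ ⊗ T₁` are merged to give `T₂ ∘ T₁`). -/
def IsMergeDiagram {n : ℕ} (D : XCDiagram (n + 2)) (D' : XCDiagram (n + 1)) : Prop :=
  ∃ q, D.graph.StrandEndsAt (Fin.last (n + 1)) q ∧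
    Nonempty (((D.graph.relabel (removeIndex (Fin.last n).castSucc) (removeIndex q)).glue).Iso
      D'.graph)

/-- `T'` is obtained from `T` by merging the last two strands. -/
def IsMerge {n : ℕ} (T : XCTangle (n + 2)) (T' : XCTangle (n + 1)) : Prop :=
  ∃ D D', mk D = T ∧ mk D' = T' ∧ IsMergeDiagram D D'

/-- An edge with rotation number zero is inserted as the last strand. -/
def insertEdge {n : ℕ} (T : XCTangle n) : XCTangle (n + 1) := tensor T (C 0)

end XCTangle

/-! ## The PROP for XC-algebras -/

/-- Formal expressions for the arrows of a PROP with the generating operations of an XC-algebra.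
`cast h` is the identity, `comp f g` is the composite, first `f`, then `g`, and `braid a b` is the
symmetry `a ⊗ b ⟶ b ⊗ a`. -/
inductive XCTerm : ℕ → ℕ → Type
  | cast {a b : ℕ} (h : a = b) : XCTerm a b
  | comp {a b c : ℕ} (f : XCTerm a b) (g : XCTerm b c) : XCTerm a c
  | tensor {a b c d : ℕ} (f : XCTerm a b) (g : XCTerm c d) : XCTerm (a + c) (b + d)
  | braid (a b : ℕ) : XCTerm (a + b) (b + a)
  | mul : XCTerm 2 1
  | unit : XCTerm 0 1
  | R : XCTerm 0 2
  | Rinv : XCTerm 0 2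
  | kappa : XCTerm 0 1
  | kappaInv : XCTerm 0 1

namespace XCTerm

/-- The identity of `n`. -/
abbrev id (n : ℕ) : XCTerm n n := cast rfl

/-- `η^{⊗n}`. -/
def unitN : ∀ n, XCTerm 0 n
  | 0 => id 0
  | n + 1 => tensor (unitN n) unit

/-- The iterated multiplication `μ_k : k ⟶ 1`. -/
def muN : ∀ k, XCTerm k 1
  | 0 => unit
  | 1 => id 1
  | k + 2 => comp (tensor (muN (k + 1)) (id 1) : XCTerm (k + 1 + 1) (1 + 1)) mul

/-- The componentwise multiplication `μ^{[k]} : 2k ⟶ k`. -/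
def mulN : ∀ k, XCTerm (k + k) k
  | 0 => id 0
  | k + 1 =>
    comp (cast (by omega : k + 1 + (k + 1) = k + (1 + k) + 1))
      (comp (tensor (tensor (id k) (braid 1 k)) (id 1))
        (comp (cast (by omega : k + (k + 1) + 1 = (k + k) + 2)) (tensor (mulN k) mul)))

/-- The product `a · b` of arrows `0 ⟶ k`. -/
def dot {k : ℕ} (a b : XCTerm 0 k) : XCTerm 0 k := comp (tensor a b) (mulN k)

/-- For a permutation `σ` of `n + 1` points, the permutation of `n` points obtained by removing the
last point and its image and shifting the rest accordingly. -/
def removeLast {n : ℕ} (σ : Equiv.Perm (Fin (n + 1))) : Equiv.Perm (Fin n) :=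
  Equiv.removeNone
    ((finSuccEquivLast.symm.trans σ).trans (finSuccEquiv' (σ (Fin.last n))))

/-- The symmetry `P_σ : n ⟶ n` induced by a permutation, which moves the `i`-th factor to the
position `σ i`: the first factors are permuted among themselves and then the last one is moved to
its position `p = σ (last)`. -/
def perm : ∀ {n : ℕ}, Equiv.Perm (Fin n) → XCTerm n n
  | 0, _ => id 0
  | n + 1, σ =>
    comp (tensor (perm (removeLast σ)) (id 1))
      (comp (cast (by omega :
          n + 1 = (σ (Fin.last n) : ℕ) + ((n - (σ (Fin.last n) : ℕ)) + 1)))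
        (comp (tensor (id _) (braid (n - (σ (Fin.last n) : ℕ)) 1))
          (cast (by omega))))

/-- `η^{⊗a} ⊗ Id ⊗ η^{⊗c}`. -/
def leg (a c : ℕ) : XCTerm 1 (a + 1 + c) :=
  comp (cast (by omega)) (tensor (tensor (unitN a) (id 1)) (unitN c))

/-- `η^{⊗a} ⊗ Id ⊗ η^{⊗b} ⊗ Id ⊗ η^{⊗c}`. -/
def legs (a b c : ℕ) : XCTerm 2 (a + 1 + b + 1 + c) :=
  comp (cast (by omega))
    (tensor (tensor (tensor (tensor (unitN a) (id 1)) (unitN b)) (id 1)) (unitN c))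

/-- The defining equations of XC-algebras: associativity and units, the invertibility of `R` and
`κ`, and (XC0), (XC1f), (XC2c), (XC2d), (XC3). -/
inductive Law : ∀ {a b : ℕ}, XCTerm a b → XCTerm a b → Prop
  | assoc : Law (comp (tensor mul (id 1) : XCTerm (2 + 1) (1 + 1)) mul)
      (comp (tensor (id 1) mul : XCTerm (1 + 2) (1 + 1)) mul)
  | mul_unit : Law (comp (tensor (id 1) unit : XCTerm (1 + 0) (1 + 1)) mul) (id 1)
  | unit_mul : Law (comp (tensor unit (id 1) : XCTerm (0 + 1) (1 + 1)) mul) (id 1)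
  | R_Rinv : Law (dot R Rinv) (unitN 2)
  | Rinv_R : Law (dot Rinv R) (unitN 2)
  | kappa_kappaInv : Law (dot kappa kappaInv) (unitN 1)
  | kappaInv_kappa : Law (dot kappaInv kappa) (unitN 1)
  | xc0 : Law R (dot (dot (tensor kappa kappa) R) (tensor kappaInv kappaInv))
  | xc0_inv : Law Rinv (dot (dot (tensor kappa kappa) Rinv) (tensor kappaInv kappaInv))
  | xc1f : Law
      (comp (dot (k := 3) (comp (comp R (braid 1 1)) (legs 0 1 0)) (comp kappa (leg 1 1))) (muN 3))
      (comp (dot (k := 3) (comp R (legs 0 1 0)) (comp kappaInv (leg 1 1))) (muN 3))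
  | xc2c : Law (tensor unit kappaInv)
      (comp (dot (k := 5) (dot (k := 5) (comp R (legs 0 3 0)) (comp Rinv (legs 1 0 2)))
        (comp kappaInv (leg 3 1))) (tensor (muN 2) (muN 3)))
  | xc2d : Law (tensor kappa unit)
      (comp (dot (k := 5) (dot (k := 5) (comp Rinv (legs 0 3 0)) (comp R (legs 2 0 1)))
        (comp kappa (leg 1 3))) (tensor (muN 3) (muN 2)))
  | xc3 : Law
      (dot (k := 3) (dot (k := 3) (comp R (legs 0 0 1)) (comp R (legs 0 1 0)))
        (comp R (legs 1 0 0)))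
      (dot (k := 3) (dot (k := 3) (comp R (legs 1 0 0)) (comp R (legs 0 1 0)))
        (comp R (legs 0 0 1)))

/-- Equality of arrows in the PROP: the congruence generated by the axioms of a strict symmetric
monoidal category and the defining equations of XC-algebras. -/
inductive Rel : ∀ {a b : ℕ}, XCTerm a b → XCTerm a b → Prop
  | refl {a b} (f : XCTerm a b) : Rel f f
  | symm {a b} {f g : XCTerm a b} : Rel f g → Rel g f
  | trans {a b} {f g h : XCTerm a b} : Rel f g → Rel g h → Rel f h
  | comp_congr {a b c} {f f' : XCTerm a b} {g g' : XCTerm b c} :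
      Rel f f' → Rel g g' → Rel (comp f g) (comp f' g')
  | tensor_congr {a b c d} {f f' : XCTerm a b} {g g' : XCTerm c d} :
      Rel f f' → Rel g g' → Rel (tensor f g) (tensor f' g')
  | id_comp {a b} (f : XCTerm a b) : Rel (comp (id a) f) f
  | comp_id {a b} (f : XCTerm a b) : Rel (comp f (id b)) f
  | comp_assoc {a b c d} (f : XCTerm a b) (g : XCTerm b c) (h : XCTerm c d) :
      Rel (comp (comp f g) h) (comp f (comp g h))
  | tensor_id (a b) : Rel (tensor (id a) (id b)) (id (a + b))
  | tensor_comp {a b c a' b' c'} (f : XCTerm a b) (g : XCTerm b c) (f' : XCTerm a' b')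
      (g' : XCTerm b' c') :
      Rel (tensor (comp f g) (comp f' g')) (comp (tensor f f') (tensor g g'))
  | tensor_assoc {a b c a' b' c'} (f : XCTerm a a') (g : XCTerm b b') (h : XCTerm c c') :
      Rel (comp (tensor (tensor f g) h) (cast (Nat.add_assoc a' b' c')))
        (comp (cast (Nat.add_assoc a b c)) (tensor f (tensor g h)))
  | unit_tensor {a b} (f : XCTerm a b) :
      Rel (comp (tensor (id 0) f) (cast (Nat.zero_add b))) (comp (cast (Nat.zero_add a)) f)
  | tensor_unit {a b} (f : XCTerm a b) :
      Rel (comp (tensor f (id 0)) (cast (Nat.add_zero b))) (comp (cast (Nat.add_zero a)) f)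
  | braid_natural {a b c d} (f : XCTerm a b) (g : XCTerm c d) :
      Rel (comp (tensor f g) (braid b d)) (comp (braid a c) (tensor g f))
  | braid_braid (a b) : Rel (comp (braid a b) (braid b a)) (id (a + b))
  | hexagon (a b c) :
      Rel (braid a (b + c))
        (comp (cast (Nat.add_assoc a b c).symm)
          (comp (tensor (braid a b) (id c))
            (comp (cast (Nat.add_assoc b a c))
              (comp (tensor (id b) (braid a c)) (cast (Nat.add_assoc b c a).symm)))))
  | law {a b} {f g : XCTerm a b} : Law f g → Rel f g

end XCTerm

/-- The arrows `a ⟶ b` of the PROP `XC`. -/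
def XCHom (a b : ℕ) : Type := Quot (XCTerm.Rel (a := a) (b := b))

namespace XCHom

/-- The arrow represented by an expression. -/
def mk {a b : ℕ} (t : XCTerm a b) : XCHom a b := Quot.mk _ t

/-- Composition in `XC`, first `f`, then `g`. -/
def comp {a b c : ℕ} : XCHom a b → XCHom b c → XCHom a c :=
  Quot.map₂ XCTerm.comp (fun f _ _ h => .comp_congr (.refl f) h)
    (fun _ _ g h => .comp_congr h (.refl g))

/-- The monoidal product in `XC`. -/
def tensor {a b c d : ℕ} : XCHom a b → XCHom c d → XCHom (a + c) (b + d) :=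
  Quot.map₂ XCTerm.tensor (fun f _ _ h => .tensor_congr (.refl f) h)
    (fun _ _ g h => .tensor_congr h (.refl g))

end XCHom

/-! ## XC-algebras in symmetric monoidal categories -/

section Algebra

variable (C : Type u) [Category.{v} C] [MonoidalCategory C] [SymmetricCategory C]

/-- An object with arrows `μ`, `η`, `R^{±1}`, `κ^{±1}`. -/
structure XCData where
  A : C
  mul : A ⊗ A ⟶ A
  unit : 𝟙_ C ⟶ A
  R : 𝟙_ C ⟶ A ⊗ A
  Rinv : 𝟙_ C ⟶ A ⊗ A
  kappa : 𝟙_ C ⟶ A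
  kappaInv : 𝟙_ C ⟶ A

variable {C}

namespace XCData

variable (D : XCData C)

/-- The tensor power `A^{⊗n}`. -/
def pow : ℕ → C
  | 0 => 𝟙_ C
  | n + 1 => pow n ⊗ D.A

/-- The canonical isomorphism `A^{⊗a} ⊗ A^{⊗b} ≅ A^{⊗(a+b)}`. -/
def powAdd (a : ℕ) : ∀ b : ℕ, D.pow a ⊗ D.pow b ≅ D.pow (a + b)
  | 0 => ρ_ (D.pow a)
  | b + 1 => (α_ (D.pow a) (D.pow b) D.A).symm ≪≫ whiskerRightIso (powAdd a b) D.A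

/-- The monoidal product of `f : A^{⊗a} ⟶ A^{⊗b}` and `g : A^{⊗c} ⟶ A^{⊗d}`. -/
def powTensor {a b c d : ℕ} (f : D.pow a ⟶ D.pow b) (g : D.pow c ⟶ D.pow d) :
    D.pow (a + c) ⟶ D.pow (b + d) :=
  (D.powAdd a c).inv ≫ (f ⊗ₘ g) ≫ (D.powAdd b d).hom

/-- The arrow `A^{⊗a} ⟶ A^{⊗b}` denoted by an expression. -/
def eval : ∀ {a b : ℕ}, XCTerm a b → (D.pow a ⟶ D.pow b)
  | _, _, .cast h => eqToHom (congrArg D.pow h)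
  | _, _, .comp f g => eval f ≫ eval g
  | _, _, .tensor f g => D.powTensor (eval f) (eval g)
  | _, _, .braid a b => (D.powAdd a b).inv ≫ (β_ (D.pow a) (D.pow b)).hom ≫ (D.powAdd b a).hom
  | _, _, .mul => ((λ_ D.A).hom ▷ D.A) ≫ D.mul ≫ (λ_ D.A).inv
  | _, _, .unit => D.unit ≫ (λ_ D.A).inv
  | _, _, .R => D.R ≫ ((λ_ D.A).inv ▷ D.A)
  | _, _, .Rinv => D.Rinv ≫ ((λ_ D.A).inv ▷ D.A)
  | _, _, .kappa => D.kappa ≫ (λ_ D.A).inv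
  | _, _, .kappaInv => D.kappaInv ≫ (λ_ D.A).inv

end XCData

variable (C) in
/-- An XC-algebra object in `C`: the arrows satisfy the defining equations of XC-algebras. -/
structure XCAlgebra extends XCData C where
  law : ∀ {a b : ℕ} {s t : XCTerm a b}, XCTerm.Law s t → toXCData.eval s = toXCData.eval t

end Algebra

/-! ## The virtual category of elements -/

/-- The sets `A(Hom_XC(0, n))` for an XC-algebra `A`, with the operations that they inherit:
`elt t` is the image of the arrow represented by `t`, `push g` is composition with the image of `g`
and `tensor` is the monoidal product. -/
structure XCElements where
  U : ℕ → Type w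
  elt : ∀ {n}, XCTerm 0 n → U n
  push : ∀ {n m}, XCTerm n m → U n → U m
  tensor : ∀ {n m}, U n → U m → U (n + m)

/-- The case of the XC-algebra object `1` in `XC`, that is, of the identity functor of `XC`. -/
def universalElements : XCElements.{0} where
  U n := XCHom 0 n
  elt t := XCHom.mk t
  push g u := u.comp (XCHom.mk g)
  tensor u v := u.tensor v

/-- The case of an XC-algebra object in a symmetric monoidal category. -/
def XCAlgebra.elements {C : Type u} [Category.{v} C] [MonoidalCategory C] [SymmetricCategory C]
    (A : XCAlgebra C) : XCElements.{v} where
  U n := {u : A.pow 0 ⟶ A.pow n // ∃ t : XCTerm 0 n, A.eval t = u}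
  elt t := ⟨A.eval t, t, rfl⟩
  push g u := ⟨u.1 ≫ A.eval g, by
    obtain ⟨u, t, rfl⟩ := u
    exact ⟨t.comp g, rfl⟩⟩
  tensor u v := ⟨A.powTensor u.1 v.1, by
    obtain ⟨u, s, rfl⟩ := u
    obtain ⟨v, t, rfl⟩ := v
    exact ⟨s.tensor t, rfl⟩⟩

namespace XCElements

variable (S : XCElements.{w})

/-- The product `u · v = μ^{[n]} (u ⊗ v)`. -/
def dot {n : ℕ} (u v : S.U n) : S.U n := S.push (XCTerm.mulN n) (S.tensor u v)

/-- The virtual category of elements. -/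
def vE : EndoCat.{w} where
  Hom n := S.U n × Equiv.Perm (Fin n)
  one n := (S.elt (XCTerm.unitN n), 1)
  comp f g := (S.dot (S.push (XCTerm.perm g.2⁻¹) f.1) g.1, f.2 * g.2)
  tensor f g := (S.tensor f.1 g.1, blockSum f.2 g.2)
  braid n m := (S.elt (XCTerm.unitN (n + m)), blockSwap n m)

/-! The external algebra action on the virtual category of elements, for the arrows `P_τ`,
`Id_n ⊗ μ` and `Id_n ⊗ η`, which generate the PROP for algebras. -/

/-- The action of `P_τ`. -/
def reorder {n : ℕ} (τ : Equiv.Perm (Fin n)) (f : S.vE.Hom n) : S.vE.Hom n :=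
  (S.push (XCTerm.perm τ) f.1, f.2 * τ⁻¹)

/-- The action of `Id_n ⊗ μ`: in the permutation, the outgoing end of the first of the two merged
strands and the incoming end of the second one are removed, the remaining ones are shifted. -/
def merge {n : ℕ} (f : S.vE.Hom (n + 2)) : S.vE.Hom (n + 1) :=
  (S.push (XCTerm.tensor (XCTerm.id n) XCTerm.mul) f.1,
    Equiv.removeNone (((finSuccEquiv' (Fin.last n).castSucc).symm.trans f.2).trans
      (finSuccEquiv' (f.2 (Fin.last (n + 1))))))

/-- The action of `Id_n ⊗ η`. -/
def insertUnit {n : ℕ} (f : S.vE.Hom n) : S.vE.Hom (n + 1) :=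
  (S.push (XCTerm.tensor (XCTerm.id n) XCTerm.unit) f.1, blockSum f.2 1)

/-- The symmetric monoidal functor `Z_A` from XC-tangles to the virtual category of elements: it is
the identity on objects, compatible with the external algebra action and has the prescribed values
on the generators. -/
structure IsUniversalInvariant (Z : EndoCat.Functor txc S.vE) : Prop where
  map_X : Z.map (XCTangle.X true) = (S.elt XCTerm.R, Equiv.swap 0 1)
  map_X_neg : Z.map (XCTangle.X false)
    = (S.elt (XCTerm.comp XCTerm.Rinv (XCTerm.braid 1 1)), Equiv.swap 0 1)
  map_C : Z.map (XCTangle.C 1) = (S.elt XCTerm.kappaInv, 1)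
  map_C_neg : Z.map (XCTangle.C (-1)) = (S.elt XCTerm.kappa, 1)
  map_reorder : ∀ {n} (τ : Equiv.Perm (Fin n)) (T : XCTangle n),
    Z.map (T.reorder τ) = S.reorder τ (Z.map T)
  map_merge : ∀ {n} (T : XCTangle (n + 2)) (T' : XCTangle (n + 1)), T.IsMerge T' →
    Z.map T' = S.merge (Z.map T)
  map_insert : ∀ {n} (T : XCTangle n), Z.map T.insertEdge = S.insertUnit (Z.map T)

end XCElements

/-- The universal virtual category of elements `vE(XC)`. -/
abbrev vEXC : EndoCat.{0} := universalElements.vE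

/-- The virtual category of elements `vE(A)` of an XC-algebra object. -/
abbrev XCAlgebra.vE {C : Type u} [Category.{v} C] [MonoidalCategory C] [SymmetricCategory C]
    (A : XCAlgebra C) : EndoCat.{v} := A.elements.vE

/-- The functor `vE(XC) ⟶ vE(A)` is the canonical one: it sends an arrow of `XC` to its image under
`A` and leaves permutations unchanged. -/
def XCAlgebra.IsCanonical {C : Type u} [Category.{v} C] [MonoidalCategory C] [SymmetricCategory C]
    (A : XCAlgebra C) (Φ : EndoCat.Functor vEXC A.vE) : Prop :=
  ∀ {n : ℕ} (t : XCTerm 0 n) (σ : Equiv.Perm (Fin n)),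
    Φ.map (XCHom.mk t, σ) = (A.elements.elt t, σ)

/-! ## Calculus in the PROP `XC` -/

namespace XCHom

variable {a b c d a' b' c' d' n m k : ℕ}

/-- The identity, as an arrow between equal objects. -/
def cst (h : a = b) : XCHom a b := mk (.cast h)

/-- The symmetry. -/
def br (a b : ℕ) : XCHom (a + b) (b + a) := mk (.braid a b)

theorem sound {s t : XCTerm a b} (h : XCTerm.Rel s t) : mk s = mk t := Quot.sound h

@[elab_as_elim]
theorem ind {p : XCHom a b → Prop} (h : ∀ t, p (mk t)) (f : XCHom a b) : p f := Quot.ind h f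

theorem tensor_mk (s : XCTerm a b) (t : XCTerm c d) : (mk s).tensor (mk t) = mk (s.tensor t) := rfl

theorem mk_cast (h : a = b) : mk (.cast h) = cst h := rfl

theorem mk_braid (a b : ℕ) : mk (.braid a b) = br a b := rfl

theorem id_comp (f : XCHom a b) : (cst rfl).comp f = f := by
  induction f using ind with | _ f => exact sound (.id_comp f)

theorem comp_id (f : XCHom a b) : f.comp (cst rfl) = f := by
  induction f using ind with | _ f => exact sound (.comp_id f)

theorem comp_assoc (f : XCHom a b) (g : XCHom b c) (h : XCHom c d) :
    (f.comp g).comp h = f.comp (g.comp h) := by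
  induction f using ind with | _ f =>
  induction g using ind with | _ g =>
  induction h using ind with | _ h => exact sound (.comp_assoc f g h)

theorem cst_comp_cst (h : a = b) (h' : b = c) : (cst h).comp (cst h') = cst (h.trans h') := by
  subst h; exact id_comp _

theorem tensor_id (a b : ℕ) : (cst rfl : XCHom a a).tensor (cst rfl : XCHom b b) = cst rfl :=
  sound (.tensor_id a b)

theorem cst_tensor_cst (h : a = b) (h' : c = d) :
    (cst h).tensor (cst h') = cst (congrArg₂ (· + ·) h h') := by
  subst h h'; exact tensor_id _ _

theorem tensor_comp (f : XCHom a b) (g : XCHom b c) (f' : XCHom a' b') (g' : XCHom b' c') :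
    (f.comp g).tensor (f'.comp g') = (f.tensor f').comp (g.tensor g') := by
  induction f using ind with | _ f =>
  induction g using ind with | _ g =>
  induction f' using ind with | _ f' =>
  induction g' using ind with | _ g' => exact sound (.tensor_comp f g f' g')

theorem tensor_assoc (f : XCHom a a') (g : XCHom b b') (h : XCHom c c') :
    ((f.tensor g).tensor h).comp (cst (Nat.add_assoc a' b' c'))
      = (cst (Nat.add_assoc a b c)).comp (f.tensor (g.tensor h)) := by
  induction f using ind with | _ f =>
  induction g using ind with | _ g =>
  induction h using ind with | _ h => exact sound (.tensor_assoc f g h)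

theorem unit_tensor (f : XCHom a b) :
    ((cst rfl : XCHom 0 0).tensor f).comp (cst (Nat.zero_add b))
      = (cst (Nat.zero_add a)).comp f := by
  induction f using ind with | _ f => exact sound (.unit_tensor f)

theorem tensor_unit (f : XCHom a b) : f.tensor (cst rfl : XCHom 0 0) = f := by
  have h : (f.tensor (cst rfl : XCHom 0 0)).comp (cst rfl) = (cst rfl).comp f := by
    induction f using ind with | _ f => exact sound (.tensor_unit f)
  rwa [comp_id, id_comp] at h

theorem braid_natural (f : XCHom a b) (g : XCHom c d) :
    (f.tensor g).comp (br b d) = (br a c).comp (g.tensor f) := by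
  induction f using ind with | _ f =>
  induction g using ind with | _ g => exact sound (.braid_natural f g)

theorem br_br (a b : ℕ) : (br a b).comp (br b a) = cst rfl := sound (.braid_braid a b)

theorem hexagon (a b c : ℕ) :
    br a (b + c) = (cst (Nat.add_assoc a b c).symm).comp (((br a b).tensor (cst rfl)).comp
      ((cst (Nat.add_assoc b a c)).comp
        (((cst rfl).tensor (br a c)).comp (cst (Nat.add_assoc b c a).symm)))) :=
  sound (.hexagon a b c)

/-- `f ⊗ Id` -/
def wr (f : XCHom a b) (c : ℕ) : XCHom (a + c) (b + c) := f.tensor (cst rfl)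

/-- `Id ⊗ f` -/
def wl (c : ℕ) (f : XCHom a b) : XCHom (c + a) (c + b) := (cst rfl).tensor f

theorem wr_comp (f : XCHom a b) (g : XCHom b c) (k : ℕ) :
    (f.comp g).wr k = (f.wr k).comp (g.wr k) := by
  rw [wr, wr, wr, ← tensor_comp, id_comp]

theorem wl_comp (f : XCHom a b) (g : XCHom b c) (k : ℕ) :
    wl k (f.comp g) = (wl k f).comp (wl k g) := by
  rw [wl, wl, wl, ← tensor_comp, id_comp]

theorem wr_wl (f : XCHom a b) (g : XCHom c d) :
    (f.wr c).comp (wl b g) = f.tensor g := by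
  rw [wr, wl, ← tensor_comp, id_comp, comp_id]

theorem wl_wr (f : XCHom a b) (g : XCHom c d) :
    (wl a g).comp (f.wr d) = f.tensor g := by
  rw [wr, wl, ← tensor_comp, id_comp, comp_id]

theorem exch (f : XCHom a b) (g : XCHom c d) :
    (f.wr c).comp (wl b g) = (wl a g).comp (f.wr d) := by
  rw [wr_wl, wl_wr]

theorem wr_wr_one (f : XCHom a b) : (f.wr k).wr 1 = f.wr (k + 1) := by
  have h := tensor_assoc f (cst rfl : XCHom k k) (cst rfl : XCHom 1 1)
  rw [tensor_id] at h
  exact (comp_id _).symm.trans (h.trans (id_comp _))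

theorem wl_wr_one (f : XCHom a b) : (wl k f).wr 1 = wl k (f.wr 1) := by
  have h := tensor_assoc (cst rfl : XCHom k k) f (cst rfl : XCHom 1 1)
  exact (comp_id _).symm.trans (h.trans (id_comp _))

theorem wl_wl_two (f : XCHom 2 2) : wl a (wl n f) = wl (a + n) f := by
  have h := tensor_assoc (cst rfl : XCHom a a) (cst rfl : XCHom n n) f
  rw [tensor_id] at h
  exact ((comp_id _).symm.trans (h.trans (id_comp _))).symm

theorem wr_cst (h : a = b) : (cst h).wr k = cst (congrArg (· + k) h) := by
  subst h; exact tensor_id _ _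

theorem wl_cst (h : a = b) : wl k (cst h) = cst (congrArg (k + ·) h) := by
  subst h; exact tensor_id _ _

/-- The symmetry of the last two strands. -/
def top (n : ℕ) : XCHom (n + 2) (n + 2) := wl n (br 1 1)

theorem top_top (n : ℕ) : (top n).comp (top n) = cst rfl := by
  rw [top, ← wl_comp]
  exact (congrArg (wl n) (br_br 1 1)).trans (wl_cst rfl)

theorem yang_baxter (n : ℕ) :
    ((top (n + 1)).comp ((top n).wr 1)).comp (top (n + 1))
      = ((top n).wr 1).comp ((top (n + 1)).comp ((top n).wr 1)) := by
  have e1 : top (n + 1) = wl n (wl 1 (br 1 1)) := (wl_wl_two _).symm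
  have e2 : (top n).wr 1 = wl n ((br 1 1).wr 1) := wl_wr_one _
  have hx : br 1 2 = ((br 1 1).wr 1).comp (wl 1 (br 1 1)) := by
    have h := hexagon 1 1 1
    have hc : ∀ f : XCHom 3 3, (cst rfl : XCHom 3 3).comp f = f := id_comp
    have hc' : ∀ f : XCHom 3 3, f.comp (cst rfl : XCHom 3 3) = f := comp_id
    refine h.trans ((hc _).trans ?_)
    refine congrArg (fun z : XCHom 3 3 => ((br 1 1).wr 1).comp z) ?_
    exact (hc _).trans (hc' _)
  have nat : (wl 1 (br 1 1)).comp (br 1 2) = (br 1 2).comp ((br 1 1).wr 1) :=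
    braid_natural (cst rfl : XCHom 1 1) (br 1 1)
  rw [hx] at nat
  have nat' := congrArg (wl n) nat
  rw [wl_comp, wl_comp, wl_comp, wl_comp, ← e2, ← e1] at nat'
  rw [comp_assoc, nat', comp_assoc]

theorem top_comm (f : XCHom n n) :
    (top n).comp ((f.wr 1).wr 1) = ((f.wr 1).wr 1).comp (top n) := by
  rw [wr_wr_one]; exact (exch f (br 1 1)).symm

end XCHom

/-! ### Words in the elementary transpositions -/

namespace StrandPerm

/-- The transposition of the last two points. -/
def top (n : ℕ) : Equiv.Perm (Fin (n + 2)) := Equiv.swap (Fin.last (n + 1)) (Fin.last n).castSucc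

/-- A permutation is extended to one more point. -/
def ext {n : ℕ} (τ : Equiv.Perm (Fin n)) : Equiv.Perm (Fin (n + 1)) := blockSum τ 1

@[simp] theorem ext_last {n : ℕ} (τ : Equiv.Perm (Fin n)) : ext τ (Fin.last n) = Fin.last n := by
  have h : finSumFinEquiv.symm (Fin.last n) = (Sum.inr 0 : Fin n ⊕ Fin 1) := by
    rw [Equiv.symm_apply_eq]; rfl
  simp only [ext, blockSum, Equiv.trans_apply, h]; rfl

@[simp] theorem ext_castSucc {n : ℕ} (τ : Equiv.Perm (Fin n)) (i : Fin n) :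
    ext τ i.castSucc = (τ i).castSucc := by
  have h : finSumFinEquiv.symm i.castSucc = (Sum.inl i : Fin n ⊕ Fin 1) := by
    rw [Equiv.symm_apply_eq]; rfl
  simp only [ext, blockSum, Equiv.trans_apply, h]; rfl

theorem ext_mul {n : ℕ} (σ τ : Equiv.Perm (Fin n)) : ext (σ * τ) = ext σ * ext τ := by
  ext i; induction i using Fin.lastCases <;> simp

theorem ext_one (n : ℕ) : ext (1 : Equiv.Perm (Fin n)) = 1 := by
  ext i; induction i using Fin.lastCases <;> simp

theorem ext_injective {n : ℕ} {σ τ : Equiv.Perm (Fin n)} (h : ext σ = ext τ) : σ = τ := by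
  ext i
  have := congrArg (fun ρ => (ρ i.castSucc : ℕ)) h
  simpa using this

@[simp] theorem top_last (n : ℕ) : top n (Fin.last (n + 1)) = (Fin.last n).castSucc :=
  Equiv.swap_apply_left _ _

@[simp] theorem top_castSucc_last (n : ℕ) : top n (Fin.last n).castSucc = Fin.last (n + 1) :=
  Equiv.swap_apply_right _ _

@[simp] theorem top_castSucc_castSucc {n : ℕ} (i : Fin n) :
    top n i.castSucc.castSucc = i.castSucc.castSucc := by
  refine Equiv.swap_apply_of_ne_of_ne ?_ ?_ <;> (rw [Ne, Fin.ext_iff]; simp; omega)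

theorem top_mul_top (n : ℕ) : top n * top n = 1 := Equiv.swap_mul_self _ _

theorem braid_rel (n : ℕ) : top (n + 1) * (ext (top n) * top (n + 1))
    = ext (top n) * top (n + 1) * ext (top n) := by
  refine Equiv.ext fun i => ?_
  induction i using Fin.lastCases with
  | last => simp
  | cast i =>
    induction i using Fin.lastCases with
    | last => simp
    | cast i => induction i using Fin.lastCases <;> simp

theorem top_ext_ext {n : ℕ} (τ : Equiv.Perm (Fin n)) :
    ext (ext τ) * top n = top n * ext (ext τ) := by
  refine Equiv.ext fun i => ?_
  induction i using Fin.lastCases with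
  | last => simp
  | cast i => induction i using Fin.lastCases <;> simp

/-- The elementary transpositions, as arrows and as permutations. -/
inductive Letter : ∀ n, XCHom n n → Equiv.Perm (Fin n) → Prop
  | top (n) : Letter (n + 2) (XCHom.top n) (top n)
  | ext {n f τ} : Letter n f τ → Letter (n + 1) (f.wr 1) (ext τ)

/-- Products of elementary transpositions. -/
inductive Word : ∀ n, XCHom n n → Equiv.Perm (Fin n) → Prop
  | nil (n) : Word n (XCHom.cst rfl) 1
  | snoc {n f τ g ρ} : Word n f τ → Letter n g ρ → Word n (f.comp g) (ρ * τ)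

/-- The arrow that moves the last strand to some position. -/
inductive Cyc : ∀ n, XCHom (n + 1) (n + 1) → Equiv.Perm (Fin (n + 1)) → Prop
  | nil (n) : Cyc n (XCHom.cst rfl) 1
  | cons {n g ρ} : Cyc n g ρ → Cyc (n + 1) ((XCHom.top n).comp (g.wr 1)) (ext ρ * top n)

/-- Normal forms. -/
inductive NF : ∀ n, XCHom n n → Equiv.Perm (Fin n) → Prop
  | zero : NF 0 (XCHom.cst rfl) 1
  | succ {n f τ g ρ} : NF n f τ → Cyc n g ρ → NF (n + 1) ((f.wr 1).comp g) (ρ * ext τ)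

theorem Cyc.unique {n g ρ} (h : Cyc n g ρ) : ∀ {g' ρ'}, Cyc n g' ρ' →
    ρ (Fin.last n) = ρ' (Fin.last n) → g = g' ∧ ρ = ρ' := by
  induction h with
  | nil n =>
    intro g' ρ' h' e
    cases h' with
    | nil => exact ⟨rfl, rfl⟩
    | cons h' => simp [Fin.ext_iff] at e; omega
  | @cons n g ρ h ih =>
    intro g' ρ' h' e
    cases h' with
    | nil => simp [Fin.ext_iff] at e; omega
    | cons h' =>
      obtain ⟨rfl, rfl⟩ := ih h' (by simpa using e)
      exact ⟨rfl, rfl⟩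

theorem Cyc.letter {n g ρ} (h : Cyc n g ρ) : ∀ {f τ}, Letter (n + 1) f τ →
    (∃ g' ρ', Cyc n g' ρ' ∧ g.comp f = g' ∧ τ * ρ = ρ') ∨
    ∃ f' τ', Letter n f' τ' ∧ g.comp f = (f'.wr 1).comp g ∧ τ * ρ = ρ * ext τ' := by
  induction h with
  | nil n =>
    intro f τ l
    cases l with
    | top m =>
      refine Or.inl ⟨_, _, Cyc.cons (Cyc.nil m), ?_, ?_⟩
      · rw [XCHom.id_comp, XCHom.wr_cst]; exact (XCHom.comp_id _).symm
      · rw [ext_one, one_mul, mul_one]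
    | @ext n f τ l =>
      exact Or.inr ⟨f, τ, l, by rw [XCHom.id_comp, XCHom.comp_id], by rw [mul_one, one_mul]⟩
  | @cons n g ρ h ih =>
    intro f τ l
    cases l with
    | top =>
      cases h with
      | nil =>
        refine Or.inl ⟨_, _, Cyc.nil _, ?_, ?_⟩
        · rw [XCHom.wr_cst]
          exact (congrArg (fun z => XCHom.comp z (XCHom.top n)) (XCHom.comp_id _)).trans
            (XCHom.top_top n)
        · rw [ext_one, one_mul, top_mul_top]
      | @cons m g ρ h =>
        refine Or.inr ⟨_, _, Letter.top m, ?_, ?_⟩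
        · rw [XCHom.wr_comp, XCHom.comp_assoc, XCHom.comp_assoc, ← XCHom.top_comm,
            ← XCHom.comp_assoc, ← XCHom.comp_assoc, XCHom.yang_baxter, XCHom.comp_assoc,
            XCHom.comp_assoc]
        · rw [ext_mul, mul_assoc, ← mul_assoc (top (m + 1)), ← top_ext_ext, mul_assoc, braid_rel]
          simp only [mul_assoc]
    | @ext _ f τ l =>
      rcases ih l with ⟨g', ρ', c, e1, e2⟩ | ⟨f', τ', l', e1, e2⟩
      · refine Or.inl ⟨_, _, Cyc.cons c, ?_, ?_⟩
        · rw [XCHom.comp_assoc, ← XCHom.wr_comp, e1]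
        · rw [← mul_assoc, ← ext_mul, e2]
      · refine Or.inr ⟨_, _, Letter.ext l', ?_, ?_⟩
        · rw [XCHom.comp_assoc, ← XCHom.wr_comp, e1, XCHom.wr_comp, ← XCHom.comp_assoc,
            XCHom.top_comm, XCHom.comp_assoc]
        · rw [← mul_assoc, ← ext_mul, e2, ext_mul, mul_assoc, top_ext_ext, mul_assoc]

theorem NF.letter {n f τ} (h : NF n f τ) : ∀ {g ρ}, Letter n g ρ → NF n (f.comp g) (ρ * τ) := by
  induction h with
  | zero => intro g ρ l; cases l
  | @succ n f τ g ρ h c ih =>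
    intro f' τ' l
    rcases c.letter l with ⟨g', ρ', c', rfl, rfl⟩ | ⟨f'', τ'', l', e1, e2⟩
    · rw [XCHom.comp_assoc, ← mul_assoc]
      exact .succ h c'
    · rw [XCHom.comp_assoc, e1, ← XCHom.comp_assoc, ← XCHom.wr_comp, ← mul_assoc, e2, mul_assoc,
        ← ext_mul]
      exact .succ (ih l') c

theorem NF.nil : ∀ n, NF n (XCHom.cst rfl) 1
  | 0 => .zero
  | n + 1 => by
    have h := NF.succ (NF.nil n) (Cyc.nil n)
    rwa [XCHom.comp_id, XCHom.wr_cst, ext_one, mul_one] at h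

theorem Word.nf {n f τ} (h : Word n f τ) : NF n f τ := by
  induction h with
  | nil => exact NF.nil n
  | snoc _ l ih => exact ih.letter l

theorem NF.unique {n f τ} (h : NF n f τ) : ∀ {f'}, NF n f' τ → f = f' := by
  induction h with
  | zero => intro f' h'; cases h'; rfl
  | @succ n f τ g ρ h c ih =>
    intro f' h'
    generalize hσ : ρ * ext τ = σ at h'
    cases h' with
    | @succ _ f' τ' g' ρ' h' c' =>
      have hl : ρ (Fin.last n) = ρ' (Fin.last n) := by
        simpa using congrArg (fun σ => σ (Fin.last n)) hσ
      obtain ⟨rfl, rfl⟩ := c.unique c' hl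
      have := ext_injective (mul_left_cancel hσ)
      subst this
      rw [ih h']

theorem Word.unique {n f f' τ} (h : Word n f τ) (h' : Word n f' τ) : f = f' :=
  h.nf.unique h'.nf

theorem Word.letter {n f τ} (h : Letter n f τ) : Word n f τ := by
  have := Word.snoc (.nil n) h
  rwa [XCHom.id_comp, mul_one] at this

theorem Word.comp {n f τ g ρ} (h : Word n f τ) (h' : Word n g ρ) : Word n (f.comp g) (ρ * τ) := by
  induction h' with
  | nil => rwa [XCHom.comp_id, one_mul]
  | snoc _ l ih => rw [← XCHom.comp_assoc, mul_assoc]; exact ih.snoc l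

theorem Letter.inv {n f τ} (h : Letter n f τ) : f.comp f = XCHom.cst rfl ∧ τ * τ = 1 := by
  induction h with
  | top n => exact ⟨XCHom.top_top n, top_mul_top n⟩
  | ext _ ih => exact ⟨by rw [← XCHom.wr_comp, ih.1, XCHom.wr_cst], by rw [← ext_mul, ih.2, ext_one]⟩

theorem Word.inv {n f τ} (h : Word n f τ) : ∃ g, Word n g τ⁻¹ ∧ f.comp g = XCHom.cst rfl ∧
    g.comp f = XCHom.cst rfl := by
  induction h with
  | nil => exact ⟨_, by rw [inv_one]; exact .nil _, XCHom.id_comp _, XCHom.id_comp _⟩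
  | @snoc f τ g ρ h l ih =>
    obtain ⟨f', h', e1, e2⟩ := ih
    obtain ⟨l1, l2⟩ := l.inv
    refine ⟨g.comp f', ?_, ?_, ?_⟩
    · rw [mul_inv_rev, inv_eq_of_mul_eq_one_left l2]
      exact (Word.letter l).comp h'
    · rw [XCHom.comp_assoc, ← XCHom.comp_assoc g, l1, XCHom.id_comp, e1]
    · rw [XCHom.comp_assoc, ← XCHom.comp_assoc f', e2, XCHom.id_comp, l1]

/-! ### Structural arrows -/

/-- The block sum of two bijections. -/
def sumE {a b c d : ℕ} (σ : Fin a ≃ Fin b) (τ : Fin c ≃ Fin d) : Fin (a + c) ≃ Fin (b + d) :=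
  (finSumFinEquiv.symm.trans (Equiv.sumCongr σ τ)).trans finSumFinEquiv

/-- The bijection underlying the symmetry. -/
def brE (a b : ℕ) : Fin (a + b) ≃ Fin (b + a) :=
  (finSumFinEquiv.symm.trans (Equiv.sumComm _ _)).trans finSumFinEquiv

/-- `f` is a composite of elementary transpositions, with underlying bijection `τ`. -/
def Gen {a b : ℕ} (f : XCHom a b) (τ : Fin a ≃ Fin b) : Prop :=
  ∃ h : b = a, Word a (f.comp (XCHom.cst h)) (τ.trans (finCongr h))

theorem gen_self {n : ℕ} {f : XCHom n n} {τ : Equiv.Perm (Fin n)} : Gen f τ ↔ Word n f τ := by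
  constructor
  · rintro ⟨h, w⟩
    rw [XCHom.comp_id] at w
    exact w
  · intro w
    exact ⟨rfl, by rw [XCHom.comp_id]; exact w⟩

theorem Gen.card {a b : ℕ} {f : XCHom a b} {τ : Fin a ≃ Fin b} (h : Gen f τ) : b = a := h.1

theorem Gen.unique {a b : ℕ} {f f' : XCHom a b} {τ : Fin a ≃ Fin b} (h : Gen f τ)
    (h' : Gen f' τ) : f = f' := by
  obtain rfl := h.card
  exact (gen_self.1 h).unique (gen_self.1 h')

theorem Gen.cst {a b : ℕ} (h : a = b) : Gen (XCHom.cst h) (finCongr h) := by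
  subst h; exact gen_self.2 (.nil _)

theorem Gen.comp {a b c : ℕ} {f : XCHom a b} {τ : Fin a ≃ Fin b} {g : XCHom b c}
    {ρ : Fin b ≃ Fin c} (h : Gen f τ) (h' : Gen g ρ) : Gen (f.comp g) (τ.trans ρ) := by
  obtain rfl := h.card
  obtain rfl := h'.card
  exact gen_self.2 ((gen_self.1 h).comp (gen_self.1 h'))

theorem Gen.inv {a b : ℕ} {f : XCHom a b} {g : XCHom b a} {τ : Fin a ≃ Fin b} (h : Gen f τ)
    (e : g.comp f = XCHom.cst rfl) : Gen g τ.symm := by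
  obtain rfl := h.card
  obtain ⟨g', h', e1, e2⟩ := (gen_self.1 h).inv
  have : g = g' := by
    rw [← XCHom.comp_id g, ← e1, ← XCHom.comp_assoc, e, XCHom.id_comp]
  subst this
  exact gen_self.2 h'

@[simp] theorem sumE_castAdd {a b c d : ℕ} (σ : Fin a ≃ Fin b) (τ : Fin c ≃ Fin d) (i : Fin a) :
    sumE σ τ (Fin.castAdd c i) = Fin.castAdd d (σ i) := by
  simp [sumE]

@[simp] theorem sumE_natAdd {a b c d : ℕ} (σ : Fin a ≃ Fin b) (τ : Fin c ≃ Fin d) (i : Fin c) :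
    sumE σ τ (Fin.natAdd a i) = Fin.natAdd b (τ i) := by
  simp [sumE]

theorem sumE_refl (a b : ℕ) : sumE (Equiv.refl (Fin a)) (Equiv.refl (Fin b)) = Equiv.refl _ := by
  ext i; induction i using Fin.addCases <;> simp

theorem sumE_trans {a b c a' b' c' : ℕ} (σ : Fin a ≃ Fin b) (τ : Fin b ≃ Fin c)
    (σ' : Fin a' ≃ Fin b') (τ' : Fin b' ≃ Fin c') :
    (sumE σ σ').trans (sumE τ τ') = sumE (σ.trans τ) (σ'.trans τ') := by
  ext i; induction i using Fin.addCases <;> simp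

theorem sumE_one_add (a : ℕ) {n : ℕ} (τ : Equiv.Perm (Fin n)) :
    sumE (Equiv.refl (Fin a)) (ext τ) = ext (sumE (Equiv.refl (Fin a)) τ) := by
  refine Equiv.ext fun i => ?_
  induction i using Fin.lastCases with
  | last => exact (sumE_natAdd _ _ (Fin.last n)).trans ((congrArg (Fin.natAdd a) (ext_last τ)).trans (ext_last _).symm)
  | cast i =>
    rw [ext_castSucc]
    induction i using Fin.addCases with
    | left i => rw [sumE_castAdd]; exact sumE_castAdd _ _ i
    | right i =>
      rw [sumE_natAdd]
      exact (sumE_natAdd _ _ i.castSucc).trans (by rw [ext_castSucc]; rfl)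

theorem sumE_add_one (a : ℕ) {n : ℕ} (τ : Equiv.Perm (Fin n)) :
    sumE τ (Equiv.refl (Fin (a + 1))) = ext (sumE τ (Equiv.refl (Fin a))) := by
  refine Equiv.ext fun i => ?_
  induction i using Fin.lastCases with
  | last => exact (sumE_natAdd _ _ (Fin.last a)).trans (ext_last _).symm
  | cast i =>
    rw [ext_castSucc]
    induction i using Fin.addCases with
    | left i => rw [sumE_castAdd]; exact sumE_castAdd _ _ i
    | right i =>
      rw [sumE_natAdd]
      exact sumE_natAdd _ _ i.castSucc

theorem sumE_top (a n : ℕ) : sumE (Equiv.refl (Fin a)) (top n) = top (a + n) := by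
  refine Equiv.ext fun i => ?_
  induction i using Fin.lastCases with
  | last => exact (sumE_natAdd _ _ (Fin.last (n + 1))).trans ((congrArg (Fin.natAdd a) (top_last n)).trans (top_last _).symm)
  | cast i =>
    induction i using Fin.lastCases with
    | last =>
      exact (sumE_natAdd _ _ (Fin.last n).castSucc).trans
        ((congrArg (Fin.natAdd a) (top_castSucc_last n)).trans (top_castSucc_last _).symm)
    | cast i =>
      rw [top_castSucc_castSucc]
      induction i using Fin.addCases with
      | left i => exact sumE_castAdd _ _ i
      | right i =>
        exact (sumE_natAdd _ _ i.castSucc.castSucc).trans (by rw [top_castSucc_castSucc]; rfl)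

theorem Letter.wl {n f τ} (h : Letter n f τ) (a : ℕ) :
    Letter (a + n) (XCHom.wl a f) (sumE (Equiv.refl _) τ) := by
  induction h with
  | top n => rw [sumE_top]; exact (XCHom.wl_wl_two _).symm ▸ Letter.top (a + n)
  | ext h ih => rw [sumE_one_add, ← XCHom.wl_wr_one]; exact .ext ih

theorem Letter.wr {n f τ} (h : Letter n f τ) : ∀ a : ℕ,
    Letter (n + a) (f.wr a) (sumE τ (Equiv.refl _))
  | 0 => by
    have e : sumE τ (Equiv.refl (Fin 0)) = τ := by
      refine Equiv.ext fun i => ?_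
      exact sumE_castAdd τ (Equiv.refl (Fin 0)) i
    rw [e, XCHom.wr, XCHom.tensor_unit]; exact h
  | a + 1 => by rw [sumE_add_one, ← XCHom.wr_wr_one]; exact .ext (h.wr a)

theorem Word.wl {n f τ} (h : Word n f τ) (a : ℕ) :
    Word (a + n) (XCHom.wl a f) (sumE (Equiv.refl _) τ) := by
  induction h with
  | nil => rw [XCHom.wl_cst]; exact (sumE_refl a n).symm ▸ .nil _
  | @snoc f τ g ρ h l ih =>
    rw [XCHom.wl_comp]
    convert ih.snoc (l.wl a) using 1
    exact (sumE_trans (Equiv.refl _) (Equiv.refl _) τ ρ).symm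

theorem Word.wr {n f τ} (h : Word n f τ) (a : ℕ) :
    Word (n + a) (f.wr a) (sumE τ (Equiv.refl _)) := by
  induction h with
  | nil => rw [XCHom.wr_cst]; exact (sumE_refl n a).symm ▸ .nil _
  | @snoc f τ g ρ h l ih =>
    rw [XCHom.wr_comp]
    convert ih.snoc (l.wr a) using 1
    exact (sumE_trans τ ρ (Equiv.refl _) (Equiv.refl _)).symm

theorem Gen.tensor {a b c d : ℕ} {f : XCHom a b} {τ : Fin a ≃ Fin b} {g : XCHom c d}
    {ρ : Fin c ≃ Fin d} (h : Gen f τ) (h' : Gen g ρ) : Gen (f.tensor g) (sumE τ ρ) := by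
  obtain rfl := h.card
  obtain rfl := h'.card
  rw [← XCHom.wr_wl]
  convert gen_self.2 (((gen_self.1 h).wr d).comp ((gen_self.1 h').wl b)) using 1
  exact (sumE_trans τ (Equiv.refl _) (Equiv.refl _) ρ).symm

theorem Gen.congr {a b : ℕ} {f : XCHom a b} {τ τ' : Fin a ≃ Fin b} (h : Gen f τ)
    (e : ∀ i, (τ i : ℕ) = τ' i) : Gen f τ' := by
  have : τ = τ' := Equiv.ext fun i => Fin.ext (e i)
  exact this ▸ h

theorem brE_val {a b : ℕ} (i : Fin (a + b)) :
    (brE a b i : ℕ) = if (i : ℕ) < a then b + i else i - a := by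
  induction i using Fin.addCases <;> simp [brE]

theorem sumE_val {a b c d : ℕ} (σ : Fin a ≃ Fin b) (τ : Fin c ≃ Fin d) (i : Fin (a + c)) :
    (sumE σ τ i : ℕ) = if h : (i : ℕ) < a then (σ ⟨i, h⟩ : ℕ)
      else b + (τ ⟨i - a, by omega⟩ : ℕ) := by
  induction i using Fin.addCases with
  | left i => simp
  | right i => simp

theorem br_zero (a : ℕ) : XCHom.br a 0 = XCHom.cst (Nat.add_comm a 0) := by
  have h := XCHom.hexagon a 0 0
  have e1 : (XCHom.br a 0).tensor (XCHom.cst rfl : XCHom 0 0) = XCHom.br a 0 := XCHom.tensor_unit _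
  have e2 := XCHom.unit_tensor (XCHom.br a 0)
  have e3 : ((XCHom.cst rfl : XCHom 0 0).tensor (XCHom.br a 0)) =
      ((XCHom.cst (Nat.zero_add a)).comp (XCHom.br a 0)).comp
        (XCHom.cst (Nat.zero_add (0 + a)).symm) := by
    rw [← e2, XCHom.comp_assoc, XCHom.cst_comp_cst, XCHom.comp_id]
  rw [e1, e3] at h
  have h2 : XCHom.br a 0 = (XCHom.br a 0).comp
      ((XCHom.cst (Nat.zero_add a)).comp (XCHom.br a 0)) := by
    refine h.trans ((XCHom.id_comp _).trans (congrArg _ ?_))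
    rw [XCHom.comp_assoc _ _ (XCHom.cst _), XCHom.comp_assoc, XCHom.cst_comp_cst,
      ← XCHom.comp_assoc (XCHom.cst _) (XCHom.cst _), XCHom.cst_comp_cst]
    exact congrArg _ (XCHom.comp_id _)
  have h3 := congrArg (fun z => (XCHom.br 0 a).comp z) h2
  simp only [← XCHom.comp_assoc, XCHom.br_br] at h3
  rw [XCHom.comp_assoc, XCHom.id_comp] at h3
  have h4 := congrArg (fun z => (XCHom.cst (Nat.zero_add a).symm).comp z) h3
  simp only [← XCHom.comp_assoc, XCHom.cst_comp_cst] at h4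
  rw [XCHom.id_comp] at h4
  exact h4.symm

theorem gen_br_zero (a : ℕ) : Gen (XCHom.br a 0) (brE a 0) := by
  rw [br_zero]
  refine (Gen.cst _).congr fun i => ?_
  have := i.2
  show (i : ℕ) = brE a 0 i
  rw [brE_val, if_pos (by omega), zero_add]

theorem gen_br_succ {a b : ℕ} (h : Gen (XCHom.br a b) (brE a b))
    (h1 : Gen (XCHom.br a 1) (brE a 1)) : Gen (XCHom.br a (b + 1)) (brE a (b + 1)) := by
  rw [XCHom.hexagon]
  refine (((Gen.cst _).comp ((h.tensor (Gen.cst rfl)).comp ((Gen.cst _).comp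
    (((Gen.cst rfl).tensor h1).comp (Gen.cst _)))))).congr fun i => ?_
  simp only [Equiv.trans_apply, finCongr_apply, Fin.val_cast, sumE_val, brE_val, finCongr_refl,
    Equiv.refl_apply]
  grind

theorem gen_br_one : ∀ a : ℕ, Gen (XCHom.br 1 a) (brE 1 a)
  | 0 => gen_br_zero 1
  | a + 1 => by
    refine gen_br_succ (gen_br_one a) (gen_self.2 ?_)
    have h : XCHom.br 1 1 = XCHom.top 0 := by
      have := XCHom.unit_tensor (XCHom.br 1 1)
      exact ((XCHom.comp_id _).symm.trans (this.trans (XCHom.id_comp _))).symm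
    have h' : brE 1 1 = top 0 := by decide
    rw [h, h']
    exact .letter (.top 0)

theorem gen_br (a : ℕ) : ∀ b : ℕ, Gen (XCHom.br a b) (brE a b)
  | 0 => gen_br_zero a
  | b + 1 => by
    refine gen_br_succ (gen_br a b) (((gen_br_one a).inv (XCHom.br_br a 1)).congr fun i => ?_)
    rfl

theorem removeLast_spec {n : ℕ} (σ : Equiv.Perm (Fin (n + 1))) (i : Fin n) :
    (σ (Fin.last n)).succAbove (XCTerm.removeLast σ i) = σ i.castSucc := by
  have hne : σ i.castSucc ≠ σ (Fin.last n) := fun h => by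
    have := σ.injective h
    simp [Fin.ext_iff] at this; omega
  set e := (finSuccEquivLast.symm.trans σ).trans (finSuccEquiv' (σ (Fin.last n))) with he
  obtain ⟨j, hj⟩ := Fin.exists_succAbove_eq hne
  have h1 : e (some i) = some j := by
    simp [he, ← hj]
  have h2 := Equiv.removeNone_some e ⟨j, h1⟩
  rw [h1, Option.some_inj] at h2
  rw [XCTerm.removeLast, ← he, h2, hj]

theorem gen_perm : ∀ {n : ℕ} (σ : Equiv.Perm (Fin n)), Gen (XCHom.mk (XCTerm.perm σ)) σ
  | 0, σ => (Gen.cst rfl).congr fun i => i.elim0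
  | n + 1, σ => by
    refine (((gen_perm (XCTerm.removeLast σ)).tensor (Gen.cst rfl)).comp ((Gen.cst _).comp
      (((Gen.cst rfl).tensor (gen_br _ 1)).comp (Gen.cst _)))).congr fun i => ?_
    simp only [Equiv.trans_apply, finCongr_apply, Fin.val_cast, sumE_val, brE_val, finCongr_refl,
      Equiv.refl_apply]
    induction i using Fin.lastCases with
    | last => simp; omega
    | cast i =>
      have h := congrArg Fin.val (removeLast_spec σ i)
      have hi := i.2
      have hp := (σ (Fin.last n)).2
      have hr := (XCTerm.removeLast σ i).2
      simp only [Fin.succAbove, Fin.lt_def] at h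
      simp only [Fin.val_castSucc, hi, dite_true, Fin.eta]
      split_ifs at h <;> simp at h <;> grind

end StrandPerm

namespace XCHom

open StrandPerm

variable {a b c d : ℕ}

/-- The symmetry induced by a bijection. -/
def P (τ : Fin a ≃ Fin b) : XCHom a b :=
  (mk (.perm (τ.trans (finCongr (by simpa using (Fintype.card_congr τ).symm))))).comp
    (cst (by simpa using Fintype.card_congr τ))

theorem gen_P (τ : Fin a ≃ Fin b) : Gen (P τ) τ :=
  ((gen_perm _).comp (Gen.cst _)).congr fun _ => rfl

theorem _root_.StrandPerm.Gen.eq_P {f : XCHom a b} {τ : Fin a ≃ Fin b} (h : Gen f τ) : f = P τ :=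
  h.unique (gen_P τ)

theorem P_refl (a : ℕ) : P (Equiv.refl (Fin a)) = cst rfl := (Gen.cst rfl).eq_P.symm

theorem P_trans (τ : Fin a ≃ Fin b) (ρ : Fin b ≃ Fin c) : (P τ).comp (P ρ) = P (τ.trans ρ) :=
  ((gen_P τ).comp (gen_P ρ)).eq_P

theorem P_tensor (τ : Fin a ≃ Fin b) (ρ : Fin c ≃ Fin d) : (P τ).tensor (P ρ) = P (sumE τ ρ) :=
  ((gen_P τ).tensor (gen_P ρ)).eq_P

theorem P_wr (τ : Fin a ≃ Fin b) (c : ℕ) : (P τ).wr c = P (sumE τ (Equiv.refl (Fin c))) := by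
  rw [← P_tensor, P_refl, wr]

theorem P_wl (τ : Fin a ≃ Fin b) (c : ℕ) : wl c (P τ) = P (sumE (Equiv.refl (Fin c)) τ) := by
  rw [← P_tensor, P_refl, wl]

theorem cst_eq_P (h : a = b) : cst h = P (finCongr h) := (Gen.cst h).eq_P

theorem br_eq_P (a b : ℕ) : br a b = P (brE a b) := (gen_br a b).eq_P

end XCHom

/-! ## Elements of the PROP with strands labelled by a type -/

namespace XCHom

variable {a b c d a' b' c' d' n m k r : ℕ}

theorem cst_comp_wl (k a : ℕ) (g : XCHom b c) :
    (cst (Nat.add_assoc k a b)).comp (wl k (wl a g))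
      = (wl (k + a) g).comp (cst (Nat.add_assoc k a c)) := by
  have h := tensor_assoc (cst rfl : XCHom k k) (cst rfl : XCHom a a) g
  rw [tensor_id] at h
  exact h.symm

theorem comp_P_P (u : XCHom d a) (τ : Fin a ≃ Fin b) (ρ : Fin b ≃ Fin c) :
    (u.comp (P τ)).comp (P ρ) = u.comp (P (τ.trans ρ)) := by
  rw [comp_assoc, P_trans]

theorem P_congr {τ τ' : Fin a ≃ Fin b} (h : ∀ i, τ i = τ' i) : P τ = P τ' :=
  congrArg P (Equiv.ext h)

end XCHom

/-- Juxtaposition of numberings. -/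
def joinE {n m : ℕ} {S T : Type} (e : Fin n ≃ S) (f : Fin m ≃ T) : Fin (n + m) ≃ S ⊕ T :=
  finSumFinEquiv.symm.trans (Equiv.sumCongr e f)

section

variable {n m n' m' : ℕ} {S T : Type}

@[simp] theorem joinE_castAdd (e : Fin n ≃ S) (f : Fin m ≃ T) (i : Fin n) :
    joinE e f (Fin.castAdd m i) = Sum.inl (e i) := by simp [joinE]

@[simp] theorem joinE_natAdd (e : Fin n ≃ S) (f : Fin m ≃ T) (i : Fin m) :
    joinE e f (Fin.natAdd n i) = Sum.inr (f i) := by simp [joinE]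

@[simp] theorem joinE_symm_inl (e : Fin n ≃ S) (f : Fin m ≃ T) (i : S) :
    (joinE e f).symm (Sum.inl i) = Fin.castAdd m (e.symm i) := by simp [joinE]

@[simp] theorem joinE_symm_inr (e : Fin n ≃ S) (f : Fin m ≃ T) (i : T) :
    (joinE e f).symm (Sum.inr i) = Fin.natAdd n (f.symm i) := by simp [joinE]

theorem joinE_trans_symm (e : Fin n ≃ S) (f : Fin m ≃ T) (e' : Fin n' ≃ S) (f' : Fin m' ≃ T) :
    (joinE e f).trans (joinE e' f').symm
      = StrandPerm.sumE (e.trans e'.symm) (f.trans f'.symm) := by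
  ext i; induction i using Fin.addCases <;> simp

end

/-- The exchange of the last two summands. -/
def sumRC (A B C : Type) : (A ⊕ B) ⊕ C ≃ (A ⊕ C) ⊕ B where
  toFun
    | .inl (.inl x) => .inl (.inl x)
    | .inl (.inr x) => .inr x
    | .inr x => .inl (.inr x)
  invFun
    | .inl (.inl x) => .inl (.inl x)
    | .inl (.inr x) => .inr x
    | .inr x => .inl (.inr x)
  left_inv := by rintro ((x | x) | x) <;> rfl
  right_inv := by rintro ((x | x) | x) <;> rfl

@[simp] theorem sumRC_inl_inl {A B C : Type} (x : A) :
    sumRC A B C (.inl (.inl x)) = .inl (.inl x) := rfl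
@[simp] theorem sumRC_inl_inr {A B C : Type} (x : B) : sumRC A B C (.inl (.inr x)) = .inr x := rfl
@[simp] theorem sumRC_inr {A B C : Type} (x : C) : sumRC A B C (.inr x) = .inl (.inr x) := rfl
@[simp] theorem sumRC_symm (A B C : Type) : (sumRC A B C).symm = sumRC A C B := by
  refine Equiv.ext fun x => ?_
  rcases x with (x | x) | x <;> rfl

theorem sumRC_trans (A B C : Type) : (sumRC A B C).trans (sumRC A C B) = Equiv.refl _ := by
  refine Equiv.ext fun x => ?_
  rcases x with (x | x) | x <;> rfl

/-- An arrow `0 ⟶ n` together with a numbering of `S`. -/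
structure Numbered (S : Type) where
  n : ℕ
  e : Fin n ≃ S
  u : XCHom 0 n

/-- Renumbering. -/
def Numbered.setoid (S : Type) : Setoid (Numbered S) where
  r p q := q.u = p.u.comp (XCHom.P (p.e.trans q.e.symm))
  iseqv :=
    { refl := fun p => by rw [Equiv.self_trans_symm, XCHom.P_refl, XCHom.comp_id]
      symm := fun {p q} h => by
        rw [h, XCHom.comp_P_P]
        refine ((congrArg _ ?_).trans (XCHom.comp_id p.u)).symm
        rw [← XCHom.P_refl]
        exact XCHom.P_congr fun i => by simp
      trans := fun {p q r} h h' => by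
        rw [h', h, XCHom.comp_P_P]
        exact congrArg _ (XCHom.P_congr fun i => by simp) }

/-- Arrows `0 ⟶ n` in the PROP `XC`, with factors labelled by the elements of `S`. -/
def Elts (S : Type) : Type := Quotient (Numbered.setoid S)

namespace Elts

open XCHom StrandPerm

variable {S T S' T' R R' Q : Type} {a b c d n m r : ℕ}

/-- The element given by a numbering. -/
def mk (e : Fin n ≃ S) (u : XCHom 0 n) : Elts S := Quotient.mk (Numbered.setoid S) ⟨n, e, u⟩

theorem mk_eq_mk {e : Fin n ≃ S} {u : XCHom 0 n} {e' : Fin m ≃ S} {v : XCHom 0 m} :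
    mk e u = mk e' v ↔ v = u.comp (P (e.trans e'.symm)) :=
  Quotient.eq (r := Numbered.setoid S)

theorem mk_inj {e : Fin n ≃ S} {u v : XCHom 0 n} (h : mk e u = mk e v) : u = v := by
  rw [mk_eq_mk, Equiv.self_trans_symm, P_refl, XCHom.comp_id] at h
  exact h.symm

theorem mk_renumber (e : Fin n ≃ S) (u : XCHom 0 n) (e' : Fin m ≃ S) :
    mk e u = mk e' (u.comp (P (e.trans e'.symm))) := mk_eq_mk.2 rfl

theorem exists_rep (x : Elts S) : ∃ (n : ℕ) (e : Fin n ≃ S) (u : XCHom 0 n), x = mk e u := by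
  induction x using Quotient.inductionOn with
  | _ p => exact ⟨p.n, p.e, p.u, rfl⟩

theorem exists_rep_of (e : Fin n ≃ S) (x : Elts S) : ∃ u : XCHom 0 n, x = mk e u := by
  obtain ⟨m, e', u, rfl⟩ := exists_rep x
  exact ⟨_, mk_renumber e' u e⟩

theorem finite_of (x : Elts S) : Finite S := by
  obtain ⟨m, e', u, rfl⟩ := exists_rep x
  exact Finite.of_equiv _ e'

/-- Renaming of the strands. -/
def map (f : S ≃ T) : Elts S → Elts T :=
  Quotient.map (sa := Numbered.setoid S) (sb := Numbered.setoid T) (fun p => ⟨p.n, p.e.trans f, p.u⟩)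
    (fun p q h => by
      show q.u = _
      refine Eq.trans h (congrArg _ (P_congr fun i => ?_))
      simp)

@[simp] theorem map_mk (f : S ≃ T) (e : Fin n ≃ S) (u : XCHom 0 n) :
    map f (mk e u) = mk (e.trans f) u := rfl

theorem map_map (f : S ≃ T) (g : T ≃ R) (x : Elts S) : map g (map f x) = map (f.trans g) x := by
  obtain ⟨n, e, u, rfl⟩ := exists_rep x; rfl

@[simp] theorem map_refl (x : Elts S) : map (Equiv.refl S) x = x := by
  obtain ⟨n, e, u, rfl⟩ := exists_rep x; rfl

theorem map_congr {f g : S ≃ T} (h : ∀ s, f s = g s) (x : Elts S) : map f x = map g x := by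
  rw [Equiv.ext h]

theorem map_symm_map (f : S ≃ T) (x : Elts S) : map f.symm (map f x) = x := by
  rw [map_map, Equiv.self_trans_symm, map_refl]

theorem map_map_symm (f : S ≃ T) (x : Elts T) : map f (map f.symm x) = x := by
  rw [map_map, Equiv.symm_trans_self, map_refl]

/-- Juxtaposition. -/
def tensor : Elts S → Elts T → Elts (S ⊕ T) :=
  Quotient.map₂ (sa := Numbered.setoid S) (sb := Numbered.setoid T)
    (sc := Numbered.setoid (S ⊕ T)) (fun p q => ⟨p.n + q.n, joinE p.e q.e, p.u.tensor q.u⟩)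
    (fun p p' h q q' h' => by
      show p'.u.tensor q'.u = (p.u.tensor q.u).comp _
      rw [show p'.u = _ from h, show q'.u = _ from h', joinE_trans_symm, ← P_tensor, ← tensor_comp])

@[simp] theorem tensor_mk (e : Fin n ≃ S) (u : XCHom 0 n) (f : Fin m ≃ T) (v : XCHom 0 m) :
    (mk e u).tensor (mk f v) = mk (joinE e f) (u.tensor v) := rfl

theorem map_tensor (f : S ≃ S') (g : T ≃ T') (x : Elts S) (y : Elts T) :
    (map f x).tensor (map g y) = map (Equiv.sumCongr f g) (x.tensor y) := by
  obtain ⟨n, e, u, rfl⟩ := exists_rep x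
  obtain ⟨m, e', v, rfl⟩ := exists_rep y
  rw [map_mk, map_mk, tensor_mk, tensor_mk, map_mk, mk_eq_mk]
  refine ((congrArg _ ?_).trans (XCHom.comp_id _)).symm
  rw [← P_refl]
  exact P_congr fun i => by
    rw [Equiv.trans_apply, Equiv.symm_apply_eq]
    induction i using Fin.addCases <;> simp

theorem mk_congr {e : Fin n ≃ S} {f : Fin m ≃ S} {u : XCHom 0 n} {v : XCHom 0 m} (h : n = m)
    (hv : v = u.comp (cst h)) (hf : ∀ i, f (finCongr h i) = e i) : mk e u = mk f v := by
  subst h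
  rw [XCHom.comp_id] at hv
  subst hv
  exact congrArg (mk · v) (Equiv.ext fun i => (hf i).symm)

theorem tensor_assoc (x : Elts S) (y : Elts T) (z : Elts R) :
    map (Equiv.sumAssoc S T R) ((x.tensor y).tensor z) = x.tensor (y.tensor z) := by
  obtain ⟨n, e, u, rfl⟩ := exists_rep x
  obtain ⟨m, f, v, rfl⟩ := exists_rep y
  obtain ⟨k, g, w, rfl⟩ := exists_rep z
  simp only [tensor_mk, map_mk]
  refine mk_congr (Nat.add_assoc n m k) ?_ fun i => ?_
  · rw [XCHom.tensor_assoc]; exact (XCHom.id_comp _).symm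
  · rw [finCongr_apply]
    induction i using Fin.addCases with
    | left i =>
      induction i using Fin.addCases with
      | left i =>
        show joinE e (joinE f g) (Fin.castAdd (m + k) i) = _
        simp
      | right i =>
        show joinE e (joinE f g) (Fin.natAdd n (Fin.castAdd k i)) = _
        simp
    | right i =>
      have h : Fin.cast (Nat.add_assoc n m k) (Fin.natAdd (n + m) i)
          = Fin.natAdd n (Fin.natAdd m i) := Fin.ext (by simp [Nat.add_assoc])
      rw [h]
      simp

theorem tensor_comm (x : Elts S) (y : Elts T) :
    map (Equiv.sumComm S T) (x.tensor y) = y.tensor x := by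
  obtain ⟨n, e, u, rfl⟩ := exists_rep x
  obtain ⟨m, f, v, rfl⟩ := exists_rep y
  simp only [tensor_mk, map_mk]
  have h0 : br 0 0 = cst rfl := br_zero 0
  have h : v.tensor u = (u.tensor v).comp (br n m) := by
    rw [XCHom.braid_natural, h0]; exact (XCHom.id_comp _).symm
  rw [mk_eq_mk, h, br_eq_P]
  refine congrArg _ (P_congr fun i => ?_)
  rw [Equiv.trans_apply, Equiv.eq_symm_apply]
  induction i using Fin.addCases <;> simp [brE]

/-- The empty element. -/
def one : Elts Empty := mk (Equiv.equivOfIsEmpty _ _) (cst rfl)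

theorem tensor_one (x : Elts S) : map (Equiv.sumEmpty S Empty) (x.tensor one) = x := by
  obtain ⟨n, e, u, rfl⟩ := exists_rep x
  rw [one, tensor_mk, map_mk]
  refine mk_congr rfl ?_ fun i => ?_
  · rw [XCHom.comp_id, tensor_unit]
  · show _ = Equiv.sumEmpty S Empty (joinE e _ (Fin.castAdd 0 i))
    rw [joinE_castAdd]; rfl

/-- The element of a labelled arrow. -/
def elt (g : XCHom 0 b) : Elts (Fin b) := mk (Equiv.refl _) g

theorem exists_block (x : Elts (R ⊕ Fin a)) :
    ∃ (r : ℕ) (e : Fin r ≃ R) (u : XCHom 0 (r + a)), x = mk (joinE e (Equiv.refl _)) u := by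
  have := x.finite_of
  have : Finite R := Finite.of_injective (Sum.inl : R → R ⊕ Fin a) Sum.inl_injective
  obtain ⟨r, ⟨e⟩⟩ := Finite.exists_equiv_fin R
  obtain ⟨u, rfl⟩ := exists_rep_of (joinE e.symm (Equiv.refl (Fin a))) x
  exact ⟨r, e.symm, u, rfl⟩

/-- The action of an arrow on the last strands. -/
noncomputable def op (g : XCHom a b) (x : Elts (R ⊕ Fin a)) : Elts (R ⊕ Fin b) :=
  mk (joinE (exists_block x).choose_spec.choose (Equiv.refl _))
    ((exists_block x).choose_spec.choose_spec.choose.comp (wl _ g))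

theorem op_mk (g : XCHom a b) (e : Fin r ≃ R) (u : XCHom 0 (r + a)) :
    op g (mk (joinE e (Equiv.refl _)) u) = mk (joinE e (Equiv.refl _)) (u.comp (wl r g)) := by
  have h := (exists_block (mk (joinE e (Equiv.refl (Fin a))) u)).choose_spec.choose_spec.choose_spec
  symm
  rw [mk_eq_mk, joinE_trans_symm] at h
  rw [op, mk_eq_mk, joinE_trans_symm, h]
  simp only [Equiv.self_trans_symm, ← P_wr, XCHom.comp_assoc]
  rw [exch]

theorem op_mk' (g : XCHom a b) (ê : Fin n ≃ R ⊕ Fin a) (u : XCHom 0 n) (e : Fin r ≃ R) :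
    op g (mk ê u) = mk (joinE e (Equiv.refl _))
      ((u.comp (P (ê.trans (joinE e (Equiv.refl _)).symm))).comp (wl r g)) := by
  rw [mk_renumber ê u (joinE e (Equiv.refl _)), op_mk]

theorem op_map (g : XCHom a b) (f : R ≃ R') (x : Elts (R ⊕ Fin a)) :
    op g (map (Equiv.sumCongr f (Equiv.refl _)) x)
      = map (Equiv.sumCongr f (Equiv.refl _)) (op g x) := by
  obtain ⟨r, e, u, rfl⟩ := exists_block x
  have h : ∀ k, (joinE e (Equiv.refl (Fin k))).trans (Equiv.sumCongr f (Equiv.refl _))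
      = joinE (e.trans f) (Equiv.refl _) := fun k => by
    ext i; induction i using Fin.addCases <;> simp
  rw [op_mk, map_mk, map_mk, h, h, op_mk]

theorem op_comp (g : XCHom a b) (h : XCHom b c) (x : Elts (R ⊕ Fin a)) :
    op (g.comp h) x = op h (op g x) := by
  obtain ⟨r, e, u, rfl⟩ := exists_block x
  rw [op_mk, op_mk, op_mk, wl_comp, XCHom.comp_assoc]

theorem op_P (τ : Fin a ≃ Fin b) (x : Elts (R ⊕ Fin a)) :
    op (P τ) x = map (Equiv.sumCongr (Equiv.refl _) τ) x := by
  obtain ⟨r, e, u, rfl⟩ := exists_block x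
  rw [op_mk, map_mk, P_wl, mk_renumber (Equiv.trans _ _) u (joinE e (Equiv.refl _))]
  refine congrArg _ (congrArg _ (P_congr fun i => ?_))
  rw [Equiv.trans_apply, Equiv.eq_symm_apply]
  induction i using Fin.addCases <;> simp

theorem op_tensor (g : XCHom a b) (y : Elts T) (x : Elts (R ⊕ Fin a)) :
    op g (map (Equiv.sumAssoc _ _ _).symm (y.tensor x))
      = map (Equiv.sumAssoc _ _ _).symm (y.tensor (op g x)) := by
  obtain ⟨r, e, u, rfl⟩ := exists_block x
  obtain ⟨t, f, v, rfl⟩ := exists_rep y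
  rw [op_mk, tensor_mk, tensor_mk, map_mk, map_mk, op_mk' g _ _ (joinE f e)]
  have h : ∀ k, ((joinE f (joinE e (Equiv.refl (Fin k)))).trans (Equiv.sumAssoc _ _ _).symm).trans
      (joinE (joinE f e) (Equiv.refl _)).symm = finCongr (Nat.add_assoc t r k).symm := fun k => by
    ext i
    induction i using Fin.addCases with
    | left i => simp
    | right i => induction i using Fin.addCases <;> simp [Nat.add_assoc]
  rw [h, ← cst_eq_P, mk_renumber (Equiv.trans _ _) _ (joinE (joinE f e) (Equiv.refl _)), h,
    ← cst_eq_P]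
  congr 1
  have e1 : v.tensor (u.comp (wl r g)) = (v.tensor u).comp (wl t (wl r g)) := by
    show _ = (v.tensor u).comp ((cst rfl).tensor (wl r g))
    rw [← tensor_comp, XCHom.comp_id]
  have e2 := congrArg (fun z => ((cst (Nat.add_assoc t r a).symm).comp z).comp
    (cst (Nat.add_assoc t r b).symm)) (cst_comp_wl t r g)
  simp only [XCHom.comp_assoc, cst_comp_cst] at e2
  simp only [← XCHom.comp_assoc, cst_comp_cst, XCHom.comp_id, XCHom.id_comp] at e2
  rw [e1, XCHom.comp_assoc, XCHom.comp_assoc, e2]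

/-- Splitting of the last strands. -/
def splitE (R : Type) (k a : ℕ) : R ⊕ Fin (k + a) ≃ (R ⊕ Fin k) ⊕ Fin a :=
  (Equiv.sumCongr (Equiv.refl _) finSumFinEquiv.symm).trans (Equiv.sumAssoc _ _ _).symm

theorem splitE_aux (e : Fin r ≃ R) (k a : ℕ) :
    ((joinE e (Equiv.refl (Fin (k + a)))).trans (splitE R k a)).trans
      (joinE (joinE e (Equiv.refl _)) (Equiv.refl _)).symm
        = finCongr (Nat.add_assoc r k a).symm := by
  ext i
  induction i using Fin.addCases with
  | left i => simp [splitE]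
  | right i => induction i using Fin.addCases <;> simp [splitE, Nat.add_assoc]

theorem op_wl (g : XCHom a b) (k : ℕ) (x : Elts (R ⊕ Fin (k + a))) :
    map (splitE R k b) (op (wl k g) x) = op g (map (splitE R k a) x) := by
  obtain ⟨r, e, u, rfl⟩ := exists_block x
  rw [op_mk, map_mk, map_mk, op_mk' g _ _ (joinE e (Equiv.refl _)), splitE_aux,
    mk_renumber (Equiv.trans _ _) _ (joinE (joinE e (Equiv.refl _)) (Equiv.refl _)), splitE_aux,
    ← cst_eq_P, ← cst_eq_P]
  congr 1
  have e2 := congrArg (fun z => ((cst (Nat.add_assoc r k a).symm).comp z).comp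
    (cst (Nat.add_assoc r k b).symm)) (cst_comp_wl r k g)
  simp only [XCHom.comp_assoc, cst_comp_cst] at e2
  simp only [← XCHom.comp_assoc, cst_comp_cst, XCHom.comp_id, XCHom.id_comp] at e2
  rw [XCHom.comp_assoc, XCHom.comp_assoc, e2]

theorem op_wr (g : XCHom a b) (k : ℕ) (x : Elts (R ⊕ Fin (a + k))) :
    map ((splitE R b k).trans (sumRC _ _ _)) (op (wr g k) x)
      = op g (map ((splitE R a k).trans (sumRC _ _ _)) x) := by
  have key : ∀ c, (splitE R c k).trans (sumRC _ _ _)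
      = (Equiv.sumCongr (Equiv.refl _) (brE c k)).trans (splitE R k c) := fun c => by
    refine Equiv.ext fun i => ?_
    rcases i with i | i
    · rfl
    · induction i using Fin.addCases <;> simp [splitE, brE]
  rw [key, key, ← map_map, ← map_map, ← op_P, ← op_P, ← br_eq_P, ← br_eq_P, ← op_comp,
    show (wr g k).comp (br b k) = (br a k).comp (wl k g) from braid_natural _ _, op_comp, op_wl]

theorem op_comm (g : XCHom a b) (h : XCHom c d) (x : Elts ((R ⊕ Fin a) ⊕ Fin c)) :
    op g (map (sumRC _ _ _) (op h x)) = map (sumRC _ _ _) (op h (map (sumRC _ _ _)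
      (op g (map (sumRC _ _ _) x)))) := by
  obtain ⟨y, rfl⟩ : ∃ y, x = map (splitE R a c) y := ⟨_, (map_map_symm (splitE R a c) x).symm⟩
  rw [map_map, ← op_wr, map_map, ← op_wl, map_map, ← op_wr, Equiv.trans_assoc]
  rw [sumRC_trans, Equiv.trans_refl, ← op_wl, map_map, ← op_comp, ← op_comp, exch]

theorem op_unit (g : XCHom 0 b) (x : Elts R) :
    op g (map (Equiv.sumEmpty R (Fin 0)).symm x) = x.tensor (elt g) := by
  obtain ⟨r, e, u, rfl⟩ := exists_rep x
  have h : mk (e.trans (Equiv.sumEmpty R (Fin 0)).symm) u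
      = mk (joinE e (Equiv.refl (Fin 0))) u := by
    refine mk_congr rfl (XCHom.comp_id _).symm fun i => ?_
    exact joinE_castAdd e (Equiv.refl (Fin 0)) i
  rw [map_mk, h, op_mk, elt, tensor_mk]
  congr 1
  have e1 : u.wr 0 = u := tensor_unit u
  have e2 := exch u g
  rw [e1] at e2
  rw [e2]
  refine Eq.trans ?_ (wl_wr u g)
  rfl

/-! ### Multiplication of one strand with another one -/

/-- A point is singled out. -/
noncomputable def pointE (s : S) : {t : S // t ≠ s} ⊕ Fin 1 ≃ S :=
  Equiv.ofBijective (Sum.elim Subtype.val fun _ => s) <| by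
    constructor
    · rintro (⟨t, ht⟩ | t) (⟨t', ht'⟩ | t') h
      · simpa using h
      · exact (ht h).elim
      · exact (ht' h.symm).elim
      · rw [Subsingleton.elim t t']
    · intro t
      by_cases h : t = s
      · exact ⟨.inr 0, h.symm⟩
      · exact ⟨.inl ⟨t, h⟩, rfl⟩

/-- Two strands `0`, `1` are viewed as an additional strand and the strand `0`. -/
def pairE (R : Type) : R ⊕ Fin 2 ≃ (R ⊕ Fin 1) ⊕ Unit where
  toFun
    | .inl x => .inl (.inl x)
    | .inr 0 => .inr ()
    | .inr 1 => .inl (.inr 0)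
  invFun
    | .inl (.inl x) => .inl x
    | .inl (.inr _) => .inr 1
    | .inr _ => .inr 0
  left_inv := by
    rintro (x | x)
    · rfl
    · fin_cases x <;> rfl
  right_inv := by
    rintro ((x | x) | x)
    · rfl
    · fin_cases x; rfl
    · rfl

@[simp] theorem pairE_inl (x : R) : pairE R (.inl x) = .inl (.inl x) := rfl
@[simp] theorem pairE_zero : pairE R (.inr 0) = .inr () := rfl
@[simp] theorem pairE_one : pairE R (.inr 1) = .inl (.inr 0) := rfl
@[simp] theorem pairE_symm_inr (x : Unit) : (pairE R).symm (.inr x) = .inr 0 := rfl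
@[simp] theorem pairE_symm_inl_inl (x : R) : (pairE R).symm (.inl (.inl x)) = .inl x := rfl
@[simp] theorem pairE_symm_inl_inr (x : Fin 1) : (pairE R).symm (.inl (.inr x)) = .inr 1 := rfl

/-- The multiplication in the PROP. -/
def mulHom : XCHom 2 1 := XCHom.mk .mul

/-- The additional strand is multiplied to the strand `s` from the left. -/
noncomputable def mg (s : S) (x : Elts (S ⊕ Unit)) : Elts S :=
  map (pointE s) (op mulHom
    (map ((pairE _).trans (Equiv.sumCongr (pointE s) (Equiv.refl _))).symm x))

theorem mg_eq (h : R ⊕ Fin 1 ≃ S) {s : S} (hs : h (.inr 0) = s) (x : Elts (R ⊕ Fin 2)) :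
    mg s (map ((pairE _).trans (Equiv.sumCongr h (Equiv.refl _))) x) = map h (op mulHom x) := by
  subst hs
  let f : R ≃ {t : S // t ≠ h (.inr 0)} := Equiv.ofBijective
    (fun r => ⟨h (.inl r), fun e => by simpa using h.injective e⟩) <| by
      constructor
      · intro r r' e
        simpa using e
      · rintro ⟨t, ht⟩
        obtain ⟨z | z, rfl⟩ := h.surjective t
        · exact ⟨z, rfl⟩
        · exact (ht (by rw [Subsingleton.elim z 0])).elim
  have hf : h = (Equiv.sumCongr f (Equiv.refl _)).trans (pointE (h (.inr 0))) := by
    refine Equiv.ext fun z => ?_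
    rcases z with z | z
    · rfl
    · rw [Subsingleton.elim z 0]; rfl
  have key : ((pairE R).trans (Equiv.sumCongr h (Equiv.refl Unit))).trans
      ((pairE _).trans (Equiv.sumCongr (pointE (h (.inr 0))) (Equiv.refl _))).symm
      = Equiv.sumCongr f (Equiv.refl _) := by
    refine Equiv.ext fun z => ?_
    rw [Equiv.trans_apply, Equiv.symm_apply_eq]
    rcases z with z | z
    · rfl
    · fin_cases z <;> rfl
  rw [mg, map_map, key, op_map, map_map, ← hf]

theorem exists_mg_form (s : S) (x : Elts (S ⊕ Unit)) :
    ∃ y : Elts ({t : S // t ≠ s} ⊕ Fin 2),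
      x = map ((pairE _).trans (Equiv.sumCongr (pointE s) (Equiv.refl _))) y :=
  ⟨_, (map_map_symm _ x).symm⟩

theorem map_mg (f : S ≃ T) (s : S) (x : Elts (S ⊕ Unit)) :
    map f (mg s x) = mg (f s) (map (Equiv.sumCongr f (Equiv.refl _)) x) := by
  obtain ⟨y, rfl⟩ := exists_mg_form s x
  rw [mg_eq (pointE s) (s := s) rfl, map_map, map_map,
    ← mg_eq ((pointE s).trans f) (s := f s) rfl]
  refine congrArg _ (map_congr (fun z => ?_) _)
  rcases z with z | z
  · rfl
  · fin_cases z <;> rfl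

theorem tensor_mg (s : S) (x : Elts (S ⊕ Unit)) (y : Elts T) :
    y.tensor (mg s x) = mg (.inr s) (map (Equiv.sumAssoc _ _ _).symm (y.tensor x)) := by
  obtain ⟨z, rfl⟩ := exists_mg_form s x
  rw [mg_eq (pointE s) (s := s) rfl]
  have h1 : ∀ {A B : Type} (f : A ≃ B) (w : Elts A), y.tensor (map f w)
      = map (Equiv.sumCongr (Equiv.refl _) f) (y.tensor w) := fun f w => by
    rw [← map_tensor, map_refl]
  have h2 : y.tensor (op mulHom z)
      = map (Equiv.sumAssoc _ _ _) (op mulHom (map (Equiv.sumAssoc _ _ _).symm (y.tensor z))) := by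
    rw [op_tensor, map_map_symm]
  rw [h1, h2, map_map, h1, map_map, ← mg_eq ((Equiv.sumAssoc _ _ _).trans
    (Equiv.sumCongr (Equiv.refl _) (pointE s))) (s := .inr s) rfl, map_map]
  refine congrArg _ (map_congr (fun z => ?_) _)
  rcases z with z | z | z
  · rfl
  · rfl
  · fin_cases z <;> rfl

theorem mg_tensor (s : S) (x : Elts (S ⊕ Unit)) (y : Elts T) :
    (mg s x).tensor y = mg (.inl s) (map (sumRC _ _ _) (x.tensor y)) := by
  rw [← tensor_comm, tensor_mg, map_mg, ← tensor_comm x y]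
  refine congrArg _ ?_
  simp only [map_map]
  refine map_congr (fun z => ?_) _
  rcases z with (z | z) | z <;> rfl

theorem mg_comm {s t : S} (hst : s ≠ t) (x : Elts ((S ⊕ Unit) ⊕ Unit)) :
    mg s (mg (.inl t) x) = mg t (mg (.inl s) (map (sumRC _ _ _) x)) := by
  -- `h` singles out `s` (left) and `t` (right)
  let s' : {z : S // z ≠ t} := ⟨s, hst⟩
  let h : ({z // z ≠ s'} ⊕ Fin 1) ⊕ Fin 1 ≃ S :=
    (Equiv.sumCongr (pointE s') (Equiv.refl _)).trans (pointE t)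
  have hs : h (.inl (.inr 0)) = s := rfl
  have ht : h (.inr 0) = t := rfl
  clear_value h
  generalize {z // z ≠ s'} = R at h hs ht
  subst hs ht
  let F : (R ⊕ Fin 2) ⊕ Fin 1 ≃ S ⊕ Unit :=
    (sumRC _ _ _).trans ((pairE _).trans (Equiv.sumCongr ((sumRC _ _ _).trans h) (Equiv.refl _)))
  let F' : (R ⊕ Fin 2) ⊕ Fin 1 ≃ S ⊕ Unit :=
    (sumRC _ _ _).trans ((pairE _).trans (Equiv.sumCongr h (Equiv.refl _)))
  obtain ⟨y, rfl⟩ : ∃ y, x = map ((pairE _).trans (Equiv.sumCongr F (Equiv.refl _))) y :=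
    ⟨_, (map_map_symm _ x).symm⟩
  have e : map (sumRC _ _ _) (map ((pairE _).trans (Equiv.sumCongr F (Equiv.refl _))) y)
      = map ((pairE _).trans (Equiv.sumCongr F' (Equiv.refl _))) (map (sumRC _ _ _) y) := by
    rw [map_map, map_map]
    refine map_congr (fun z => ?_) _
    rcases z with (z | z) | z
    · rfl
    · fin_cases z <;> rfl
    · fin_cases z <;> rfl
  have hF : ∀ z, map F z = map ((pairE _).trans (Equiv.sumCongr ((sumRC _ _ _).trans h)
      (Equiv.refl _))) (map (sumRC _ _ _) z) := fun z => (map_map _ _ z).symm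
  have hF' : ∀ z, map F' z = map ((pairE _).trans (Equiv.sumCongr h
      (Equiv.refl _))) (map (sumRC _ _ _) z) := fun z => (map_map _ _ z).symm
  rw [e, mg_eq F (s := .inl (h (.inr 0))) rfl,
    mg_eq F' (s := .inl (h (.inl (.inr 0)))) rfl, hF, hF',
    mg_eq ((sumRC _ _ _).trans h) (s := h (.inl (.inr 0))) rfl, ← map_map,
    mg_eq h (s := h (.inr 0)) rfl, op_comm, map_map (sumRC _ _ _) (sumRC _ _ _)]
  rw [sumRC_trans, map_refl]

theorem mulHom_assoc : (mulHom.wr 1).comp mulHom = (wl 1 mulHom).comp mulHom :=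
  XCHom.sound (.law .assoc)

theorem mg_assoc (s : S) (x : Elts ((S ⊕ Unit) ⊕ Unit)) :
    mg s (mg (.inr ()) x) = mg s (mg (.inl s) (map (sumRC _ _ _) x)) := by
  let h := pointE s
  have hs : h (.inr 0) = s := rfl
  clear_value h
  generalize {z // z ≠ s} = R at h
  subst hs
  let G : (R ⊕ Fin 1) ⊕ Fin 1 ≃ S ⊕ Unit :=
    (sumRC _ _ _).trans (((splitE R 1 1).symm.trans (pairE _)).trans
      (Equiv.sumCongr h (Equiv.refl _)))
  let G' : (R ⊕ Fin 1) ⊕ Fin 1 ≃ S ⊕ Unit :=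
    ((splitE R 1 1).symm.trans (pairE _)).trans (Equiv.sumCongr h (Equiv.refl _))
  obtain ⟨y, rfl⟩ : ∃ y : Elts (R ⊕ Fin (2 + 1)), x = map (((splitE R 2 1).trans
      (sumRC _ _ _)).trans ((pairE _).trans (Equiv.sumCongr G (Equiv.refl _)))) y :=
    ⟨_, (map_map_symm _ x).symm⟩
  have e : map (sumRC _ _ _) (map (((splitE R 2 1).trans
      (sumRC _ _ _)).trans ((pairE _).trans (Equiv.sumCongr G (Equiv.refl _)))) y)
      = map ((pairE _).trans (Equiv.sumCongr G' (Equiv.refl _)))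
        (map (splitE R 1 2) y) := by
    rw [map_map, map_map]
    refine map_congr (fun z => ?_) _
    rcases z with z | z
    · rfl
    · fin_cases z <;> rfl
  rw [e, mg_eq G' (s := .inl (h (.inr 0))) rfl, ← op_wl, ← map_map,
    mg_eq G (s := .inr ()) rfl, ← op_wr, map_map, map_map]
  have e1 : ((splitE R 1 1).trans (sumRC _ _ _)).trans G
      = (pairE _).trans (Equiv.sumCongr h (Equiv.refl _)) := by
    refine Equiv.ext fun z => ?_
    rcases z with z | z
    · rfl
    · fin_cases z <;> rfl
  have e2 : (splitE R 1 1).trans G' = (pairE _).trans (Equiv.sumCongr h (Equiv.refl _)) := by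
    refine Equiv.ext fun z => ?_
    rcases z with z | z
    · rfl
    · fin_cases z <;> rfl
  rw [e1, e2, mg_eq h (s := h (.inr 0)) rfl, mg_eq h (s := h (.inr 0)) rfl, ← op_comp, ← op_comp, mulHom_assoc]

/-- The unit of the algebra. -/
def unitHom : XCHom 0 1 := XCHom.mk .unit

/-- The unit, as an element. -/
def eta : Elts Unit := map (Equiv.ofUnique _ _) (elt unitHom)

theorem tensor_eta (x : Elts S) : x.tensor eta = map (Equiv.sumCongr (Equiv.refl _)
    (Equiv.ofUnique _ _)) (op unitHom (map (Equiv.sumEmpty S (Fin 0)).symm x)) := by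
  rw [op_unit, eta, ← map_tensor, map_refl]

theorem mg_eta (s : S) (x : Elts S) : mg s (x.tensor eta) = x := by
  obtain ⟨y, rfl⟩ : ∃ y, x = map (pointE s) y := ⟨_, (map_map_symm _ x).symm⟩
  have law : (unitHom.wr 1).comp mulHom = cst rfl := XCHom.sound (.law .unit_mul)
  have e0 := op_wr unitHom 1 (a := 0) (R := {z // z ≠ s}) y
  have e1 : map ((splitE {z // z ≠ s} 0 1).trans (sumRC _ _ _)) y
      = map (Equiv.sumEmpty _ (Fin 0)).symm y := by
    refine map_congr (fun z => ?_) _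
    rcases z with z | z
    · rfl
    · fin_cases z; rfl
  have e2 : map (Equiv.sumEmpty _ (Fin 0)).symm (map (pointE s) y)
      = map (Equiv.sumCongr (pointE s) (Equiv.refl _)) (map (Equiv.sumEmpty _ (Fin 0)).symm y) := by
    rw [map_map, map_map]
    refine map_congr (fun z => ?_) _
    rfl
  rw [tensor_eta, e2, op_map, ← e1, ← e0, map_map, map_map]
  have e3 := mg_eq (pointE s) rfl (op (unitHom.wr 1) y)
  rw [← op_comp, law, ← P_refl, op_P] at e3
  refine Eq.trans (congrArg _ (map_congr (fun z => ?_) _)) (e3.trans ?_)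
  · rcases z with z | z
    · rfl
    · change Fin 2 at z
      fin_cases z <;> rfl
  · refine congrArg _ (Eq.trans (map_congr (fun z => ?_) _) (map_refl _))
    rcases z with z | z <;> rfl

open Classical in
theorem mg_eta_swap (s : S) (x : Elts S) :
    mg s (map (Equiv.swap (.inl s) (.inr ())) (x.tensor eta)) = x := by
  obtain ⟨y, rfl⟩ : ∃ y, x = map (pointE s) y := ⟨_, (map_map_symm _ x).symm⟩
  have law : (wl 1 unitHom).comp mulHom = cst rfl := XCHom.sound (.law .mul_unit)
  have e0 := op_wl unitHom 1 (R := {z // z ≠ s}) y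
  have e1 : map (splitE {z // z ≠ s} 1 0) y = map (Equiv.sumEmpty _ (Fin 0)).symm y := by
    refine map_congr (fun z => ?_) _
    rcases z with z | z
    · rfl
    · fin_cases z; rfl
  have e2 : map (Equiv.sumEmpty _ (Fin 0)).symm (map (pointE s) y)
      = map (Equiv.sumCongr (pointE s) (Equiv.refl _)) (map (Equiv.sumEmpty _ (Fin 0)).symm y) := by
    rw [map_map, map_map]
    refine map_congr (fun z => ?_) _
    rfl
  rw [tensor_eta, e2, op_map, ← e1, ← e0, map_map, map_map, map_map]
  have e3 := mg_eq (pointE s) rfl (op (wl 1 unitHom) y)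
  rw [← op_comp, law, ← P_refl, op_P] at e3
  refine Eq.trans (congrArg _ (map_congr (fun z => ?_) _)) (e3.trans ?_)
  · rcases z with z | z
    · have : (Sum.inl z.1 : S ⊕ Unit) ≠ Sum.inl s := fun h => z.2 (Sum.inl_injective h)
      exact Equiv.swap_apply_of_ne_of_ne this Sum.inl_ne_inr
    · change Fin 2 at z
      fin_cases z
      · exact Equiv.swap_apply_left (Sum.inl s : S ⊕ Unit) (.inr ())
      · exact Equiv.swap_apply_right (Sum.inl s : S ⊕ Unit) (.inr ())
  · refine congrArg _ (Eq.trans (map_congr (fun z => ?_) _) (map_refl _))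
    rcases z with z | z <;> rfl

end Elts

/-! ## Elements with a permutation, and glueing -/

/-- `Fin (n + 1)` with its last element singled out. -/
def lastE (n : ℕ) : Fin (n + 1) ≃ Fin n ⊕ Unit :=
  finSuccEquivLast.trans (Equiv.optionEquivSumPUnit _)

@[simp] theorem lastE_castSucc {n : ℕ} (i : Fin n) : lastE n i.castSucc = .inl i := by
  simp [lastE]

@[simp] theorem lastE_last (n : ℕ) : lastE n (Fin.last n) = .inr () := by
  simp [lastE]

@[simp] theorem lastE_symm_inl {n : ℕ} (i : Fin n) : (lastE n).symm (.inl i) = i.castSucc := by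
  rw [Equiv.symm_apply_eq, lastE_castSucc]

@[simp] theorem lastE_symm_inr {n : ℕ} (i : Unit) : (lastE n).symm (.inr i) = Fin.last n := by
  rw [Equiv.symm_apply_eq, lastE_last]

theorem StrandPerm.letter_induction (p : ∀ n, Equiv.Perm (Fin n) → Prop)
    (one : ∀ n, p n 1) (mul : ∀ {n} {σ τ : Equiv.Perm (Fin n)}, p n σ → p n τ → p n (σ * τ))
    (ext : ∀ {n} {σ : Equiv.Perm (Fin n)}, p n σ → p (n + 1) (StrandPerm.ext σ))
    (top : ∀ n, p (n + 2) (StrandPerm.top n)) {n : ℕ} (σ : Equiv.Perm (Fin n)) : p n σ := by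
  have l : ∀ {n f τ}, StrandPerm.Letter n f τ → p n τ := by
    intro n f τ h
    induction h with
    | top n => exact top n
    | ext _ ih => exact ext ih
  have w := StrandPerm.gen_self.1 (StrandPerm.gen_perm σ)
  generalize XCHom.mk (XCTerm.perm σ) = f at w
  induction w with
  | nil => exact one n
  | snoc _ h ih => exact mul (l h) ih

/-- Elements with strands starting at `O` and ending at `I`; `none` is the result of closing a
strand. -/
abbrev SElts (O I : Type) : Type := Option (Elts O × (O ≃ I))

namespace SElts

variable {O I O' I' O'' I'' K K' : Type}

/-- The bijection obtained by glueing. -/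
def ctr (σ : O ⊕ Unit ≃ I ⊕ Unit) : O ≃ I :=
  Equiv.removeNone (((Equiv.optionEquivSumPUnit O).trans σ).trans (Equiv.optionEquivSumPUnit I).symm)

theorem ctr_of_inl {σ : O ⊕ Unit ≃ I ⊕ Unit} {x : O} {y : I} (h : σ (.inl x) = .inl y) :
    ctr σ x = y := by
  have := Equiv.removeNone_some
    (((Equiv.optionEquivSumPUnit O).trans σ).trans (Equiv.optionEquivSumPUnit I).symm)
    (x := x) ⟨y, by simp [h]⟩
  simp [h] at this
  exact this

theorem ctr_of_inr {σ : O ⊕ Unit ≃ I ⊕ Unit} {x : O} {y : I} (h : σ (.inl x) = .inr ())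
    (h' : σ (.inr ()) = .inl y) : ctr σ x = y := by
  have := Equiv.removeNone_none
    (((Equiv.optionEquivSumPUnit O).trans σ).trans (Equiv.optionEquivSumPUnit I).symm)
    (x := x) (by simp [h])
  simp [h'] at this
  exact this

theorem ctr_congr (σ : O ⊕ Unit ≃ I ⊕ Unit) (o : O ≃ O') (i : I ≃ I') :
    ctr ((Equiv.sumCongr o (Equiv.refl _)).symm.trans
      (σ.trans (Equiv.sumCongr i (Equiv.refl _)))) = o.symm.trans ((ctr σ).trans i) := by
  refine Equiv.ext fun x => ?_
  obtain ⟨x, rfl⟩ := o.surjective x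
  simp only [Equiv.trans_apply, Equiv.symm_apply_apply]
  rcases h : σ (.inl x) with y | ⟨⟩
  · rw [ctr_of_inl h]
    exact ctr_of_inl (by simp [h])
  · rcases h' : σ (.inr ()) with y | ⟨⟩
    · rw [ctr_of_inr h h']
      exact ctr_of_inr (by simp [h]) (by simp [h'])
    · simpa using σ.injective (h.trans h'.symm)

theorem ctr_sum (σ : O ⊕ Unit ≃ I ⊕ Unit) (τ : O' ≃ I') :
    ctr ((sumRC _ _ _).symm.trans ((Equiv.sumCongr σ τ).trans (sumRC _ _ _)))
      = Equiv.sumCongr (ctr σ) τ := by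
  refine Equiv.ext fun x => ?_
  rcases x with x | x
  · rcases h : σ (.inl x) with y | ⟨⟩
    · refine ctr_of_inl ?_
      simp [h, ctr_of_inl h]
    · rcases h' : σ (.inr ()) with y | ⟨⟩
      · refine ctr_of_inr (by simp [h]) ?_
        simp [h', ctr_of_inr h h']
      · simpa using σ.injective (h.trans h'.symm)
  · exact ctr_of_inl (by simp)

theorem ctr_comm (σ : (O ⊕ Unit) ⊕ Unit ≃ (I ⊕ Unit) ⊕ Unit) :
    ctr (ctr ((sumRC _ _ _).symm.trans (σ.trans (sumRC _ _ _)))) = ctr (ctr σ) := by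
  refine Equiv.ext fun x => ?_
  set σ' := (sumRC _ _ _).symm.trans (σ.trans (sumRC _ _ _)) with hσ
  rcases h : σ (.inl (.inl x)) with (y | ⟨⟩) | ⟨⟩
  · rw [ctr_of_inl (ctr_of_inl h)]
    exact ctr_of_inl (ctr_of_inl (by simp [hσ, h]))
  · rcases h1 : σ (.inl (.inr ())) with (y | ⟨⟩) | ⟨⟩
    · rw [ctr_of_inr (ctr_of_inl h) (ctr_of_inl h1)]
      exact ctr_of_inl (ctr_of_inr (by simp [hσ, h]) (by simp [hσ, h1]))
    · simpa using σ.injective (h.trans h1.symm)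
    · rcases h2 : σ (.inr ()) with (y | ⟨⟩) | ⟨⟩
      · rw [ctr_of_inr (ctr_of_inl h) (ctr_of_inr h1 h2)]
        exact ctr_of_inr (ctr_of_inr (y := Sum.inr ()) (by simp [hσ, h]) (by simp [hσ, h1]))
          (ctr_of_inl (by simp [hσ, h2]))
      · simpa using σ.injective (h.trans h2.symm)
      · simpa using σ.injective (h1.trans h2.symm)
  · rcases h2 : σ (.inr ()) with (y | ⟨⟩) | ⟨⟩
    · rw [ctr_of_inl (ctr_of_inr h h2)]
      exact ctr_of_inr (ctr_of_inl (y := Sum.inr ()) (by simp [hσ, h]))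
        (ctr_of_inl (by simp [hσ, h2]))
    · rcases h1 : σ (.inl (.inr ())) with (y | ⟨⟩) | ⟨⟩
      · rw [ctr_of_inr (ctr_of_inr h h2) (ctr_of_inl h1)]
        exact ctr_of_inr (ctr_of_inl (by simp [hσ, h])) (ctr_of_inr (by simp [hσ, h2])
          (by simp [hσ, h1]))
      · simpa using σ.injective (h1.trans h2.symm)
      · simpa using σ.injective (h1.trans h.symm)
    · simpa using σ.injective (h.trans h2.symm)

/-- Renaming of the endpoints. -/
def rl (o : O ≃ O') (i : I ≃ I') : SElts O I → SElts O' I' :=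
  Option.map fun p => (Elts.map o p.1, o.symm.trans (p.2.trans i))

/-- Juxtaposition. -/
def un : SElts O I → SElts O' I' → SElts (O ⊕ O') (I ⊕ I') :=
  Option.map₂ fun p q => (p.1.tensor q.1, Equiv.sumCongr p.2 q.2)

/-- The additional end is glued to the additional start. -/
noncomputable def glue1 (x : SElts (O ⊕ Unit) (I ⊕ Unit)) : SElts O I :=
  Option.bind x fun p => match p.2.symm (.inr ()) with
    | .inl a => some (Elts.mg a p.1, ctr p.2)
    | .inr _ => none

/-- An element with a permutation. -/
def ofElt (u : Elts O) (σ : O ≃ I) : SElts O I := some (u, σ)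

theorem cases (x : SElts O I) : x = none ∨ ∃ u σ, x = ofElt u σ := by
  rcases x with _ | ⟨u, σ⟩
  · exact .inl rfl
  · exact .inr ⟨u, σ, rfl⟩

@[simp] theorem rl_none (o : O ≃ O') (i : I ≃ I') : rl o i none = none := rfl

@[simp] theorem rl_ofElt (o : O ≃ O') (i : I ≃ I') (u : Elts O) (σ : O ≃ I) :
    rl o i (ofElt u σ) = ofElt (u.map o) (o.symm.trans (σ.trans i)) := rfl

theorem un_ofElt (u : Elts O) (σ : O ≃ I) (u' : Elts O') (σ' : O' ≃ I') :
    un (ofElt u σ) (ofElt u' σ') = ofElt (u.tensor u') (Equiv.sumCongr σ σ') := rfl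

@[simp] theorem none_un (y : SElts O' I') : un (none : SElts O I) y = none := rfl

@[simp] theorem un_none (x : SElts O I) : un x (none : SElts O' I') = none := Option.map₂_none_right _ _

@[simp] theorem glue1_none : glue1 (none : SElts (O ⊕ Unit) (I ⊕ Unit)) = none := rfl

theorem glue1_ofElt (u : Elts (O ⊕ Unit)) {σ : O ⊕ Unit ≃ I ⊕ Unit} {a : O}
    (h : σ (.inl a) = .inr ()) : glue1 (ofElt u σ) = ofElt (Elts.mg a u) (ctr σ) := by
  have h' : σ.symm (.inr ()) = .inl a := by rw [← h, Equiv.symm_apply_apply]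
  simp [glue1, ofElt, h']

theorem glue1_loop (u : Elts (O ⊕ Unit)) {σ : O ⊕ Unit ≃ I ⊕ Unit}
    (h : σ (.inr ()) = .inr ()) : glue1 (ofElt u σ) = none := by
  have h' : σ.symm (.inr ()) = .inr () := by rw [Equiv.symm_apply_eq, h]
  simp [glue1, ofElt, h']

theorem rl_rl (o : O ≃ O') (i : I ≃ I') (o' : O' ≃ O'') (i' : I' ≃ I'') (x : SElts O I) :
    rl o' i' (rl o i x) = rl (o.trans o') (i.trans i') x := by
  obtain rfl | ⟨u, σ, rfl⟩ := x.cases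
  · rfl
  · simp only [rl_ofElt, Elts.map_map]; rfl

theorem rl_congr {o o' : O ≃ O'} {i i' : I ≃ I'} (h : ∀ x, o x = o' x) (h' : ∀ x, i x = i' x)
    (x : SElts O I) : rl o i x = rl o' i' x := by
  rw [Equiv.ext h, Equiv.ext h']

theorem rl_refl (x : SElts O I) : rl (Equiv.refl _) (Equiv.refl _) x = x := by
  obtain rfl | ⟨u, σ, rfl⟩ := x.cases
  · rfl
  · simp only [rl_ofElt, Elts.map_refl]; rfl

theorem rl_id {o : O ≃ O} {i : I ≃ I} (h : ∀ x, o x = x) (h' : ∀ x, i x = x)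
    (x : SElts O I) : rl o i x = x :=
  (rl_congr h h' x).trans (rl_refl x)

theorem un_rl (o : O ≃ O') (i : I ≃ I') {P Q P' Q' : Type} (p : P ≃ P') (q : Q ≃ Q')
    (x : SElts O I) (y : SElts P Q) :
    un (rl o i x) (rl p q y) = rl (Equiv.sumCongr o p) (Equiv.sumCongr i q) (un x y) := by
  obtain rfl | ⟨u, σ, rfl⟩ := x.cases
  · rfl
  obtain rfl | ⟨v, τ, rfl⟩ := y.cases
  · simp
  simp only [rl_ofElt, un_ofElt, Elts.map_tensor]
  congr 1
  ext z
  rcases z with z | z <;> simp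

theorem un_comm (x : SElts O I) (y : SElts O' I') :
    rl (Equiv.sumComm _ _) (Equiv.sumComm _ _) (un x y) = un y x := by
  obtain rfl | ⟨u, σ, rfl⟩ := x.cases
  · simp
  obtain rfl | ⟨v, τ, rfl⟩ := y.cases
  · simp
  simp only [rl_ofElt, un_ofElt, Elts.tensor_comm]
  congr 1
  ext z
  rcases z with z | z <;> simp

theorem un_assoc (x : SElts O I) (y : SElts O' I') (z : SElts O'' I'') :
    rl (Equiv.sumAssoc _ _ _) (Equiv.sumAssoc _ _ _) (un (un x y) z) = un x (un y z) := by
  obtain rfl | ⟨u, σ, rfl⟩ := x.cases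
  · simp
  obtain rfl | ⟨v, τ, rfl⟩ := y.cases
  · simp
  obtain rfl | ⟨w, ρ, rfl⟩ := z.cases
  · simp
  simp only [rl_ofElt, un_ofElt, Elts.tensor_assoc]
  congr 1
  ext z
  rcases z with z | z | z <;> simp

theorem glue1_rl (o : O ≃ O') (i : I ≃ I') (x : SElts (O ⊕ Unit) (I ⊕ Unit)) :
    glue1 (rl (Equiv.sumCongr o (Equiv.refl _)) (Equiv.sumCongr i (Equiv.refl _)) x)
      = rl o i (glue1 x) := by
  obtain rfl | ⟨u, σ, rfl⟩ := x.cases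
  · rfl
  rcases h : σ.symm (.inr ()) with a | ⟨⟩
  · rw [Equiv.symm_apply_eq] at h
    rw [glue1_ofElt u h.symm, rl_ofElt, rl_ofElt, Elts.map_mg, ← ctr_congr]
    exact glue1_ofElt _ (by simp [← h])
  · rw [Equiv.symm_apply_eq] at h
    rw [glue1_loop u h.symm, rl_ofElt, rl_none]
    exact glue1_loop _ (by simp [← h])

theorem un_glue1 (x : SElts (O ⊕ Unit) (I ⊕ Unit)) (y : SElts O' I') :
    un (glue1 x) y = glue1 (rl (sumRC _ _ _) (sumRC _ _ _) (un x y)) := by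
  obtain rfl | ⟨u, σ, rfl⟩ := x.cases
  · rfl
  obtain rfl | ⟨v, τ, rfl⟩ := y.cases
  · simp
  rcases h : σ.symm (.inr ()) with a | ⟨⟩
  · rw [Equiv.symm_apply_eq] at h
    rw [glue1_ofElt u h.symm, un_ofElt, un_ofElt, rl_ofElt, Elts.mg_tensor, ← ctr_sum]
    refine (glue1_ofElt _ ?_).symm
    simp [← h]
  · rw [Equiv.symm_apply_eq] at h
    rw [glue1_loop u h.symm, un_ofElt, rl_ofElt, none_un]
    refine (glue1_loop _ ?_).symm
    simp [← h]

theorem glue1_comm (x : SElts ((O ⊕ Unit) ⊕ Unit) ((I ⊕ Unit) ⊕ Unit)) :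
    glue1 (glue1 (rl (sumRC _ _ _) (sumRC _ _ _) x)) = glue1 (glue1 x) := by
  obtain rfl | ⟨u, σ, rfl⟩ := x.cases
  · rfl
  rw [rl_ofElt]
  have hc := ctr_comm σ
  set σ' := (sumRC _ _ _).symm.trans (σ.trans (sumRC _ _ _)) with hσ
  have inj : ∀ {z z' w}, σ z = w → σ z' = w → z = z' := fun h h' => σ.injective (h.trans h'.symm)
  rcases h2 : σ.symm (.inr ()) with (b | ⟨⟩) | ⟨⟩ <;> rw [Equiv.symm_apply_eq] at h2 <;>
  replace h2 := h2.symm <;>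
  rcases h1 : σ.symm (.inl (.inr ())) with (a | ⟨⟩) | ⟨⟩ <;> rw [Equiv.symm_apply_eq] at h1 <;>
  replace h1 := h1.symm
  · have hab : b ≠ a := by
      rintro rfl
      simpa using h1.symm.trans h2
    rw [glue1_ofElt u h2, glue1_ofElt (a := a) _ (ctr_of_inl h1),
      glue1_ofElt (σ := σ') (a := .inl a) _ (by simp [hσ, h1]),
      glue1_ofElt (a := b) _ (ctr_of_inl (by simp [hσ, h2])), Elts.mg_comm hab, hc, Elts.map_map,
      sumRC_trans, Elts.map_refl]
  · rw [glue1_ofElt u h2, glue1_loop (σ := σ') _ (by simp [hσ, h1]),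
      glue1_loop _ (ctr_of_inl h1)]; rfl
  · rw [glue1_ofElt u h2, glue1_ofElt (a := b) _ (ctr_of_inr h2 h1),
      glue1_ofElt (σ := σ') (a := .inr ()) _ (by simp [hσ, h1]),
      glue1_ofElt (a := b) _ (ctr_of_inl (by simp [hσ, h2])), Elts.mg_assoc, hc, Elts.map_map,
      sumRC_trans, Elts.map_refl]
  · rw [glue1_ofElt u h2, glue1_ofElt (a := a) _ (ctr_of_inl h1),
      glue1_ofElt (σ := σ') (a := .inl a) _ (by simp [hσ, h1]),
      glue1_ofElt (a := a) _ (ctr_of_inr (by simp [hσ, h1]) (by simp [hσ, h2])), Elts.mg_assoc, hc]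
  · simpa using h1.symm.trans h2
  · rw [glue1_ofElt u h2, glue1_loop _ (ctr_of_inr h2 h1),
      glue1_ofElt (σ := σ') (a := .inr ()) _ (by simp [hσ, h1]),
      glue1_loop _ (ctr_of_inr (by simp [hσ, h1]) (by simp [hσ, h2]))]
  · rw [glue1_loop u h2, glue1_ofElt (σ := σ') (a := .inl a) _ (by simp [hσ, h1]),
      glue1_loop _ (ctr_of_inl (by simp [hσ, h2]))]; rfl
  · rw [glue1_loop u h2, glue1_loop (σ := σ') _ (by simp [hσ, h1])]
  · simpa using h1.symm.trans h2

/-- `Fin (n + 1)` as a summand, with its last element singled out. -/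
def sumLastE (O : Type) (n : ℕ) : O ⊕ Fin (n + 1) ≃ (O ⊕ Fin n) ⊕ Unit :=
  (Equiv.sumCongr (Equiv.refl _) (lastE n)).trans (Equiv.sumAssoc _ _ _).symm

@[simp] theorem sumLastE_inl (n : ℕ) (x : O) : sumLastE O n (.inl x) = .inl (.inl x) := rfl

@[simp] theorem sumLastE_castSucc {n : ℕ} (i : Fin n) :
    sumLastE O n (.inr i.castSucc) = .inl (.inr i) := by simp [sumLastE]

@[simp] theorem sumLastE_last (n : ℕ) : sumLastE O n (.inr (Fin.last n)) = .inr () := by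
  simp [sumLastE]

/-- Glueing of numbered endpoints. -/
noncomputable def glueFin : ∀ n : ℕ, SElts (O ⊕ Fin n) (I ⊕ Fin n) → SElts O I
  | 0, x => rl (Equiv.sumEmpty _ _) (Equiv.sumEmpty _ _) x
  | n + 1, x => glueFin n (glue1 (rl (sumLastE O n) (sumLastE I n) x))

theorem glueFin_zero (x : SElts (O ⊕ Fin 0) (I ⊕ Fin 0)) :
    glueFin 0 x = rl (Equiv.sumEmpty _ _) (Equiv.sumEmpty _ _) x := rfl

theorem glueFin_succ (n : ℕ) (x : SElts (O ⊕ Fin (n + 1)) (I ⊕ Fin (n + 1))) :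
    glueFin (n + 1) x = glueFin n (glue1 (rl (sumLastE O n) (sumLastE I n) x)) := rfl

theorem glueFin_none : ∀ n : ℕ, glueFin n (none : SElts (O ⊕ Fin n) (I ⊕ Fin n)) = none
  | 0 => rfl
  | n + 1 => glueFin_none n

theorem glueFin_rl (o : O ≃ O') (i : I ≃ I') : ∀ (n : ℕ) (x : SElts (O ⊕ Fin n) (I ⊕ Fin n)),
    glueFin n (rl (Equiv.sumCongr o (Equiv.refl _)) (Equiv.sumCongr i (Equiv.refl _)) x)
      = rl o i (glueFin n x)
  | 0, x => by
    rw [glueFin_zero, glueFin_zero, rl_rl, rl_rl]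
    refine rl_congr (fun z => ?_) (fun z => ?_) x <;> rcases z with z | z
    exacts [rfl, z.elim0, rfl, z.elim0]
  | n + 1, x => by
    rw [glueFin_succ, glueFin_succ, ← glueFin_rl o i n, ← glue1_rl, rl_rl, rl_rl]
    refine congrArg _ (congrArg _ (rl_congr (fun z => ?_) (fun z => ?_) x)) <;>
    · rcases z with z | z
      · rfl
      · induction z using Fin.lastCases <;> simp

theorem glueFin_perm {n : ℕ} (τ : Equiv.Perm (Fin n)) : ∀ x : SElts (O ⊕ Fin n) (I ⊕ Fin n),
    glueFin n (rl (Equiv.sumCongr (Equiv.refl _) τ) (Equiv.sumCongr (Equiv.refl _) τ) x)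
      = glueFin n x := by
  induction τ using StrandPerm.letter_induction with
  | one n =>
    intro x
    refine congrArg _ (rl_id (fun z => ?_) (fun z => ?_) x) <;> rcases z with z | z <;> rfl
  | @mul n σ τ h1 h2 =>
    intro x
    refine Eq.trans ?_ ((h1 _).trans (h2 x))
    rw [rl_rl]
    refine congrArg _ (rl_congr (fun z => ?_) (fun z => ?_) x) <;> rcases z with z | z <;> rfl
  | @ext n σ h =>
    intro x
    rw [glueFin_succ, glueFin_succ]
    refine Eq.trans ?_ (h _)
    rw [← glue1_rl, rl_rl, rl_rl]
    refine congrArg _ (congrArg _ (rl_congr (fun z => ?_) (fun z => ?_) x)) <;>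
    · rcases z with z | z
      · rfl
      · induction z using Fin.lastCases <;> simp
  | top n =>
    intro x
    simp only [glueFin]
    rw [← glue1_rl, ← glue1_rl, ← glue1_comm, rl_rl, rl_rl, rl_rl, rl_rl]
    refine congrArg _ (congrArg _ (congrArg _ (rl_congr (fun z => ?_) (fun z => ?_) x))) <;>
    · rcases z with z | z
      · rfl
      · induction z using Fin.lastCases with
        | last => simp
        | cast z => induction z using Fin.lastCases <;> simp

/-- Glueing. -/
noncomputable def glue (K : Type) [Finite K] (x : SElts (O ⊕ K) (I ⊕ K)) : SElts O I :=
  glueFin (Nat.card K) (rl (Equiv.sumCongr (Equiv.refl _) (Finite.equivFin K))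
    (Equiv.sumCongr (Equiv.refl _) (Finite.equivFin K)) x)

theorem glue_eq [Finite K] {n : ℕ} (e : K ≃ Fin n) (x : SElts (O ⊕ K) (I ⊕ K)) :
    glue K x = glueFin n (rl (Equiv.sumCongr (Equiv.refl _) e)
      (Equiv.sumCongr (Equiv.refl _) e) x) := by
  obtain rfl : Nat.card K = n := by rw [Nat.card_congr e, Nat.card_fin]
  rw [glue, ← glueFin_perm ((Finite.equivFin K).symm.trans e), rl_rl]
  refine congrArg _ (rl_congr (fun z => ?_) (fun z => ?_) x) <;> rcases z with z | z <;> simp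

theorem glue_reindex [Finite K] [Finite K'] (k : K ≃ K') (x : SElts (O ⊕ K) (I ⊕ K)) :
    glue K' (rl (Equiv.sumCongr (Equiv.refl _) k) (Equiv.sumCongr (Equiv.refl _) k) x)
      = glue K x := by
  rw [glue_eq (Finite.equivFin K'), glue_eq (k.trans (Finite.equivFin K')), rl_rl]
  refine congrArg _ (rl_congr (fun z => ?_) (fun z => ?_) x) <;> rcases z with z | z <;> simp

theorem glue_rl [Finite K] (o : O ≃ O') (i : I ≃ I') (x : SElts (O ⊕ K) (I ⊕ K)) :
    glue K (rl (Equiv.sumCongr o (Equiv.refl _)) (Equiv.sumCongr i (Equiv.refl _)) x)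
      = rl o i (glue K x) := by
  rw [glue, glue, ← glueFin_rl, rl_rl, rl_rl]
  refine congrArg _ (rl_congr (fun z => ?_) (fun z => ?_) x) <;> rcases z with z | z <;> simp

theorem glue_none [Finite K] : glue K (none : SElts (O ⊕ K) (I ⊕ K)) = none := by
  have : ∀ n, glueFin n (none : SElts (O ⊕ Fin n) (I ⊕ Fin n)) = none := by
    intro n
    induction n with
    | zero => rfl
    | succ n ih => rw [glueFin, rl_none, glue1_none, ih]
  exact this _

theorem un_glueFin (y : SElts O' I') : ∀ (n : ℕ) (x : SElts (O ⊕ Fin n) (I ⊕ Fin n)),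
    un (glueFin n x) y = glueFin n (rl (sumRC _ _ _) (sumRC _ _ _) (un x y))
  | 0, x => by
    rw [glueFin_zero, glueFin_zero, rl_rl]
    conv_lhs => rw [← rl_refl y]
    rw [un_rl]
    refine rl_congr (fun z => ?_) (fun z => ?_) _ <;> rcases z with (z | z) | z
    exacts [rfl, z.elim0, rfl, rfl, z.elim0, rfl]
  | n + 1, x => by
    rw [glueFin_succ, glueFin_succ, un_glueFin y n, un_glue1, ← glue1_rl]
    conv_lhs => rw [← rl_refl y]
    rw [un_rl, rl_rl, rl_rl, rl_rl]
    refine congrArg _ (congrArg _ (rl_congr (fun z => ?_) (fun z => ?_) _)) <;>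
    · rcases z with (z | z) | z
      · rfl
      · induction z using Fin.lastCases <;> simp
      · rfl

theorem un_glue [Finite K] (x : SElts (O ⊕ K) (I ⊕ K)) (y : SElts O' I') :
    un (glue K x) y = glue K (rl (sumRC _ _ _) (sumRC _ _ _) (un x y)) := by
  rw [glue, glue, un_glueFin]
  conv_lhs => rw [← rl_refl y]
  rw [un_rl, rl_rl, rl_rl]
  refine congrArg _ (rl_congr (fun z => ?_) (fun z => ?_) _) <;> rcases z with (z | z) | z <;> rfl

theorem glue_of_isEmpty [Finite K] [IsEmpty K] (x : SElts (O ⊕ K) (I ⊕ K)) :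
    glue K x = rl (Equiv.sumEmpty _ _) (Equiv.sumEmpty _ _) x := by
  rw [glue_eq (Equiv.equivOfIsEmpty K (Fin 0)), glueFin, rl_rl]
  refine rl_congr (fun z => ?_) (fun z => ?_) _ <;> rcases z with z | z
  exacts [rfl, isEmptyElim z, rfl, isEmptyElim z]

theorem glue_unit (x : SElts (O ⊕ Unit) (I ⊕ Unit)) : glue Unit x = glue1 x := by
  rw [glue_eq (Equiv.ofUnique Unit (Fin 1)), glueFin, glueFin, ← glue1_rl, rl_rl, rl_rl]
  refine congrArg _ (rl_id (fun z => ?_) (fun z => ?_) x) <;> rcases z with z | z <;> rfl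

theorem glueFin_glueFin {n : ℕ} : ∀ (m : ℕ) (x : SElts ((O ⊕ Fin n) ⊕ Fin m) ((I ⊕ Fin n) ⊕ Fin m)),
    glueFin n (glueFin m x) = glueFin (n + m) (rl
      ((Equiv.sumAssoc _ _ _).trans (Equiv.sumCongr (Equiv.refl _) finSumFinEquiv))
      ((Equiv.sumAssoc _ _ _).trans (Equiv.sumCongr (Equiv.refl _) finSumFinEquiv)) x)
  | 0, x => by
    rw [glueFin]
    refine congrArg _ (rl_congr (fun z => ?_) (fun z => ?_) _) <;> rcases z with (z | z) | z
    exacts [rfl, rfl, z.elim0, rfl, rfl, z.elim0]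
  | m + 1, x => by
    rw [glueFin, glueFin_glueFin m]
    show _ = glueFin (n + m) _
    rw [← glue1_rl, rl_rl, rl_rl]
    refine congrArg _ (congrArg _ (rl_congr (fun z => ?_) (fun z => ?_) _)) <;>
    · rcases z with (z | z) | z
      · rfl
      · exact (sumLastE_castSucc (Fin.castAdd m z)).symm
      · induction z using Fin.lastCases with
        | last =>
          simp only [Equiv.trans_apply, sumLastE_last]
          exact (sumLastE_last (n + m)).symm
        | cast z =>
          simp only [Equiv.trans_apply, sumLastE_castSucc]
          exact (sumLastE_castSucc (Fin.natAdd n z)).symm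

theorem glue_glue [Finite K] [Finite K'] (x : SElts ((O ⊕ K) ⊕ K') ((I ⊕ K) ⊕ K')) :
    glue K (glue K' x)
      = glue (K ⊕ K') (rl (Equiv.sumAssoc _ _ _) (Equiv.sumAssoc _ _ _) x) := by
  rw [glue, ← glue_rl, glue, glueFin_glueFin,
    glue_eq ((Equiv.sumCongr (Finite.equivFin K) (Finite.equivFin K')).trans finSumFinEquiv),
    rl_rl, rl_rl, rl_rl]
  refine congrArg _ (rl_congr (fun z => ?_) (fun z => ?_) _) <;> rcases z with (z | z) | z <;> rfl

/-! ### Glueing closes no strand if the glued endpoints can be ordered -/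

/-- The strands starting at `K` do not close up. -/
def Ranked (σ : O ⊕ K ≃ I ⊕ K) : Prop :=
  ∃ r : K → ℕ, ∀ k k', σ (.inr k) = .inr k' → r k < r k'

theorem ranked_ctr (σ : (O ⊕ K) ⊕ Unit ≃ (I ⊕ K) ⊕ Unit) (h : σ (.inr ()) ≠ .inr ()) :
    Ranked (ctr σ) ↔ Ranked ((Equiv.sumAssoc _ _ _).symm.trans
      (σ.trans (Equiv.sumAssoc _ _ _))) := by
  obtain ⟨t, ht⟩ : ∃ t, σ (.inr ()) = .inl t := by
    rcases h' : σ (.inr ()) with t | ⟨⟩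
    · exact ⟨t, rfl⟩
    · exact (h h').elim
  constructor
  · rintro ⟨r, hr⟩
    obtain ⟨m, hm, hm'⟩ : ∃ m : ℕ, (∀ k, σ (.inl (.inr k)) = .inr () → 2 * r k + 1 < m) ∧
        ∀ k, t = .inr k → m < 2 * r k + 1 := by
      rcases hp : σ.symm (.inr ()) with (o | p) | ⟨⟩ <;> rw [Equiv.symm_apply_eq] at hp
      · refine ⟨0, fun k hk => ?_, fun k _ => by omega⟩
        simpa using σ.injective (hk.trans hp)
      · refine ⟨2 * r p + 2, fun k hk => ?_, fun k hk => ?_⟩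
        · obtain rfl : k = p := by simpa using σ.injective (hk.trans hp)
          omega
        · have := hr p k (by rw [ctr_of_inr hp.symm ht, hk])
          omega
      · exact (h hp.symm).elim
    refine ⟨Sum.elim (fun k => 2 * r k + 1) fun _ => m, ?_⟩
    rintro (k | ⟨⟩) (k' | ⟨⟩) e
    · have e' : σ (.inl (.inr k)) = .inl (.inr k') := by
        simpa [Equiv.eq_symm_apply] using congrArg (Equiv.sumAssoc _ _ _).symm e
      have := hr k k' (ctr_of_inl e')
      simp only [Sum.elim_inl]; omega
    · have e' : σ (.inl (.inr k)) = .inr () := by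
        simpa [Equiv.eq_symm_apply] using congrArg (Equiv.sumAssoc _ _ _).symm e
      exact hm k e'
    · have e' : σ (.inr ()) = .inl (.inr k') := by
        simpa [Equiv.eq_symm_apply] using congrArg (Equiv.sumAssoc _ _ _).symm e
      rw [ht] at e'
      exact hm' k' (Sum.inl_injective e')
    · have e' : σ (.inr ()) = .inr () := by
        simpa [Equiv.eq_symm_apply] using congrArg (Equiv.sumAssoc _ _ _).symm e
      exact (h e').elim
  · rintro ⟨r, hr⟩
    refine ⟨fun k => r (.inl k), fun k k' e => ?_⟩
    rcases hk : σ (.inl (.inr k)) with y | ⟨⟩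
    · rw [ctr_of_inl hk] at e
      subst e
      exact hr _ _ (by simp [hk])
    · rw [ctr_of_inr hk ht] at e
      subst e
      exact (hr (.inl k) (.inr ()) (by simp [hk])).trans (hr (.inr ()) (.inl k') (by simp [ht]))

theorem ranked_congr (σ : O ⊕ K ≃ I ⊕ K) (k : K ≃ K') :
    Ranked ((Equiv.sumCongr (Equiv.refl _) k).symm.trans
      (σ.trans (Equiv.sumCongr (Equiv.refl _) k))) ↔ Ranked σ := by
  constructor
  · rintro ⟨r, hr⟩
    exact ⟨fun x => r (k x), fun x y e => hr _ _ (by simp [e])⟩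
  · rintro ⟨r, hr⟩
    refine ⟨fun x => r (k.symm x), fun x y e => hr _ _ ?_⟩
    have := congrArg (Equiv.sumCongr (Equiv.refl _) k).symm e
    simpa using this

theorem glueFin_isSome : ∀ (n : ℕ) (u : Elts (O ⊕ Fin n)) (σ : O ⊕ Fin n ≃ I ⊕ Fin n),
    (∃ v τ, glueFin n (ofElt u σ) = ofElt v τ) ↔ Ranked σ
  | 0, u, σ => by
    constructor
    · exact fun _ => ⟨fun _ => 0, fun k => k.elim0⟩
    · exact fun _ => ⟨_, _, rfl⟩
  | n + 1, u, σ => by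
    rw [glueFin, rl_ofElt]
    set σ' := (sumLastE O n).symm.trans (σ.trans (sumLastE I n)) with hσ
    have h1 : Ranked σ ↔ Ranked ((Equiv.sumAssoc _ _ _).symm.trans
        (σ'.trans (Equiv.sumAssoc _ _ _))) := by
      rw [← ranked_congr σ (lastE n)]
      refine iff_of_eq (congrArg _ (Equiv.ext fun z => ?_))
      rcases z with z | z | z <;> simp [hσ, sumLastE]
    rcases hp : σ'.symm (.inr ()) with a | ⟨⟩ <;> rw [Equiv.symm_apply_eq] at hp
    · rw [glue1_ofElt _ hp.symm, glueFin_isSome n, h1]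
      exact ranked_ctr σ' fun h => by simpa using σ'.injective (hp.symm.trans h.symm)
    · rw [glue1_loop _ hp.symm, h1]
      constructor
      · rintro ⟨v, τ, h⟩
        rw [glueFin_none] at h
        cases h
      · rintro ⟨r, hr⟩
        exact (lt_irrefl _ (hr (.inr ()) (.inr ()) (by simp [← hp]))).elim

theorem glue_isSome [Finite K] (u : Elts (O ⊕ K)) (σ : O ⊕ K ≃ I ⊕ K) :
    (∃ v τ, glue K (ofElt u σ) = ofElt v τ) ↔ Ranked σ := by
  rw [glue, rl_ofElt, glueFin_isSome, ranked_congr]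

end SElts

/-! ### Unordered tensor products -/

namespace Elts

variable {X Y F S T : Type}

/-- `Fin (n + 1) × F` with the last copy of `F` singled out. -/
def prodLastE (n : ℕ) (F : Type) : (Fin n × F) ⊕ F ≃ Fin (n + 1) × F where
  toFun := Sum.elim (fun p => (p.1.castSucc, p.2)) fun f => (Fin.last n, f)
  invFun p := (lastE n p.1).elim (fun i => .inl (i, p.2)) fun _ => .inr p.2
  left_inv := by rintro (⟨i, f⟩ | f) <;> simp
  right_inv := by
    rintro ⟨i, f⟩
    induction i using Fin.lastCases <;> simp

@[simp] theorem prodLastE_inl {n : ℕ} (p : Fin n × F) :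
    prodLastE n F (.inl p) = (p.1.castSucc, p.2) := rfl

@[simp] theorem prodLastE_inr {n : ℕ} (f : F) : prodLastE n F (.inr f) = (Fin.last n, f) := rfl

/-- The tensor product of a numbered family. -/
def prodFin : ∀ {n : ℕ}, (Fin n → Elts F) → Elts (Fin n × F)
  | 0, _ => map (Equiv.equivOfIsEmpty _ _) one
  | n + 1, a => map (prodLastE n F) ((prodFin fun i => a i.castSucc).tensor (a (Fin.last n)))

theorem map_tensor_left (f : S ≃ X) (x : Elts S) (y : Elts T) :
    (map f x).tensor y = map (Equiv.sumCongr f (Equiv.refl _)) (x.tensor y) := by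
  rw [← map_tensor, map_refl]

theorem map_tensor_right (f : S ≃ X) (x : Elts S) (y : Elts T) :
    y.tensor (map f x) = map (Equiv.sumCongr (Equiv.refl _) f) (y.tensor x) := by
  rw [← map_tensor, map_refl]

theorem tensor_right_comm (x : Elts S) (y : Elts T) (z : Elts X) :
    map (sumRC _ _ _) ((x.tensor y).tensor z) = (x.tensor z).tensor y := by
  have h : (x.tensor z).tensor y = map (Equiv.sumAssoc _ _ _).symm (x.tensor (z.tensor y)) := by
    rw [← tensor_assoc, map_symm_map]
  rw [h, ← tensor_comm y z, map_tensor_right, ← tensor_assoc, map_map, map_map]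
  refine map_congr (fun w => ?_) _
  rcases w with (w | w) | w <;> rfl

theorem prodFin_perm {n : ℕ} (τ : Equiv.Perm (Fin n)) : ∀ a : Fin n → Elts F,
    map (Equiv.prodCongr τ (Equiv.refl F)) (prodFin (a ∘ τ)) = prodFin a := by
  induction τ using StrandPerm.letter_induction with
  | one n =>
    intro a
    exact map_refl _
  | @mul n σ τ h1 h2 =>
    intro a
    refine Eq.trans ?_ ((congrArg _ (h2 (a ∘ σ))).trans (h1 a))
    rw [map_map]
    rfl
  | @ext n σ h =>
    intro a
    have h' := h fun i => a i.castSucc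
    rw [prodFin, prodFin, ← h', map_tensor_left, map_map, map_map]
    simp only [Function.comp_def, StrandPerm.ext_last, StrandPerm.ext_castSucc]
    refine map_congr (fun w => ?_) _
    rcases w with w | w <;> simp
  | top n =>
    intro a
    simp only [prodFin, Function.comp_def, StrandPerm.top_last, StrandPerm.top_castSucc_last,
      StrandPerm.top_castSucc_castSucc, map_tensor_left, map_map]
    rw [← tensor_right_comm _ (a (Fin.last (n + 1))), map_map]
    conv_rhs => rw [← tensor_right_comm, map_map]
    rw [← tensor_right_comm, map_map]
    refine map_congr (fun w => ?_) _
    rcases w with (w | w) | w <;> simp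

/-- The tensor product of a family. -/
noncomputable def prod [Finite X] (a : X → Elts F) : Elts (X × F) :=
  map (Equiv.prodCongr (Finite.equivFin X).symm (Equiv.refl F)) (prodFin (a ∘ (Finite.equivFin X).symm))

theorem prod_eq [Finite X] {n : ℕ} (e : Fin n ≃ X) (a : X → Elts F) :
    prod a = map (Equiv.prodCongr e (Equiv.refl F)) (prodFin (a ∘ e)) := by
  obtain rfl : Nat.card X = n := by rw [← Nat.card_congr e, Nat.card_fin]
  rw [prod, ← prodFin_perm (e.trans (Finite.equivFin X)), map_map]
  simp only [Function.comp_def, Equiv.trans_apply, Equiv.symm_apply_apply]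
  refine map_congr (fun w => ?_) _
  simp [Prod.map]

theorem prod_map [Finite X] [Finite Y] (f : X ≃ Y) (a : Y → Elts F) :
    map (Equiv.prodCongr f (Equiv.refl F)) (prod (a ∘ f)) = prod a := by
  rw [prod_eq ((Finite.equivFin X).symm.trans f) a, prod, map_map]
  rfl

theorem prodFin_add {n : ℕ} : ∀ {m : ℕ} (a : Fin (n + m) → Elts F),
    map ((Equiv.sumProdDistrib _ _ _).symm.trans (Equiv.prodCongr finSumFinEquiv (Equiv.refl F)))
      ((prodFin fun i => a (Fin.castAdd m i)).tensor (prodFin fun i => a (Fin.natAdd n i)))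
      = prodFin a
  | 0, a => by
    show map _ ((prodFin a).tensor (map (Equiv.equivOfIsEmpty _ _) one)) = _
    rw [map_tensor_right, map_map]
    conv_rhs => rw [← tensor_one (prodFin a)]
    refine map_congr (fun w => ?_) _
    rcases w with w | w
    · rfl
    · exact w.elim
  | m + 1, a => by
    have e : prodFin a = map (prodLastE (n + m) F) ((prodFin (n := n + m)
      fun i => a i.castSucc).tensor (a (Fin.last (n + m)))) := rfl
    have e' := prodFin_add (n := n) (m := m) fun i => a i.castSucc
    rw [e, ← e', prodFin, map_tensor_left, map_tensor_right, map_map, map_map]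
    rw [← map_symm_map (Equiv.sumAssoc _ _ _) (tensor (tensor _ _) _), tensor_assoc, map_map]
    refine map_congr (fun w => ?_) _
    rcases w with w | w | w <;> rfl

theorem prod_sum [Finite X] [Finite Y] (a : X → Elts F) (b : Y → Elts F) :
    prod (Sum.elim a b) = map (Equiv.sumProdDistrib _ _ _).symm ((prod a).tensor (prod b)) := by
  rw [prod_eq (finSumFinEquiv.symm.trans (Equiv.sumCongr (Finite.equivFin X).symm
    (Finite.equivFin Y).symm)), ← prodFin_add, prod, prod, map_tensor, map_map, map_map]
  simp only [Function.comp_def, Equiv.trans_apply, finSumFinEquiv_symm_apply_castAdd,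
    finSumFinEquiv_symm_apply_natAdd, Equiv.sumCongr_apply, Sum.map_inl, Sum.map_inr,
    Sum.elim_inl, Sum.elim_inr]
  refine map_congr (fun w => ?_) _
  rcases w with ⟨w, f⟩ | ⟨w, f⟩ <;> simp

theorem prod_of_isEmpty [Finite X] [IsEmpty X] (a : X → Elts F) :
    prod a = map (Equiv.equivOfIsEmpty _ _) one := by
  rw [prod_eq (Equiv.equivOfIsEmpty (Fin 0) X), prodFin, map_map]
  exact map_congr (fun w => w.elim) _

theorem prod_unique (a : Unit → Elts F) : prod a = map (Equiv.punitProd F).symm (a ()) := by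
  rw [prod_eq (Equiv.ofUnique (Fin 1) Unit), prodFin, prodFin, ← tensor_comm, map_map,
    map_tensor_right, map_map, map_map]
  conv_rhs => rw [← tensor_one (a ()), map_map]
  refine map_congr (fun w => ?_) _
  rcases w with w | w
  · rfl
  · exact w.elim

end Elts

/-! ## Graphs up to moves -/

namespace XCGraph

variable {O I O' I' O'' I'' K K' : Type}

/-- Isomorphism, the subdivision move, and, if `P` holds, all moves. -/
inductive TStep (P : Prop) : XCGraph O I → XCGraph O I → Prop
  | iso {D D' : XCGraph O I} : D.Iso D' → TStep P D D'
  | zeroR {D D' : XCGraph O I} (e : D.E) (i j : SignType)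
      (h : (D.rot e : ℤ) = (i : ℤ) + (j : ℤ)) : (D.subdivide e i j).Iso D' → TStep P D D'
  | step {D D' : XCGraph O I} (p : P) : D.Step D' → TStep P D D'

variable {P : Prop}

theorem TStep.relabel {D D' : XCGraph O I} (h : TStep P D D') (o : O ≃ O') (i : I ≃ I') :
    TStep P (D.relabel o i) (D'.relabel o i) := by
  cases h with
  | iso f => exact .iso (f.relabel o i)
  | zeroR e a b h f =>
    exact .zeroR (D := D.relabel o i) e a b h
      ((subdivideRelabel D e a b o i).trans (f.relabel o i))
  | step p h => exact .step p (h.relabel o i)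

theorem TStep.glue {D D' : XCGraph (O ⊕ K) (I ⊕ K)} (h : TStep P D D') :
    TStep P D.glue D'.glue := by
  cases h with
  | iso f => exact .iso f.glue
  | zeroR e a b h f =>
    exact .zeroR (D := D.glue) e a b h ((subdivideGlue D e a b).trans f.glue)
  | step p h => exact .step p h.glue

theorem TStep.union_right {D D' : XCGraph O I} (h : TStep P D D') (T : XCGraph O' I') :
    TStep P (D.union T) (D'.union T) := by
  cases h with
  | iso f => exact .iso (f.union (Iso.refl T))
  | zeroR e a b h f =>
    exact .zeroR (D := D.union T) (Sum.inl e) a b h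
      ((subdivideUnion D T e a b).trans (f.union (Iso.refl T)))
  | step p h => exact .step p (h.union_right T)

/-- The graph without edges. -/
def nil : XCGraph Empty Empty where
  E := Empty
  B := Empty
  X := Empty
  finite_edges := inferInstance
  pos := Empty.elim
  rot := Empty.elim
  src := Equiv.equivOfIsEmpty _ _
  tgt := Equiv.equivOfIsEmpty _ _

/-- Renaming twice. -/
def relabelRelabel (D : XCGraph O I) (o : O ≃ O') (i : I ≃ I') (o' : O' ≃ O'') (i' : I' ≃ I'') :
    ((D.relabel o i).relabel o' i').Iso (D.relabel (o.trans o') (i.trans i')) where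
  e := Equiv.refl _
  b := Equiv.refl _
  x := Equiv.refl _
  pos_eq _ := rfl
  rot_eq _ := rfl
  src_eq y := by
    show Sum.map _ _ (D.src y) = Sum.map _ _ (Sum.map _ _ (Sum.map _ _ (D.src y)))
    rcases D.src y with a | b | ⟨x, s⟩ <;> rfl
  tgt_eq y := by
    show Sum.map _ _ (D.tgt y) = Sum.map _ _ (Sum.map _ _ (Sum.map _ _ (D.tgt y)))
    rcases D.tgt y with a | b | ⟨x, s⟩ <;> rfl

/-- Renaming by identities. -/
def relabelRefl (D : XCGraph O I) : (D.relabel (Equiv.refl _) (Equiv.refl _)).Iso D where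
  e := Equiv.refl _
  b := Equiv.refl _
  x := Equiv.refl _
  pos_eq _ := rfl
  rot_eq _ := rfl
  src_eq y := by
    show D.src y = Sum.map _ _ (Sum.map _ _ (D.src y))
    rcases D.src y with a | b | ⟨x, s⟩ <;> rfl
  tgt_eq y := by
    show D.tgt y = Sum.map _ _ (Sum.map _ _ (D.tgt y))
    rcases D.tgt y with a | b | ⟨x, s⟩ <;> rfl

/-- Disjoint union commutes with renaming. -/
def unionRelabel {U V U' V' : Type} (D : XCGraph O I) (T : XCGraph U V) (o : O ≃ O') (i : I ≃ I')
    (u : U ≃ U') (v : V ≃ V') : ((D.relabel o i).union (T.relabel u v)).Iso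
      ((D.union T).relabel (Equiv.sumCongr o u) (Equiv.sumCongr i v)) where
  e := Equiv.refl _
  b := Equiv.refl _
  x := Equiv.refl _
  pos_eq _ := rfl
  rot_eq _ := rfl
  src_eq := by
    rintro (y | y)
    · show Sum.map _ _ (unionPorts _ _ _ _ _ _ (.inl (D.src y)))
        = Sum.map _ _ (unionPorts _ _ _ _ _ _ (.inl (Sum.map _ _ (D.src y))))
      rcases D.src y with a | b | ⟨x, s⟩ <;> rfl
    · show Sum.map _ _ (unionPorts _ _ _ _ _ _ (.inr (T.src y)))
        = Sum.map _ _ (unionPorts _ _ _ _ _ _ (.inr (Sum.map _ _ (T.src y))))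
      rcases T.src y with a | b | ⟨x, s⟩ <;> rfl
  tgt_eq := by
    rintro (y | y)
    · show Sum.map _ _ (unionPorts _ _ _ _ _ _ (.inl (D.tgt y)))
        = Sum.map _ _ (unionPorts _ _ _ _ _ _ (.inl (Sum.map _ _ (D.tgt y))))
      rcases D.tgt y with a | b | ⟨x, s⟩ <;> rfl
    · show Sum.map _ _ (unionPorts _ _ _ _ _ _ (.inr (T.tgt y)))
        = Sum.map _ _ (unionPorts _ _ _ _ _ _ (.inr (Sum.map _ _ (T.tgt y))))
      rcases T.tgt y with a | b | ⟨x, s⟩ <;> rfl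

/-- Disjoint union is associative. -/
def unionAssoc (D : XCGraph O I) (T : XCGraph O' I') (S : XCGraph O'' I'') :
    (((D.union T).union S).relabel (Equiv.sumAssoc _ _ _) (Equiv.sumAssoc _ _ _)).Iso
      (D.union (T.union S)) where
  e := Equiv.sumAssoc _ _ _
  b := Equiv.sumAssoc _ _ _
  x := Equiv.sumAssoc _ _ _
  pos_eq := by rintro ((y | y) | y) <;> rfl
  rot_eq := by rintro ((y | y) | y) <;> rfl
  src_eq := by
    rintro ((y | y) | y)
    · show unionPorts _ _ _ _ _ _ (.inl (D.src y)) = Sum.map _ _ (Sum.map _ _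
        (unionPorts _ _ _ _ _ _ (.inl (unionPorts _ _ _ _ _ _ (.inl (D.src y))))))
      rcases D.src y with a | b | ⟨x, s⟩ <;> rfl
    · show unionPorts _ _ _ _ _ _ (.inr (unionPorts _ _ _ _ _ _ (.inl (T.src y))))
        = Sum.map _ _ (Sum.map _ _
        (unionPorts _ _ _ _ _ _ (.inl (unionPorts _ _ _ _ _ _ (.inr (T.src y))))))
      rcases T.src y with a | b | ⟨x, s⟩ <;> rfl
    · show unionPorts _ _ _ _ _ _ (.inr (unionPorts _ _ _ _ _ _ (.inr (S.src y))))
        = Sum.map _ _ (Sum.map _ _ (unionPorts _ _ _ _ _ _ (.inr (S.src y))))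
      rcases S.src y with a | b | ⟨x, s⟩ <;> rfl
  tgt_eq := by
    rintro ((y | y) | y)
    · show unionPorts _ _ _ _ _ _ (.inl (D.tgt y)) = Sum.map _ _ (Sum.map _ _
        (unionPorts _ _ _ _ _ _ (.inl (unionPorts _ _ _ _ _ _ (.inl (D.tgt y))))))
      rcases D.tgt y with a | b | ⟨x, s⟩ <;> rfl
    · show unionPorts _ _ _ _ _ _ (.inr (unionPorts _ _ _ _ _ _ (.inl (T.tgt y))))
        = Sum.map _ _ (Sum.map _ _
        (unionPorts _ _ _ _ _ _ (.inl (unionPorts _ _ _ _ _ _ (.inr (T.tgt y))))))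
      rcases T.tgt y with a | b | ⟨x, s⟩ <;> rfl
    · show unionPorts _ _ _ _ _ _ (.inr (unionPorts _ _ _ _ _ _ (.inr (S.tgt y))))
        = Sum.map _ _ (Sum.map _ _ (unionPorts _ _ _ _ _ _ (.inr (S.tgt y))))
      rcases S.tgt y with a | b | ⟨x, s⟩ <;> rfl

/-- The disjoint union with the empty graph. -/
def unionNil (D : XCGraph O I) :
    ((D.union nil).relabel (Equiv.sumEmpty _ _) (Equiv.sumEmpty _ _)).Iso D where
  e := Equiv.sumEmpty D.E Empty
  b := Equiv.sumEmpty D.B Empty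
  x := Equiv.sumEmpty D.X Empty
  pos_eq := by rintro (y | y); exacts [rfl, y.elim]
  rot_eq := by rintro (y | y); exacts [rfl, y.elim]
  src_eq := by
    rintro (y | y)
    · show D.src y = Sum.map _ _ (Sum.map _ _ (unionPorts _ _ _ _ _ _ (.inl (D.src y))))
      rcases D.src y with a | b | ⟨x, s⟩ <;> rfl
    · exact y.elim
  tgt_eq := by
    rintro (y | y)
    · show D.tgt y = Sum.map _ _ (Sum.map _ _ (unionPorts _ _ _ _ _ _ (.inl (D.tgt y))))
      rcases D.tgt y with a | b | ⟨x, s⟩ <;> rfl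
    · exact y.elim

/-- Glueing commutes with renaming, also of the glued vertices. -/
def glueRelabel (D : XCGraph (O ⊕ K) (I ⊕ K)) (o : O ≃ O') (i : I ≃ I') (k : K ≃ K') :
    (D.relabel (Equiv.sumCongr o k) (Equiv.sumCongr i k)).glue.Iso (D.glue.relabel o i) where
  e := Equiv.refl _
  b := Equiv.sumCongr (Equiv.refl _) k.symm
  x := Equiv.refl _
  pos_eq _ := rfl
  rot_eq _ := rfl
  src_eq y := by
    show Sum.map _ _ (gluePorts _ _ _ _ (D.src y))
      = Sum.map _ _ (gluePorts _ _ _ _ (Sum.map _ _ (D.src y)))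
    rcases D.src y with (a | z) | b | ⟨x, s⟩
    exacts [rfl,
      congrArg (fun t : K => (Sum.inr (Sum.inl (Sum.inr t)) : O' ⊕ (D.B ⊕ K) ⊕ D.X × Bool))
        (k.symm_apply_apply z).symm, rfl, rfl]
  tgt_eq y := by
    show Sum.map _ _ (gluePorts _ _ _ _ (D.tgt y))
      = Sum.map _ _ (gluePorts _ _ _ _ (Sum.map _ _ (D.tgt y)))
    rcases D.tgt y with (a | z) | b | ⟨x, s⟩
    exacts [rfl,
      congrArg (fun t : K => (Sum.inr (Sum.inl (Sum.inr t)) : I' ⊕ (D.B ⊕ K) ⊕ D.X × Bool))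
        (k.symm_apply_apply z).symm, rfl, rfl]

/-- Glueing twice. -/
def glueGlue (D : XCGraph ((O ⊕ K) ⊕ K') ((I ⊕ K) ⊕ K')) :
    D.glue.glue.Iso (D.relabel (Equiv.sumAssoc _ _ _) (Equiv.sumAssoc _ _ _)).glue where
  e := Equiv.refl _
  b := (sumRC _ _ _).trans (Equiv.sumAssoc _ _ _)
  x := Equiv.refl _
  pos_eq _ := rfl
  rot_eq _ := rfl
  src_eq y := by
    show gluePorts _ _ _ _ (Sum.map _ _ (D.src y))
      = Sum.map _ _ (gluePorts _ _ _ _ (gluePorts _ _ _ _ (D.src y)))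
    rcases D.src y with ((a | z) | z) | b | ⟨x, s⟩ <;> rfl
  tgt_eq y := by
    show gluePorts _ _ _ _ (Sum.map _ _ (D.tgt y))
      = Sum.map _ _ (gluePorts _ _ _ _ (gluePorts _ _ _ _ (D.tgt y)))
    rcases D.tgt y with ((a | z) | z) | b | ⟨x, s⟩ <;> rfl

/-- Disjoint union commutes with glueing. -/
def unionGlue (D : XCGraph (O ⊕ K) (I ⊕ K)) (T : XCGraph O' I') :
    (D.glue.union T).Iso ((D.union T).relabel (sumRC _ _ _) (sumRC _ _ _)).glue where
  e := Equiv.refl _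
  b := sumRC _ _ _
  x := Equiv.refl _
  pos_eq _ := rfl
  rot_eq _ := rfl
  src_eq := by
    rintro (y | y)
    · show gluePorts _ _ _ _ (Sum.map _ _ (unionPorts _ _ _ _ _ _ (.inl (D.src y))))
        = Sum.map _ _ (unionPorts _ _ _ _ _ _ (.inl (gluePorts _ _ _ _ (D.src y))))
      rcases D.src y with (a | z) | b | ⟨x, s⟩ <;> rfl
    · show gluePorts _ _ _ _ (Sum.map _ _ (unionPorts _ _ _ _ _ _ (.inr (T.src y))))
        = Sum.map _ _ (unionPorts _ _ _ _ _ _ (.inr (T.src y)))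
      rcases T.src y with a | b | ⟨x, s⟩ <;> rfl
  tgt_eq := by
    rintro (y | y)
    · show gluePorts _ _ _ _ (Sum.map _ _ (unionPorts _ _ _ _ _ _ (.inl (D.tgt y))))
        = Sum.map _ _ (unionPorts _ _ _ _ _ _ (.inl (gluePorts _ _ _ _ (D.tgt y))))
      rcases D.tgt y with (a | z) | b | ⟨x, s⟩ <;> rfl
    · show gluePorts _ _ _ _ (Sum.map _ _ (unionPorts _ _ _ _ _ _ (.inr (T.tgt y))))
        = Sum.map _ _ (unionPorts _ _ _ _ _ _ (.inr (T.tgt y)))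
      rcases T.tgt y with a | b | ⟨x, s⟩ <;> rfl

/-- Glueing nothing. -/
def glueOfIsEmpty [IsEmpty K] (D : XCGraph (O ⊕ K) (I ⊕ K)) :
    D.glue.Iso (D.relabel (Equiv.sumEmpty _ _) (Equiv.sumEmpty _ _)) where
  e := Equiv.refl _
  b := Equiv.sumEmpty _ _
  x := Equiv.refl _
  pos_eq _ := rfl
  rot_eq _ := rfl
  src_eq y := by
    show Sum.map _ _ (D.src y) = Sum.map _ _ (gluePorts _ _ _ _ (D.src y))
    rcases D.src y with (a | z) | b | ⟨x, s⟩
    exacts [rfl, isEmptyElim z, rfl, rfl]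
  tgt_eq y := by
    show Sum.map _ _ (D.tgt y) = Sum.map _ _ (gluePorts _ _ _ _ (D.tgt y))
    rcases D.tgt y with (a | z) | b | ⟨x, s⟩
    exacts [rfl, isEmptyElim z, rfl, rfl]

end XCGraph

/-- Graphs up to isomorphism and the subdivision move, and, if `P` holds, all moves. -/
def Tg (P : Prop) (O I : Type) : Type 1 := Quot (XCGraph.TStep P (O := O) (I := I))

namespace Tg

variable {P : Prop} {O I O' I' O'' I'' K K' : Type}

/-- The class of a graph. -/
def mk (P : Prop) (D : XCGraph O I) : Tg P O I := Quot.mk _ D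

theorem sound_iso {D D' : XCGraph O I} (f : D.Iso D') : mk P D = mk P D' :=
  Quot.sound (.iso f)

theorem sound_zeroR {D : XCGraph O I} (e : D.E) (i j : SignType)
    (h : (D.rot e : ℤ) = (i : ℤ) + (j : ℤ)) : mk P (D.subdivide e i j) = mk P D :=
  (Quot.sound (.zeroR e i j h (.refl _))).symm

theorem exists_rep (x : Tg P O I) : ∃ D, mk P D = x := Quot.exists_rep x

/-- Renaming of the univalent vertices. -/
def rl (o : O ≃ O') (i : I ≃ I') : Tg P O I → Tg P O' I' :=
  Quot.map (fun D => D.relabel o i) fun _ _ h => h.relabel o i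

/-- Disjoint union. -/
def un : Tg P O I → Tg P O' I' → Tg P (O ⊕ O') (I ⊕ I') :=
  Quot.lift₂ (fun D T => mk P (D.union T))
    (fun T D D' h => (sound_iso (XCGraph.unionComm D T).symm).trans
      ((Quot.sound ((h.union_right T).relabel _ _)).trans (sound_iso (XCGraph.unionComm D' T))))
    (fun _ _ T h => Quot.sound (h.union_right T))

/-- Glueing. -/
def gl (K : Type) : Tg P (O ⊕ K) (I ⊕ K) → Tg P O I :=
  Quot.map XCGraph.glue fun _ _ h => h.glue

/-- The empty graph. -/
def nil (P : Prop) : Tg P Empty Empty := mk P XCGraph.nil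

theorem rl_rl (o : O ≃ O') (i : I ≃ I') (o' : O' ≃ O'') (i' : I' ≃ I'') (x : Tg P O I) :
    rl o' i' (rl o i x) = rl (o.trans o') (i.trans i') x := by
  obtain ⟨D, rfl⟩ := x.exists_rep
  exact sound_iso (D.relabelRelabel o i o' i')

theorem rl_congr {o o' : O ≃ O'} {i i' : I ≃ I'} (h : ∀ x, o x = o' x) (h' : ∀ x, i x = i' x)
    (x : Tg P O I) : rl o i x = rl o' i' x := by
  rw [Equiv.ext h, Equiv.ext h']

theorem rl_refl (x : Tg P O I) : rl (Equiv.refl _) (Equiv.refl _) x = x := by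
  obtain ⟨D, rfl⟩ := x.exists_rep
  exact sound_iso D.relabelRefl

theorem rl_id {o : O ≃ O} {i : I ≃ I} (h : ∀ x, o x = x) (h' : ∀ x, i x = x)
    (x : Tg P O I) : rl o i x = x :=
  (rl_congr h h' x).trans (rl_refl x)

theorem rl_injective (o : O ≃ O') (i : I ≃ I') : Function.Injective (rl (P := P) o i) := by
  intro x y h
  have := congrArg (rl o.symm i.symm) h
  rwa [rl_rl, rl_rl, rl_id (by simp) (by simp), rl_id (by simp) (by simp)] at this

theorem un_rl (o : O ≃ O') (i : I ≃ I') {U V U' V' : Type} (u : U ≃ U') (v : V ≃ V')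
    (x : Tg P O I) (y : Tg P U V) :
    un (rl o i x) (rl u v y) = rl (Equiv.sumCongr o u) (Equiv.sumCongr i v) (un x y) := by
  obtain ⟨D, rfl⟩ := x.exists_rep
  obtain ⟨T, rfl⟩ := y.exists_rep
  exact sound_iso (D.unionRelabel T o i u v)

theorem rl_un (o : O ≃ O') (i : I ≃ I') {U V : Type} (x : Tg P O I) (y : Tg P U V) :
    un (rl o i x) y = rl (Equiv.sumCongr o (.refl _)) (Equiv.sumCongr i (.refl _)) (un x y) := by
  rw [← un_rl, rl_refl]

theorem un_rl_right (o : O ≃ O') (i : I ≃ I') {U V : Type} (x : Tg P O I) (y : Tg P U V) :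
    un y (rl o i x) = rl (Equiv.sumCongr (.refl _) o) (Equiv.sumCongr (.refl _) i) (un y x) := by
  rw [← un_rl, rl_refl]

theorem un_comm (x : Tg P O I) (y : Tg P O' I') :
    rl (Equiv.sumComm _ _) (Equiv.sumComm _ _) (un x y) = un y x := by
  obtain ⟨D, rfl⟩ := x.exists_rep
  obtain ⟨T, rfl⟩ := y.exists_rep
  exact sound_iso (D.unionComm T)

theorem un_assoc (x : Tg P O I) (y : Tg P O' I') (z : Tg P O'' I'') :
    rl (Equiv.sumAssoc _ _ _) (Equiv.sumAssoc _ _ _) (un (un x y) z) = un x (un y z) := by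
  obtain ⟨D, rfl⟩ := x.exists_rep
  obtain ⟨T, rfl⟩ := y.exists_rep
  obtain ⟨S, rfl⟩ := z.exists_rep
  exact sound_iso (D.unionAssoc T S)

theorem un_nil (x : Tg P O I) :
    rl (Equiv.sumEmpty _ _) (Equiv.sumEmpty _ _) (un x (nil P)) = x := by
  obtain ⟨D, rfl⟩ := x.exists_rep
  exact sound_iso D.unionNil

theorem un_right_comm (x : Tg P O I) (y : Tg P O' I') (z : Tg P O'' I'') :
    rl (sumRC _ _ _) (sumRC _ _ _) (un (un x y) z) = un (un x z) y := by
  refine rl_injective (Equiv.sumAssoc _ _ _) (Equiv.sumAssoc _ _ _) ?_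
  rw [un_assoc, ← un_comm y z, un_rl_right, ← un_assoc, rl_rl, rl_rl]
  refine rl_congr (fun w => ?_) (fun w => ?_) _ <;> rcases w with (w | w) | w <;> rfl

theorem gl_rl' (o : O ≃ O') (i : I ≃ I') (k : K ≃ K') (x : Tg P (O ⊕ K) (I ⊕ K)) :
    gl K' (rl (Equiv.sumCongr o k) (Equiv.sumCongr i k) x) = rl o i (gl K x) := by
  obtain ⟨D, rfl⟩ := x.exists_rep
  exact sound_iso (D.glueRelabel o i k)

theorem gl_rl (o : O ≃ O') (i : I ≃ I') (x : Tg P (O ⊕ K) (I ⊕ K)) :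
    rl o i (gl K x) = gl K (rl (Equiv.sumCongr o (.refl _)) (Equiv.sumCongr i (.refl _)) x) :=
  (gl_rl' o i (Equiv.refl _) x).symm

theorem gl_reindex (k : K ≃ K') (x : Tg P (O ⊕ K) (I ⊕ K)) :
    gl K' (rl (Equiv.sumCongr (.refl _) k) (Equiv.sumCongr (.refl _) k) x) = gl K x := by
  rw [gl_rl', rl_refl]

theorem gl_gl (x : Tg P ((O ⊕ K) ⊕ K') ((I ⊕ K) ⊕ K')) :
    gl K (gl K' x) = gl (K ⊕ K') (rl (Equiv.sumAssoc _ _ _) (Equiv.sumAssoc _ _ _) x) := by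
  obtain ⟨D, rfl⟩ := x.exists_rep
  exact sound_iso D.glueGlue

theorem gl_gl_comm (x : Tg P ((O ⊕ K) ⊕ K') ((I ⊕ K) ⊕ K')) :
    gl K (gl K' x) = gl K' (gl K (rl (sumRC _ _ _) (sumRC _ _ _) x)) := by
  rw [gl_gl, gl_gl, ← gl_reindex (Equiv.sumComm K K'), rl_rl, rl_rl]
  refine congrArg _ (rl_congr (fun z => ?_) (fun z => ?_) _) <;> rcases z with (z | z) | z <;> rfl

theorem un_gl (x : Tg P (O ⊕ K) (I ⊕ K)) (y : Tg P O' I') :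
    un (gl K x) y = gl K (rl (sumRC _ _ _) (sumRC _ _ _) (un x y)) := by
  obtain ⟨D, rfl⟩ := x.exists_rep
  obtain ⟨T, rfl⟩ := y.exists_rep
  exact sound_iso (D.unionGlue T)

theorem gl_of_isEmpty [IsEmpty K] (x : Tg P (O ⊕ K) (I ⊕ K)) :
    gl K x = rl (Equiv.sumEmpty _ _) (Equiv.sumEmpty _ _) x := by
  obtain ⟨D, rfl⟩ := x.exists_rep
  exact sound_iso D.glueOfIsEmpty

end Tg

/-! ## Contraction of bivalent vertices -/

namespace XCGraph

variable {O I : Type} {P : Prop}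

/-- Half-edges of `D` as half-edges of a graph with the same tetravalent vertices and the
additional bivalent vertices `N`. -/
def oldPort {U B N B' X X' : Type} (b : B ⊕ N ≃ B') (x : X ≃ X') :
    U ⊕ B ⊕ X × Bool → U ⊕ B' ⊕ X' × Bool :=
  Sum.map id (Sum.map (fun z => b (.inl z)) (Prod.map x id))

/-- The edges of `G` over an edge of `D` form a path, ordered by `r`, whose interior vertices are the
bivalent vertices in `N`. -/
structure Fibered (G D : XCGraph O I) (N : Type) where
  φ : G.E → D.E
  r : G.E → ℕ
  b : D.B ⊕ N ≃ G.B
  x : D.X ≃ G.X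
  s : D.E → G.E
  pos_eq : ∀ y, G.pos (x y) = D.pos y
  src_eq : ∀ g, (∃ n, G.src g = .inr (.inl (b (.inr n)))) ∨
    G.src g = oldPort b x (D.src (φ g)) ∧ ∀ g', φ g' = φ g → r g ≤ r g'
  tgt_eq : ∀ g, (∃ n, G.tgt g = .inr (.inl (b (.inr n)))) ∨
    G.tgt g = oldPort b x (D.tgt (φ g)) ∧ ∀ g', φ g' = φ g → r g' ≤ r g
  next : ∀ g g' n, G.tgt g = .inr (.inl (b (.inr n))) → G.src g' = .inr (.inl (b (.inr n))) →
    φ g' = φ g ∧ r g' = r g + 1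
  inj : ∀ g g', φ g = φ g' → r g = r g' → g = g'
  φ_s : ∀ d, φ (s d) = d
  rot_s : ∀ d, G.rot (s d) = D.rot d
  rot_zero : ∀ g, g ≠ s (φ g) → G.rot g = 0

namespace Fibered

variable {G D : XCGraph O I} {N M : Type}

/-- Renaming of the additional vertices. -/
def reindex (c : Fibered G D N) (e : M ≃ N) : Fibered G D M where
  φ := c.φ
  r := c.r
  b := (Equiv.sumCongr (Equiv.refl _) e).trans c.b
  x := c.x
  s := c.s
  pos_eq := c.pos_eq
  src_eq g := (c.src_eq g).imp (fun ⟨n, h⟩ => ⟨e.symm n, by simp [h]⟩) fun h => h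
  tgt_eq g := (c.tgt_eq g).imp (fun ⟨n, h⟩ => ⟨e.symm n, by simp [h]⟩) fun h => h
  next g g' n h h' := c.next g g' (e n) h h'
  inj := c.inj
  φ_s := c.φ_s
  rot_s := c.rot_s
  rot_zero := c.rot_zero

theorem mk_eq_of_isEmpty [IsEmpty N] (c : Fibered G D N) : Tg.mk P G = Tg.mk P D := by
  have hs : ∀ g, G.src g = oldPort c.b c.x (D.src (c.φ g)) := fun g =>
    ((c.src_eq g).resolve_left fun ⟨n, _⟩ => isEmptyElim n).1
  have ht : ∀ g, G.tgt g = oldPort c.b c.x (D.tgt (c.φ g)) := fun g =>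
    ((c.tgt_eq g).resolve_left fun ⟨n, _⟩ => isEmptyElim n).1
  have hφ : Function.Bijective c.φ := by
    refine ⟨fun g g' h => G.src.injective ?_, fun d => ⟨_, c.φ_s d⟩⟩
    rw [hs, hs, h]
  have e : ∀ d, (Equiv.ofBijective _ hφ).symm d = c.s d := fun d => by
    rw [Equiv.symm_apply_eq]
    exact (c.φ_s d).symm
  refine (Tg.sound_iso (D := D) (D' := G) ⟨(Equiv.ofBijective _ hφ).symm,
    (Equiv.sumEmpty D.B N).symm.trans c.b, c.x, c.pos_eq, fun d => ?_, fun d => ?_,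
    fun d => ?_⟩).symm
  · rw [e, c.rot_s]
  · rw [e, hs, c.φ_s]
    rfl
  · rw [e, ht, c.φ_s]
    rfl

/-- Bookkeeping for bivalent vertices. -/
def optionE (B N : Type) : Option B ⊕ N ≃ B ⊕ Option N where
  toFun
    | .inl none => .inr none
    | .inl (some b) => .inl b
    | .inr n => .inr (some n)
  invFun
    | .inr none => .inl none
    | .inl b => .inl (some b)
    | .inr (some n) => .inr n
  left_inv := by rintro ((_ | b) | n) <;> rfl
  right_inv := by rintro (b | _ | n) <;> rfl

theorem oldPort_newPort {U B B' X X' : Type} (b : B ⊕ Option N ≃ B') (x : X ≃ X')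
    (p : U ⊕ B ⊕ X × Bool) :
    oldPort ((optionE B N).trans b) x (newPort _ _ _ (some p)) = oldPort b x p := by
  rcases p with p | p | p <;> rfl

open Classical in
/-- The first interior vertex is put into the base by subdivision. -/
theorem exists_subdivide (c : Fibered G D (Option N)) : ∃ (d : D.E) (i j : SignType),
    (D.rot d : ℤ) = (i : ℤ) + (j : ℤ) ∧ Nonempty (Fibered G (D.subdivide d i j) N) := by
  obtain ⟨g, hg⟩ := G.tgt.surjective (.inr (.inl (c.b (.inr none))))
  obtain ⟨g', hg'⟩ := G.src.surjective (.inr (.inl (c.b (.inr none))))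
  obtain ⟨hφ, hr⟩ := c.next g g' none hg hg'
  generalize hd : c.φ g = d at hφ
  let φ' : G.E → Option D.E := fun h => if c.φ h = d ∧ c.r g < c.r h then none else some (c.φ h)
  have φn : ∀ {h}, c.φ h = d → c.r g < c.r h → φ' h = none := fun h1 h2 => if_pos ⟨h1, h2⟩
  have φs : ∀ {h}, ¬ (c.φ h = d ∧ c.r g < c.r h) → φ' h = some (c.φ h) := fun h1 => if_neg h1
  have φn' : ∀ {h}, φ' h = none → c.φ h = d ∧ c.r g < c.r h := fun {h} e => by
    by_contra h1
    rw [φs h1] at e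
    cases e
  have φs' : ∀ {h e}, φ' h = some e → c.φ h = e ∧ ¬ (c.φ h = d ∧ c.r g < c.r h) := fun {h e} w => by
    by_cases h1 : c.φ h = d ∧ c.r g < c.r h
    · rw [φn h1.1 h1.2] at w
      cases w
    · rw [φs h1] at w
      exact ⟨Option.some_injective _ w, h1⟩
  have srcN : ∀ {h n n'}, G.src h = .inr (.inl (c.b (.inr n))) →
      G.src h = .inr (.inl (c.b (.inr n'))) → n = n' := fun h1 h2 => by
    simpa using h1.symm.trans h2
  have tgtN : ∀ {h n n'}, G.tgt h = .inr (.inl (c.b (.inr n))) →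
      G.tgt h = .inr (.inl (c.b (.inr n'))) → n = n' := fun h1 h2 => by
    simpa using h1.symm.trans h2
  let s' : Option D.E → G.E := fun
    | none => if c.r g < c.r (c.s d) then c.s d else g'
    | some e => if e = d ∧ c.r g < c.r (c.s d) then g else c.s e
  refine ⟨d, if c.r g < c.r (c.s d) then 0 else D.rot d, if c.r g < c.r (c.s d) then D.rot d else 0,
    by split_ifs <;> simp, ⟨⟨φ', c.r, (optionE _ _).trans c.b, c.x, s', c.pos_eq, fun h => ?_,
    fun h => ?_, fun h h' n e e' => ?_, fun h h' e e' => ?_, fun e => ?_, fun e => ?_,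
    fun h e => ?_⟩⟩⟩
  · rcases c.src_eq h with ⟨_ | n, e⟩ | ⟨e, m⟩
    · obtain rfl : h = g' := G.src.injective (e.trans hg'.symm)
      have e1 : φ' h = none := φn hφ (by omega)
      refine .inr ⟨?_, fun k hk => ?_⟩
      · rw [e1, e]
        rfl
      · rw [e1] at hk
        have := (φn' hk).2
        omega
    · exact .inl ⟨n, e⟩
    · have e1 : φ' h = some (c.φ h) := φs fun ⟨h1, h2⟩ => by
        have := m g (hd.trans h1.symm)
        omega
      refine .inr ⟨?_, fun k hk => ?_⟩
      · rw [e1, e]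
        exact (oldPort_newPort _ _ _).symm
      · rw [e1] at hk
        exact m k (φs' hk).1
  · rcases c.tgt_eq h with ⟨_ | n, e⟩ | ⟨e, m⟩
    · obtain rfl : h = g := G.tgt.injective (e.trans hg.symm)
      have e1 : φ' h = some d := (φs (by simp)).trans (congrArg some hd)
      refine .inr ⟨?_, fun k hk => ?_⟩
      · rw [e1, e, subdivide_tgt_self]
        rfl
      · rw [e1] at hk
        have := φs' hk
        by_contra h3
        exact this.2 ⟨this.1, by omega⟩
    · exact .inl ⟨n, e⟩
    · by_cases h1 : c.φ h = d
      · have e1 : φ' h = none := φn h1 (by have := m g' (hφ.trans h1.symm); omega)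
        refine .inr ⟨?_, fun k hk => ?_⟩
        · rw [e1, e, subdivide_tgt_none, h1]
          exact (oldPort_newPort _ _ _).symm
        · rw [e1] at hk
          exact m k ((φn' hk).1.trans h1.symm)
      · have e1 : φ' h = some (c.φ h) := φs fun h2 => h1 h2.1
        refine .inr ⟨?_, fun k hk => ?_⟩
        · rw [e1, e, subdivide_tgt_ne _ h1]
          exact (oldPort_newPort _ _ _).symm
        · rw [e1] at hk
          exact m k (φs' hk).1
  · obtain ⟨h1, h2⟩ := c.next h h' (some n) e e'
    refine ⟨?_, h2⟩
    by_cases h3 : c.φ h = d ∧ c.r g < c.r h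
    · rw [φn h3.1 h3.2, φn (h1.trans h3.1) (by omega)]
    · rw [φs h3, φs, h1]
      rintro ⟨h4, h5⟩
      rw [h1] at h4
      have : h = g := by
        refine c.inj _ _ (h4.trans hd.symm) ?_
        by_contra h6
        exact h3 ⟨h4, by omega⟩
      subst this
      cases tgtN e hg
  · refine c.inj _ _ ?_ e'
    rcases w : φ' h with _ | z
    · rw [w] at e
      rw [(φn' w).1, (φn' e.symm).1]
    · rw [w] at e
      rw [(φs' w).1, (φs' e.symm).1]
  · rcases e with _ | e
    · show φ' (if _ then _ else _) = _
      split_ifs with h1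
      · exact φn (c.φ_s d) h1
      · exact φn hφ (by omega)
    · show φ' (if _ then _ else _) = _
      split_ifs with h1
      · rw [φs (by simp), hd, h1.1]
      · rw [φs, c.φ_s]
        rw [c.φ_s]
        rintro ⟨rfl, h2⟩
        exact h1 ⟨rfl, h2⟩
  · rcases e with _ | e
    · show G.rot (if _ then _ else _) = if _ then _ else _
      split_ifs with h1
      · exact c.rot_s d
      · refine c.rot_zero _ fun h2 => h1 ?_
        rw [hφ] at h2
        rw [← h2]
        omega
    · show G.rot (if _ then _ else _) = _
      by_cases h0 : e = d
      · subst h0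
        rw [subdivide_rot_self]
        by_cases h1 : c.r g < c.r (c.s e)
        · rw [if_pos ⟨rfl, h1⟩, if_pos h1]
          refine c.rot_zero _ fun h2 => ?_
          rw [hd] at h2
          rw [← h2] at h1
          exact lt_irrefl _ h1
        · rw [if_neg fun h => h1 h.2, if_neg h1, c.rot_s]
      · rw [subdivide_rot_ne _ h0, if_neg fun h => h0 h.1, c.rot_s]
  · refine c.rot_zero h fun w => e ?_
    by_cases h1 : c.φ h = d ∧ c.r g < c.r h
    · rw [φn h1.1 h1.2]
      show _ = if _ then _ else _
      rw [h1.1] at w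
      rw [← w, if_pos h1.2]
    · rw [φs h1]
      show _ = if _ then _ else _
      rw [if_neg, ← w]
      rintro ⟨h2, h3⟩
      rw [h2] at w
      rw [← w] at h3
      exact h1 ⟨h2, h3⟩

theorem mk_eq [Finite N] (c : Fibered G D N) : Tg.mk P G = Tg.mk P D := by
  revert c
  revert D
  refine Finite.induction_empty_option (P := fun N => ∀ {D : XCGraph O I}, Fibered G D N →
    Tg.mk P G = Tg.mk P D) (fun e ih _ c => ih (c.reindex e)) (fun c => c.mk_eq_of_isEmpty)
    (fun ih _ c => ?_) N
  obtain ⟨d, i, j, h, ⟨c'⟩⟩ := c.exists_subdivide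
  exact (ih c').trans (Tg.sound_zeroR d i j h)

end Fibered

/-- Contraction of the bivalent vertices in `N`: the edges of `G` over an edge of `D` form a path,
and all of them but one have rotation number zero. -/
theorem mk_eq_of_contraction {G D : XCGraph O I} {N : Type} [Finite N] (φ : G.E → D.E)
    (r : G.E → ℕ) (b : D.B ⊕ N ≃ G.B) (x : D.X ≃ G.X) (s : D.E → G.E)
    (pos_eq : ∀ y, G.pos (x y) = D.pos y)
    (src_eq : ∀ g, (∃ n, G.src g = .inr (.inl (b (.inr n)))) ∨
      G.src g = oldPort b x (D.src (φ g)) ∧ r g = 0)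
    (tgt_eq : ∀ g, (∃ n, G.tgt g = .inr (.inl (b (.inr n)))) ∨
      G.tgt g = oldPort b x (D.tgt (φ g)))
    (next : ∀ g g' n, G.tgt g = .inr (.inl (b (.inr n))) → G.src g' = .inr (.inl (b (.inr n))) →
      φ g' = φ g ∧ r g' = r g + 1)
    (φ_s : ∀ d, φ (s d) = d) (rot_s : ∀ d, G.rot (s d) = D.rot d)
    (rot_zero : ∀ g, g ≠ s (φ g) → G.rot g = 0) : Tg.mk P G = Tg.mk P D := by
  have pred : ∀ g, r g ≠ 0 → ∃ g' n, G.src g = .inr (.inl (b (.inr n))) ∧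
      G.tgt g' = .inr (.inl (b (.inr n))) ∧ φ g = φ g' ∧ r g = r g' + 1 := by
    intro g hg
    obtain ⟨n, hn⟩ := (src_eq g).resolve_right fun h => hg h.2
    obtain ⟨g', hg'⟩ := G.tgt.surjective (.inr (.inl (b (.inr n))))
    exact ⟨g', n, hn, hg', next _ _ _ hg' hn⟩
  have inj : ∀ k g g', φ g = φ g' → r g = k → r g' = k → g = g' := by
    intro k
    induction k with
    | zero =>
      intro g g' h h1 h2
      have z : ∀ g, r g = 0 → G.src g = oldPort b x (D.src (φ g)) := by
        intro g hg
        refine ((src_eq g).resolve_left ?_).1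
        rintro ⟨n, hn⟩
        obtain ⟨g', hg'⟩ := G.tgt.surjective (.inr (.inl (b (.inr n))))
        have := (next _ _ _ hg' hn).2
        omega
      exact G.src.injective (by rw [z g h1, z g' h2, h])
    | succ k ih =>
      intro g g' h h1 h2
      obtain ⟨p, n, e1, e2, e3, e4⟩ := pred g (by omega)
      obtain ⟨p', n', e1', e2', e3', e4'⟩ := pred g' (by omega)
      obtain rfl := ih p p' (by rw [← e3, ← e3', h]) (by omega) (by omega)
      obtain rfl : n = n' := by simpa using e2.symm.trans e2'
      exact G.src.injective (e1.trans e1'.symm)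
  have desc : ∀ m g, r g ≥ m → ∃ g', φ g' = φ g ∧ r g' = m ∧
      (r g > m → ∃ n, G.tgt g' = .inr (.inl (b (.inr n)))) := by
    intro m g
    induction h : r g generalizing g with
    | zero =>
      intro hm
      exact ⟨g, rfl, by omega, fun h => by omega⟩
    | succ k ih =>
      intro hm
      rcases eq_or_lt_of_le hm with e | e
      · exact ⟨g, rfl, by omega, fun h => by omega⟩
      · obtain ⟨p, n, e1, e2, e3, e4⟩ := pred g (by omega)
        obtain ⟨q, h1, h2, h3⟩ := ih p (by omega) (by omega)
        refine ⟨q, h1.trans e3.symm, h2, fun _ => ?_⟩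
        by_cases h4 : k > m
        · exact h3 h4
        · obtain rfl := inj m q p h1 h2 (by omega)
          exact ⟨n, e2⟩
  refine Fibered.mk_eq (N := N) ⟨φ, r, b, x, s, pos_eq, fun g => (src_eq g).imp_right fun h =>
    ⟨h.1, fun g' _ => by omega⟩, fun g => ?_, next, fun g g' h h' => inj _ g g' h h' rfl, φ_s,
    rot_s, rot_zero⟩
  by_cases hn : ∃ n, G.tgt g = .inr (.inl (b (.inr n)))
  · exact .inl hn
  · refine .inr ⟨(tgt_eq g).resolve_left hn, fun g' hg' => ?_⟩
    by_contra h
    obtain ⟨q, h1, h2, h3⟩ := desc (r g) g' (by omega)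
    obtain rfl := inj _ q g (h1.trans hg') h2 rfl
    exact hn (h3 (by omega))

end XCGraph

/-! ## The value of a graph -/

namespace Elts

open XCHom

/-- An arrow `0 ⟶ 1` as an element. -/
def pt (g : XCHom 0 1) : Elts Unit := mk (Equiv.ofUnique _ _) g

theorem mg_pt (g h : XCHom 0 1) : mg () ((pt g).tensor (pt h)) = pt ((h.tensor g).comp mulHom) := by
  let e : Fin 0 ≃ Empty := Equiv.equivOfIsEmpty _ _
  let k : Empty ⊕ Fin 1 ≃ Unit := (Equiv.emptySum _ _).trans (Equiv.ofUnique _ _)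
  have h1 := mg_eq k (s := ()) rfl
    (mk (joinE e (Equiv.refl (Fin 2))) ((h.tensor g).comp (cst (Nat.zero_add 2).symm)))
  have h2 : (h.tensor g).comp ((cst (Nat.zero_add 2).symm).comp (wl 0 mulHom))
      = ((h.tensor g).comp mulHom).comp (cst (Nat.zero_add 1).symm) := by
    have := XCHom.unit_tensor mulHom
    rw [comp_assoc]
    refine congrArg _ ?_
    have h3 := congrArg (fun z => ((cst (Nat.zero_add 2).symm).comp z).comp
      (cst (Nat.zero_add 1).symm)) this
    simp only [← comp_assoc, cst_comp_cst, id_comp] at h3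
    rw [comp_assoc, cst_comp_cst, comp_id] at h3
    exact (id_comp (a := 2) _).trans h3
  rw [op_mk, comp_assoc, h2, map_mk, map_mk] at h1
  rw [← tensor_comm, pt, pt, tensor_mk, map_mk, pt]
  refine Eq.trans (congrArg _ (mk_congr (Nat.zero_add 2).symm rfl fun i => ?_)) (h1.trans
    (mk_congr (Nat.zero_add 1).symm rfl fun i => ?_).symm)
  · fin_cases i <;> rfl
  · rfl

theorem eta_eq_pt : eta = pt unitHom := rfl

theorem mk_mulN_one : XCHom.mk (XCTerm.mulN 1) = mulHom := by
  have e : ∀ {b c : ℕ} (f : XCHom b c) {d : ℕ} (h : d = 0 + b) (h' : 0 + c = c),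
      (cst h).comp (((cst rfl : XCHom 0 0).tensor f).comp (cst h')) = (cst (by omega)).comp f := by
    intro b c f d h h'
    have h2 := XCHom.unit_tensor f
    rw [h2, ← comp_assoc, cst_comp_cst]
  have h2 : XCHom.mk (XCTerm.mulN 1) = (cst (by omega : 0 + 1 + (0 + 1) = 0 + (1 + 0) + 1)).comp
      ((((cst rfl : XCHom 0 0).tensor (br 1 0)).tensor (cst rfl : XCHom 1 1)).comp
        ((cst (by omega : 0 + (0 + 1) + 1 = (0 + 0) + 2)).comp
          ((cst rfl : XCHom 0 0).tensor mulHom))) := rfl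
  have e2 := e mulHom (d := 2) rfl rfl
  rw [comp_id] at e2
  rw [h2, StrandPerm.br_zero, cst_tensor_cst, cst_tensor_cst, ← comp_assoc, cst_comp_cst, ← comp_assoc,
    cst_comp_cst]
  exact e2.trans (XCHom.id_comp _)

theorem mg_pt_unit {g h : XCTerm 0 1} (l : XCTerm.Law (XCTerm.dot h g) (XCTerm.unitN 1)) :
    mg () ((pt (XCHom.mk g)).tensor (pt (XCHom.mk h))) = eta := by
  rw [mg_pt, eta_eq_pt, ← mk_mulN_one]
  refine congrArg pt ((XCHom.sound (.law l)).trans ?_)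
  have := XCHom.unit_tensor unitHom
  exact (comp_id _).symm.trans (this.trans (id_comp _))

theorem mg_eta_tensor (x : Elts Unit) : mg () (eta.tensor x) = x := by
  conv_rhs => rw [← mg_eta_swap () x]
  rw [← tensor_comm]
  refine congrArg _ (map_congr (fun z => ?_) _)
  rcases z with ⟨⟩ | ⟨⟩ <;> simp

/-- The value of an edge. -/
def ke : SignType → Elts Unit
  | 0 => eta
  | 1 => pt (XCHom.mk .kappaInv)
  | -1 => pt (XCHom.mk .kappa)

theorem ke_zero : ke 0 = eta := rfl

theorem mg_ke (r i j : SignType) (h : (r : ℤ) = (i : ℤ) + (j : ℤ)) :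
    mg () ((ke i).tensor (ke j)) = ke r := by
  by_cases hj : j = 0
  · obtain rfl : r = i := by revert r i j; decide
    rw [hj, ke_zero, mg_eta]
  by_cases hi : i = 0
  · obtain rfl : r = j := by revert r i j; decide
    rw [hi, ke_zero, mg_eta_tensor]
  obtain ⟨rfl, ⟨rfl, rfl⟩ | ⟨rfl, rfl⟩⟩ : r = 0 ∧ (i = 1 ∧ j = -1 ∨ i = -1 ∧ j = 1) := by
    revert r i j; decide
  · exact mg_pt_unit .kappa_kappaInv
  · exact mg_pt_unit .kappaInv_kappa

/-- The value of a crossing, the strands of which are named by their starting points. -/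
def cr : Bool → Elts Bool
  | true => mk finTwoEquiv (XCHom.mk .R)
  | false => mk (finTwoEquiv.trans Equiv.boolNot) (XCHom.mk .Rinv)

variable {X Y S T R : Type}

theorem tensor_tensor_comm {A B C D : Type} (a : Elts A) (b : Elts B) (c : Elts C) (d : Elts D) :
    map (Equiv.sumSumSumComm _ _ _ _) ((a.tensor b).tensor (c.tensor d))
      = (a.tensor c).tensor (b.tensor d) := by
  rw [← tensor_assoc (a.tensor b) c d, ← tensor_assoc (a.tensor c) b d,
    ← tensor_right_comm a b c, map_tensor_left, map_map, map_map]
  exact map_congr (fun z => by rcases z with ((z | z) | z) | z <;> rfl) _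

/-- The value of vertex-free strands. -/
noncomputable def edges [Finite X] (ρ : X → SignType) : Elts X :=
  map (Equiv.prodPUnit X) (prod fun x => ke (ρ x))

theorem edges_map [Finite X] [Finite Y] (f : X ≃ Y) {ρ : Y → SignType} {ρ' : X → SignType}
    (h : ∀ x, ρ (f x) = ρ' x) : map f (edges ρ') = edges ρ := by
  rw [edges, edges, ← prod_map f, map_map, map_map]
  simp only [Function.comp_def, h]
  exact map_congr (fun _ => rfl) _

theorem edges_sum [Finite X] [Finite Y] (ρ : X → SignType) (ρ' : Y → SignType) :
    edges (Sum.elim ρ ρ') = (edges ρ).tensor (edges ρ') := by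
  have h : (fun x => ke (Sum.elim ρ ρ' x))
      = Sum.elim (fun x => ke (ρ x)) (fun x => ke (ρ' x)) := by
    funext x
    rcases x with x | x <;> rfl
  rw [edges, edges, edges, map_tensor, h, prod_sum, map_map]
  exact map_congr (fun z => by rcases z with z | z <;> rfl) _

theorem edges_unit (ρ : Unit → SignType) : edges ρ = ke (ρ ()) := by
  rw [edges, prod_unique, map_map]
  exact (map_congr (fun _ => rfl) _).trans (map_refl _)

open Classical in
/-- Two consecutive edges are replaced by one. -/
theorem mg_edges [Finite X] (ρ : X → SignType) (e : X) (i j : SignType)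
    (h : (ρ e : ℤ) = (i : ℤ) + (j : ℤ)) :
    mg e ((edges fun f => if f = e then i else ρ f).tensor (ke j)) = edges ρ := by
  let f : {x // x ≠ e} ⊕ Unit ≃ X :=
    (Equiv.optionEquivSumPUnit _).symm.trans (Equiv.optionSubtypeNe e)
  have h1 : edges ρ = map f ((edges fun x : {x // x ≠ e} => ρ x).tensor (ke (ρ e))) := by
    rw [← edges_unit fun _ => ρ e, ← edges_sum]
    refine (edges_map f fun x => ?_).symm
    rcases x with x | x <;> simp [f]
  have h2 : edges (fun f => if f = e then i else ρ f)
      = map f ((edges fun x : {x // x ≠ e} => ρ x).tensor (ke i)) := by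
    rw [← edges_unit fun _ => i, ← edges_sum]
    refine (edges_map f fun x => ?_).symm
    rcases x with x | x
    · simp [f, x.2]
    · simp [f]
  have h3 : f (.inr ()) = e := by simp [f]
  rw [h1, h2, ← mg_ke _ i j h, tensor_mg, map_mg, h3, map_tensor_left]
  refine congrArg _ ?_
  rw [← tensor_assoc, map_map, map_map]
  exact map_congr (fun z => by rcases z with (z | z) | z <;> rfl) _

end Elts

namespace SElts

variable {O I O' I' O'' I'' K K' : Type}

theorem ofElt_map {S T : Type} (f : S ≃ T) (o : T ≃ O) (i : T ≃ I) (u : Elts S) :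
    rl o i (ofElt (u.map f) (Equiv.refl _)) = rl (f.trans o) (f.trans i) (ofElt u (Equiv.refl _)) := by
  rw [rl_ofElt, rl_ofElt, Elts.map_map]
  congr 1
  ext z
  simp

theorem un_glue_glue [Finite K] [Finite K'] (x : SElts (O ⊕ K) (I ⊕ K))
    (y : SElts (O' ⊕ K') (I' ⊕ K')) :
    un (glue K x) (glue K' y)
      = glue (K ⊕ K') (rl (Equiv.sumSumSumComm _ _ _ _) (Equiv.sumSumSumComm _ _ _ _) (un x y)) := by
  rw [un_glue, ← un_comm, un_glue, ← glue_rl, ← glue_rl, glue_glue, ← un_comm x y, rl_rl, rl_rl,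
    rl_rl, rl_rl]
  refine congrArg _ (rl_congr (fun z => ?_) (fun z => ?_) _) <;>
    rcases z with (z | z) | (z | z) <;> rfl

end SElts

namespace XCGraph

variable {O I O' I' K : Type}

instance (D : XCGraph O I) : Finite D.E := D.finite_edges

instance (D : XCGraph O I) : Finite D.B :=
  Finite.of_injective (fun b => D.src.symm (.inr (.inl b))) fun b b' h => by simpa using h

instance (D : XCGraph O I) : Finite D.X :=
  Finite.of_injective (fun x => D.src.symm (.inr (.inr (x, true)))) fun b b' h => by simpa using h

/-- The bivalent vertices and the half-edges at the tetravalent vertices, first the incoming and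
then the outgoing ones. -/
abbrev Ports (D : XCGraph O I) : Type := D.B ⊕ D.X × Bool ⊕ D.X × Bool

/-- Bookkeeping for starting points. -/
def startE (U B Y : Type) : (U ⊕ B ⊕ Y) ⊕ Y ≃ U ⊕ (B ⊕ Y ⊕ Y) where
  toFun
    | .inl (.inl u) => .inl u
    | .inl (.inr (.inl b)) => .inr (.inl b)
    | .inl (.inr (.inr y)) => .inr (.inr (.inr y))
    | .inr y => .inr (.inr (.inl y))
  invFun
    | .inl u => .inl (.inl u)
    | .inr (.inl b) => .inl (.inr (.inl b))
    | .inr (.inr (.inr y)) => .inl (.inr (.inr y))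
    | .inr (.inr (.inl y)) => .inr y
  left_inv := by rintro ((u | b | y) | y) <;> rfl
  right_inv := by rintro (u | b | y | y) <;> rfl

/-- Bookkeeping for endpoints. -/
def endE (U B Y : Type) : (U ⊕ B ⊕ Y) ⊕ Y ≃ U ⊕ (B ⊕ Y ⊕ Y) where
  toFun
    | .inl (.inl u) => .inl u
    | .inl (.inr (.inl b)) => .inr (.inl b)
    | .inl (.inr (.inr y)) => .inr (.inr (.inl y))
    | .inr y => .inr (.inr (.inr y))
  invFun
    | .inl u => .inl (.inl u)
    | .inr (.inl b) => .inl (.inr (.inl b))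
    | .inr (.inr (.inl y)) => .inl (.inr (.inr y))
    | .inr (.inr (.inr y)) => .inr y
  left_inv := by rintro ((u | b | y) | y) <;> rfl
  right_inv := by rintro (u | b | y | y) <;> rfl

/-- The other side of a tetravalent vertex. -/
def acrossE (X : Type) : X × Bool ≃ X × Bool := Equiv.prodCongr (Equiv.refl X) Equiv.boolNot

/-- The starting points of the edges and of the passages through tetravalent vertices. -/
def starts (D : XCGraph O I) : D.E ⊕ D.X × Bool ≃ O ⊕ D.Ports :=
  (Equiv.sumCongr D.src (Equiv.refl _)).trans (startE _ _ _)

/-- The endpoints of the edges and of the passages through tetravalent vertices. -/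
def ends (D : XCGraph O I) : D.E ⊕ D.X × Bool ≃ I ⊕ D.Ports :=
  (Equiv.sumCongr D.tgt (acrossE _)).trans (endE _ _ _)

/-- The edges and the crossings of a graph, as an element. -/
noncomputable def parts (D : XCGraph O I) : Elts (D.E ⊕ D.X × Bool) :=
  (Elts.edges D.rot).tensor (Elts.prod fun x => Elts.cr (D.pos x))

/-- The value of a graph. -/
noncomputable def value (D : XCGraph O I) : SElts O I :=
  SElts.glue D.Ports (SElts.rl D.starts D.ends (SElts.ofElt D.parts (Equiv.refl _)))

open SElts

theorem Iso.value_eq {D D' : XCGraph O I} (f : D.Iso D') : D'.value = D.value := by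
  have h : D'.parts = D.parts.map (Equiv.sumCongr f.e (Equiv.prodCongr f.x (Equiv.refl _))) := by
    rw [parts, parts, ← Elts.map_tensor, Elts.edges_map f.e f.rot_eq,
      ← Elts.prod_map f.x (fun x => Elts.cr (D'.pos x))]
    simp only [Function.comp_def, f.pos_eq]
  rw [value, h, ofElt_map, value, ← glue_reindex (Equiv.sumCongr f.b (Equiv.sumCongr
    (Equiv.prodCongr f.x (Equiv.refl _)) (Equiv.prodCongr f.x (Equiv.refl _)))), rl_rl]
  refine congrArg _ (rl_congr (fun z => ?_) (fun z => ?_) _)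
  · rcases z with z | ⟨x, s⟩
    · show startE _ _ _ (.inl (D'.src (f.e z))) = Sum.map _ _ (startE _ _ _ (.inl (D.src z)))
      rw [f.src_eq]
      rcases D.src z with a | b | ⟨x, s⟩ <;> rfl
    · rfl
  · rcases z with z | ⟨x, s⟩
    · show endE _ _ _ (.inl (D'.tgt (f.e z))) = Sum.map _ _ (endE _ _ _ (.inl (D.tgt z)))
      rw [f.tgt_eq]
      rcases D.tgt z with a | b | ⟨x, s⟩ <;> rfl
    · rfl

theorem value_relabel (D : XCGraph O I) (o : O ≃ O') (i : I ≃ I') :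
    (D.relabel o i).value = rl o i D.value := by
  rw [value, value, ← glue_rl, rl_rl]
  refine congrArg (SElts.glue D.Ports) (rl_congr (fun z => ?_) (fun z => ?_) _)
  · rcases z with z | ⟨x, s⟩
    · show startE _ _ _ (.inl (Sum.map _ _ (D.src z))) = Sum.map _ _ (startE _ _ _ (.inl (D.src z)))
      rcases D.src z with a | b | ⟨x, s⟩ <;> rfl
    · rfl
  · rcases z with z | ⟨x, s⟩
    · show endE _ _ _ (.inl (Sum.map _ _ (D.tgt z))) = Sum.map _ _ (endE _ _ _ (.inl (D.tgt z)))
      rcases D.tgt z with a | b | ⟨x, s⟩ <;> rfl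
    · rfl

theorem value_glue (D : XCGraph (O ⊕ K) (I ⊕ K)) [Finite K] :
    D.glue.value = SElts.glue K D.value := by
  rw [value, value, glue_glue, rl_rl]
  let k : (D.B ⊕ K) ⊕ D.X × Bool ⊕ D.X × Bool ≃ K ⊕ D.Ports :=
    (Equiv.sumCongr (Equiv.sumComm _ _) (Equiv.refl _)).trans (Equiv.sumAssoc _ _ _)
  rw [← glue_reindex (K := D.glue.Ports) k, rl_rl]
  refine congrArg (SElts.glue _) (rl_congr (fun z => ?_) (fun z => ?_) _)
  · rcases z with z | ⟨x, s⟩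
    · show Sum.map _ k (startE _ _ _ (.inl (gluePorts _ _ _ _ (D.src z))))
        = Equiv.sumAssoc _ _ _ (startE _ _ _ (.inl (D.src z)))
      rcases D.src z with (a | a) | b | ⟨x, s⟩ <;> rfl
    · rfl
  · rcases z with z | ⟨x, s⟩
    · show Sum.map _ k (endE _ _ _ (.inl (gluePorts _ _ _ _ (D.tgt z))))
        = Equiv.sumAssoc _ _ _ (endE _ _ _ (.inl (D.tgt z)))
      rcases D.tgt z with (a | a) | b | ⟨x, s⟩ <;> rfl
    · rfl

theorem value_union (D : XCGraph O I) (T : XCGraph O' I') :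
    (D.union T).value = un D.value T.value := by
  let g : (D.E ⊕ T.E) ⊕ (D.X × Bool) ⊕ (T.X × Bool) ≃ (D.E ⊕ T.E) ⊕ ((D.X ⊕ T.X) × Bool) :=
    Equiv.sumCongr (Equiv.refl _) (Equiv.sumProdDistrib _ _ _).symm
  have h : (D.union T).parts = ((D.parts.tensor T.parts).map (Equiv.sumSumSumComm _ _ _ _)).map g := by
    have e1 : (fun x => Elts.cr ((D.union T).pos x))
        = Sum.elim (fun x => Elts.cr (D.pos x)) (fun x => Elts.cr (T.pos x)) := by
      funext x
      rcases x with x | x <;> rfl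
    rw [parts, parts, parts, Elts.tensor_tensor_comm, e1]
    exact (congrArg₂ Elts.tensor (Elts.edges_sum _ _) (Elts.prod_sum _ _)).trans
      (Elts.map_tensor_right _ _ _)
  let k : D.Ports ⊕ T.Ports ≃ (D.B ⊕ T.B) ⊕ ((D.X ⊕ T.X) × Bool) ⊕ ((D.X ⊕ T.X) × Bool) :=
    (Equiv.sumSumSumComm _ _ _ _).trans (Equiv.sumCongr (Equiv.refl _)
      ((Equiv.sumSumSumComm _ _ _ _).trans (Equiv.sumCongr (Equiv.sumProdDistrib _ _ _).symm
        (Equiv.sumProdDistrib _ _ _).symm)))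
  have e2 : ofElt (D.parts.tensor T.parts) (Equiv.refl _)
      = un (ofElt D.parts (Equiv.refl _)) (ofElt T.parts (Equiv.refl _)) := by
    rw [un_ofElt, Equiv.sumCongr_refl]
  rw [value, h, Elts.map_map]
  refine (congrArg (SElts.glue _) (ofElt_map _ _ _ _)).trans ?_
  rw [value, value, un_glue_glue, e2, un_rl, rl_rl,
    ← glue_reindex (K' := (D.union T).Ports) k, rl_rl]
  refine congrArg (SElts.glue _) (rl_congr (fun z => ?_) (fun z => ?_) _)
  · rcases z with (z | ⟨x, s⟩) | (z | ⟨x, s⟩)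
    · show startE _ _ _ (.inl (unionPorts _ _ _ _ _ _ (.inl (D.src z))))
        = Sum.map _ k (Equiv.sumSumSumComm _ _ _ _ (.inl (startE _ _ _ (.inl (D.src z)))))
      rcases D.src z with a | b | ⟨x, s⟩ <;> rfl
    · rfl
    · show startE _ _ _ (.inl (unionPorts _ _ _ _ _ _ (.inr (T.src z))))
        = Sum.map _ k (Equiv.sumSumSumComm _ _ _ _ (.inr (startE _ _ _ (.inl (T.src z)))))
      rcases T.src z with a | b | ⟨x, s⟩ <;> rfl
    · rfl
  · rcases z with (z | ⟨x, s⟩) | (z | ⟨x, s⟩)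
    · show endE _ _ _ (.inl (unionPorts _ _ _ _ _ _ (.inl (D.tgt z))))
        = Sum.map _ k (Equiv.sumSumSumComm _ _ _ _ (.inl (endE _ _ _ (.inl (D.tgt z)))))
      rcases D.tgt z with a | b | ⟨x, s⟩ <;> rfl
    · rfl
    · show endE _ _ _ (.inl (unionPorts _ _ _ _ _ _ (.inr (T.tgt z))))
        = Sum.map _ k (Equiv.sumSumSumComm _ _ _ _ (.inr (endE _ _ _ (.inl (T.tgt z)))))
      rcases T.tgt z with a | b | ⟨x, s⟩ <;> rfl
    · rfl

open Classical in
theorem value_subdivide (D : XCGraph O I) (e : D.E) (i j : SignType)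
    (h : (D.rot e : ℤ) = (i : ℤ) + (j : ℤ)) : (D.subdivide e i j).value = D.value := by
  let ρ : D.E → SignType := fun f => if f = e then i else D.rot f
  let u : Elts (D.E ⊕ D.X × Bool) := (Elts.edges ρ).tensor (Elts.prod fun x => Elts.cr (D.pos x))
  let g : (D.E ⊕ D.X × Bool) ⊕ Unit ≃ Option D.E ⊕ D.X × Bool :=
    (sumRC _ _ _).trans (Equiv.sumCongr (Equiv.optionEquivSumPUnit _).symm (Equiv.refl _))
  have h1 : (D.subdivide e i j).parts = (u.tensor (Elts.ke j)).map g := by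
    have h2 : Elts.edges (D.subdivide e i j).rot = Elts.map (Equiv.optionEquivSumPUnit _).symm
        ((Elts.edges ρ).tensor (Elts.ke j)) := by
      rw [← Elts.edges_unit fun _ => j, ← Elts.edges_sum]
      refine (Elts.edges_map _ fun x => ?_).symm
      rcases x with x | x <;> rfl
    rw [parts, h2]
    show (Elts.map (Equiv.optionEquivSumPUnit D.E).symm ((Elts.edges ρ).tensor (Elts.ke j))).tensor
      (Elts.prod fun x => Elts.cr (D.pos x)) = _
    rw [Elts.map_tensor_left, ← Elts.tensor_right_comm, Elts.map_map]
  let k : D.Ports ⊕ Unit ≃ Option D.B ⊕ D.X × Bool ⊕ D.X × Bool :=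
    (sumRC _ _ _).trans (Equiv.sumCongr (Equiv.optionEquivSumPUnit _).symm (Equiv.refl _))
  let τ : Equiv.Perm ((D.E ⊕ D.X × Bool) ⊕ Unit) := Equiv.swap (.inl (.inl e)) (.inr ())
  have h3 : glue1 (rl (Equiv.refl _) τ (ofElt (u.tensor (Elts.ke j)) (Equiv.refl _)))
      = ofElt D.parts (Equiv.refl _) := by
    rw [rl_ofElt, Elts.map_refl, glue1_ofElt (a := .inl e) _ (by simp [τ])]
    congr 1
    · rw [parts, ← Elts.mg_edges D.rot e i j h, Elts.mg_tensor, Elts.tensor_right_comm]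
    · refine Equiv.ext fun z => ?_
      by_cases hz : z = .inl e
      · subst hz
        exact ctr_of_inr (by simp [τ]) (by simp [τ])
      · exact ctr_of_inl (by simp [τ, Equiv.swap_apply_of_ne_of_ne, hz])
  rw [value, h1]
  refine (congrArg (SElts.glue _) (ofElt_map _ _ _ _)).trans ?_
  rw [value, ← h3, ← glue1_rl, ← glue_unit, glue_glue, rl_rl, rl_rl,
    ← glue_reindex (K' := (D.subdivide e i j).Ports) k, rl_rl]
  refine congrArg (SElts.glue _) (rl_congr (fun z => ?_) (fun z => ?_) _)
  · rcases z with (z | ⟨x, s⟩) | z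
    · show startE _ _ _ (.inl (newPort _ _ _ (some (D.src z))))
        = Sum.map _ k (Equiv.sumAssoc _ _ _ (.inl (startE _ _ _ (.inl (D.src z)))))
      rcases D.src z with a | b | ⟨x, s⟩ <;> rfl
    · rfl
    · rfl
  · have new : ∀ p : I ⊕ D.B ⊕ D.X × Bool, endE _ _ _ (.inl (newPort _ _ _ (some p)))
        = Sum.map id k (Equiv.sumAssoc _ _ _ (.inl (endE _ _ _ (.inl p)))) := by
      rintro (a | b | ⟨x, s⟩) <;> rfl
    rcases z with (z | ⟨x, s⟩) | z
    · by_cases hz : z = e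
      · subst hz
        refine (congrArg (fun p => endE _ _ _ (.inl p)) (subdivide_tgt_self D z i j)).trans ?_
        simp [τ]
        rfl
      · refine (congrArg (fun p => endE _ _ _ (.inl p)) (subdivide_tgt_ne D hz i j)).trans
          ((new _).trans ?_)
        simp [τ, Equiv.swap_apply_of_ne_of_ne, hz]
        rfl
    · simp [τ, Equiv.swap_apply_of_ne_of_ne]
      rfl
    · refine (congrArg (fun p => endE _ _ _ (.inl p)) (subdivide_tgt_none D e i j)).trans
        ((new _).trans ?_)
      simp [τ]
      rfl

end XCGraph

namespace XCGraph

variable {O I O' I' K : Type}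

open SElts

theorem exists_rank {D : XCGraph O I} (h : D.IsOpen) :
    ∃ r : D.E → ℕ, ∀ y z, D.Next y z → r y < r z := by
  refine ⟨fun e => Nat.card {f // Relation.TransGen D.Next f e}, fun y z hyz => ?_⟩
  let f : {f // Relation.TransGen D.Next f y} → {f // Relation.TransGen D.Next f z} :=
    fun p => ⟨p.1, p.2.tail hyz⟩
  have hf : Function.Injective f := fun p q e => by
    simpa [f, Subtype.ext_iff] using e
  refine lt_of_le_of_ne (Nat.card_le_card_of_injective f hf) fun e => ?_
  obtain ⟨⟨p, hp⟩, e'⟩ := ((Nat.bijective_iff_injective_and_card f).2 ⟨hf, e⟩).2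
    ⟨y, Relation.TransGen.single hyz⟩
  obtain rfl : p = y := congrArg Subtype.val e'
  exact h _ hp

theorem strand_edge (D : XCGraph O I) (e : D.E) {k : D.Ports} (h : D.starts (.inl e) = .inr k) :
    D.starts.symm.trans D.ends (.inr k) = D.ends (.inl e) := by
  rw [← h, Equiv.trans_apply, Equiv.symm_apply_apply]

theorem strand_cross (D : XCGraph O I) (p : D.X × Bool) :
    D.starts.symm.trans D.ends (.inr (.inr (.inl p))) = .inr (.inr (.inr (acrossE _ p))) := rfl

theorem ranked_iff (D : XCGraph O I) : Ranked (D.starts.symm.trans D.ends) ↔ D.IsOpen := by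
  constructor
  · rintro ⟨r, hr⟩
    refine isOpen_of_rank (fun e => Sum.elim (fun _ => 0) (fun k => r k + 1) (D.starts (.inl e))) ?_
    intro y z h
    obtain ⟨k, hk, hr'⟩ : ∃ k, D.starts (.inl z) = .inr k ∧
        ∀ l, D.starts (.inl y) = .inr l → r l < r k := by
      rcases h with ⟨b, h1, h2⟩ | ⟨x, s, h1, h2⟩
      · refine ⟨.inl b, congrArg (fun p => startE _ _ _ (.inl p)) h2, fun l hl => hr _ _ ?_⟩
        rw [D.strand_edge y hl]
        exact congrArg (fun p => endE _ _ _ (.inl p)) h1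
      · refine ⟨.inr (.inr (x, !s)), congrArg (fun p => startE _ _ _ (.inl p)) h2, fun l hl =>
          (hr _ (.inr (.inl (x, s))) ?_).trans (hr _ _ (D.strand_cross (x, s)))⟩
        rw [D.strand_edge y hl]
        exact congrArg (fun p => endE _ _ _ (.inl p)) h1
    simp only [hk, Sum.elim_inr]
    rcases h0 : D.starts (.inl y) with o | l
    · simp
    · simpa using hr' l h0
  · intro h
    obtain ⟨r, hr⟩ := exists_rank h
    let rk : D.Ports → ℕ := Sum.elim (fun b => 2 * r (D.src.symm (.inr (.inl b))))
      (Sum.elim (fun p => 2 * r (D.tgt.symm (.inr (.inr p))) + 1)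
        fun p => 2 * r (D.src.symm (.inr (.inr p))))
    have key : ∀ e k', D.ends (.inl e) = .inr k' → 2 * r e < rk k' := by
      intro e k' he
      have he : endE _ _ _ (.inl (D.tgt e)) = Sum.inr k' := he
      rcases ht : D.tgt e with i | b | ⟨x, s⟩
      · rw [ht] at he; cases he
      · rw [ht] at he; cases he
        have : r e < r (D.src.symm (.inr (.inl b))) :=
          hr _ _ (.inl ⟨b, ht, Equiv.apply_symm_apply _ _⟩)
        simp only [rk, Sum.elim_inl]; omega
      · rw [ht] at he; cases he
        simp only [rk, Sum.elim_inl, Sum.elim_inr]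
        rw [← ht, Equiv.symm_apply_apply]; omega
    refine ⟨rk, ?_⟩
    rintro (b | p | p) k' hk
    · rw [D.strand_edge (D.src.symm (.inr (.inl b)))] at hk
      · exact key _ _ hk
      · exact congrArg (fun p => startE _ _ _ (.inl p)) (Equiv.apply_symm_apply D.src _)
    · rw [strand_cross] at hk
      cases hk
      have : r (D.tgt.symm (.inr (.inr p))) < r (D.src.symm (.inr (.inr (acrossE _ p)))) :=
        hr _ _ (.inr ⟨p.1, p.2, Equiv.apply_symm_apply _ _, Equiv.apply_symm_apply _ _⟩)
      simp only [rk, Sum.elim_inr, Sum.elim_inl]; omega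
    · rw [D.strand_edge (D.src.symm (.inr (.inr p)))] at hk
      · exact key _ _ hk
      · exact congrArg (fun p => startE _ _ _ (.inl p)) (Equiv.apply_symm_apply D.src _)

theorem value_isSome (D : XCGraph O I) : (∃ u σ, D.value = ofElt u σ) ↔ D.IsOpen := by
  rw [← ranked_iff, value, rl_ofElt, glue_isSome]
  rfl

end XCGraph

namespace Tg

variable {O I O' I' K : Type}

/-- The value of a graph up to isomorphism and subdivision. -/
noncomputable def val : Tg False O I → SElts O I :=
  Quot.lift XCGraph.value fun D D' h => by
    rcases h with f | ⟨e, i, j, h, f⟩ | ⟨⟨⟩⟩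
    · exact f.value_eq.symm
    · rw [f.value_eq, D.value_subdivide e i j h]

theorem val_mk (D : XCGraph O I) : val (mk False D) = D.value := rfl

theorem val_rl (o : O ≃ O') (i : I ≃ I') (x : Tg False O I) :
    val (rl o i x) = SElts.rl o i (val x) := by
  obtain ⟨D, rfl⟩ := x.exists_rep
  exact D.value_relabel o i

theorem val_un (x : Tg False O I) (y : Tg False O' I') :
    val (un x y) = SElts.un (val x) (val y) := by
  obtain ⟨D, rfl⟩ := x.exists_rep
  obtain ⟨T, rfl⟩ := y.exists_rep
  exact D.value_union T

theorem val_gl [Finite K] (x : Tg False (O ⊕ K) (I ⊕ K)) : val (gl K x) = SElts.glue K (val x) := by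
  obtain ⟨D, rfl⟩ := x.exists_rep
  exact D.value_glue

end Tg

/-! ### The values of small graphs -/

namespace SElts

variable {O I K K' : Type}

/-- Strands without vertices and with rotation number zero. -/
noncomputable def triv (K : Type) [Finite K] : SElts K K :=
  ofElt (Elts.edges fun _ => 0) (Equiv.refl _)

theorem triv_rl [Finite K] [Finite K'] (k : K ≃ K') : rl k k (triv K) = triv K' := by
  rw [triv, rl_ofElt, triv, Elts.edges_map k (ρ := fun _ => 0) fun _ => rfl]
  simp

theorem triv_sum [Finite K] [Finite K'] : un (triv K) (triv K') = triv (K ⊕ K') := by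
  rw [triv, triv, un_ofElt, Equiv.sumCongr_refl, triv, ← Elts.edges_sum]
  congr 2
  funext x
  rcases x with x | x <;> rfl

theorem rl_un {O' I' U V : Type} (o : O ≃ O') (i : I ≃ I') (x : SElts O I) (y : SElts U V) :
    un (rl o i x) y = rl (Equiv.sumCongr o (.refl _)) (Equiv.sumCongr i (.refl _)) (un x y) := by
  rw [← un_rl, rl_refl]

theorem un_rl_right {O' I' U V : Type} (o : O ≃ O') (i : I ≃ I') (x : SElts O I) (y : SElts U V) :
    un y (rl o i x) = rl (Equiv.sumCongr (.refl _) o) (Equiv.sumCongr (.refl _) i) (un y x) := by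
  rw [← un_rl, rl_refl]

theorem glue1_after (x : SElts O (I ⊕ Unit)) :
    glue1 (rl (Equiv.refl _) (sumRC _ _ _) (un x (triv Unit))) = x := by
  obtain rfl | ⟨u, σ, rfl⟩ := x.cases
  · rfl
  rw [triv, un_ofElt, rl_ofElt, Elts.edges_unit, Elts.ke_zero, Elts.map_refl]
  obtain ⟨a, ha⟩ := σ.surjective (.inr ())
  rw [glue1_ofElt (a := a) _ (by simp [ha]), Elts.mg_eta]
  congr 1
  refine Equiv.ext fun z => ?_
  rcases hz : σ z with y | ⟨⟩
  · exact ctr_of_inl (by simp [hz])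
  · exact ctr_of_inr (by simp [hz]) (by simp)

theorem glue1_before (x : SElts (O ⊕ Unit) I) :
    glue1 (rl (sumRC _ _ _) (Equiv.refl _) (un x (triv Unit))) = x := by
  obtain rfl | ⟨u, σ, rfl⟩ := x.cases
  · rfl
  rw [triv, un_ofElt, rl_ofElt, Elts.edges_unit, Elts.ke_zero]
  rw [glue1_ofElt (a := .inr ()) _ (by simp)]
  have h := Elts.mg_eta_swap (.inr ()) u
  congr 1
  · conv_rhs => rw [← h]
    refine congrArg _ (Elts.map_congr (fun z => ?_) _)
    rcases z with (z | z) | z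
    · simp [Equiv.swap_apply_of_ne_of_ne]
    · simp
    · simp
  · refine Equiv.ext fun z => ?_
    rcases z with z | ⟨⟩
    · exact ctr_of_inl (by simp)
    · exact ctr_of_inr (by simp) (by simp)

theorem finite_sum_induction {p : Type → Prop} (equiv : ∀ {K K'}, K ≃ K' → p K → p K')
    (empty : p Empty) (unit : ∀ K, Finite K → p K → p (K ⊕ Unit)) (K : Type) [Finite K] : p K :=
  Finite.induction_empty_option (P := p) equiv
    (equiv (Equiv.equivOfIsEmpty _ _) empty)
    (fun {K} _ h => equiv (Equiv.optionEquivSumPUnit K).symm (unit K inferInstance h)) K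

theorem triv_empty : triv Empty = ofElt Elts.one (Equiv.refl _) := by
  rw [triv, Elts.edges, Elts.prod_of_isEmpty, Elts.map_map]
  congr 1
  exact (Elts.map_congr (fun z => z.elim) _).trans (Elts.map_refl _)

theorem un_triv_empty (x : SElts O I) :
    rl (Equiv.sumEmpty _ _) (Equiv.sumEmpty _ _) (un x (triv Empty)) = x := by
  obtain rfl | ⟨u, σ, rfl⟩ := x.cases
  · rfl
  rw [triv_empty, un_ofElt, rl_ofElt, Elts.tensor_one]
  congr 1

theorem un_right_comm {O' I' O'' I'' : Type} (x : SElts O I) (y : SElts O' I')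
    (z : SElts O'' I'') :
    rl (sumRC _ _ _) (sumRC _ _ _) (un (un x y) z) = un (un x z) y := by
  have h := un_assoc x z y
  have h' := congrArg (rl (Equiv.sumAssoc _ _ _).symm (Equiv.sumAssoc _ _ _).symm) h
  rw [rl_rl, rl_id (by simp) (by simp)] at h'
  rw [h', ← un_comm y z, un_rl_right, ← un_assoc, rl_rl, rl_rl]
  refine rl_congr (fun w => ?_) (fun w => ?_) _ <;> rcases w with (w | w) | w <;> rfl

theorem un_assoc_symm {O' I' O'' I'' : Type} (x : SElts O I) (y : SElts O' I')
    (z : SElts O'' I'') : rl (Equiv.sumAssoc _ _ _).symm (Equiv.sumAssoc _ _ _).symm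
      (un x (un y z)) = un (un x y) z := by
  rw [← un_assoc, rl_rl]
  exact rl_id (by simp) (by simp) _

theorem glue_after [Finite K] (x : SElts O (I ⊕ K)) :
    glue K (rl (.refl _) (sumRC _ _ _) (un x (triv K))) = x := by
  refine finite_sum_induction (p := fun K => ∀ (_ : Finite K) (I : Type)
    (x : SElts O (I ⊕ K)), glue K (rl (.refl _) (sumRC _ _ _) (un x (triv K))) = x)
    (fun {K K'} k ih _ I x => ?_) (fun _ I x => ?_) (fun K _ ih _ I x => ?_) K _ _ x
  · have : Finite K := Finite.of_equiv _ k.symm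
    have h := ih this I (rl (.refl _) (Equiv.sumCongr (.refl _) k.symm) x)
    rw [← glue_reindex k, rl_un, rl_rl, rl_rl] at h
    rw [← triv_rl k, un_rl_right, rl_rl]
    have h2 := congrArg (rl (.refl _) (Equiv.sumCongr (.refl _) k)) h
    rw [rl_rl, rl_id (fun _ => rfl) (fun z => by rcases z with z | z <;> simp), ← glue_rl, rl_rl] at h2
    conv_rhs => rw [← h2]
    refine congrArg _ (rl_congr (fun z => ?_) (fun z => ?_) _)
    · rcases z with z | z <;> rfl
    · rcases z with (z | z) | z <;> simp
  · have h : un x (triv Empty) = rl (Equiv.sumEmpty _ _).symm (Equiv.sumEmpty _ _).symm x := by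
      have h := congrArg (rl (Equiv.sumEmpty _ Empty).symm (Equiv.sumEmpty _ Empty).symm) (un_triv_empty x)
      rwa [rl_rl, rl_id (fun z => by rcases z with z | z; exacts [rfl, z.elim])
        (fun z => by rcases z with z | z; exacts [rfl, z.elim])] at h
    rw [h, rl_rl, glue_of_isEmpty, rl_rl]
    refine rl_id (fun z => ?_) (fun z => ?_) _
    · rfl
    · rcases z with z | z
      exacts [rfl, z.elim]
  · obtain ⟨y, rfl⟩ : ∃ y, x = rl (.refl _) (Equiv.sumAssoc _ _ _) y :=
      ⟨rl (.refl _) (Equiv.sumAssoc _ _ _).symm x, by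
        rw [rl_rl]
        exact (rl_id (by simp) (by simp) x).symm⟩
    have h1 := glue1_after y
    have h2 := ih ‹_› (I ⊕ Unit) (rl (.refl _) (sumRC _ _ _) y)
    conv at h2 =>
      lhs
      rw [← h1]
    rw [rl_un, rl_rl, ← glue_unit, un_glue, ← glue_rl, glue_glue, rl_un, rl_rl, rl_rl,
      ← un_right_comm, rl_rl, ← un_assoc_symm, triv_sum, rl_rl] at h2
    have h3 := congrArg (rl (.refl _) ((sumRC _ _ _).trans (Equiv.sumAssoc _ _ _))) h2
    rw [rl_rl, ← glue_rl, rl_rl, rl_rl] at h3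
    refine Eq.trans ?_ (h3.trans (rl_congr (fun z => ?_) (fun z => ?_) _))
    · rw [rl_un, rl_rl]
      refine congrArg _ (rl_congr (fun z => ?_) (fun z => ?_) _)
      · rcases z with z | z | z <;> rfl
      · rcases z with ((z | z) | z) | z | z <;> rfl
    · rfl
    · rcases z with (z | z) | z <;> rfl

theorem glue_before [Finite K] (x : SElts (O ⊕ K) I) :
    glue K (rl (sumRC _ _ _) (.refl _) (un x (triv K))) = x := by
  refine finite_sum_induction (p := fun K => ∀ (_ : Finite K) (O : Type)
    (x : SElts (O ⊕ K) I), glue K (rl (sumRC _ _ _) (.refl _) (un x (triv K))) = x)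
    (fun {K K'} k ih _ O x => ?_) (fun _ O x => ?_) (fun K _ ih _ O x => ?_) K _ _ x
  · have : Finite K := Finite.of_equiv _ k.symm
    have h := ih this O (rl (Equiv.sumCongr (.refl _) k.symm) (.refl _) x)
    rw [← glue_reindex k, rl_un, rl_rl, rl_rl] at h
    rw [← triv_rl k, un_rl_right, rl_rl]
    have h2 := congrArg (rl (Equiv.sumCongr (.refl _) k) (.refl _)) h
    rw [rl_rl, rl_id (fun z => by rcases z with z | z <;> simp) (fun _ => rfl), ← glue_rl, rl_rl] at h2
    conv_rhs => rw [← h2]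
    refine congrArg _ (rl_congr (fun z => ?_) (fun z => ?_) _)
    · rcases z with (z | z) | z <;> simp
    · rcases z with z | z <;> rfl
  · have h : un x (triv Empty) = rl (Equiv.sumEmpty _ _).symm (Equiv.sumEmpty _ _).symm x := by
      have h := congrArg (rl (Equiv.sumEmpty _ Empty).symm (Equiv.sumEmpty _ Empty).symm) (un_triv_empty x)
      rwa [rl_rl, rl_id (fun z => by rcases z with z | z; exacts [rfl, z.elim])
        (fun z => by rcases z with z | z; exacts [rfl, z.elim])] at h
    rw [h, rl_rl, glue_of_isEmpty, rl_rl]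
    refine rl_id (fun z => ?_) (fun z => ?_) _
    · rcases z with z | z
      exacts [rfl, z.elim]
    · rfl
  · obtain ⟨y, rfl⟩ : ∃ y, x = rl (Equiv.sumAssoc _ _ _) (.refl _) y :=
      ⟨rl (Equiv.sumAssoc _ _ _).symm (.refl _) x, by
        rw [rl_rl]
        exact (rl_id (by simp) (by simp) x).symm⟩
    have h1 := glue1_before y
    have h2 := ih ‹_› (O ⊕ Unit) (rl (sumRC _ _ _) (.refl _) y)
    conv at h2 =>
      lhs
      rw [← h1]
    rw [rl_un, rl_rl, ← glue_unit, un_glue, ← glue_rl, glue_glue, rl_un, rl_rl, rl_rl,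
      ← un_right_comm, rl_rl, ← un_assoc_symm, triv_sum, rl_rl] at h2
    have h3 := congrArg (rl ((sumRC _ _ _).trans (Equiv.sumAssoc _ _ _)) (.refl _)) h2
    rw [rl_rl, ← glue_rl, rl_rl, rl_rl] at h3
    refine Eq.trans ?_ (h3.trans (rl_congr (fun z => ?_) (fun z => ?_) _))
    · rw [rl_un, rl_rl]
      refine congrArg _ (rl_congr (fun z => ?_) (fun z => ?_) _)
      · rcases z with ((z | z) | z) | z | z <;> rfl
      · rcases z with z | z | z <;> rfl
    · rcases z with (z | z) | z <;> rfl
    · rfl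

theorem glue_before_after [Finite K] [Finite K'] (x : SElts K K') (f : K ≃ O) (g : K' ≃ I)
    (o : K ⊕ K ⊕ K' ≃ O ⊕ K ⊕ K') (i : K' ⊕ K ⊕ K' ≃ I ⊕ K ⊕ K')
    (ho : ∀ k, o (.inl k) = .inr (.inl k)) (ho' : ∀ k, o (.inr (.inl k)) = .inl (f k))
    (ho'' : ∀ k, o (.inr (.inr k)) = .inr (.inr k)) (hi : ∀ k, i (.inl k) = .inr (.inr k))
    (hi' : ∀ k, i (.inr (.inl k)) = .inr (.inl k)) (hi'' : ∀ k, i (.inr (.inr k)) = .inl (g k)) :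
    glue (K ⊕ K') (rl o i (un x (triv (K ⊕ K')))) = rl f g x := by
  have h1 := glue_before (O := Empty) (rl (Equiv.emptySum _ _).symm (Equiv.refl _) x)
  have h2 := glue_after (I := Empty) (rl (Equiv.refl _) (Equiv.emptySum _ _).symm
    (rl (Equiv.emptySum Empty _).symm (Equiv.refl _) x))
  conv at h2 =>
    lhs
    rw [← h1]
  have h3 := congrArg (rl ((Equiv.emptySum _ _).trans f) ((Equiv.emptySum _ _).trans g)) h2
  rw [rl_rl, rl_rl, ← glue_rl, rl_rl, rl_un, rl_rl, un_glue, ← glue_rl, glue_glue] at h3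
  simp only [rl_un, rl_rl] at h3
  rw [← un_assoc_symm, triv_sum, rl_rl, ← glue_reindex (Equiv.sumComm _ _), rl_rl] at h3
  refine Eq.trans (congrArg _ (rl_congr (fun z => ?_) (fun z => ?_) _))
    (h3.trans (rl_congr (fun _ => rfl) (fun _ => rfl) x))
  · rcases z with z | z | z
    · simp [ho]
    · simp [ho']
    · simp [ho'']
  · rcases z with z | z | z
    · simp [hi]
    · simp [hi']
    · simp [hi'']

end SElts

namespace XCGraph

open SElts

theorem value_of_parts {O I S K : Type} [Finite K] (D : XCGraph O I) (f : S ≃ D.E ⊕ D.X × Bool)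
    {u : Elts S} (h : D.parts = u.map f) (q : D.Ports ≃ K) :
    D.value = SElts.glue K (rl (f.trans (D.starts.trans (Equiv.sumCongr (.refl _) q)))
      (f.trans (D.ends.trans (Equiv.sumCongr (.refl _) q))) (ofElt u (Equiv.refl _))) := by
  rw [value, h, ofElt_map, ← glue_reindex q, rl_rl]
  rfl

theorem value_strands {n : ℕ} (σ : Equiv.Perm (Fin n)) (ρ : Fin n → SignType) :
    (strands σ ρ).value = ofElt (Elts.edges ρ) σ := by
  let D := strands σ ρ
  have h : D.parts = (Elts.edges ρ).map
      ((Equiv.sumEmpty _ Empty).symm.trans (Equiv.sumCongr (Equiv.refl _) (Equiv.equivOfIsEmpty Empty (Fin 0 × Bool)))) := by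
    rw [parts, ← Elts.tensor_one (Elts.edges ρ), Elts.map_map]
    have e : (Elts.prod fun x : Fin 0 => Elts.cr (D.pos x))
        = Elts.map (Equiv.equivOfIsEmpty _ _) Elts.one := Elts.prod_of_isEmpty _
    refine (congrArg (Elts.tensor _) e).trans ((Elts.map_tensor_right _ _ _).trans ?_)
    exact Elts.map_congr (fun z => by rcases z with z | z; exacts [rfl, z.elim]) _
  refine (value_of_parts D _ h
    (Equiv.equivOfIsEmpty (Fin 0 ⊕ Fin 0 × Bool ⊕ Fin 0 × Bool) Empty)).trans ?_
  rw [glue_of_isEmpty, rl_rl]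
  refine (rl_congr (o' := .refl _) (i' := σ) (fun _ => rfl) (fun _ => rfl) _).trans ?_
  rw [rl_ofElt, Elts.map_refl]
  rfl

/-- The half-edge at the only tetravalent vertex, as a number. -/
def sideE : Fin 1 × Bool ≃ Fin 2 := (Equiv.uniqueProd Bool (Fin 1)).trans finTwoEquiv.symm

/-- The edges of a crossing. -/
def crossingE : (Fin 1 × Bool) ⊕ (Fin 1 × Bool) ≃ Fin 4 :=
  (Equiv.sumCongr sideE sideE).trans finSumFinEquiv

theorem value_crossing (s : Bool) :
    (crossing s 0 0).value = ofElt ((Elts.cr s).map finTwoEquiv.symm) (Equiv.swap 0 1) := by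
  let D := crossing s 0 0
  let c : Elts (Fin 1 × Bool) := Elts.prod fun x => Elts.cr (D.pos x)
  have h : D.parts = (c.tensor (Elts.edges fun _ => 0)).map
      ((Equiv.sumComm _ _).trans (Equiv.sumCongr crossingE (Equiv.refl _))) := by
    rw [← Elts.map_map, Elts.tensor_comm, ← Elts.map_tensor_left,
      Elts.edges_map crossingE (ρ := fun _ => 0) fun _ => rfl]
    refine congrArg (fun z => Elts.tensor z c) (congrArg Elts.edges (funext fun x : Fin 4 => ?_))
    show D.rot x = 0
    fin_cases x <;> rfl
  let x : SElts (Fin 1 × Bool) (Fin 1 × Bool) := ofElt c (acrossE _)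
  have hx : un x (triv ((Fin 1 × Bool) ⊕ (Fin 1 × Bool))) = rl (Equiv.refl _)
      (Equiv.sumCongr (acrossE _) (Equiv.refl _))
        (ofElt (c.tensor (Elts.edges fun _ => 0)) (Equiv.refl _)) := by
    rw [triv, un_ofElt, rl_ofElt, Elts.map_refl]
    rfl
  let q : (Fin 0 ⊕ Fin 1 × Bool ⊕ Fin 1 × Bool) ≃ Fin 1 × Bool ⊕ Fin 1 × Bool := Equiv.emptySum _ _
  have h1 := glue_before_after x sideE sideE
    (((Equiv.sumComm _ _).trans (Equiv.sumCongr crossingE (Equiv.refl _))).trans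
      (D.starts.trans (Equiv.sumCongr (.refl _) q)))
    ((Equiv.sumCongr (acrossE _).symm (Equiv.refl _)).trans
      (((Equiv.sumComm _ _).trans (Equiv.sumCongr crossingE (Equiv.refl _))).trans
        (D.ends.trans (Equiv.sumCongr (.refl _) q))))
    (fun _ => rfl)
    (by rintro ⟨x, s⟩; fin_cases x; cases s <;> rfl)
    (by rintro ⟨x, s⟩; fin_cases x; cases s <;> rfl)
    (by rintro ⟨x, s⟩; fin_cases x; cases s <;> rfl)
    (by rintro ⟨x, s⟩; fin_cases x; cases s <;> rfl)
    (by rintro ⟨x, s⟩; fin_cases x; cases s <;> rfl)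
  rw [hx, rl_rl] at h1
  refine (value_of_parts D _ h q).trans ((congrArg _ (rl_congr (fun _ => rfl) (fun z => ?_) _)).trans
    (h1.trans ?_))
  · rcases z with z | z
    · rcases z with ⟨z, b⟩
      cases b <;> rfl
    · rfl
  · rw [rl_ofElt]
    congr 1
    · have e : c = Elts.map (Equiv.prodCongr (Equiv.ofUnique Unit (Fin 1)) (Equiv.refl _))
          (Elts.map (Equiv.punitProd Bool).symm (Elts.cr s)) := by
        rw [← Elts.prod_unique fun _ => Elts.cr s]
        exact (Elts.prod_map (Equiv.ofUnique Unit (Fin 1)) (fun x => Elts.cr (D.pos x))).symm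
      rw [e, Elts.map_map, Elts.map_map]
      exact Elts.map_congr (fun _ => rfl) _
    · decide

end XCGraph

/-! ## Natural operations on graphs -/

/-- The bijection `O ⊕ A ≃ (O ⊕ K) ⊕ B` given by a bijection `A ≃ K ⊕ B`. -/
def sumP {A K B : Type} (O : Type) (p : A ≃ K ⊕ B) : O ⊕ A ≃ (O ⊕ K) ⊕ B :=
  (Equiv.sumCongr (Equiv.refl O) p).trans (Equiv.sumAssoc O K B).symm

section
variable {A K B : Type} (O : Type) (p : A ≃ K ⊕ B)

@[simp] theorem sumP_inl (o : O) : sumP O p (.inl o) = .inl (.inl o) := rfl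

theorem sumP_inr (a : A) : sumP O p (.inr a) = (Equiv.sumAssoc O K B).symm (.inr (p a)) := rfl

@[simp] theorem sumP_inr_symm_inl (k : K) :
    sumP O p (.inr (p.symm (.inl k))) = .inl (.inr k) := by
  rw [sumP_inr, Equiv.apply_symm_apply]; rfl

@[simp] theorem sumP_inr_symm_inr (b : B) : sumP O p (.inr (p.symm (.inr b))) = .inr b := by
  rw [sumP_inr, Equiv.apply_symm_apply]; rfl

theorem sumP_ext {O : Type} {T : Type} (p : A ≃ K ⊕ B) {f g : O ⊕ A → T}
    (h₀ : ∀ o, f (.inl o) = g (.inl o))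
    (h₁ : ∀ k, f (.inr (p.symm (.inl k))) = g (.inr (p.symm (.inl k))))
    (h₂ : ∀ b, f (.inr (p.symm (.inr b))) = g (.inr (p.symm (.inr b)))) (z : O ⊕ A) :
    f z = g z := by
  rcases z with o | a
  · exact h₀ o
  · obtain ⟨k | b, rfl⟩ := p.symm.surjective a
    exacts [h₁ k, h₂ b]

theorem sumP_ext' {O U : Type} {T : Type} (p : A ≃ K ⊕ B) {f g : (O ⊕ A) ⊕ U → T}
    (h₀ : ∀ o, f (.inl (.inl o)) = g (.inl (.inl o)))
    (h₁ : ∀ k, f (.inl (.inr (p.symm (.inl k)))) = g (.inl (.inr (p.symm (.inl k)))))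
    (h₂ : ∀ b, f (.inl (.inr (p.symm (.inr b)))) = g (.inl (.inr (p.symm (.inr b)))))
    (h₃ : ∀ u, f (.inr u) = g (.inr u)) (z : (O ⊕ A) ⊕ U) : f z = g z := by
  rcases z with z | u
  · exact sumP_ext p (f := fun z => f (.inl z)) (g := fun z => g (.inl z)) h₀ h₁ h₂ z
  · exact h₃ u

@[simp] theorem sumP_symm_inl_inl (o : O) : (sumP O p).symm (.inl (.inl o)) = .inl o := rfl

@[simp] theorem sumP_symm_inl_inr (k : K) :
    (sumP O p).symm (.inl (.inr k)) = .inr (p.symm (.inl k)) := rfl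

@[simp] theorem sumP_symm_inr (b : B) : (sumP O p).symm (.inr b) = .inr (p.symm (.inr b)) := rfl
end

/-- Operations on graphs with distinguished univalent vertices that are natural in the remaining
part of the graph. -/
@[ext] structure Fam (P : Prop) (A B : Type) where
  app : ∀ {O I : Type}, Tg P (O ⊕ A) (I ⊕ A) → Tg P (O ⊕ B) (I ⊕ B)
  app_rl : ∀ {O I O' I' : Type} (o : O ≃ O') (i : I ≃ I') (x : Tg P (O ⊕ A) (I ⊕ A)),
    app (Tg.rl (.sumCongr o (.refl _)) (.sumCongr i (.refl _)) x)
      = Tg.rl (.sumCongr o (.refl _)) (.sumCongr i (.refl _)) (app x)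
  app_gl : ∀ {O I K : Type} (x : Tg P ((O ⊕ K) ⊕ A) ((I ⊕ K) ⊕ A)),
    Tg.gl K (Tg.rl (sumRC _ _ _) (sumRC _ _ _) (app x))
      = app (Tg.gl K (Tg.rl (sumRC _ _ _) (sumRC _ _ _) x))
  app_un : ∀ {O I U V : Type} (x : Tg P (O ⊕ A) (I ⊕ A)) (y : Tg P U V),
    Tg.rl (sumRC _ _ _) (sumRC _ _ _) (Tg.un (app x) y)
      = app (Tg.rl (sumRC _ _ _) (sumRC _ _ _) (Tg.un x y))

namespace Fam

variable {P : Prop} {A B C D K L X Y Z W : Type}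

/-- Composition, first `f`, then `g`. -/
def comp (f : Fam P A B) (g : Fam P B C) : Fam P A C where
  app x := g.app (f.app x)
  app_rl o i x := by rw [f.app_rl, g.app_rl]
  app_gl x := by rw [g.app_gl, f.app_gl]
  app_un x y := by rw [g.app_un, f.app_un]

/-- Glueing the ends in `K`, and renaming. -/
def fuse (p q : A ≃ B ⊕ K) : Fam P A B where
  app x := Tg.gl K (Tg.rl (sumP _ p) (sumP _ q) x)
  app_rl o i x := by
    rw [Tg.gl_rl, Tg.rl_rl, Tg.rl_rl]
    refine congrArg _ (Tg.rl_congr (sumP_ext p ?_ ?_ ?_) (sumP_ext q ?_ ?_ ?_) _) <;>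
      intro z <;> simp
  app_gl x := by
    rw [Tg.gl_rl, Tg.gl_gl_comm, Tg.gl_rl (K := _), Tg.rl_rl, Tg.rl_rl, Tg.rl_rl]
    refine congrArg _ (congrArg _ (Tg.rl_congr (sumP_ext p ?_ ?_ ?_) (sumP_ext q ?_ ?_ ?_) _))
    on_goal 1 => rintro (z | z) <;> simp
    on_goal 3 => rintro (z | z) <;> simp
    all_goals intro z; simp
  app_un x y := by
    rw [Tg.un_gl, Tg.gl_rl, Tg.rl_un, Tg.rl_rl, Tg.rl_rl, Tg.rl_rl]
    refine congrArg _ (Tg.rl_congr (sumP_ext' p ?_ ?_ ?_ ?_) (sumP_ext' q ?_ ?_ ?_ ?_) _) <;>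
      intro z <;> simp

/-- Renaming. -/
def perm (e : A ≃ B) : Fam P A B where
  app x := Tg.rl (.sumCongr (.refl _) e) (.sumCongr (.refl _) e) x
  app_rl o i x := by
    rw [Tg.rl_rl, Tg.rl_rl]
    refine Tg.rl_congr ?_ ?_ _ <;> rintro (z | z) <;> rfl
  app_gl x := by
    rw [Tg.gl_rl, Tg.rl_rl, Tg.rl_rl]
    refine congrArg _ (Tg.rl_congr ?_ ?_ _) <;> rintro ((z | z) | z) <;> rfl
  app_un x y := by
    rw [Tg.rl_un, Tg.rl_rl, Tg.rl_rl]
    refine Tg.rl_congr ?_ ?_ _ <;> rintro ((z | z) | z) <;> rfl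

/-- Adding a disjoint graph. -/
def add (G : Tg P B B) : Fam P Empty B where
  app x := Tg.un (Tg.rl (.sumEmpty _ _) (.sumEmpty _ _) x) G
  app_rl o i x := by
    rw [Tg.rl_rl, Tg.rl_un, Tg.rl_un, Tg.rl_rl]
    refine Tg.rl_congr ?_ ?_ _ <;> rintro ((z | ⟨⟨⟩⟩) | z) <;> rfl
  app_gl x := by
    rw [Tg.gl_rl, Tg.un_gl, Tg.rl_un, Tg.rl_un, Tg.rl_un, Tg.rl_rl, Tg.rl_rl, Tg.rl_rl]
    refine congrArg _ (Tg.rl_congr ?_ ?_ _) <;> rintro (((z | z) | ⟨⟨⟩⟩) | z) <;> rfl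
  app_un x y := by
    rw [Tg.un_right_comm, Tg.rl_rl, Tg.rl_un, Tg.rl_un, Tg.rl_un]
    refine Tg.rl_congr ?_ ?_ _ <;> rintro (((z | ⟨⟨⟩⟩) | z) | z) <;> rfl

/-- The operation `f` performed on part of the distinguished vertices. -/
def amb (p : X ≃ K ⊕ A) (q : Y ≃ K ⊕ B) (f : Fam P A B) : Fam P X Y where
  app x := Tg.rl (sumP _ q).symm (sumP _ q).symm (f.app (Tg.rl (sumP _ p) (sumP _ p) x))
  app_rl {O I O' I'} o i x := by
    have h : Tg.rl (sumP _ p) (sumP _ p) (Tg.rl (.sumCongr o (.refl _)) (.sumCongr i (.refl _)) x)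
        = Tg.rl (.sumCongr (.sumCongr o (.refl _)) (.refl _))
          (.sumCongr (.sumCongr i (.refl _)) (.refl _)) (Tg.rl (sumP _ p) (sumP _ p) x) := by
      rw [Tg.rl_rl, Tg.rl_rl]
      refine Tg.rl_congr (sumP_ext p ?_ ?_ ?_) (sumP_ext p ?_ ?_ ?_) _ <;> intro z <;> simp
    rw [h, f.app_rl, Tg.rl_rl, Tg.rl_rl]
    refine Tg.rl_congr ?_ ?_ _ <;> rintro ((z | z) | z) <;> rfl
  app_gl {O I L} x := by
    have h : Tg.rl (sumP _ p) (sumP _ p) (Tg.gl L (Tg.rl (sumRC _ _ _) (sumRC _ _ _) x))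
        = Tg.gl L (Tg.rl (sumRC _ _ _) (sumRC _ _ _)
          (Tg.rl (.sumCongr (sumRC _ _ _) (.refl _)) (.sumCongr (sumRC _ _ _) (.refl _))
            (Tg.rl (sumP _ p) (sumP _ p) x))) := by
      rw [Tg.gl_rl, Tg.rl_rl, Tg.rl_rl, Tg.rl_rl]
      refine congrArg _ (Tg.rl_congr (sumP_ext p ?_ ?_ ?_) (sumP_ext p ?_ ?_ ?_) _)
      on_goal 1 => rintro (z | z) <;> simp
      on_goal 3 => rintro (z | z) <;> simp
      all_goals intro z; simp
    rw [h, ← f.app_gl, f.app_rl, Tg.gl_rl, Tg.rl_rl, Tg.rl_rl, Tg.rl_rl]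
    refine congrArg _ (Tg.rl_congr ?_ ?_ _) <;> rintro (((z | z) | z) | z) <;> rfl
  app_un {O I U V} x y := by
    have h : Tg.rl (sumP _ p) (sumP _ p) (Tg.rl (sumRC _ _ _) (sumRC _ _ _) (Tg.un x y))
        = Tg.rl (.sumCongr (sumRC _ _ _) (.refl _)) (.sumCongr (sumRC _ _ _) (.refl _))
          (Tg.rl (sumRC _ _ _) (sumRC _ _ _) (Tg.un (Tg.rl (sumP _ p) (sumP _ p) x) y)) := by
      rw [Tg.rl_un, Tg.rl_rl, Tg.rl_rl, Tg.rl_rl]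
      refine Tg.rl_congr (sumP_ext' p ?_ ?_ ?_ ?_) (sumP_ext' p ?_ ?_ ?_ ?_) _ <;>
        intro z <;> simp
    rw [h, f.app_rl, ← f.app_un, Tg.rl_un, Tg.rl_rl, Tg.rl_rl, Tg.rl_rl]
    refine Tg.rl_congr ?_ ?_ _ <;> rintro (((z | z) | z) | z) <;> rfl

theorem comp_assoc (f : Fam P A B) (g : Fam P B C) (h : Fam P C D) :
    (f.comp g).comp h = f.comp (g.comp h) := rfl

theorem perm_refl_comp (f : Fam P A B) : (perm (Equiv.refl A)).comp f = f := by
  ext O I x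
  exact congrArg f.app (Tg.rl_id (by simp) (by simp) x)

theorem comp_perm_refl (f : Fam P A B) : f.comp (perm (Equiv.refl B)) = f := by
  ext O I x
  exact Tg.rl_id (by simp) (by simp) _

theorem perm_comp (e : A ≃ B) (e' : B ≃ C) :
    (perm e : Fam P A B).comp (perm e') = perm (e.trans e') := by
  ext O I x
  refine (Tg.rl_rl _ _ _ _ x).trans (Tg.rl_congr ?_ ?_ x) <;> rintro (z | z) <;> rfl

theorem perm_congr {e e' : A ≃ B} (h : ∀ a, e a = e' a) : (perm e : Fam P A B) = perm e' := by
  rw [Equiv.ext h]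

theorem amb_congr {p p' : X ≃ K ⊕ A} {q q' : Y ≃ K ⊕ B} (h : ∀ z, p.symm z = p'.symm z)
    (h' : ∀ z, q.symm z = q'.symm z) (f : Fam P A B) : amb p q f = amb p' q' f := by
  rw [Equiv.symm_bijective.injective (Equiv.ext h), Equiv.symm_bijective.injective (Equiv.ext h')]

theorem amb_comp (p : X ≃ K ⊕ A) (q : Y ≃ K ⊕ B) (r : Z ≃ K ⊕ C) (f : Fam P A B) (g : Fam P B C) :
    (amb p q f).comp (amb q r g) = amb p r (f.comp g) := by
  ext O I x
  refine congrArg (Tg.rl _ _) (congrArg g.app ?_)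
  exact (Tg.rl_rl _ _ _ _ _).trans (Tg.rl_id (by simp) (by simp) _)

theorem perm_amb (e : W ≃ X) (p : X ≃ K ⊕ A) (q : Y ≃ K ⊕ B) (f : Fam P A B) :
    (perm e).comp (amb p q f) = amb (e.trans p) q f := by
  ext O I x
  refine congrArg (Tg.rl _ _) (congrArg f.app ?_)
  refine (Tg.rl_rl _ _ _ _ _).trans (Tg.rl_congr ?_ ?_ x) <;> rintro (z | z) <;> rfl

theorem amb_perm (p : X ≃ K ⊕ A) (q : Y ≃ K ⊕ B) (e : Y ≃ W) (f : Fam P A B) :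
    (amb p q f).comp (perm e) = amb p (e.symm.trans q) f := by
  ext O I x
  refine (Tg.rl_rl _ _ _ _ _).trans (Tg.rl_congr ?_ ?_ _) <;> rintro ((z | z) | z) <;> rfl

theorem amb_of_perm (p : X ≃ K ⊕ A) (q : Y ≃ K ⊕ B) (e : A ≃ B) :
    amb p q (perm e : Fam P A B)
      = perm ((p.trans (Equiv.sumCongr (Equiv.refl _) e)).trans q.symm) := by
  ext O I x
  refine (congrArg _ (Tg.rl_rl _ _ _ _ _)).trans ((Tg.rl_rl _ _ _ _ _).trans
    (Tg.rl_congr (sumP_ext p ?_ ?_ ?_) (sumP_ext p ?_ ?_ ?_) _)) <;> intro z <;> simp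

theorem amb_amb (p : X ≃ K ⊕ A) (q : Y ≃ K ⊕ B) (p' : A ≃ L ⊕ C) (q' : B ≃ L ⊕ D)
    (f : Fam P C D) : amb p q (amb p' q' f)
      = amb ((p.trans (Equiv.sumCongr (Equiv.refl _) p')).trans (Equiv.sumAssoc _ _ _).symm)
        ((q.trans (Equiv.sumCongr (Equiv.refl _) q')).trans (Equiv.sumAssoc _ _ _).symm) f := by
  ext O I x
  have h : Tg.rl (sumP (O ⊕ K) p') (sumP (I ⊕ K) p') (Tg.rl (sumP O p) (sumP I p) x)
      = Tg.rl (.sumCongr (Equiv.sumAssoc _ _ _).symm (.refl _))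
        (.sumCongr (Equiv.sumAssoc _ _ _).symm (.refl _)) (Tg.rl (sumP O
        ((p.trans (Equiv.sumCongr (Equiv.refl _) p')).trans (Equiv.sumAssoc _ _ _).symm))
        (sumP I ((p.trans (Equiv.sumCongr (Equiv.refl _) p')).trans (Equiv.sumAssoc _ _ _).symm))
        x) := by
    rw [Tg.rl_rl, Tg.rl_rl]
    refine Tg.rl_congr (sumP_ext p ?_ ?_ ?_) (sumP_ext p ?_ ?_ ?_) _
    on_goal 3 =>
      intro z
      obtain ⟨z | z, rfl⟩ := p'.symm.surjective z <;> simp [sumP_inr]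
    on_goal 5 =>
      intro z
      obtain ⟨z | z, rfl⟩ := p'.symm.surjective z <;> simp [sumP_inr]
    all_goals intro z; simp [sumP_inr]
  show Tg.rl _ _ (Tg.rl _ _ (f.app (Tg.rl _ _ (Tg.rl _ _ x)))) = Tg.rl _ _ (f.app _)
  rw [h, f.app_rl, Tg.rl_rl, Tg.rl_rl]
  refine Tg.rl_congr ?_ ?_ _ <;> rintro ((z | z | z) | z) <;> simp

theorem amb_reindex (k : K ≃ L) (p : X ≃ K ⊕ A) (q : Y ≃ K ⊕ B) (f : Fam P A B) :
    amb (p.trans (Equiv.sumCongr k (Equiv.refl _))) (q.trans (Equiv.sumCongr k (Equiv.refl _))) f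
      = amb p q f := by
  ext O I x
  have h : Tg.rl (sumP O (p.trans (Equiv.sumCongr k (Equiv.refl _))))
        (sumP I (p.trans (Equiv.sumCongr k (Equiv.refl _)))) x
      = Tg.rl (.sumCongr (.sumCongr (.refl _) k) (.refl _))
        (.sumCongr (.sumCongr (.refl _) k) (.refl _)) (Tg.rl (sumP O p) (sumP I p) x) := by
    rw [Tg.rl_rl]
    refine Tg.rl_congr (sumP_ext p ?_ ?_ ?_) (sumP_ext p ?_ ?_ ?_) _ <;> intro z <;>
      simp [sumP_inr]
  show Tg.rl _ _ (f.app _) = Tg.rl _ _ (f.app _)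
  rw [h, f.app_rl, Tg.rl_rl]
  refine Tg.rl_congr ?_ ?_ _ <;> rintro ((z | z) | z) <;> simp

theorem amb_of_isEmpty [IsEmpty K] (p : X ≃ K ⊕ A) (q : Y ≃ K ⊕ B) (f : Fam P A B) :
    amb p q f = ((perm (p.trans (Equiv.emptySum _ _))).comp f).comp
      (perm (q.trans (Equiv.emptySum _ _)).symm) := by
  ext O I x
  have h : Tg.rl (sumP O p) (sumP I p) x
      = Tg.rl (.sumCongr (Equiv.sumEmpty _ _).symm (.refl _))
        (.sumCongr (Equiv.sumEmpty _ _).symm (.refl _))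
        (Tg.rl (.sumCongr (.refl _) (p.trans (Equiv.emptySum _ _)))
          (.sumCongr (.refl _) (p.trans (Equiv.emptySum _ _))) x) := by
    rw [Tg.rl_rl]
    refine Tg.rl_congr (sumP_ext p ?_ ?_ ?_) (sumP_ext p ?_ ?_ ?_) _
    on_goal 2 => exact isEmptyElim
    on_goal 4 => exact isEmptyElim
    all_goals intro z; simp
  show Tg.rl _ _ (f.app _) = Tg.rl _ _ (f.app _)
  rw [h, f.app_rl, Tg.rl_rl]
  refine Tg.rl_congr ?_ ?_ _ <;> rintro (z | z) <;> rfl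

/-- Operations on different vertices commute. -/
def Commutes (f : Fam P A B) (g : Fam P C D) : Prop :=
  ∀ {O I : Type} (x : Tg P ((O ⊕ C) ⊕ A) ((I ⊕ C) ⊕ A)),
    g.app (Tg.rl (sumRC _ _ _) (sumRC _ _ _) (f.app x))
      = Tg.rl (sumRC _ _ _) (sumRC _ _ _) (f.app (Tg.rl (sumRC _ _ _) (sumRC _ _ _)
          (g.app (Tg.rl (sumRC _ _ _) (sumRC _ _ _) x))))

theorem Commutes.exch {f : Fam P A B} {g : Fam P C D} (h : Commutes f g) (p : X ≃ C ⊕ A)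
    (q : Y ≃ C ⊕ B) (r : Z ≃ B ⊕ D) (s : W ≃ A ⊕ D) :
    (amb p q f).comp (amb (q.trans (Equiv.sumComm _ _)) r g)
      = (amb (p.trans (Equiv.sumComm _ _)) s g).comp
        (amb (s.trans (Equiv.sumComm _ _)) (r.trans (Equiv.sumComm _ _)) f) := by
  ext O I x
  show Tg.rl _ _ (g.app (Tg.rl _ _ (Tg.rl _ _ (f.app _))))
    = Tg.rl _ _ (f.app (Tg.rl _ _ (Tg.rl _ _ (g.app _))))
  have h1 : ∀ {A B C : Type} (q : A ≃ B ⊕ C) {O I : Type} (y : Tg P ((O ⊕ B) ⊕ C) ((I ⊕ B) ⊕ C)),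
      Tg.rl (sumP _ (q.trans (Equiv.sumComm _ _))) (sumP _ (q.trans (Equiv.sumComm _ _)))
        (Tg.rl (sumP _ q).symm (sumP _ q).symm y) = Tg.rl (sumRC _ _ _) (sumRC _ _ _) y := by
    intro A B C q O I y
    rw [Tg.rl_rl]
    refine Tg.rl_congr ?_ ?_ _ <;> rintro ((z | z) | z) <;> simp [sumP_inr]
  have h2 : Tg.rl (sumP O (p.trans (Equiv.sumComm _ _))) (sumP I (p.trans (Equiv.sumComm _ _))) x
      = Tg.rl (sumRC _ _ _) (sumRC _ _ _) (Tg.rl (sumP O p) (sumP I p) x) := by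
    rw [Tg.rl_rl]
    refine Tg.rl_congr (sumP_ext p ?_ ?_ ?_) (sumP_ext p ?_ ?_ ?_) _ <;> intro z <;>
      simp [sumP_inr]
  rw [h1, h1, h2, h, Tg.rl_rl]
  refine Tg.rl_congr ?_ ?_ _ <;> rintro ((z | z) | z) <;> simp

end Fam

namespace Fam

variable {P : Prop} {A B C D K L X Y Z W : Type} {f : Fam P A B}

theorem Commutes.of_perm (e : C ≃ D) : Commutes f (perm e) := by
  intro O I x
  show Tg.rl _ _ (Tg.rl _ _ (f.app x)) = Tg.rl _ _ (f.app (Tg.rl _ _ (Tg.rl _ _ (Tg.rl _ _ x))))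
  have h : Tg.rl (sumRC O A D) (sumRC I A D) (Tg.rl (.sumCongr (.refl _) e) (.sumCongr (.refl _) e)
      (Tg.rl (sumRC O C A) (sumRC I C A) x)) = Tg.rl (.sumCongr (.sumCongr (.refl _) e) (.refl _))
        (.sumCongr (.sumCongr (.refl _) e) (.refl _)) x := by
    rw [Tg.rl_rl, Tg.rl_rl]
    refine Tg.rl_congr ?_ ?_ _ <;> rintro ((z | z) | z) <;> rfl
  rw [h, f.app_rl, Tg.rl_rl, Tg.rl_rl]
  refine Tg.rl_congr ?_ ?_ _ <;> rintro ((z | z) | z) <;> rfl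

theorem Commutes.comp {g : Fam P C D} {h : Fam P D X} (hg : Commutes f g) (hh : Commutes f h) :
    Commutes f (g.comp h) := by
  intro O I x
  have e : ∀ {O I D : Type} (y : Tg P ((O ⊕ D) ⊕ B) ((I ⊕ D) ⊕ B)),
      Tg.rl (sumRC _ _ _) (sumRC _ _ _) (Tg.rl (sumRC _ _ _) (sumRC _ _ _) y) = y := fun y => by
    rw [Tg.rl_rl]
    refine Tg.rl_id ?_ ?_ _ <;> rintro ((z | z) | z) <;> rfl
  have e' : ∀ {O I : Type} (y : Tg P ((O ⊕ A) ⊕ D) ((I ⊕ A) ⊕ D)),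
      Tg.rl (sumRC _ _ _) (sumRC _ _ _) (Tg.rl (sumRC _ _ _) (sumRC _ _ _) y) = y := fun y => by
    rw [Tg.rl_rl]
    refine Tg.rl_id ?_ ?_ _ <;> rintro ((z | z) | z) <;> rfl
  show h.app (g.app _) = Tg.rl _ _ (f.app (Tg.rl _ _ (h.app (g.app _))))
  rw [hg, hh, e']

theorem Commutes.of_amb {g : Fam P C D} (h : Commutes f g) (p : X ≃ K ⊕ C) (q : Y ≃ K ⊕ D) :
    Commutes f (amb p q g) := by
  intro O I x
  show Tg.rl _ _ (g.app (Tg.rl _ _ (Tg.rl _ _ (f.app x))))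
    = Tg.rl _ _ (f.app (Tg.rl _ _ (Tg.rl _ _ (g.app (Tg.rl _ _ (Tg.rl _ _ x))))))
  obtain ⟨x, rfl⟩ : ∃ y, x = Tg.rl (.sumCongr (sumP O p).symm (.refl _))
      (.sumCongr (sumP I p).symm (.refl _)) y :=
    ⟨Tg.rl (.sumCongr (sumP O p) (.refl _)) (.sumCongr (sumP I p) (.refl _)) x, by
      rw [Tg.rl_rl, Tg.rl_id] <;> rintro (z | z) <;> simp⟩
  have h1 : ∀ {O I B : Type} (y : Tg P (((O ⊕ K) ⊕ C) ⊕ B) (((I ⊕ K) ⊕ C) ⊕ B)),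
      Tg.rl (sumP (O ⊕ B) p) (sumP (I ⊕ B) p) (Tg.rl (sumRC _ _ _) (sumRC _ _ _)
        (Tg.rl (.sumCongr (sumP O p).symm (.refl _)) (.sumCongr (sumP I p).symm (.refl _)) y))
      = Tg.rl (.sumCongr (sumRC _ _ _) (.refl _)) (.sumCongr (sumRC _ _ _) (.refl _))
        (Tg.rl (sumRC _ _ _) (sumRC _ _ _) y) := fun y => by
    rw [Tg.rl_rl, Tg.rl_rl, Tg.rl_rl]
    refine Tg.rl_congr ?_ ?_ _ <;> rintro (((z | z) | z) | z) <;> simp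
  have h2 : ∀ {O I B : Type} (y : Tg P (((O ⊕ K) ⊕ B) ⊕ D) (((I ⊕ K) ⊕ B) ⊕ D)),
      Tg.rl (sumRC _ _ _) (sumRC _ _ _) (Tg.rl (sumP _ q).symm (sumP _ q).symm
        (Tg.rl (.sumCongr (sumRC _ _ _) (.refl _)) (.sumCongr (sumRC _ _ _) (.refl _)) y))
      = Tg.rl (.sumCongr (sumP _ q).symm (.refl _)) (.sumCongr (sumP _ q).symm (.refl _))
        (Tg.rl (sumRC _ _ _) (sumRC _ _ _) y) := fun y => by
    rw [Tg.rl_rl, Tg.rl_rl, Tg.rl_rl]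
    refine Tg.rl_congr ?_ ?_ _ <;> rintro (((z | z) | z) | z) <;> simp
  rw [f.app_rl, h1, h1, g.app_rl, g.app_rl, h, h2, f.app_rl, Tg.rl_rl, Tg.rl_rl, Tg.rl_rl]
  refine Tg.rl_congr ?_ ?_ _ <;> rintro (((z | z) | z) | z) <;> simp

theorem Commutes.of_fuse (p q : C ≃ D ⊕ K) : Commutes f (fuse p q) := by
  intro O I x
  show Tg.gl _ (Tg.rl _ _ (Tg.rl _ _ (f.app x)))
    = Tg.rl _ _ (f.app (Tg.rl _ _ (Tg.gl _ (Tg.rl _ _ (Tg.rl _ _ x)))))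
  obtain ⟨x, rfl⟩ : ∃ y, x = Tg.rl (.sumCongr (sumP O p).symm (.refl _))
      (.sumCongr (sumP I q).symm (.refl _)) y :=
    ⟨Tg.rl (.sumCongr (sumP O p) (.refl _)) (.sumCongr (sumP I q) (.refl _)) x, by
      rw [Tg.rl_rl, Tg.rl_id] <;> rintro (z | z) <;> simp⟩
  have h1 : ∀ {B : Type} (y : Tg P (((O ⊕ D) ⊕ K) ⊕ B) (((I ⊕ D) ⊕ K) ⊕ B)),
      Tg.rl (sumP (O ⊕ B) p) (sumP (I ⊕ B) q) (Tg.rl (sumRC _ _ _) (sumRC _ _ _)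
        (Tg.rl (.sumCongr (sumP O p).symm (.refl _)) (.sumCongr (sumP I q).symm (.refl _)) y))
      = Tg.rl (.sumCongr (sumRC _ _ _) (.refl _)) (.sumCongr (sumRC _ _ _) (.refl _))
        (Tg.rl (sumRC _ _ _) (sumRC _ _ _) y) := fun y => by
    rw [Tg.rl_rl, Tg.rl_rl, Tg.rl_rl]
    refine Tg.rl_congr ?_ ?_ _ <;> rintro (((z | z) | z) | z) <;> simp
  rw [f.app_rl, h1, h1, ← Tg.gl_rl, ← Tg.gl_rl, f.app_gl, Tg.rl_rl, Tg.rl_id]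
  all_goals rintro ((z | z) | z) <;> rfl

theorem Commutes.of_add (G : Tg P D D) : Commutes f (add G) := by
  intro O I x
  show Tg.un (Tg.rl _ _ (Tg.rl _ _ (f.app x))) G
    = Tg.rl _ _ (f.app (Tg.rl _ _ (Tg.un (Tg.rl _ _ (Tg.rl _ _ x)) G)))
  obtain ⟨x, rfl⟩ : ∃ y, x = Tg.rl (.sumCongr (Equiv.sumEmpty _ _).symm (.refl _))
      (.sumCongr (Equiv.sumEmpty _ _).symm (.refl _)) y :=
    ⟨Tg.rl (.sumCongr (Equiv.sumEmpty _ _) (.refl _)) (.sumCongr (Equiv.sumEmpty _ _) (.refl _)) x,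
      by rw [Tg.rl_rl, Tg.rl_id] <;> rintro (z | z) <;> simp⟩
  have h1 : ∀ {B : Type} (y : Tg P (O ⊕ B) (I ⊕ B)),
      Tg.rl (Equiv.sumEmpty _ Empty) (Equiv.sumEmpty _ Empty) (Tg.rl (sumRC _ _ _) (sumRC _ _ _)
        (Tg.rl (.sumCongr (Equiv.sumEmpty _ _).symm (.refl _))
          (.sumCongr (Equiv.sumEmpty _ _).symm (.refl _)) y)) = y := fun y => by
    rw [Tg.rl_rl, Tg.rl_rl]
    refine Tg.rl_id ?_ ?_ _ <;> rintro (z | z) <;> rfl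
  rw [f.app_rl, h1, h1, ← f.app_un, Tg.rl_rl, Tg.rl_id]
  all_goals rintro ((z | z) | z) <;> rfl

theorem fuse_congr {p p' q q' : A ≃ B ⊕ K} (h : ∀ a, p a = p' a) (h' : ∀ a, q a = q' a) :
    (fuse p q : Fam P A B) = fuse p' q' := by
  rw [Equiv.ext h, Equiv.ext h']

theorem fuse_reindex (k : K ≃ L) (p q : A ≃ B ⊕ K) :
    (fuse (p.trans (Equiv.sumCongr (.refl _) k)) (q.trans (Equiv.sumCongr (.refl _) k)) :
      Fam P A B) = fuse p q := by
  ext O I x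
  refine Eq.trans (congrArg (Tg.gl L) ?_) (Tg.gl_reindex k (Tg.rl (sumP O p) (sumP I q) x))
  rw [Tg.rl_rl]
  refine Tg.rl_congr (sumP_ext p ?_ ?_ ?_) (sumP_ext q ?_ ?_ ?_) _ <;> intro z <;> simp [sumP_inr]

theorem fuse_comp_fuse (p q : A ≃ B ⊕ K) (p' q' : B ≃ C ⊕ L) :
    (fuse p q : Fam P A B).comp (fuse p' q')
      = fuse ((p.trans (Equiv.sumCongr p' (.refl _))).trans (Equiv.sumAssoc _ _ _))
        ((q.trans (Equiv.sumCongr q' (.refl _))).trans (Equiv.sumAssoc _ _ _)) := by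
  ext O I x
  show Tg.gl L (Tg.rl _ _ (Tg.gl K _)) = Tg.gl _ _
  rw [Tg.gl_rl, Tg.rl_rl, Tg.gl_gl, Tg.rl_rl]
  refine congrArg _ (Tg.rl_congr (sumP_ext p ?_ ?_ ?_) (sumP_ext q ?_ ?_ ?_) _)
  on_goal 2 =>
    intro z
    obtain ⟨z | z, rfl⟩ := p'.symm.surjective z <;> simp [sumP_inr]
  on_goal 4 =>
    intro z
    obtain ⟨z | z, rfl⟩ := q'.symm.surjective z <;> simp [sumP_inr]
  all_goals intro z; simp [sumP_inr]

theorem perm_eq_fuse (e : A ≃ B) : (perm e : Fam P A B)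
    = fuse (e.trans (Equiv.sumEmpty B Empty).symm) (e.trans (Equiv.sumEmpty B Empty).symm) := by
  ext O I x
  refine Eq.trans ?_ (Tg.gl_of_isEmpty _).symm
  rw [Tg.rl_rl]
  refine Tg.rl_congr ?_ ?_ _ <;> rintro (z | z) <;> rfl

theorem perm_comp_fuse (e : A ≃ B) (p q : B ≃ C ⊕ K) :
    (perm e).comp (fuse p q : Fam P B C) = fuse (e.trans p) (e.trans q) := by
  ext O I x
  refine congrArg _ ((Tg.rl_rl _ _ _ _ _).trans (Tg.rl_congr ?_ ?_ _)) <;> rintro (z | z) <;> rfl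

theorem amb_fuse (p : X ≃ K ⊕ A) (q : Y ≃ K ⊕ B) (p' q' : A ≃ B ⊕ L) :
    amb p q (fuse p' q' : Fam P A B)
      = fuse (((p.trans (Equiv.sumCongr (.refl _) p')).trans (Equiv.sumAssoc _ _ _).symm).trans
          (Equiv.sumCongr q.symm (.refl _)))
        (((p.trans (Equiv.sumCongr (.refl _) q')).trans (Equiv.sumAssoc _ _ _).symm).trans
          (Equiv.sumCongr q.symm (.refl _))) := by
  ext O I x
  show Tg.rl _ _ (Tg.gl L (Tg.rl _ _ (Tg.rl _ _ _))) = Tg.gl _ (Tg.rl _ _ _)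
  rw [Tg.gl_rl, Tg.rl_rl, Tg.rl_rl]
  refine congrArg _ (Tg.rl_congr (sumP_ext p ?_ ?_ ?_) (sumP_ext p ?_ ?_ ?_) _)
  on_goal 3 =>
    intro z
    obtain ⟨z | z, rfl⟩ := p'.symm.surjective z <;> simp [sumP_inr]
  on_goal 5 =>
    intro z
    obtain ⟨z | z, rfl⟩ := q'.symm.surjective z <;> simp [sumP_inr]
  all_goals intro z; simp [sumP_inr]

end Fam

namespace XCTerm

variable {P : Prop}

/-- The bijection that selects the first of two strands as the glued one. -/
def mulE : Fin 2 ≃ Fin 1 ⊕ Unit where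
  toFun := ![.inr (), .inl 0]
  invFun := Sum.elim (fun _ => 1) (fun _ => 0)
  left_inv := by intro i; fin_cases i <;> rfl
  right_inv := by rintro (i | ⟨⟩); exacts [congrArg Sum.inl (Subsingleton.elim _ _), rfl]

/-- The operation on graphs given by an expression. -/
noncomputable def act (P : Prop) : ∀ {a b : ℕ}, XCTerm a b → Fam P (Fin a) (Fin b)
  | _, _, .cast h => .perm (finCongr h)
  | _, _, .comp f g => (act P f).comp (act P g)
  | _, _, .tensor f g =>
    (Fam.amb finSumFinEquiv.symm finSumFinEquiv.symm (act P g)).comp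
      (Fam.amb (finSumFinEquiv.symm.trans (Equiv.sumComm _ _))
        (finSumFinEquiv.symm.trans (Equiv.sumComm _ _)) (act P f))
  | _, _, .braid a b => .perm (StrandPerm.brE a b)
  | _, _, .mul => .fuse mulE ((Equiv.swap 0 1).trans mulE)
  | _, _, .unit => (Fam.perm (Equiv.equivOfIsEmpty _ _)).comp (.add (.mk P (.strands 1 0)))
  | _, _, .R => (Fam.perm (Equiv.equivOfIsEmpty _ _)).comp
      (.add (.mk P ((XCGraph.crossing true 0 0).relabel (.refl _) (.swap 0 1))))
  | _, _, .Rinv => (Fam.perm (Equiv.equivOfIsEmpty _ _)).comp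
      (.add (.mk P ((XCGraph.crossing false 0 0).relabel (.swap 0 1) (.refl _))))
  | _, _, .kappa => (Fam.perm (Equiv.equivOfIsEmpty _ _)).comp (.add (.mk P (.strands 1 (-1))))
  | _, _, .kappaInv => (Fam.perm (Equiv.equivOfIsEmpty _ _)).comp (.add (.mk P (.strands 1 1)))

theorem act_commutes {A B : Type} (f : Fam P A B) {a b : ℕ} (t : XCTerm a b) :
    f.Commutes (act P t) := by
  induction t with
  | cast h => exact Fam.Commutes.of_perm _
  | comp _ _ hf hg => exact Fam.Commutes.comp hf hg
  | tensor _ _ hf hg => exact Fam.Commutes.comp (Fam.Commutes.of_amb hg _ _) (Fam.Commutes.of_amb hf _ _)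
  | braid a b => exact Fam.Commutes.of_perm _
  | mul => exact Fam.Commutes.of_fuse _ _
  | unit => exact Fam.Commutes.comp (Fam.Commutes.of_perm _) (Fam.Commutes.of_add _)
  | R => exact Fam.Commutes.comp (Fam.Commutes.of_perm _) (Fam.Commutes.of_add _)
  | Rinv => exact Fam.Commutes.comp (Fam.Commutes.of_perm _) (Fam.Commutes.of_add _)
  | kappa => exact Fam.Commutes.comp (Fam.Commutes.of_perm _) (Fam.Commutes.of_add _)
  | kappaInv => exact Fam.Commutes.comp (Fam.Commutes.of_perm _) (Fam.Commutes.of_add _)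

end XCTerm

namespace Fam

variable {P : Prop} {A B C D K L X Y Z W : Type}

theorem amb_ext (k : K ≃ L) {p : X ≃ K ⊕ A} {p' : X ≃ L ⊕ A} {q : Y ≃ K ⊕ B} {q' : Y ≃ L ⊕ B}
    (h₁ : ∀ z, p'.symm (.inl (k z)) = p.symm (.inl z)) (h₂ : ∀ z, p'.symm (.inr z) = p.symm (.inr z))
    (h₃ : ∀ z, q'.symm (.inl (k z)) = q.symm (.inl z)) (h₄ : ∀ z, q'.symm (.inr z) = q.symm (.inr z))
    (f : Fam P A B) : amb p q f = amb p' q' f := by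
  rw [← amb_reindex k]
  refine amb_congr ?_ ?_ f <;> rintro (z | z)
  · obtain ⟨z, rfl⟩ := k.surjective z
    simpa using (h₁ z).symm
  · exact (h₂ z).symm
  · obtain ⟨z, rfl⟩ := k.surjective z
    simpa using (h₃ z).symm
  · exact (h₄ z).symm

end Fam

namespace XCTerm

variable {P : Prop}

theorem act_tensor_exch {a b c d : ℕ} (f : XCTerm a b) (g : XCTerm c d) :
    act P (.tensor f g) = (Fam.amb (finSumFinEquiv.symm.trans (Equiv.sumComm _ _))
      (finSumFinEquiv.symm.trans (Equiv.sumComm _ _)) (act P f)).comp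
      (Fam.amb finSumFinEquiv.symm finSumFinEquiv.symm (act P g)) := by
  refine (Fam.Commutes.exch (act_commutes (act P g) f) finSumFinEquiv.symm finSumFinEquiv.symm
    (finSumFinEquiv.symm.trans (Equiv.sumComm _ _))
    (finSumFinEquiv.symm.trans (Equiv.sumComm _ _))).trans ?_
  refine congrArg _ (Fam.amb_congr ?_ ?_ _) <;> rintro (z | z) <;> rfl

theorem act_id (a : ℕ) : act P (id a) = Fam.perm (Equiv.refl _) := Fam.perm_congr fun _ => rfl

theorem act_sound (hlaw : ∀ {a b : ℕ} {s t : XCTerm a b}, Law s t → act P s = act P t) {a b : ℕ}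
    {s t : XCTerm a b} (h : Rel s t) : act P s = act P t := by
  induction h with
  | refl => rfl
  | symm _ h => exact h.symm
  | trans _ _ h h' => exact h.trans h'
  | comp_congr _ _ h h' => exact congrArg₂ Fam.comp h h'
  | tensor_congr _ _ h h' => simp only [act, h, h']
  | id_comp f => exact (congrArg (Fam.comp · _) (act_id _)).trans (Fam.perm_refl_comp _)
  | comp_id f => exact (congrArg (Fam.comp _) (act_id _)).trans (Fam.comp_perm_refl _)
  | comp_assoc f g h => rfl
  | tensor_id a b =>
    simp only [act, Fam.amb_of_perm, Fam.perm_comp]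
    refine Fam.perm_congr fun i => ?_
    simp
  | tensor_comp f g f' g' =>
    refine ((congrArg₂ Fam.comp (Fam.amb_comp _ finSumFinEquiv.symm _ (act P f') (act P g'))
      (Fam.amb_comp _ (finSumFinEquiv.symm.trans (Equiv.sumComm _ _)) _ (act P f)
        (act P g))).symm).trans ?_
    exact congrArg (fun x => Fam.comp _ (Fam.comp x _)) (act_tensor_exch f g')
  | @tensor_assoc a b c a' b' c' f g h =>
    have hf : (Fam.amb (finSumFinEquiv.symm.trans (Equiv.sumComm (Fin (a + b')) (Fin c')))
          (finSumFinEquiv.symm.trans (Equiv.sumComm (Fin (a' + b')) (Fin c')))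
          (Fam.amb (finSumFinEquiv.symm.trans (Equiv.sumComm (Fin a) (Fin b')))
            (finSumFinEquiv.symm.trans (Equiv.sumComm (Fin a') (Fin b'))) (act P f))).comp
          (.perm (finCongr (Nat.add_assoc a' b' c')))
        = (Fam.perm (finCongr (Nat.add_assoc a b' c'))).comp
          (Fam.amb (finSumFinEquiv.symm.trans (Equiv.sumComm _ _))
            (finSumFinEquiv.symm.trans (Equiv.sumComm _ _)) (act P f)) := by
      rw [Fam.amb_amb, Fam.amb_perm, Fam.perm_amb]
      refine Fam.amb_ext ((Equiv.sumComm _ _).trans finSumFinEquiv) ?_ ?_ ?_ ?_ _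
      on_goal 1 => rintro (z | z)
      on_goal 4 => rintro (z | z)
      all_goals first | intro z | skip
      all_goals apply Fin.ext; simp [Nat.add_assoc]
    have hg : (Fam.amb (finSumFinEquiv.symm.trans (Equiv.sumComm (Fin (a + b)) (Fin c')))
          (finSumFinEquiv.symm.trans (Equiv.sumComm (Fin (a + b')) (Fin c')))
          (Fam.amb (finSumFinEquiv (m := a)).symm (finSumFinEquiv (m := a)).symm (act P g))).comp
          (.perm (finCongr (Nat.add_assoc a b' c')))
        = (Fam.perm (finCongr (Nat.add_assoc a b c'))).comp
          (Fam.amb finSumFinEquiv.symm finSumFinEquiv.symm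
          (Fam.amb (finSumFinEquiv.symm.trans (Equiv.sumComm _ _))
            (finSumFinEquiv.symm.trans (Equiv.sumComm _ _)) (act P g))) := by
      rw [Fam.amb_amb, Fam.amb_amb, Fam.amb_perm, Fam.perm_amb]
      refine Fam.amb_ext (Equiv.sumComm _ _) ?_ ?_ ?_ ?_ _
      on_goal 1 => rintro (z | z)
      on_goal 4 => rintro (z | z)
      all_goals first | intro z | skip
      all_goals apply Fin.ext; simp [Nat.add_assoc]
    have hh : (Fam.amb (finSumFinEquiv (m := a + b)).symm finSumFinEquiv.symm (act P h)).comp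
          (.perm (finCongr (Nat.add_assoc a b c')))
        = (Fam.perm (finCongr (Nat.add_assoc a b c))).comp
          (Fam.amb finSumFinEquiv.symm finSumFinEquiv.symm
          (Fam.amb finSumFinEquiv.symm finSumFinEquiv.symm (act P h))) := by
      rw [Fam.amb_amb, Fam.amb_perm, Fam.perm_amb]
      refine Fam.amb_ext finSumFinEquiv.symm ?_ ?_ ?_ ?_ _
      on_goal 1 => intro z; obtain ⟨z | z, rfl⟩ := finSumFinEquiv.surjective z
      on_goal 4 => intro z; obtain ⟨z | z, rfl⟩ := finSumFinEquiv.surjective z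
      all_goals first | intro z | skip
      all_goals apply Fin.ext; simp [Nat.add_assoc]
    simp only [act]
    rw [← Fam.amb_comp (finSumFinEquiv.symm.trans (Equiv.sumComm (Fin (a + b)) (Fin c')))
        (finSumFinEquiv.symm.trans (Equiv.sumComm (Fin (a + b')) (Fin c'))),
      ← Fam.amb_comp (finSumFinEquiv (m := a)).symm (finSumFinEquiv (m := a)).symm
        (finSumFinEquiv (m := a)).symm, Fam.comp_assoc, Fam.comp_assoc, hf, ← Fam.comp_assoc (Fam.amb _ _ _) (Fam.perm _), hg,
      ← Fam.comp_assoc, ← Fam.comp_assoc, hh]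
    rfl
  | unit_tensor f =>
    simp only [act, Fam.amb_of_perm, Fam.amb_of_isEmpty, Fam.perm_comp, Fam.comp_assoc]
    refine congrArg₂ Fam.comp (Fam.perm_congr fun i => ?_) ((congrArg _ ?_).trans
      (Fam.comp_perm_refl _))
    · apply Fin.ext
      obtain ⟨z | z, rfl⟩ := finSumFinEquiv.surjective i
      exacts [z.elim0, by simp [-finSumFinEquiv_apply_right]; simp [finSumFinEquiv_apply_right]]
    · exact Fam.perm_congr fun i => by apply Fin.ext; simp
  | tensor_unit f =>
    simp only [act, Fam.amb_of_perm, Fam.amb_of_isEmpty, Fam.perm_comp, Fam.comp_assoc]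
    rw [← Fam.comp_assoc, Fam.perm_comp]
    refine congrArg₂ Fam.comp (Fam.perm_congr fun i => ?_) ((congrArg _ ?_).trans
      (Fam.comp_perm_refl _))
    · apply Fin.ext
      obtain ⟨z | z, rfl⟩ := finSumFinEquiv.surjective i
      exacts [by simp [-finSumFinEquiv_apply_left]; rfl, z.elim0]
    · exact Fam.perm_congr fun i => by apply Fin.ext; simp; rfl
  | @braid_natural a b c d f g =>
    have hf : (Fam.perm (StrandPerm.brE a c)).comp
        (Fam.amb finSumFinEquiv.symm finSumFinEquiv.symm (act P f))
        = (Fam.amb (finSumFinEquiv.symm.trans (Equiv.sumComm _ _))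
          (finSumFinEquiv.symm.trans (Equiv.sumComm _ _)) (act P f)).comp
          (.perm (StrandPerm.brE b c)) := by
      rw [Fam.perm_amb, Fam.amb_perm]
      refine Fam.amb_congr ?_ ?_ _ <;> rintro (z | z) <;> simp [StrandPerm.brE]
    have hg : (Fam.perm (StrandPerm.brE b c)).comp
        (Fam.amb (finSumFinEquiv.symm.trans (Equiv.sumComm _ _))
          (finSumFinEquiv.symm.trans (Equiv.sumComm _ _)) (act P g))
        = (Fam.amb finSumFinEquiv.symm finSumFinEquiv.symm (act P g)).comp
          (.perm (StrandPerm.brE b d)) := by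
      rw [Fam.perm_amb, Fam.amb_perm]
      refine Fam.amb_congr ?_ ?_ _ <;> rintro (z | z) <;> simp [StrandPerm.brE]
    rw [show act P (.comp (.tensor f g) (.braid b d))
      = (act P (.tensor f g)).comp (.perm (StrandPerm.brE b d)) from rfl, act_tensor_exch,
      Fam.comp_assoc, ← hg, ← Fam.comp_assoc, ← hf]
    rfl
  | braid_braid a b =>
    simp only [act, Fam.perm_comp]
    refine Fam.perm_congr fun i => ?_
    induction i using Fin.addCases <;> simp [StrandPerm.brE]
  | hexagon a b c =>
    simp only [act, Fam.amb_of_perm, Fam.perm_comp]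
    refine Fam.perm_congr fun i => Fin.ext ?_
    obtain ⟨z | z, rfl⟩ := finSumFinEquiv.surjective i
    · have h₁ : Fin.cast (Nat.add_assoc a b c).symm (Fin.castAdd (b + c) z)
          = Fin.castAdd c (Fin.castAdd b z) := rfl
      have h₂ : Fin.cast (Nat.add_assoc b a c) (Fin.castAdd c (Fin.natAdd b z))
          = Fin.natAdd b (Fin.castAdd c z) := rfl
      simp [StrandPerm.brE, h₁, h₂, Nat.add_assoc]
    · obtain ⟨z | z, rfl⟩ := finSumFinEquiv.surjective z
      · have h₁ : Fin.cast (Nat.add_assoc a b c).symm (Fin.natAdd a (Fin.castAdd c z))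
            = Fin.castAdd c (Fin.natAdd a z) := rfl
        have h₂ : Fin.cast (Nat.add_assoc b a c) (Fin.castAdd c (Fin.castAdd a z))
            = Fin.castAdd (a + c) z := rfl
        simp [StrandPerm.brE, h₁, h₂]
      · have h₁ : Fin.cast (Nat.add_assoc a b c).symm (Fin.natAdd a (Fin.natAdd b z))
            = Fin.natAdd (a + b) z := Fin.ext (Nat.add_assoc _ _ _).symm
        have h₂ : Fin.cast (Nat.add_assoc b a c) (Fin.natAdd (b + a) z)
            = Fin.natAdd b (Fin.natAdd a z) := Fin.ext (Nat.add_assoc _ _ _)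
        simp [StrandPerm.brE, h₁, h₂]
  | law h => exact hlaw h

end XCTerm

namespace Fam

variable {a b c d : ℕ}

/-- On graphs whose strands return to their starting points, `F` acts on values as `g`. -/
def Acts (F : Fam False (Fin a) (Fin b)) (g : XCHom a b) : Prop :=
  ∀ {S : Type} (x : Tg False (S ⊕ Fin a) (S ⊕ Fin a)) (y : Elts (S ⊕ Fin a)),
    x.val = SElts.ofElt y (.refl _) → (F.app x).val = SElts.ofElt (Elts.op g y) (.refl _)

theorem Acts.comp {F : Fam False (Fin a) (Fin b)} {G : Fam False (Fin b) (Fin c)} {f : XCHom a b}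
    {g : XCHom b c} (hF : F.Acts f) (hG : G.Acts g) : (F.comp G).Acts (f.comp g) := fun x y h =>
  (hG _ _ (hF x y h)).trans (by rw [Elts.op_comp])

theorem acts_perm (e : Fin a ≃ Fin b) : (perm e).Acts (XCHom.P e) := fun x y h => by
  refine (Tg.val_rl _ _ x).trans ?_
  rw [h, Elts.op_P, SElts.rl_ofElt]
  congr 1
  ext z
  simp

theorem Acts.amb {F : Fam False (Fin a) (Fin b)} {f : XCHom a b} (hF : F.Acts f) {k m n : ℕ}
    {g : XCHom m n} (p : Fin m ≃ Fin k ⊕ Fin a) (q : Fin n ≃ Fin k ⊕ Fin b)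
    (h : ∀ {S : Type} (y : Elts (S ⊕ Fin m)),
      (Elts.op g y).map (sumP S q) = Elts.op f (y.map (sumP S p))) : (amb p q F).Acts g := by
  intro S x y hx
  refine (Tg.val_rl _ _ _).trans ?_
  rw [hF _ (y.map (sumP S p)), ← h, SElts.rl_ofElt, Elts.map_symm_map]
  · congr 1
    ext z
    simp
  · rw [Tg.val_rl, hx, SElts.rl_ofElt]
    congr 1
    ext z
    simp

theorem acts_mul : (fuse XCTerm.mulE ((Equiv.swap 0 1).trans XCTerm.mulE)).Acts Elts.mulHom := by
  intro S x y hx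
  refine (Tg.val_gl _).trans ?_
  have h : (Equiv.refl (S ⊕ Fin 2)).trans (sumP S ((Equiv.swap 0 1).trans XCTerm.mulE))
      (.inr 1) = .inr () := rfl
  have e := Elts.mg_eq (Equiv.refl (S ⊕ Fin 1)) (s := .inr 0) rfl y
  rw [Elts.map_refl] at e
  rw [Tg.val_rl, hx, SElts.rl_ofElt, SElts.glue_unit, SElts.glue1_ofElt _ (a := .inr 0), ← e]
  · congr 1
    · refine congrArg _ (Elts.map_congr (fun z => ?_) _)
      rcases z with z | z
      · rfl
      · fin_cases z <;> rfl
    · ext z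
      rcases z with z | z
      · exact SElts.ctr_of_inl rfl
      · obtain rfl := Subsingleton.elim z 0
        exact SElts.ctr_of_inr rfl rfl
  · rfl

theorem acts_add (e : Fin 0 ≃ Empty) (G : Tg False (Fin b) (Fin b)) {g : XCHom 0 b}
    (h : G.val = SElts.ofElt (Elts.elt g) (.refl _)) : ((perm e).comp (add G)).Acts g := by
  intro S x y hx
  refine (Tg.val_un _ _).trans ?_
  obtain ⟨y, rfl⟩ : ∃ z, y = Elts.map (Equiv.sumEmpty S (Fin 0)).symm z :=
    ⟨_, (Elts.map_symm_map (Equiv.sumEmpty S (Fin 0)) y).symm⟩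
  rw [Elts.op_unit, h, Tg.val_rl]
  refine (congrArg (fun t => SElts.un (SElts.rl _ _ t) _) (Tg.val_rl _ _ x)).trans ?_
  rw [hx, SElts.rl_ofElt, SElts.rl_ofElt, SElts.un_ofElt, Elts.map_map, Elts.map_map]
  congr 1
  · refine congrArg (Elts.tensor · _) ?_
    exact (Elts.map_congr (fun _ => rfl) y).trans (Elts.map_refl y)
  · ext z
    rcases z with z | z <;> simp

end Fam

namespace XCTerm

theorem edges_fin_one (s : SignType) (g : XCHom 0 1) (h : Elts.ke s = Elts.pt g) :
    Elts.edges (fun _ : Fin 1 => s) = Elts.elt g := by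
  rw [← Elts.edges_map (Equiv.ofUnique Unit (Fin 1)) (ρ' := fun _ => s) (fun _ => rfl),
    Elts.edges_unit, h, Elts.pt, Elts.map_mk]
  exact congrArg (Elts.mk · g) (Equiv.ext fun _ => Subsingleton.elim _ _)

theorem val_strands_one (s : SignType) (g : XCHom 0 1) (h : Elts.ke s = Elts.pt g) :
    (Tg.mk False (XCGraph.strands 1 fun _ => s)).val = SElts.ofElt (Elts.elt g) (.refl _) := by
  rw [Tg.val_mk, XCGraph.value_strands, edges_fin_one s g h]
  rfl

theorem act_acts {a b : ℕ} (t : XCTerm a b) : (act False t).Acts (XCHom.mk t) := by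
  induction t with
  | cast h => 
    rw [XCHom.mk_cast, XCHom.cst_eq_P]
    exact Fam.acts_perm _
  | comp f g hf hg => exact Fam.Acts.comp hf hg
  | @tensor a b c d f g hf hg =>
    rw [← XCHom.tensor_mk, ← XCHom.wl_wr]
    refine Fam.Acts.comp (Fam.Acts.amb hg _ _ fun y => ?_) (Fam.Acts.amb hf _ _ fun y => ?_)
    · exact Elts.op_wl _ _ y
    · have e : ∀ {S : Type} (n : ℕ), sumP S (finSumFinEquiv.symm.trans
          (Equiv.sumComm (Fin n) (Fin d))) = (Elts.splitE S n d).trans (sumRC _ _ _) := fun n => by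
        refine Equiv.ext fun z => ?_
        rcases z with z | z
        · rfl
        · obtain ⟨z | z, rfl⟩ := finSumFinEquiv.surjective z <;> simp [sumP_inr, Elts.splitE]
      rw [e, e]
      exact Elts.op_wr _ _ y
  | braid a b =>
    rw [XCHom.mk_braid, XCHom.br_eq_P]
    exact Fam.acts_perm _
  | mul => exact Fam.acts_mul
  | unit => exact Fam.acts_add _ _ (val_strands_one 0 _ Elts.eta_eq_pt)
  | R =>
    refine Fam.acts_add _ _ ?_
    rw [Tg.val_mk, XCGraph.value_relabel, XCGraph.value_crossing, SElts.rl_ofElt, Elts.map_map,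
      Elts.cr, Elts.map_mk]
    congr 1
    · exact congrArg (Elts.mk · _) (Equiv.ext (by decide))
    · exact Equiv.ext (by decide)
  | Rinv =>
    refine Fam.acts_add _ _ ?_
    rw [Tg.val_mk, XCGraph.value_relabel, XCGraph.value_crossing, SElts.rl_ofElt, Elts.map_map,
      Elts.cr, Elts.map_mk]
    congr 1
    · exact congrArg (Elts.mk · _) (Equiv.ext (by decide))
    · exact Equiv.ext (by decide)
  | kappa => exact Fam.acts_add _ _ (val_strands_one (-1) _ rfl)
  | kappaInv => exact Fam.acts_add _ _ (val_strands_one 1 _ rfl)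

end XCTerm

namespace XCGraph

/-- Edges with rotation number zero and no vertices in between. -/
def triv (K : Type) [Finite K] : XCGraph K K where
  E := K
  B := Empty
  X := Empty
  finite_edges := inferInstance
  pos := Empty.elim
  rot _ := 0
  src := (Equiv.sumEmpty _ _).symm
  tgt := (Equiv.sumEmpty _ _).symm

end XCGraph

namespace Tg

variable {P : Prop} {O I K L : Type}

/-- Edges with rotation number zero and no vertices in between. -/
def triv (P : Prop) (K : Type) [Finite K] : Tg P K K := mk P (.triv K)

theorem mk_strands_one (n : ℕ) : mk P (.strands (n := n) 1 0) = triv P (Fin n) :=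
  sound_iso
    { e := Equiv.refl _
      b := Equiv.equivOfIsEmpty (Fin 0) Empty
      x := Equiv.equivOfIsEmpty (Fin 0) Empty
      pos_eq := fun y => y.elim0
      rot_eq := fun _ => rfl
      src_eq := fun _ => rfl
      tgt_eq := fun _ => rfl }

theorem triv_rl [Finite K] [Finite L] (e : K ≃ L) : rl e e (triv P K) = triv P L :=
  sound_iso
    { e := e
      b := Equiv.refl _
      x := Equiv.refl _
      pos_eq := fun y => y.elim
      rot_eq := fun _ => rfl
      src_eq := fun _ => rfl
      tgt_eq := fun _ => rfl }

theorem triv_sum [Finite K] [Finite L] : un (triv P K) (triv P L) = triv P (K ⊕ L) :=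
  sound_iso
    { e := Equiv.refl _
      b := Equiv.equivOfIsEmpty (Empty ⊕ Empty) Empty
      x := Equiv.equivOfIsEmpty (Empty ⊕ Empty) Empty
      pos_eq := by rintro (y | y) <;> exact y.elim
      rot_eq := by rintro (y | y) <;> rfl
      src_eq := by rintro (y | y) <;> rfl
      tgt_eq := by rintro (y | y) <;> rfl }

theorem triv_empty : triv P Empty = nil P :=
  sound_iso
    { e := Equiv.refl _
      b := Equiv.refl _
      x := Equiv.refl _
      pos_eq := fun y => y.elim
      rot_eq := fun y => y.elim
      src_eq := fun y => y.elim
      tgt_eq := fun y => y.elim }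

open Classical in
/-- Edges with rotation number zero are attached to starting points. -/
theorem gl_triv_start [Finite K] (x : Tg P (O ⊕ K) I) :
    gl K (rl (sumRC O K K) (Equiv.refl _) (un x (triv P K))) = x := by
  obtain ⟨D, rfl⟩ := x.exists_rep
  refine XCGraph.mk_eq_of_contraction
    (G := ((D.union (.triv K)).relabel (sumRC O K K) (Equiv.refl _)).glue) (N := K)
    (Sum.elim id fun k => D.src.symm (.inl (.inr k)))
    (Sum.elim (fun e => if ∃ k, D.src e = .inl (.inr k) then 1 else 0) fun _ => 0)
    (Equiv.sumCongr (Equiv.sumEmpty D.B Empty).symm (Equiv.refl _)) (Equiv.sumEmpty D.X Empty).symm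
    Sum.inl
    (fun _ => rfl) ?_ ?_ ?_ (fun _ => rfl) (fun _ => rfl) ?_
  · rintro (e | k)
    · have key : ∀ p : (O ⊕ K) ⊕ D.B ⊕ D.X × Bool, (∃ n, XCGraph.gluePorts _ _ _ _
          (Sum.map (sumRC O K K) id (XCGraph.unionPorts _ _ _ _ _ _ (.inl p)))
          = (.inr (.inl (.inr n)) : (O ⊕ K) ⊕ ((D.B ⊕ Empty) ⊕ K) ⊕ (D.X ⊕ Empty) × Bool)) ∨
          XCGraph.gluePorts _ _ _ _
          (Sum.map (sumRC O K K) id (XCGraph.unionPorts _ _ _ _ _ _ (.inl p)))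
          = XCGraph.oldPort (N := K)
            (Equiv.sumCongr (Equiv.sumEmpty D.B Empty).symm (Equiv.refl K))
            (Equiv.sumEmpty D.X Empty).symm p ∧
            (if ∃ k, p = .inl (.inr k) then 1 else 0) = 0 := by
        rintro ((o | k) | b | ⟨y, s⟩)
        · exact .inr ⟨rfl, if_neg (by simp)⟩
        · exact .inl ⟨k, rfl⟩
        · exact .inr ⟨rfl, if_neg (by simp)⟩
        · exact .inr ⟨rfl, if_neg (by simp)⟩
      exact key (D.src e)
    · right
      refine ⟨?_, rfl⟩
      show (.inl (.inr k) : (O ⊕ K) ⊕ ((D.B ⊕ Empty) ⊕ K) ⊕ (D.X ⊕ Empty) × Bool)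
        = XCGraph.oldPort _ _ (D.src (D.src.symm (.inl (.inr k))))
      rw [Equiv.apply_symm_apply]
      rfl
  · rintro (e | k)
    · right
      have key : ∀ p : I ⊕ D.B ⊕ D.X × Bool, XCGraph.gluePorts I K (D.B ⊕ Empty) _
          (Sum.map (Equiv.refl _) id (XCGraph.unionPorts _ _ _ _ _ _ (.inl p)))
          = XCGraph.oldPort (N := K)
            (Equiv.sumCongr (Equiv.sumEmpty D.B Empty).symm (Equiv.refl K))
            (Equiv.sumEmpty D.X Empty).symm p := by
        rintro (o | b | ⟨y, s⟩) <;> rfl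
      exact key (D.tgt e)
    · exact .inl ⟨k, rfl⟩
  · have h1 : ∀ (p : I ⊕ D.B ⊕ D.X × Bool) n, XCGraph.gluePorts _ _ _ _
          (Sum.map (Equiv.refl _) id (XCGraph.unionPorts _ _ _ _ _ _ (.inl p)))
          ≠ (.inr (.inl (.inr n)) : I ⊕ ((D.B ⊕ Empty) ⊕ K) ⊕ (D.X ⊕ Empty) × Bool) := by
      rintro (o | b | ⟨y, s⟩) n h <;> simp [XCGraph.gluePorts, XCGraph.unionPorts] at h
    have h2 : ∀ (p : (O ⊕ K) ⊕ D.B ⊕ D.X × Bool) n, XCGraph.gluePorts _ _ _ _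
          (Sum.map (sumRC O K K) id (XCGraph.unionPorts _ _ _ _ _ _ (.inl p)))
          = (.inr (.inl (.inr n)) : (O ⊕ K) ⊕ ((D.B ⊕ Empty) ⊕ K) ⊕ (D.X ⊕ Empty) × Bool) →
          p = .inl (.inr n) := by
      rintro ((o | k) | b | ⟨y, s⟩) n h <;>
        simp_all [XCGraph.gluePorts, XCGraph.unionPorts]
    rintro (e | k) (e' | k') n h h'
    · exact absurd h (h1 (D.tgt e) n)
    · exact absurd h (h1 (D.tgt e) n)
    · have h : (.inr (.inl (.inr k)) : I ⊕ ((D.B ⊕ Empty) ⊕ K) ⊕ (D.X ⊕ Empty) × Bool)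
        = .inr (.inl (.inr n)) := h
      obtain rfl : k = n := Sum.inr_injective (Sum.inl_injective (Sum.inr_injective h))
      have h' := h2 (D.src e') k h'
      refine ⟨?_, ?_⟩
      · show e' = D.src.symm _
        rw [← h', Equiv.symm_apply_apply]
      · show (if ∃ k, D.src e' = .inl (.inr k) then 1 else 0) = 0 + 1
        rw [if_pos ⟨k, h'⟩]
    · have h' : (.inl (.inr k') : (O ⊕ K) ⊕ ((D.B ⊕ Empty) ⊕ K) ⊕ (D.X ⊕ Empty) × Bool)
        = .inr (.inl (.inr n)) := h'
      simp at h'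
  · rintro (e | k) h
    · exact absurd rfl h
    · rfl

open Classical in
/-- Edges with rotation number zero are attached to end points. -/
theorem gl_triv_end [Finite K] (x : Tg P O (I ⊕ K)) :
    gl K (rl (Equiv.refl _) (sumRC I K K) (un x (triv P K))) = x := by
  obtain ⟨D, rfl⟩ := x.exists_rep
  refine XCGraph.mk_eq_of_contraction
    (G := ((D.union (.triv K)).relabel (Equiv.refl _) (sumRC I K K)).glue) (N := K)
    (Sum.elim id fun k => D.tgt.symm (.inl (.inr k)))
    (Sum.elim (fun _ => 0) fun _ => 1)
    (Equiv.sumCongr (Equiv.sumEmpty D.B Empty).symm (Equiv.refl _)) (Equiv.sumEmpty D.X Empty).symm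
    Sum.inl
    (fun _ => rfl) ?_ ?_ ?_ (fun _ => rfl) (fun _ => rfl) ?_
  · rintro (e | k)
    · right
      have key : ∀ p : O ⊕ D.B ⊕ D.X × Bool, XCGraph.gluePorts O K (D.B ⊕ Empty) _
          (Sum.map (Equiv.refl _) id (XCGraph.unionPorts _ _ _ _ _ _ (.inl p)))
          = XCGraph.oldPort (N := K)
            (Equiv.sumCongr (Equiv.sumEmpty D.B Empty).symm (Equiv.refl K))
            (Equiv.sumEmpty D.X Empty).symm p := by
        rintro (o | b | ⟨y, s⟩) <;> rfl
      exact ⟨key (D.src e), rfl⟩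
    · exact .inl ⟨k, rfl⟩
  · rintro (e | k)
    · have key : ∀ p : (I ⊕ K) ⊕ D.B ⊕ D.X × Bool, (∃ n, XCGraph.gluePorts _ _ _ _
          (Sum.map (sumRC I K K) id (XCGraph.unionPorts _ _ _ _ _ _ (.inl p)))
          = (.inr (.inl (.inr n)) : (I ⊕ K) ⊕ ((D.B ⊕ Empty) ⊕ K) ⊕ (D.X ⊕ Empty) × Bool)) ∨
          XCGraph.gluePorts _ _ _ _
          (Sum.map (sumRC I K K) id (XCGraph.unionPorts _ _ _ _ _ _ (.inl p)))
          = XCGraph.oldPort (N := K)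
            (Equiv.sumCongr (Equiv.sumEmpty D.B Empty).symm (Equiv.refl K))
            (Equiv.sumEmpty D.X Empty).symm p := by
        rintro ((o | k) | b | ⟨y, s⟩)
        · exact .inr rfl
        · exact .inl ⟨k, rfl⟩
        · exact .inr rfl
        · exact .inr rfl
      exact key (D.tgt e)
    · right
      show (.inl (.inr k) : (I ⊕ K) ⊕ ((D.B ⊕ Empty) ⊕ K) ⊕ (D.X ⊕ Empty) × Bool)
        = XCGraph.oldPort _ _ (D.tgt (D.tgt.symm (.inl (.inr k))))
      rw [Equiv.apply_symm_apply]
      rfl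
  · have h1 : ∀ (p : O ⊕ D.B ⊕ D.X × Bool) n, XCGraph.gluePorts _ _ _ _
          (Sum.map (Equiv.refl _) id (XCGraph.unionPorts _ _ _ _ _ _ (.inl p)))
          ≠ (.inr (.inl (.inr n)) : O ⊕ ((D.B ⊕ Empty) ⊕ K) ⊕ (D.X ⊕ Empty) × Bool) := by
      rintro (o | b | ⟨y, s⟩) n h <;> simp [XCGraph.gluePorts, XCGraph.unionPorts] at h
    have h2 : ∀ (p : (I ⊕ K) ⊕ D.B ⊕ D.X × Bool) n, XCGraph.gluePorts _ _ _ _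
          (Sum.map (sumRC I K K) id (XCGraph.unionPorts _ _ _ _ _ _ (.inl p)))
          = (.inr (.inl (.inr n)) : (I ⊕ K) ⊕ ((D.B ⊕ Empty) ⊕ K) ⊕ (D.X ⊕ Empty) × Bool) →
          p = .inl (.inr n) := by
      rintro ((o | k) | b | ⟨y, s⟩) n h <;>
        simp_all [XCGraph.gluePorts, XCGraph.unionPorts]
    rintro (e | k) (e' | k') n h h'
    · exact absurd h' (h1 (D.src e') n)
    · have h' : (.inr (.inl (.inr k')) : O ⊕ ((D.B ⊕ Empty) ⊕ K) ⊕ (D.X ⊕ Empty) × Bool)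
        = .inr (.inl (.inr n)) := h'
      obtain rfl : k' = n :=
        Sum.inr_injective (Sum.inl_injective (Sum.inr_injective h'))
      have h := h2 (D.tgt e) k' h
      refine ⟨?_, rfl⟩
      show D.tgt.symm _ = e
      rw [← h, Equiv.symm_apply_apply]
    · have h : (.inl (.inr k) : (I ⊕ K) ⊕ ((D.B ⊕ Empty) ⊕ K) ⊕ (D.X ⊕ Empty) × Bool)
        = .inr (.inl (.inr n)) := h
      simp at h
    · have h : (.inl (.inr k) : (I ⊕ K) ⊕ ((D.B ⊕ Empty) ⊕ K) ⊕ (D.X ⊕ Empty) × Bool)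
        = .inr (.inl (.inr n)) := h
      simp at h
  · rintro (e | k) h
    · exact absurd rfl h
    · rfl

end Tg

namespace Fam

variable {P : Prop} {A B C D K L U V X Y Z W : Type}

theorem fuse_ext (k : K ≃ L) {p q : A ≃ B ⊕ K} {p' q' : A ≃ B ⊕ L}
    (h : ∀ a, p' a = Sum.map id k (p a)) (h' : ∀ a, q' a = Sum.map id k (q a)) :
    (fuse p q : Fam P A B) = fuse p' q' := by
  rw [← fuse_reindex k]
  exact fuse_congr (fun a => (h a).symm) fun a => (h' a).symm

/-- The graph obtained from the empty one. -/
def dia (f : Fam P (Fin 0) B) : Tg P B B :=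
  Tg.rl (Equiv.emptySum _ _) (Equiv.emptySum _ _)
    (f.app (Tg.rl (Equiv.sumEmpty _ _).symm (Equiv.sumEmpty _ _).symm (Tg.nil P)))

theorem app_eq_un (f : Fam P (Fin 0) B) {O I : Type} (x : Tg P O I) :
    f.app (Tg.rl (Equiv.sumEmpty _ _).symm (Equiv.sumEmpty _ _).symm x) = Tg.un x f.dia := by
  have h := f.app_un (Tg.rl (Equiv.sumEmpty _ _).symm (Equiv.sumEmpty _ _).symm (Tg.nil P)) x
  have e : Tg.rl (sumRC _ _ _) (sumRC _ _ _)
      (Tg.un (Tg.rl (Equiv.sumEmpty Empty (Fin 0)).symm (Equiv.sumEmpty Empty (Fin 0)).symm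
        (Tg.nil P)) x)
      = Tg.rl (Equiv.sumCongr (Equiv.emptySum _ _).symm (.refl _))
        (Equiv.sumCongr (Equiv.emptySum _ _).symm (.refl _))
        (Tg.rl (Equiv.sumEmpty _ _).symm (Equiv.sumEmpty _ _).symm x) := by
    conv_rhs => rw [← Tg.un_nil x]
    rw [← Tg.un_comm, Tg.un_rl_right, Tg.rl_rl, Tg.rl_rl, Tg.rl_rl, Tg.rl_rl]
    refine Tg.rl_congr ?_ ?_ _ <;> rintro (z | ⟨⟨⟩⟩) <;> rfl
  rw [e, f.app_rl] at h
  refine Tg.rl_injective (Equiv.sumCongr (Equiv.emptySum Empty O).symm (.refl B))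
    (Equiv.sumCongr (Equiv.emptySum Empty I).symm (.refl B)) (h.symm.trans ?_)
  rw [dia, ← Tg.un_comm, Tg.un_rl_right, Tg.rl_rl, Tg.rl_rl]
  refine Tg.rl_congr ?_ ?_ _ <;> rintro (z | ⟨⟨⟩⟩ | z) <;> rfl

theorem eq_of_dia_eq {f g : Fam P (Fin 0) B} (h : f.dia = g.dia) : f = g := by
  ext O I x
  obtain ⟨x, rfl⟩ : ∃ y, x = Tg.rl (Equiv.sumEmpty _ _).symm (Equiv.sumEmpty _ _).symm y :=
    ⟨Tg.rl (Equiv.sumEmpty _ _) (Equiv.sumEmpty _ _) x, by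
      rw [Tg.rl_rl, Tg.rl_id] <;> rintro (z | z) <;> simp⟩
  rw [app_eq_un, app_eq_un, h]

theorem nil_un (G : Tg P A B) : Tg.rl (Equiv.emptySum _ _) (Equiv.emptySum _ _)
    (Tg.un (Tg.nil P) G) = G := by
  conv_rhs => rw [← Tg.un_nil G]
  rw [← Tg.un_comm, Tg.rl_rl]
  exact Tg.rl_congr (by rintro (z | ⟨⟨⟩⟩); rfl) (by rintro (z | ⟨⟨⟩⟩); rfl) _

theorem dia_add (e : Fin 0 ≃ Empty) (G : Tg P B B) : ((perm e).comp (add G)).dia = G := by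
  show Tg.rl _ _ (Tg.un (Tg.rl _ _ (Tg.rl _ _ (Tg.rl _ _ (Tg.nil P)))) G) = _
  rw [Tg.rl_rl, Tg.rl_rl, Tg.rl_id, nil_un] <;> rintro ⟨⟩

theorem dia_comp_fuse (f : Fam P (Fin 0) A) (p q : A ≃ B ⊕ K) :
    (f.comp (fuse p q)).dia = Tg.gl K (Tg.rl p q f.dia) := by
  refine (Tg.gl_rl _ _ _).trans (congrArg _ ?_)
  rw [dia, Tg.rl_rl, Tg.rl_rl]
  refine Tg.rl_congr (sumP_ext p ?_ ?_ ?_) (sumP_ext q ?_ ?_ ?_) _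
  on_goal 1 => rintro ⟨⟩
  on_goal 3 => rintro ⟨⟩
  all_goals intro z; simp

theorem dia_comp_perm (f : Fam P (Fin 0) A) (e : A ≃ B) :
    (f.comp (perm e)).dia = Tg.rl e e f.dia := by
  refine (Tg.rl_rl _ _ _ _ _).trans (Eq.trans (Tg.rl_congr ?_ ?_ _) (Tg.rl_rl _ _ _ _ _).symm) <;>
  rintro (⟨⟨⟩⟩ | z) <;> rfl

theorem dia_amb (f : Fam P (Fin 0) A) (g : Fam P (Fin 0) B) {r : B ≃ B ⊕ Fin 0}
    (hr : ∀ b, r b = .inl b) (q : Y ≃ B ⊕ A) :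
    (g.comp (amb r q f)).dia = Tg.rl q.symm q.symm (Tg.un g.dia f.dia) := by
  have h : ∀ x : Tg P (Empty ⊕ B) (Empty ⊕ B), Tg.rl (sumP _ r) (sumP _ r) x
      = Tg.rl (Equiv.sumEmpty _ _).symm (Equiv.sumEmpty _ _).symm x := fun x => by
    refine Tg.rl_congr ?_ ?_ x <;>
    · rintro (⟨⟨⟩⟩ | z)
      rw [sumP_inr, hr]
      rfl
  show Tg.rl _ _ (Tg.rl _ _ (f.app (Tg.rl _ _ (g.app _)))) = _
  rw [h, app_eq_un, Tg.rl_rl, show g.dia = Tg.rl (Equiv.emptySum _ _) (Equiv.emptySum _ _) (g.app _)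
    from rfl, Tg.rl_un, Tg.rl_rl]
  refine Tg.rl_congr ?_ ?_ _ <;> rintro ((⟨⟨⟩⟩ | z) | z) <;> rfl

theorem perm_comp_dia (e : Fin 0 ≃ Fin 0) (f : Fam P (Fin 0) A) : ((perm e).comp f).dia = f.dia := by
  rw [show e = Equiv.refl _ from Equiv.ext fun z => z.elim0, perm_refl_comp]

end Fam

namespace XCTerm

variable {P : Prop}

/-- The graph given by an expression for an element. -/
noncomputable def dia (P : Prop) {a : ℕ} (t : XCTerm 0 a) : Tg P (Fin a) (Fin a) := (act P t).dia

theorem dia_tensor {a b : ℕ} (s : XCTerm 0 a) (t : XCTerm 0 b) :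
    dia P (.tensor s t : XCTerm 0 (a + b))
      = Tg.rl finSumFinEquiv finSumFinEquiv (Tg.un (dia P s) (dia P t)) := by
  have h : act P (.tensor s t) = ((Fam.perm (Equiv.refl (Fin 0))).comp (act P s)).comp
      (Fam.amb (Equiv.sumEmpty (Fin a) (Fin 0)).symm finSumFinEquiv.symm (act P t)) := by
    rw [act_tensor_exch, Fam.amb_of_isEmpty, Fam.comp_assoc, Fam.perm_amb]
    refine congrArg₂ Fam.comp (congrArg₂ Fam.comp (Fam.perm_congr fun z => z.elim0) rfl) ?_
    refine Fam.amb_congr ?_ ?_ _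
    · rintro (z | z)
      · simp
      · exact z.elim0
    · rintro (z | z) <;> rfl
  rw [dia, h, Fam.dia_amb _ _ (fun _ => rfl), Fam.perm_comp_dia]
  rfl

theorem act_tensor_perm {a b c d : ℕ} {s : XCTerm a b} {t : XCTerm c d} {σ : Fin a ≃ Fin b}
    {τ : Fin c ≃ Fin d} (hs : act P s = .perm σ) (ht : act P t = .perm τ) :
    act P (.tensor s t) = .perm (StrandPerm.sumE σ τ) := by
  simp only [act, hs, ht, Fam.amb_of_perm, Fam.perm_comp]
  refine Fam.perm_congr fun i => ?_
  induction i using Fin.addCases <;> simp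

/-- In a componentwise product, the first half of the strands are glued to the ends of the second
half. -/
def dotE (k : ℕ) : Fin (k + k) ≃ Fin k ⊕ Fin k := finSumFinEquiv.symm.trans (Equiv.sumComm _ _)

theorem act_mulN (k : ℕ) : act P (mulN k) = .fuse (dotE k) finSumFinEquiv.symm := by
  induction k with
  | zero =>
    refine (act_id 0).trans ((Fam.perm_eq_fuse _).trans
      (Fam.fuse_ext (Equiv.equivOfIsEmpty _ _) ?_ ?_)) <;> exact fun z => z.elim0
  | succ k ih =>
    have h : act P (.tensor (mulN k) mul) = Fam.comp (Fam.amb finSumFinEquiv.symm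
      finSumFinEquiv.symm (act P mul)) (Fam.amb (finSumFinEquiv.symm.trans (Equiv.sumComm _ _))
        (finSumFinEquiv.symm.trans (Equiv.sumComm _ _)) (act P (mulN k))) := rfl
    have e : act P (.tensor (.tensor (id k) (.braid 1 k)) (id 1)) = .perm (StrandPerm.sumE
        (StrandPerm.sumE (Equiv.refl _) (StrandPerm.brE 1 k)) (Equiv.refl _)) :=
      act_tensor_perm (act_tensor_perm (act_id _) rfl) (act_id _)
    have h₁ : k + 1 + (k + 1) = k + (1 + k) + 1 := by omega
    have h₂ : k + (k + 1) + 1 = (k + k) + 2 := by omega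
    have e' : act P (mulN (k + 1)) = (Fam.perm (finCongr h₁)).comp ((Fam.perm
      (StrandPerm.sumE (StrandPerm.sumE (Equiv.refl _) (StrandPerm.brE 1 k)) (Equiv.refl _))).comp
        ((Fam.perm (finCongr h₂)).comp (act P (.tensor (mulN k) mul)))) := by
      rw [← e]
      rfl
    have v : ∀ i, (((finCongr h₁).trans ((StrandPerm.sumE (StrandPerm.sumE (Equiv.refl (Fin k))
        (StrandPerm.brE 1 k)) (Equiv.refl (Fin 1))).trans (finCongr h₂))) i : ℕ)
          = if (i : ℕ) = k then 2 * k else if k < i ∧ (i : ℕ) < 2 * k + 1 then i - 1 else i := by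
      intro i
      obtain ⟨i, rfl⟩ := (finCongr h₁).symm.surjective i
      rw [Equiv.trans_apply, Equiv.apply_symm_apply, Equiv.trans_apply]
      induction i using Fin.addCases with
      | left i =>
        induction i using Fin.addCases with
        | left i =>
          simp
          split_ifs <;> omega
        | right i =>
          have hi := i.2
          simp only [StrandPerm.sumE_castAdd, StrandPerm.sumE_natAdd, finCongr_apply, Fin.val_cast,
            Fin.val_castAdd, Fin.val_natAdd, StrandPerm.brE_val, finCongr_symm]
          split_ifs <;> omega
      | right i =>
        simp
        split_ifs <;> omega
    rw [e', h, ih, show act P mul = .fuse mulE ((Equiv.swap 0 1).trans mulE) from rfl,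
      Fam.amb_fuse, Fam.amb_fuse, Fam.fuse_comp_fuse, Fam.perm_comp_fuse, Fam.perm_comp_fuse,
      Fam.perm_comp_fuse]
    simp only [← Equiv.trans_assoc]
    simp only [Equiv.trans_assoc _ _ (finCongr h₂)]
    set E := (finCongr h₁).trans ((StrandPerm.sumE (StrandPerm.sumE (Equiv.refl (Fin k))
        (StrandPerm.brE 1 k)) (Equiv.refl (Fin 1))).trans (finCongr h₂))
    have E₁ : ∀ i : Fin k, E (Fin.castAdd (k + 1) (Fin.castAdd 1 i))
        = Fin.castAdd 2 (Fin.castAdd k i) := fun i => Fin.ext (by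
      rw [v]
      simp
      split_ifs <;> omega)
    have E₂ : E (Fin.castAdd (k + 1) (Fin.natAdd k 0)) = Fin.natAdd (k + k) 0 := Fin.ext (by
      rw [v]
      simp
      omega)
    have E₃ : ∀ i : Fin k, E (Fin.natAdd (k + 1) (Fin.castAdd 1 i))
        = Fin.castAdd 2 (Fin.natAdd k i) := fun i => Fin.ext (by
      rw [v]
      simp
      split_ifs <;> omega)
    have E₄ : E (Fin.natAdd (k + 1) (Fin.natAdd k 0)) = Fin.natAdd (k + k) 1 := Fin.ext (by
      rw [v]
      simp
      split_ifs <;> omega)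
    clear_value E
    refine Fam.fuse_ext (K := Fin k ⊕ Unit) ((Equiv.sumCongr (.refl (Fin k))
      (Equiv.ofUnique Unit (Fin 1))).trans finSumFinEquiv) ?_ ?_
    all_goals
      intro z
      obtain ⟨z | z, rfl⟩ := finSumFinEquiv.surjective z <;>
      obtain ⟨z | z, rfl⟩ := finSumFinEquiv.surjective z
    all_goals try obtain rfl : z = 0 := Subsingleton.elim _ _
    all_goals simp [-Fin.natAdd_eq_addNat, E₁, E₂, E₃, E₄, dotE, mulE]

end XCTerm

namespace Fam

variable {P : Prop} {A B C D K L U V X Y Z W : Type}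

/-- Adding edges with rotation number zero. -/
def pad [Finite U] (q : B ≃ A ⊕ U) : Fam P A B :=
  amb (Equiv.sumEmpty A Empty).symm q (add (Tg.triv P U))

theorem pad_app [Finite U] (q : B ≃ A ⊕ U) {O I : Type} (x : Tg P (O ⊕ A) (I ⊕ A)) :
    (pad q).app x = Tg.rl (sumP _ q).symm (sumP _ q).symm (Tg.un x (Tg.triv P U)) := by
  refine congrArg (fun t => Tg.rl _ _ (Tg.un t (Tg.triv P U))) ?_
  refine (Tg.rl_rl _ _ _ _ _).trans (Tg.rl_id ?_ ?_ x) <;> rintro (z | z) <;> rfl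

theorem pad_reindex [Finite U] [Finite V] (e : U ≃ V) (q : B ≃ A ⊕ U) :
    (pad (q.trans (Equiv.sumCongr (.refl A) e)) : Fam P A B) = pad q := by
  ext O I x
  rw [pad_app, pad_app, ← Tg.triv_rl e, Tg.un_rl_right, Tg.rl_rl]
  refine Tg.rl_congr ?_ ?_ _ <;> rintro ((z | z) | z) <;> simp

/-- `f` adds edges with rotation number zero; `j` says where the old strands go. -/
def IsPad (f : Fam P A B) (j : A → B) : Prop :=
  ∃ (U : Type) (_ : Finite U) (q : B ≃ A ⊕ U), f = pad q ∧ ∀ a, q.symm (.inl a) = j a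

theorem IsPad.eq_pad {f : Fam P A B} {j : A → B} (h : IsPad f j) [Finite V] (q : B ≃ A ⊕ V)
    (hq : ∀ a, q.symm (.inl a) = j a) : f = pad q := by
  obtain ⟨U, _, p, rfl, hp⟩ := h
  have h1 : ∀ a, q (p.symm (.inl a)) = .inl a := fun a => by
    rw [hp, ← hq, Equiv.apply_symm_apply]
  have h2 : ∀ u, ∃ v, q (p.symm (.inr u)) = .inr v := fun u => by
    rcases h : q (p.symm (.inr u)) with a | v
    · rw [← h1] at h
      simpa using p.symm.injective (q.injective h)
    · exact ⟨v, rfl⟩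
  choose k hk using h2
  have bij : Function.Bijective k := by
    constructor
    · intro u u' h
      have := (hk u).trans ((congrArg Sum.inr h).trans (hk u').symm)
      simpa using p.symm.injective (q.injective this)
    · intro v
      obtain ⟨z | u, hz⟩ := (p.symm.trans q).surjective (.inr v)
      · exact absurd ((h1 z).symm.trans hz) (by simp)
      · exact ⟨u, Sum.inr_injective ((hk u).symm.trans hz)⟩
  rw [← pad_reindex (Equiv.ofBijective k bij)]
  refine congrArg pad (Equiv.ext fun z => ?_)
  obtain ⟨a | u, rfl⟩ := p.symm.surjective z
  · simp [h1]
  · simp [hk]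

theorem IsPad.of_perm (e : A ≃ B) : IsPad (perm e : Fam P A B) e := by
  refine ⟨Empty, inferInstance, e.symm.trans (Equiv.sumEmpty _ _).symm, ?_, fun a => rfl⟩
  ext O I x
  rw [pad_app, Tg.triv_empty]
  conv_lhs => rw [← Tg.un_nil x]
  refine (Tg.rl_rl _ _ _ _ _).trans (Tg.rl_congr ?_ ?_ _) <;> rintro ((z | z) | ⟨⟨⟩⟩) <;> rfl

theorem IsPad.comp {f : Fam P A B} {g : Fam P B C} {j : A → B} {j' : B → C} (hf : IsPad f j)
    (hg : IsPad g j') : IsPad (f.comp g) (j' ∘ j) := by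
  obtain ⟨U, _, p, rfl, hp⟩ := hf
  obtain ⟨V, _, q, rfl, hq⟩ := hg
  refine ⟨U ⊕ V, inferInstance, (q.trans (Equiv.sumCongr p (.refl V))).trans
    (Equiv.sumAssoc _ _ _), ?_, fun a => ?_⟩
  · ext O I x
    show (pad q).app ((pad p).app x) = _
    rw [pad_app, pad_app, pad_app, ← Tg.triv_sum, ← Tg.un_assoc, Tg.rl_un, Tg.rl_rl, Tg.rl_rl]
    refine Tg.rl_congr ?_ ?_ _ <;> rintro (((z | z) | z) | z) <;> simp
  · simp [hp, hq]

theorem IsPad.amb {f : Fam P A B} {j : A → B} (hf : IsPad f j) (p : X ≃ K ⊕ A) (q : Y ≃ K ⊕ B) :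
    IsPad (amb p q f) fun x => q.symm (Sum.map id j (p x)) := by
  obtain ⟨U, _, r, rfl, hr⟩ := hf
  refine ⟨U, inferInstance, ((q.trans (Equiv.sumCongr (.refl K) r)).trans
    (Equiv.sumAssoc _ _ _).symm).trans (Equiv.sumCongr p.symm (.refl U)), ?_, fun x => ?_⟩
  · ext O I x
    refine (congrArg (Tg.rl _ _) (pad_app _ _)).trans ?_
    rw [pad_app, Tg.rl_un, Tg.rl_rl, Tg.rl_rl]
    refine Tg.rl_congr (sumP_ext' p ?_ ?_ ?_ ?_) (sumP_ext' p ?_ ?_ ?_ ?_) _ <;> intro z <;> simp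
  · obtain ⟨k | a, rfl⟩ := p.symm.surjective x <;> simp [hr]

theorem IsPad.of_add (e : Fin 0 ≃ Empty) (j : Fin 0 → B) [Finite B] :
    IsPad ((perm e).comp (add (Tg.triv P B))) j := by
  refine ⟨B, inferInstance, (Equiv.emptySum (Fin 0) B).symm, ?_, fun a => a.elim0⟩
  ext O I x
  rw [pad_app]
  show Tg.un (Tg.rl _ _ (Tg.rl _ _ x)) _ = _
  rw [Tg.rl_un, Tg.rl_un, Tg.rl_rl]
  refine Tg.rl_congr ?_ ?_ _ <;> rintro ((z | z) | z)
  exacts [rfl, z.elim0, rfl, rfl, z.elim0, rfl]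

theorem IsPad.congr {f f' : Fam P A B} {j j' : A → B} (h : IsPad f j) (hf : f' = f)
    (hj : ∀ a, j a = j' a) : IsPad f' j' := by
  obtain rfl := funext hj
  exact hf ▸ h

theorem dia_comp_pad (f : Fam P (Fin 0) A) [Finite U] (q : B ≃ A ⊕ U) :
    (f.comp (pad q)).dia = Tg.rl q.symm q.symm (Tg.un f.dia (Tg.triv P U)) := by
  refine (congrArg (Tg.rl _ _) (pad_app _ _)).trans ?_
  rw [dia, Tg.rl_un, Tg.rl_rl, Tg.rl_rl]
  refine Tg.rl_congr ?_ ?_ _ <;> rintro ((⟨⟨⟩⟩ | z) | z) <;> rfl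

end Fam

namespace XCTerm

variable {P : Prop}

/-- The map between strands induced by a padding of tensor products. -/
def padSum {a b c d : ℕ} (j : Fin a → Fin b) (j' : Fin c → Fin d) (i : Fin (a + c)) : Fin (b + d) :=
  finSumFinEquiv (Sum.map j j' (finSumFinEquiv.symm i))

theorem isPad_tensor {a b c d : ℕ} {s : XCTerm a b} {t : XCTerm c d} {j : Fin a → Fin b}
    {j' : Fin c → Fin d} (hs : (act P s).IsPad j) (ht : (act P t).IsPad j') :
    (act P (.tensor s t)).IsPad (padSum j j') := by
  have := Fam.IsPad.comp (Fam.IsPad.amb ht finSumFinEquiv.symm finSumFinEquiv.symm)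
    (Fam.IsPad.amb hs (finSumFinEquiv.symm.trans (Equiv.sumComm _ _))
      (finSumFinEquiv.symm.trans (Equiv.sumComm _ _)))
  refine this.congr rfl fun i => ?_
  obtain ⟨i | i, rfl⟩ := finSumFinEquiv.surjective i <;> simp [padSum]

theorem isPad_comp {a b c : ℕ} {s : XCTerm a b} {t : XCTerm b c} {j : Fin a → Fin b}
    {j' : Fin b → Fin c} (hs : (act P s).IsPad j) (ht : (act P t).IsPad j') :
    (act P (.comp s t)).IsPad (j' ∘ j) := Fam.IsPad.comp hs ht

theorem isPad_cast {a b : ℕ} (h : a = b) : (act P (.cast h)).IsPad (Fin.cast h) :=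
  Fam.IsPad.of_perm _

theorem isPad_unit : (act P .unit).IsPad Fin.elim0 := by
  have := Fam.IsPad.of_add (P := P) (B := Fin 1) (Equiv.equivOfIsEmpty _ _) Fin.elim0
  rw [← Tg.mk_strands_one] at this
  exact this

theorem isPad_unitN (n : ℕ) : (act P (unitN n)).IsPad Fin.elim0 := by
  induction n with
  | zero => 
    exact (isPad_cast (P := P) (rfl : 0 = 0)).congr rfl fun z => z.elim0
  | succ n ih =>
    exact (isPad_tensor ih isPad_unit).congr rfl fun z => z.elim0

theorem isPad_leg (a c : ℕ) : (act P (leg a c)).IsPad (padSum (padSum (Fin.elim0 : Fin 0 → Fin a)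
    (_root_.id : Fin 1 → Fin 1)) (Fin.elim0 : Fin 0 → Fin c)) := by
  exact (isPad_comp (isPad_cast (by omega : 1 = 0 + 1 + 0)) (isPad_tensor (isPad_tensor
    (isPad_unitN a) (isPad_cast (rfl : 1 = 1))) (isPad_unitN c))).congr rfl fun i => rfl

theorem isPad_legs (a b c : ℕ) : (act P (legs a b c)).IsPad
    (padSum (padSum (padSum (padSum (Fin.elim0 : Fin 0 → Fin a) (_root_.id : Fin 1 → Fin 1))
      (Fin.elim0 : Fin 0 → Fin b)) (_root_.id : Fin 1 → Fin 1)) (Fin.elim0 : Fin 0 → Fin c)) := by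
  exact (isPad_comp (isPad_cast (by omega : 2 = 0 + 1 + 0 + 1 + 0)) (isPad_tensor (isPad_tensor
    (isPad_tensor (isPad_tensor (isPad_unitN a) (isPad_cast (rfl : 1 = 1))) (isPad_unitN b))
      (isPad_cast (rfl : 1 = 1))) (isPad_unitN c))).congr rfl fun i => rfl

theorem dia_leg (t : XCTerm 0 1) (a c : ℕ) {U : Type} [Finite U] (q : Fin (a + 1 + c) ≃ Fin 1 ⊕ U)
    (hq : ∀ i, q.symm (.inl i) = padSum (padSum (Fin.elim0 : Fin 0 → Fin a)
      (_root_.id : Fin 1 → Fin 1)) (Fin.elim0 : Fin 0 → Fin c) i) :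
    dia P (.comp t (leg a c)) = Tg.rl q.symm q.symm (Tg.un (dia P t) (Tg.triv P U)) := by
  rw [dia, dia, ← Fam.dia_comp_pad, ← (isPad_leg a c).eq_pad q hq]
  rfl

theorem dia_legs (t : XCTerm 0 2) (a b c : ℕ) {U : Type} [Finite U]
    (q : Fin (a + 1 + b + 1 + c) ≃ Fin 2 ⊕ U)
    (hq : ∀ i, q.symm (.inl i) = padSum (padSum (padSum (padSum (Fin.elim0 : Fin 0 → Fin a)
      (_root_.id : Fin 1 → Fin 1)) (Fin.elim0 : Fin 0 → Fin b)) (_root_.id : Fin 1 → Fin 1))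
        (Fin.elim0 : Fin 0 → Fin c) i) :
    dia P (.comp t (legs a b c)) = Tg.rl q.symm q.symm (Tg.un (dia P t) (Tg.triv P U)) := by
  rw [dia, dia, ← Fam.dia_comp_pad, ← (isPad_legs a b c).eq_pad q hq]
  rfl

theorem dia_unit : dia P .unit = Tg.triv P (Fin 1) :=
  (Fam.dia_add _ _).trans (Tg.mk_strands_one 1)

theorem dia_unitN (n : ℕ) : dia P (unitN n) = Tg.triv P (Fin n) := by
  induction n with
  | zero =>
    show Tg.rl (Equiv.emptySum _ _) (Equiv.emptySum _ _)
      (Tg.rl (.sumCongr (.refl _) (finCongr rfl)) (.sumCongr (.refl _) (finCongr rfl))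
        (Tg.rl (Equiv.sumEmpty Empty (Fin 0)).symm (Equiv.sumEmpty Empty (Fin 0)).symm (Tg.nil P)))
      = _
    rw [Tg.rl_rl, Tg.rl_rl, ← Tg.triv_empty, ← Tg.triv_rl (Equiv.equivOfIsEmpty Empty (Fin 0))]
    refine Tg.rl_congr ?_ ?_ _ <;> rintro ⟨⟩
  | succ n ih =>
    refine (dia_tensor (unitN n) unit).trans ?_
    rw [ih, dia_unit, Tg.triv_sum, Tg.triv_rl]

theorem dia_dot {k : ℕ} (s t : XCTerm 0 k) : dia P (dot s t)
    = Tg.gl (Fin k) (Tg.rl (Equiv.sumComm _ _) (.refl _) (Tg.un (dia P s) (dia P t))) := by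
  have h : act P (dot s t) = (act P (.tensor s t)).comp (act P (mulN k)) := rfl
  rw [dia, h, act_mulN, Fam.dia_comp_fuse]
  refine congrArg _ ((congrArg (Tg.rl _ _) (dia_tensor s t)).trans ((Tg.rl_rl _ _ _ _ _).trans
    (Tg.rl_congr ?_ ?_ _))) <;> rintro (z | z) <;>
    simp [dotE, -Fin.natAdd_eq_addNat]

end XCTerm

namespace XCGraph

variable {P : Prop} {O I : Type}

/-- Contraction of all bivalent vertices; `pre` and `post` are the edges before and after a bivalent
vertex. -/
theorem mk_eq_of_contract_all {G D : XCGraph O I} [Finite G.B] [IsEmpty D.B] (φ : G.E → D.E)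
    (r : G.E → ℕ) (x : D.X ≃ G.X) (s : D.E → G.E) (pre post : G.B → G.E)
    (pos_eq : ∀ y, G.pos (x y) = D.pos y)
    (src_eq : ∀ g, (∃ n, G.src g = .inr (.inl n)) ∨
      G.src g = Sum.map id (Sum.map isEmptyElim (Prod.map x id)) (D.src (φ g)) ∧ r g = 0)
    (tgt_eq : ∀ g, (∃ n, G.tgt g = .inr (.inl n)) ∨
      G.tgt g = Sum.map id (Sum.map isEmptyElim (Prod.map x id)) (D.tgt (φ g)))
    (tgt_pre : ∀ n, G.tgt (pre n) = .inr (.inl n)) (src_post : ∀ n, G.src (post n) = .inr (.inl n))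
    (next : ∀ n, φ (post n) = φ (pre n) ∧ r (post n) = r (pre n) + 1)
    (φ_s : ∀ d, φ (s d) = d) (rot_s : ∀ d, G.rot (s d) = D.rot d)
    (rot_zero : ∀ g, g ≠ s (φ g) → G.rot g = 0) : Tg.mk P G = Tg.mk P D := by
  have port : ∀ z : O ⊕ D.B ⊕ D.X × Bool, oldPort (Equiv.emptySum D.B G.B) x z
      = Sum.map id (Sum.map isEmptyElim (Prod.map x id)) z := by
    rintro (z | z | z)
    exacts [rfl, isEmptyElim z, rfl]
  have port' : ∀ z : I ⊕ D.B ⊕ D.X × Bool, oldPort (Equiv.emptySum D.B G.B) x z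
      = Sum.map id (Sum.map isEmptyElim (Prod.map x id)) z := by
    rintro (z | z | z)
    exacts [rfl, isEmptyElim z, rfl]
  refine mk_eq_of_contraction φ r (Equiv.emptySum D.B G.B) x s pos_eq (fun g => ?_) (fun g => ?_)
    (fun g g' n h h' => ?_) φ_s rot_s rot_zero
  · rw [port]
    exact src_eq g
  · rw [port']
    exact tgt_eq g
  · rw [G.tgt.injective (h.trans (tgt_pre n).symm), G.src.injective (h'.trans (src_post n).symm)]
    exact next n

end XCGraph

namespace XCTerm

variable {P : Prop}

open Fam

/-- The operation given by `muN 2`. -/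
theorem act_muN_two : act P (muN 2) = fuse mulE ((Equiv.swap 0 1).trans mulE) := by
  have h : act P (muN 2) = (act P (.tensor (id 1) (id 1))).comp (act P mul) := rfl
  rw [h, act_tensor_perm (act_id 1) (act_id 1)]
  refine (perm_comp_fuse _ _ _).trans (fuse_congr (fun i => ?_) fun i => ?_) <;>
  fin_cases i <;> rfl

/-- Which starts of strands are glued in the threefold product. -/
noncomputable def mulThreeStart : Fin 3 ≃ Fin 1 ⊕ Fin 2 :=
  Equiv.ofBijective ![.inr 0, .inr 1, .inl 0] (by decide)

/-- Which ends of strands are glued in the threefold product. -/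
noncomputable def mulThreeEnd : Fin 3 ≃ Fin 1 ⊕ Fin 2 :=
  Equiv.ofBijective ![.inl 0, .inr 0, .inr 1] (by decide)

theorem act_muN_three : act P (muN 3) = fuse mulThreeStart mulThreeEnd := by
  have h : act P (muN 3) = ((amb finSumFinEquiv.symm finSumFinEquiv.symm (act P (id 1))).comp
    (amb (finSumFinEquiv.symm.trans (Equiv.sumComm _ _))
        (finSumFinEquiv.symm.trans (Equiv.sumComm _ _)) (act P (muN 2)))).comp (act P mul) := rfl
  rw [h, act_muN_two, act_id, amb_of_perm, amb_fuse, perm_comp_fuse, act, fuse_comp_fuse]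
  refine fuse_ext ((Equiv.sumComm _ _).trans ((Equiv.sumCongr (Equiv.equivPUnit (Fin 1)).symm (Equiv.equivPUnit (Fin 1)).symm).trans finSumFinEquiv)) (fun i => ?_) fun i => ?_ <;>
  fin_cases i <;> rfl

theorem act_tensor_fuse {a b c d : ℕ} {s : XCTerm a b} {t : XCTerm c d} {K L : Type}
    {p q : Fin a ≃ Fin b ⊕ K} {p' q' : Fin c ≃ Fin d ⊕ L} (hs : act P s = fuse p q)
    (ht : act P t = fuse p' q') {p'' q'' : Fin (a + c) ≃ Fin (b + d) ⊕ (K ⊕ L)}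
    (hp : ∀ z, p'' (finSumFinEquiv z) = Sum.map finSumFinEquiv _root_.id (Equiv.sumSumSumComm _ _ _ _
      (Sum.map p p' z)))
    (hq : ∀ z, q'' (finSumFinEquiv z) = Sum.map finSumFinEquiv _root_.id (Equiv.sumSumSumComm _ _ _ _
      (Sum.map q q' z))) : act P (.tensor s t) = fuse p'' q'' := by
  rw [act, hs, ht, amb_fuse, amb_fuse, fuse_comp_fuse]
  refine fuse_congr (fun i => ?_) fun i => ?_
  · obtain ⟨z | z, rfl⟩ := finSumFinEquiv.surjective i
    · rw [hp]
      rcases h : p z with y | y <;> simp [h, -finSumFinEquiv_apply_left, -finSumFinEquiv_apply_right]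
    · rw [hp]
      rcases h : p' z with y | y <;> simp [h, -finSumFinEquiv_apply_left, -finSumFinEquiv_apply_right]
  · obtain ⟨z | z, rfl⟩ := finSumFinEquiv.surjective i
    · rw [hq]
      rcases h : q z with y | y <;> simp [h, -finSumFinEquiv_apply_left, -finSumFinEquiv_apply_right]
    · rw [hq]
      rcases h : q' z with y | y <;> simp [h, -finSumFinEquiv_apply_left, -finSumFinEquiv_apply_right]

/-- Which starts of strands are glued by a product of two and one of three factors. -/
noncomputable def mulTwoThreeStart : Fin (2 + 3) ≃ Fin (1 + 1) ⊕ (Unit ⊕ Fin 2) :=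
  Equiv.ofBijective ![.inr (.inl ()), .inl 0, .inr (.inr 0), .inr (.inr 1), .inl 1] (by decide)

/-- Which ends of strands are glued by a product of two and one of three factors. -/
noncomputable def mulTwoThreeEnd : Fin (2 + 3) ≃ Fin (1 + 1) ⊕ (Unit ⊕ Fin 2) :=
  Equiv.ofBijective ![.inl 0, .inr (.inl ()), .inl 1, .inr (.inr 0), .inr (.inr 1)] (by decide)

/-- Which starts of strands are glued by a product of three and one of two factors. -/
noncomputable def mulThreeTwoStart : Fin (3 + 2) ≃ Fin (1 + 1) ⊕ (Fin 2 ⊕ Unit) :=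
  Equiv.ofBijective ![.inr (.inl 0), .inr (.inl 1), .inl 0, .inr (.inr ()), .inl 1] (by decide)

/-- Which ends of strands are glued by a product of three and one of two factors. -/
noncomputable def mulThreeTwoEnd : Fin (3 + 2) ≃ Fin (1 + 1) ⊕ (Fin 2 ⊕ Unit) :=
  Equiv.ofBijective ![.inl 0, .inr (.inl 0), .inr (.inl 1), .inl 1, .inr (.inr ())] (by decide)

theorem act_muN_two_three :
    act P (.tensor (muN 2) (muN 3)) = fuse mulTwoThreeStart mulTwoThreeEnd := by
  refine act_tensor_fuse act_muN_two act_muN_three ?_ ?_ <;> rintro (z | z) <;> fin_cases z <;> rfl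

theorem act_muN_three_two :
    act P (.tensor (muN 3) (muN 2)) = fuse mulThreeTwoStart mulThreeTwoEnd := by
  refine act_tensor_fuse act_muN_three act_muN_two ?_ ?_ <;> rintro (z | z) <;> fin_cases z <;> rfl

theorem act_assoc : act P (comp (tensor mul (id 1) : XCTerm (2 + 1) (1 + 1)) mul)
    = act P (comp (tensor (id 1) mul : XCTerm (1 + 2) (1 + 1)) mul) := by
  have h : act P (comp (tensor mul (id 1) : XCTerm (2 + 1) (1 + 1)) mul)
    = ((amb finSumFinEquiv.symm finSumFinEquiv.symm (act P (id 1))).comp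
    (amb (finSumFinEquiv.symm.trans (Equiv.sumComm _ _))
        (finSumFinEquiv.symm.trans (Equiv.sumComm _ _)) (act P mul))).comp (act P mul) := rfl
  have h' : act P (comp (tensor (id 1) mul : XCTerm (1 + 2) (1 + 1)) mul)
    = (act P (tensor (id 1) mul)).comp (act P mul) := rfl
  rw [h, h', act_tensor_exch, act_id, amb_of_perm, amb_of_perm, act, amb_fuse, amb_fuse,
    perm_comp_fuse, perm_comp_fuse, fuse_comp_fuse, fuse_comp_fuse]
  refine fuse_ext (Equiv.sumComm _ _) (fun i => ?_) fun i => ?_ <;>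
  fin_cases i <;> rfl

end XCTerm

namespace XCGraph

variable {P : Prop} {O I O' I' : Type}

section Check

variable {E B X E' X' : Type} [Fintype E] [DecidableEq E] [Fintype B] [DecidableEq B]
  [Fintype X] [DecidableEq X] [DecidableEq E'] [Fintype E'] [Fintype X'] [DecidableEq X']
  [DecidableEq O] [DecidableEq I]

/-- A decidable form of the conditions for a contraction. -/
def Check (φ : E → E') (r : E → ℕ) (x : X' → X) (s : E' → E) (pos : X → Bool) (rot : E → SignType)
    (src : E → O ⊕ B ⊕ X × Bool) (tgt : E → I ⊕ B ⊕ X × Bool) (pos' : X' → Bool)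
    (rot' : E' → SignType) (src' : E' → O ⊕ Fin 0 ⊕ X' × Bool)
    (tgt' : E' → I ⊕ Fin 0 ⊕ X' × Bool) : Prop :=
  (∀ y, pos (x y) = pos' y) ∧ Function.Bijective x ∧
    (∀ g, (∃ n, src g = .inr (.inl n)) ∨
      src g = Sum.map id (Sum.map Fin.elim0 (Prod.map x id)) (src' (φ g)) ∧ r g = 0) ∧
    (∀ g, (∃ n, tgt g = .inr (.inl n)) ∨
      tgt g = Sum.map id (Sum.map Fin.elim0 (Prod.map x id)) (tgt' (φ g))) ∧
    (∀ n, ∃ g g', tgt g = .inr (.inl n) ∧ src g' = .inr (.inl n) ∧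
      φ g' = φ g ∧ r g' = r g + 1) ∧
    (∀ d, φ (s d) = d ∧ rot (s d) = rot' d) ∧ ∀ g, g ≠ s (φ g) → rot g = 0

instance (φ : E → E') (r : E → ℕ) (x : X' → X) (s : E' → E) (pos : X → Bool) (rot : E → SignType)
    (src : E → O ⊕ B ⊕ X × Bool) (tgt : E → I ⊕ B ⊕ X × Bool) (pos' : X' → Bool)
    (rot' : E' → SignType) (src' : E' → O ⊕ Fin 0 ⊕ X' × Bool)
    (tgt' : E' → I ⊕ Fin 0 ⊕ X' × Bool) :
    Decidable (Check φ r x s pos rot src tgt pos' rot' src' tgt') := by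
  unfold Check
  refine @instDecidableAnd _ _ ?_ (@instDecidableAnd _ _ ?_ (@instDecidableAnd _ _ ?_
    (@instDecidableAnd _ _ ?_ (@instDecidableAnd _ _ ?_ (@instDecidableAnd _ _ ?_ ?_))))) <;>
  infer_instance

theorem mk_eq_of_check {fin : Finite E} {pos : X → Bool} {rot : E → SignType}
    {src : E ≃ O ⊕ B ⊕ X × Bool} {tgt : E ≃ I ⊕ B ⊕ X × Bool} {fin' : Finite E'} {pos' : X' → Bool}
    {rot' : E' → SignType} {src' : E' ≃ O ⊕ Fin 0 ⊕ X' × Bool} {tgt' : E' ≃ I ⊕ Fin 0 ⊕ X' × Bool}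
    (φ : E → E') (r : E → ℕ) (x : X' → X) (s : E' → E)
    (h : decide (Check φ r x s pos rot src tgt pos' rot' src' tgt') = true) :
    Tg.mk P ⟨E, B, X, fin, pos, rot, src, tgt⟩
      = Tg.mk P ⟨E', Fin 0, X', fin', pos', rot', src', tgt'⟩ := by
  obtain ⟨h₁, h₂, h₃, h₄, h₅, h₆, h₇⟩ := of_decide_eq_true h
  choose pre post a₁ a₂ a₃ using h₅
  have e : (isEmptyElim : Fin 0 → B) = Fin.elim0 := funext fun z => z.elim0
  exact mk_eq_of_contract_all (G := ⟨E, B, X, fin, pos, rot, src, tgt⟩)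
    (D := ⟨E', Fin 0, X', fin', pos', rot', src', tgt'⟩) φ r (.ofBijective x h₂) s pre post h₁
    (by rw [← e] at h₃; exact h₃) (by rw [← e] at h₄; exact h₄) a₁ a₂ a₃
    (fun d => (h₆ d).1) (fun d => (h₆ d).2) h₇

end Check

/-- The graph for a product of elements. -/
def dotG {k : ℕ} (S T : XCGraph (Fin k) (Fin k)) : XCGraph (Fin k) (Fin k) :=
  ((S.union T).relabel (Equiv.sumComm _ _) (.refl _)).glue

/-- The graph for a monoidal product of elements. -/
def tensorG {a b : ℕ} (S : XCGraph (Fin a) (Fin a)) (T : XCGraph (Fin b) (Fin b)) :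
    XCGraph (Fin (a + b)) (Fin (a + b)) :=
  (S.union T).relabel finSumFinEquiv finSumFinEquiv

/-- The graph with additional edges with rotation number zero. -/
def padG {a b k : ℕ} (e : Fin a ⊕ Fin b ≃ Fin k) (S : XCGraph (Fin a) (Fin a)) :
    XCGraph (Fin k) (Fin k) :=
  (S.union (triv (Fin b))).relabel e e

/-- Some of the univalent vertices are glued. -/
def fuseG {A B K : Type} (p q : A ≃ B ⊕ K) (S : XCGraph A A) : XCGraph B B := (S.relabel p q).glue

/-- The graph for the generator `R`. -/
noncomputable def rG : XCGraph (Fin 2) (Fin 2) :=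
  (crossing true 0 0).relabel (.refl _) (.swap 0 1)

/-- The graph for the generator `Rinv`. -/
noncomputable def rinvG : XCGraph (Fin 2) (Fin 2) :=
  (crossing false 0 0).relabel (.swap 0 1) (.refl _)

/-- Insertion at the given positions. -/
noncomputable def legs₁₃ : Fin 2 ⊕ Fin 1 ≃ Fin 3 :=
  .ofBijective (Sum.elim ![0, 2] ![1]) (by decide)
/-- Insertion at the given positions. -/
noncomputable def leg₂ : Fin 1 ⊕ Fin 2 ≃ Fin 3 :=
  .ofBijective (Sum.elim ![1] ![0, 2]) (by decide)
/-- Insertion at the given positions. -/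
noncomputable def legs₁₂ : Fin 2 ⊕ Fin 1 ≃ Fin 3 :=
  .ofBijective (Sum.elim ![0, 1] ![2]) (by decide)
/-- Insertion at the given positions. -/
noncomputable def legs₂₃₃ : Fin 2 ⊕ Fin 1 ≃ Fin 3 :=
  .ofBijective (Sum.elim ![1, 2] ![0]) (by decide)
/-- Insertion at the given positions. -/
noncomputable def legs₁₅ : Fin 2 ⊕ Fin 3 ≃ Fin 5 :=
  .ofBijective (Sum.elim ![0, 4] ![1, 2, 3]) (by decide)
/-- Insertion at the given positions. -/
noncomputable def legs₂₃ : Fin 2 ⊕ Fin 3 ≃ Fin 5 :=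
  .ofBijective (Sum.elim ![1, 2] ![0, 3, 4]) (by decide)
/-- Insertion at the given positions. -/
noncomputable def legs₃₄ : Fin 2 ⊕ Fin 3 ≃ Fin 5 :=
  .ofBijective (Sum.elim ![2, 3] ![0, 1, 4]) (by decide)
/-- Insertion at the given positions. -/
noncomputable def leg₄ : Fin 1 ⊕ Fin 4 ≃ Fin 5 :=
  .ofBijective (Sum.elim ![3] ![0, 1, 2, 4]) (by decide)
/-- Insertion at the given positions. -/
noncomputable def leg₂₅ : Fin 1 ⊕ Fin 4 ≃ Fin 5 :=
  .ofBijective (Sum.elim ![1] ![0, 2, 3, 4]) (by decide)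

theorem mk_dot_R_Rinv : Tg.mk P (dotG rG rinvG)
    = Tg.mk P parallelNegPos :=
  mk_eq_of_check (E := (Fin 4 ⊕ Fin 4)) (E' := Fin 6)
    (X := (Fin 1 ⊕ Fin 1)) (X' := Fin 2)
    (B := ((Fin 0 ⊕ Fin 0) ⊕ Fin 2))
    (Sum.elim ![1, 4, 5, 2] ![3, 0, 1, 4])
    (Sum.elim ![1, 1, 0, 0] ![0, 0, 0, 0])
    ![.inl 0, .inr 0]
    ![.inr 1, .inr 2, .inl 3, .inr 0, .inr 3, .inl 2]
    (by decide +kernel)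

theorem mk_dot_Rinv_R : Tg.mk P (dotG rinvG rG)
    = Tg.mk P parallelPosNeg :=
  mk_eq_of_check (E := (Fin 4 ⊕ Fin 4)) (E' := Fin 6)
    (X := (Fin 1 ⊕ Fin 1)) (X' := Fin 2)
    (B := ((Fin 0 ⊕ Fin 0) ⊕ Fin 2))
    (Sum.elim ![4, 1, 2, 5] ![0, 3, 4, 1])
    (Sum.elim ![1, 1, 0, 0] ![0, 0, 0, 0])
    ![.inr 0, .inl 0]
    ![.inr 0, .inr 3, .inl 2, .inr 1, .inr 2, .inl 3]
    (by decide +kernel)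

theorem mk_conj_R : Tg.mk P (dotG (dotG (tensorG (strands 1 fun _ : Fin 1 => -1) (strands 1 fun _
      : Fin 1 => -1)) rG)
    (tensorG (strands 1 fun _ : Fin 1 => 1) (strands 1 fun _ : Fin 1 => 1)))
    = Tg.mk P ((crossing true 1 (-1)).relabel (.refl _) (.swap 0 1)) :=
  mk_eq_of_check (E := (((Fin 1 ⊕ Fin 1) ⊕ Fin 4) ⊕ (Fin 1 ⊕ Fin 1))) (E' := Fin 4)
    (X := (((Fin 0 ⊕ Fin 0) ⊕ Fin 1) ⊕ (Fin 0 ⊕ Fin 0))) (X' := Fin 1)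
    (B := (((((Fin 0 ⊕ Fin 0) ⊕ Fin 0) ⊕ Fin 2) ⊕ (Fin 0 ⊕ Fin 0)) ⊕ Fin 2))
    (Sum.elim (Sum.elim (Sum.elim ![3] ![2]) ![0, 1, 2, 3]) (Sum.elim ![0] ![1]))
    (Sum.elim (Sum.elim (Sum.elim ![1] ![1]) ![1, 1, 0, 0]) (Sum.elim ![0] ![0]))
    ![.inl (.inr 0)]
    ![.inr (.inl 0), .inr (.inr 0), .inl (.inl (.inr 0)), .inl (.inl (.inl 0))]
    (by decide +kernel)

theorem mk_conj_Rinv : Tg.mk P (dotG (dotG (tensorG (strands 1 fun _ : Fin 1 => -1) (strands 1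
      fun _ : Fin 1 => -1)) rinvG)
    (tensorG (strands 1 fun _ : Fin 1 => 1) (strands 1 fun _ : Fin 1 => 1)))
    = Tg.mk P ((crossing false 1 (-1)).relabel (.swap 0 1) (.refl _)) :=
  mk_eq_of_check (E := (((Fin 1 ⊕ Fin 1) ⊕ Fin 4) ⊕ (Fin 1 ⊕ Fin 1))) (E' := Fin 4)
    (X := (((Fin 0 ⊕ Fin 0) ⊕ Fin 1) ⊕ (Fin 0 ⊕ Fin 0))) (X' := Fin 1)
    (B := (((((Fin 0 ⊕ Fin 0) ⊕ Fin 0) ⊕ Fin 2) ⊕ (Fin 0 ⊕ Fin 0)) ⊕ Fin 2))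
    (Sum.elim (Sum.elim (Sum.elim ![2] ![3]) ![0, 1, 2, 3]) (Sum.elim ![1] ![0]))
    (Sum.elim (Sum.elim (Sum.elim ![1] ![1]) ![1, 1, 0, 0]) (Sum.elim ![0] ![0]))
    ![.inl (.inr 0)]
    ![.inr (.inr 0), .inr (.inl 0), .inl (.inl (.inl 0)), .inl (.inl (.inr 0))]
    (by decide +kernel)

theorem mk_kink_over : Tg.mk P (fuseG XCTerm.mulThreeStart XCTerm.mulThreeEnd (dotG
    (padG legs₁₃ (rG.relabel (StrandPerm.brE 1 1) (StrandPerm.brE 1 1)))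
    (padG leg₂ (strands 1 fun _ : Fin 1 => -1))))
    = Tg.mk P kinkOverFirst :=
  mk_eq_of_check (E := ((Fin 4 ⊕ Fin 1) ⊕ (Fin 1 ⊕ Fin 2))) (E' := Fin 3)
    (X := ((Fin 1 ⊕ Empty) ⊕ (Fin 0 ⊕ Empty))) (X' := Fin 1)
    (B := ((((Fin 0 ⊕ Empty) ⊕ (Fin 0 ⊕ Empty)) ⊕ Fin 3) ⊕ Fin 2))
    (Sum.elim (Sum.elim ![0, 1, 2, 1] ![1]) (Sum.elim ![1] ![1, 0]))
    (Sum.elim (Sum.elim ![1, 4, 0, 0] ![2]) (Sum.elim ![1] ![3, 0]))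
    ![.inl (.inl 0)]
    ![.inr (.inr 1), .inr (.inl 0), .inl (.inl 2)]
    (by decide +kernel)

theorem mk_kink_under : Tg.mk P (fuseG XCTerm.mulThreeStart XCTerm.mulThreeEnd (dotG (padG legs₁₃
      rG)
    (padG leg₂ (strands 1 fun _ : Fin 1 => 1))))
    = Tg.mk P kinkUnderFirst :=
  mk_eq_of_check (E := ((Fin 4 ⊕ Fin 1) ⊕ (Fin 1 ⊕ Fin 2))) (E' := Fin 3)
    (X := ((Fin 1 ⊕ Empty) ⊕ (Fin 0 ⊕ Empty))) (X' := Fin 1)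
    (B := ((((Fin 0 ⊕ Empty) ⊕ (Fin 0 ⊕ Empty)) ⊕ Fin 3) ⊕ Fin 2))
    (Sum.elim (Sum.elim ![1, 0, 1, 2] ![1]) (Sum.elim ![1] ![1, 0]))
    (Sum.elim (Sum.elim ![4, 1, 0, 0] ![2]) (Sum.elim ![1] ![3, 0]))
    ![.inl (.inl 0)]
    ![.inr (.inr 1), .inr (.inl 0), .inl (.inl 3)]
    (by decide +kernel)

theorem mk_anti_c : Tg.mk P (fuseG XCTerm.mulTwoThreeStart XCTerm.mulTwoThreeEnd (dotG (dotG
      (padG legs₁₅ rG)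
    (padG legs₂₃ rinvG)) (padG leg₄ (strands 1 fun _ : Fin 1 => 1))))
    = Tg.mk P antiparallelC :=
  mk_eq_of_check (E := (((Fin 4 ⊕ Fin 3) ⊕ (Fin 4 ⊕ Fin 3)) ⊕ (Fin 1 ⊕ Fin 4))) (E' := Fin 6)
    (X := (((Fin 1 ⊕ Empty) ⊕ (Fin 1 ⊕ Empty)) ⊕ (Fin 0 ⊕ Empty))) (X' := Fin 2)
    (B := ((((((Fin 0 ⊕ Empty) ⊕ (Fin 0 ⊕ Empty)) ⊕ Fin 5) ⊕ (Fin 0 ⊕ Empty)) ⊕ Fin 5) ⊕ (Unit ⊕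
      Fin 2)))
    (Sum.elim (Sum.elim (Sum.elim ![1, 3, 4, 2] ![1, 5, 4]) (Sum.elim ![4, 0, 1, 5] ![1, 4, 3]))
      (Sum.elim ![4] ![1, 0, 4, 3]))
    (Sum.elim (Sum.elim (Sum.elim ![4, 2, 0, 0] ![1, 1, 3]) (Sum.elim ![5, 1, 0, 0] ![3, 2, 1]))
      (Sum.elim ![1] ![2, 0, 4, 0]))
    ![.inl (.inl (.inl 0)), .inl (.inr (.inl 0))]
    ![.inr (.inr 1), .inl (.inr (.inl 2)), .inl (.inl (.inl 3)), .inr (.inr 3), .inr (.inl 0),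
      .inl (.inr (.inl 3))]
    (by decide +kernel)

theorem mk_anti_d : Tg.mk P (fuseG XCTerm.mulThreeTwoStart XCTerm.mulThreeTwoEnd (dotG (dotG
      (padG legs₁₅ rinvG)
    (padG legs₃₄ rG)) (padG leg₂₅ (strands 1 fun _ : Fin 1 => -1))))
    = Tg.mk P antiparallelD :=
  mk_eq_of_check (E := (((Fin 4 ⊕ Fin 3) ⊕ (Fin 4 ⊕ Fin 3)) ⊕ (Fin 1 ⊕ Fin 4))) (E' := Fin 6)
    (X := (((Fin 1 ⊕ Empty) ⊕ (Fin 1 ⊕ Empty)) ⊕ (Fin 0 ⊕ Empty))) (X' := Fin 2)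
    (B := ((((((Fin 0 ⊕ Empty) ⊕ (Fin 0 ⊕ Empty)) ⊕ Fin 5) ⊕ (Fin 0 ⊕ Empty)) ⊕ Fin 5) ⊕ (Fin 2 ⊕
      Unit)))
    (Sum.elim (Sum.elim (Sum.elim ![3, 1, 2, 4] ![1, 1, 5]) (Sum.elim ![0, 4, 5, 1] ![1, 1, 3]))
      (Sum.elim ![1] ![1, 0, 4, 3]))
    (Sum.elim (Sum.elim (Sum.elim ![2, 7, 0, 0] ![4, 1, 1]) (Sum.elim ![1, 2, 0, 0] ![6, 3, 1]))
      (Sum.elim ![2] ![5, 0, 1, 0]))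
    ![.inl (.inr (.inl 0)), .inl (.inl (.inl 0))]
    ![.inr (.inr 1), .inr (.inl 0), .inl (.inl (.inl 2)), .inr (.inr 3), .inl (.inl (.inl 3)),
      .inl (.inr (.inl 2))]
    (by decide +kernel)

theorem mk_triple_left : Tg.mk P (dotG (dotG (padG legs₁₂ rG) (padG legs₁₃ rG)) (padG legs₂₃₃ rG))
    = Tg.mk P tripleLeft :=
  mk_eq_of_check (E := (((Fin 4 ⊕ Fin 1) ⊕ (Fin 4 ⊕ Fin 1)) ⊕ (Fin 4 ⊕ Fin 1))) (E' := Fin 9)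
    (X := (((Fin 1 ⊕ Empty) ⊕ (Fin 1 ⊕ Empty)) ⊕ (Fin 1 ⊕ Empty))) (X' := Fin 3)
    (B := (((((Fin 0 ⊕ Empty) ⊕ (Fin 0 ⊕ Empty)) ⊕ Fin 3) ⊕ (Fin 0 ⊕ Empty)) ⊕ Fin 3))
    (Sum.elim (Sum.elim (Sum.elim ![1, 4, 5, 2] ![8]) (Sum.elim ![0, 7, 8, 1] ![4])) (Sum.elim
      ![3, 6, 7, 4] ![0]))
    (Sum.elim (Sum.elim (Sum.elim ![1, 2, 0, 0] ![1]) (Sum.elim ![1, 1, 0, 0] ![1])) (Sum.elim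
      ![0, 0, 0, 0] ![0]))
    ![.inl (.inl (.inl 0)), .inl (.inr (.inl 0)), .inr (.inl 0)]
    ![.inr (.inr 0), .inl (.inr (.inl 3)), .inl (.inl (.inl 3)), .inr (.inl 0), .inr (.inl 3),
      .inl (.inl (.inl 2)), .inr (.inl 1), .inr (.inl 2), .inl (.inr (.inl 2))]
    (by decide +kernel)

theorem mk_triple_right : Tg.mk P (dotG (dotG (padG legs₂₃₃ rG) (padG legs₁₃ rG)) (padG legs₁₂
      rG))
    = Tg.mk P tripleRight :=
  mk_eq_of_check (E := (((Fin 4 ⊕ Fin 1) ⊕ (Fin 4 ⊕ Fin 1)) ⊕ (Fin 4 ⊕ Fin 1))) (E' := Fin 9)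
    (X := (((Fin 1 ⊕ Empty) ⊕ (Fin 1 ⊕ Empty)) ⊕ (Fin 1 ⊕ Empty))) (X' := Fin 3)
    (B := (((((Fin 0 ⊕ Empty) ⊕ (Fin 0 ⊕ Empty)) ⊕ Fin 3) ⊕ (Fin 0 ⊕ Empty)) ⊕ Fin 3))
    (Sum.elim (Sum.elim (Sum.elim ![4, 7, 8, 5] ![2]) (Sum.elim ![1, 6, 7, 2] ![4])) (Sum.elim
      ![0, 3, 4, 1] ![6]))
    (Sum.elim (Sum.elim (Sum.elim ![2, 1, 0, 0] ![1]) (Sum.elim ![1, 1, 0, 0] ![1])) (Sum.elim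
      ![0, 0, 0, 0] ![0]))
    ![.inr (.inl 0), .inl (.inr (.inl 0)), .inl (.inl (.inl 0))]
    ![.inr (.inl 0), .inr (.inl 3), .inl (.inr (.inl 3)), .inr (.inl 1), .inr (.inl 2), .inl
      (.inl (.inl 3)), .inr (.inr 0), .inl (.inr (.inl 2)), .inl (.inl (.inl 2))]
    (by decide +kernel)

end XCGraph

namespace XCTerm

variable {P : Prop}

open XCGraph

theorem dia_R : dia P .R = .mk P rG := Fam.dia_add _ _

theorem dia_Rinv : dia P .Rinv = .mk P rinvG := Fam.dia_add _ _

theorem dia_kappa : dia P .kappa = .mk P (strands 1 fun _ : Fin 1 => -1) := Fam.dia_add _ _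

theorem dia_kappaInv : dia P .kappaInv = .mk P (strands 1 fun _ : Fin 1 => 1) := Fam.dia_add _ _

theorem dia_unit_eq : dia P .unit = .mk P (strands 1 fun _ : Fin 1 => 0) := Fam.dia_add _ _

theorem dia_dot_mk {k : ℕ} {s t : XCTerm 0 k} {S T : XCGraph (Fin k) (Fin k)}
    (hs : dia P s = .mk P S) (ht : dia P t = .mk P T) : dia P (dot s t) = .mk P (dotG S T) := by
  rw [dia_dot, hs, ht]
  rfl

theorem dia_tensor_mk {a b : ℕ} {s : XCTerm 0 a} {t : XCTerm 0 b} {S : XCGraph (Fin a) (Fin a)}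
    {T : XCGraph (Fin b) (Fin b)} (hs : dia P s = .mk P S) (ht : dia P t = .mk P T) :
    dia P (.tensor s t : XCTerm 0 (a + b)) = .mk P (tensorG S T) := by
  rw [dia_tensor, hs, ht]
  rfl

theorem dia_leg_mk {t : XCTerm 0 1} {T : XCGraph (Fin 1) (Fin 1)} (ht : dia P t = .mk P T)
    (a c : ℕ) {b : ℕ} (e : Fin 1 ⊕ Fin b ≃ Fin (a + 1 + c))
    (he : ∀ i, e (.inl i) = padSum (padSum (Fin.elim0 : Fin 0 → Fin a)
      (_root_.id : Fin 1 → Fin 1)) (Fin.elim0 : Fin 0 → Fin c) i) :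
    dia P (.comp t (leg a c)) = .mk P (padG e T) := by
  rw [dia_leg t a c e.symm he, ht]
  rfl

theorem dia_legs_mk {t : XCTerm 0 2} {T : XCGraph (Fin 2) (Fin 2)} (ht : dia P t = .mk P T)
    (a b c : ℕ) {d : ℕ} (e : Fin 2 ⊕ Fin d ≃ Fin (a + 1 + b + 1 + c))
    (he : ∀ i, e (.inl i) = padSum (padSum (padSum (padSum (Fin.elim0 : Fin 0 → Fin a)
      (_root_.id : Fin 1 → Fin 1)) (Fin.elim0 : Fin 0 → Fin b)) (_root_.id : Fin 1 → Fin 1))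
        (Fin.elim0 : Fin 0 → Fin c) i) :
    dia P (.comp t (legs a b c)) = .mk P (padG e T) := by
  rw [dia_legs t a b c e.symm he, ht]
  rfl

theorem dia_comp_mk {a b : ℕ} {K : Type} {s : XCTerm 0 a} {t : XCTerm a b}
    {S : XCGraph (Fin a) (Fin a)} (hs : dia P s = .mk P S) {p q : Fin a ≃ Fin b ⊕ K}
    (ht : act P t = Fam.fuse p q) : dia P (.comp s t) = .mk P (fuseG p q S) := by
  have h : act P (.comp s t) = (act P s).comp (act P t) := rfl
  rw [dia, h, ht, Fam.dia_comp_fuse]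
  exact congrArg (fun x => Tg.gl K (Tg.rl p q x)) hs

theorem dia_braid_mk {a b : ℕ} {s : XCTerm 0 (a + b)} {S : XCGraph (Fin (a + b)) (Fin (a + b))}
    (hs : dia P s = .mk P S) : dia P (.comp s (.braid a b))
      = .mk P (S.relabel (StrandPerm.brE a b) (StrandPerm.brE a b)) :=
  (Fam.dia_comp_perm _ _).trans (congrArg (Tg.rl _ _) hs)

theorem mk_dot_strands (i j k : SignType) (h : (k : ℤ) = (i : ℤ) + (j : ℤ)) :
    Tg.mk P (dotG (strands 1 fun _ : Fin 1 => j) (strands 1 fun _ : Fin 1 => i))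
      = .mk P (strands 1 fun _ : Fin 1 => k) := by
  let D := strands 1 fun _ : Fin 1 => k
  let e : Option (Fin 1) ≃ Fin 1 ⊕ Fin 1 :=
    Equiv.ofBijective (fun y => y.elim (.inl 0) fun _ => .inr 0) (by decide)
  let b : Option (Fin 0) ≃ (Fin 0 ⊕ Fin 0) ⊕ Fin 1 :=
    Equiv.ofBijective (fun y => y.elim (.inr 0) fun x => x.elim0) (by decide)
  refine Eq.trans (Eq.symm ?_) (Tg.sound_zeroR (D := D) (0 : Fin 1) i j h)
  exact Tg.sound_iso
    { e := e
      b := b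
      x := Equiv.equivOfIsEmpty (Fin 0) (Fin 0 ⊕ Fin 0)
      pos_eq := fun y => Fin.elim0 y
      rot_eq := by
        rintro (_ | f)
        · rfl
        · obtain rfl := Subsingleton.elim (α := Fin 1) f (0 : Fin 1)
          exact (subdivide_rot_self D _ i j).symm
      src_eq := by
        rintro (_ | f)
        · rfl
        · obtain rfl := Subsingleton.elim (α := Fin 1) f (0 : Fin 1)
          rfl
      tgt_eq := by
        rintro (_ | f)
        · rw [show (D.subdivide (0 : Fin 1) i j).tgt none = _ from subdivide_tgt_none D _ i j]
          rfl
        · obtain rfl := Subsingleton.elim (α := Fin 1) f (0 : Fin 1)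
          rw [show (D.subdivide (0 : Fin 1) i j).tgt (some (0 : Fin 1)) = _ from
            subdivide_tgt_self D _ i j]
          rfl }

theorem mk_tensor_strands (i j : SignType) :
    Tg.mk P (tensorG (strands 1 fun _ : Fin 1 => i) (strands 1 fun _ : Fin 1 => j))
      = .mk P (strands 1 ![i, j]) :=
  Tg.sound_iso
    { e := finSumFinEquiv
      b := Equiv.equivOfIsEmpty (Fin 0 ⊕ Fin 0) (Fin 0)
      x := Equiv.equivOfIsEmpty (Fin 0 ⊕ Fin 0) (Fin 0)
      pos_eq := by rintro (y | y) <;> exact Fin.elim0 y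
      rot_eq := by rintro (y | y) <;> (obtain rfl := Subsingleton.elim (α := Fin 1) y (0 : Fin 1)) <;> rfl
      src_eq := by rintro (y | y) <;> (obtain rfl := Subsingleton.elim (α := Fin 1) y (0 : Fin 1)) <;> rfl
      tgt_eq := by rintro (y | y) <;> (obtain rfl := Subsingleton.elim (α := Fin 1) y (0 : Fin 1)) <;> rfl }

theorem dia_unitN_one : dia P (unitN 1) = .mk P (strands 1 fun _ : Fin 1 => 0) :=
  (dia_unitN 1).trans (Tg.mk_strands_one 1).symm

theorem dia_unitN_two : dia P (unitN 2) = .mk P (strands 1 ![0, 0]) := by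
  refine (dia_unitN 2).trans ((Tg.mk_strands_one 2).symm.trans ?_)
  rw [show (![0, 0] : Fin 2 → SignType) = 0 from funext (by decide)]

theorem dia_conj_R : dia P (dot (dot (tensor kappa kappa) R) (tensor kappaInv kappaInv))
    = .mk P ((crossing true 1 (-1)).relabel (.refl _) (.swap 0 1)) :=
  (dia_dot_mk (dia_dot_mk (dia_tensor_mk dia_kappa dia_kappa) dia_R)
    (dia_tensor_mk dia_kappaInv dia_kappaInv)).trans mk_conj_R

theorem dia_conj_Rinv : dia P (dot (dot (tensor kappa kappa) Rinv) (tensor kappaInv kappaInv))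
    = .mk P ((crossing false 1 (-1)).relabel (.swap 0 1) (.refl _)) :=
  (dia_dot_mk (dia_dot_mk (dia_tensor_mk dia_kappa dia_kappa) dia_Rinv)
    (dia_tensor_mk dia_kappaInv dia_kappaInv)).trans mk_conj_Rinv

theorem dia_kink_over :
    dia P (comp (dot (k := 3) (comp (comp R (braid 1 1)) (legs 0 1 0)) (comp kappa (leg 1 1)))
      (muN 3)) = .mk P kinkOverFirst :=
  (dia_comp_mk (dia_dot_mk (k := 3) (dia_legs_mk (dia_braid_mk (a := 1) (b := 1) dia_R)
    0 1 0 legs₁₃ (by decide +kernel))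
    (dia_leg_mk dia_kappa 1 1 leg₂ (by decide +kernel))) act_muN_three).trans mk_kink_over

theorem dia_kink_under :
    dia P (comp (dot (k := 3) (comp R (legs 0 1 0)) (comp kappaInv (leg 1 1))) (muN 3))
      = .mk P kinkUnderFirst :=
  (dia_comp_mk (dia_dot_mk (k := 3) (dia_legs_mk dia_R 0 1 0 legs₁₃ (by decide +kernel))
    (dia_leg_mk dia_kappaInv 1 1 leg₂ (by decide +kernel))) act_muN_three).trans mk_kink_under

theorem dia_anti_c :
    dia P (comp (dot (k := 5) (dot (k := 5) (comp R (legs 0 3 0)) (comp Rinv (legs 1 0 2)))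
        (comp kappaInv (leg 3 1))) (tensor (muN 2) (muN 3))) = .mk P antiparallelC :=
  (dia_comp_mk (dia_dot_mk (k := 5) (dia_dot_mk (k := 5)
    (dia_legs_mk dia_R 0 3 0 legs₁₅ (by decide +kernel))
    (dia_legs_mk dia_Rinv 1 0 2 legs₂₃ (by decide +kernel)))
    (dia_leg_mk dia_kappaInv 3 1 leg₄ (by decide +kernel))) act_muN_two_three).trans mk_anti_c

theorem dia_anti_d :
    dia P (comp (dot (k := 5) (dot (k := 5) (comp Rinv (legs 0 3 0)) (comp R (legs 2 0 1)))
        (comp kappa (leg 1 3))) (tensor (muN 3) (muN 2))) = .mk P antiparallelD :=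
  (dia_comp_mk (dia_dot_mk (k := 5) (dia_dot_mk (k := 5)
    (dia_legs_mk dia_Rinv 0 3 0 legs₁₅ (by decide +kernel))
    (dia_legs_mk dia_R 2 0 1 legs₃₄ (by decide +kernel)))
    (dia_leg_mk dia_kappa 1 3 leg₂₅ (by decide +kernel))) act_muN_three_two).trans mk_anti_d

theorem dia_triple_left :
    dia P (dot (k := 3) (dot (k := 3) (comp R (legs 0 0 1)) (comp R (legs 0 1 0)))
        (comp R (legs 1 0 0))) = .mk P tripleLeft :=
  (dia_dot_mk (k := 3) (dia_dot_mk (k := 3) (dia_legs_mk dia_R 0 0 1 legs₁₂ (by decide +kernel))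
    (dia_legs_mk dia_R 0 1 0 legs₁₃ (by decide +kernel)))
    (dia_legs_mk dia_R 1 0 0 legs₂₃₃ (by decide +kernel))).trans mk_triple_left

theorem dia_triple_right :
    dia P (dot (k := 3) (dot (k := 3) (comp R (legs 1 0 0)) (comp R (legs 0 1 0)))
        (comp R (legs 0 0 1))) = .mk P tripleRight :=
  (dia_dot_mk (k := 3) (dia_dot_mk (k := 3) (dia_legs_mk dia_R 1 0 0 legs₂₃₃ (by decide +kernel))
    (dia_legs_mk dia_R 0 1 0 legs₁₃ (by decide +kernel)))
    (dia_legs_mk dia_R 0 0 1 legs₁₂ (by decide +kernel))).trans mk_triple_right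

/-- The moves come from relations between arrows of the PROP. -/
theorem exists_rel_of_move {k : ℕ} {l r : XCGraph (Fin k) (Fin k)} (m : Move l r) :
    ∃ (s t : XCTerm 0 k) (o i : Equiv.Perm (Fin k)), Rel s t ∧
      ∀ P, dia P s = .mk P (l.relabel o i) ∧ dia P t = .mk P (r.relabel o i) := by
  have e : ∀ (P : Prop) {k : ℕ} (G : XCGraph (Fin k) (Fin k)), Tg.mk P G
      = .mk P (G.relabel (.refl _) (.refl _)) := fun P _ G => (Tg.rl_refl (Tg.mk P G)).symm
  cases m with
  | zeroA => exact ⟨_, _, _, _, .law .xc0, fun P => ⟨dia_R, dia_conj_R⟩⟩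
  | zeroB => exact ⟨_, _, _, _, .law .xc0_inv, fun P => ⟨dia_Rinv, dia_conj_Rinv⟩⟩
  | oneF => exact ⟨_, _, _, _, .law .xc1f, fun P =>
      ⟨dia_kink_over.trans (e _ _), dia_kink_under.trans (e _ _)⟩⟩
  | twoA => exact ⟨_, _, _, _, .symm (.law .R_Rinv), fun P => ⟨dia_unitN_two.trans (e _ _),
      ((dia_dot_mk dia_R dia_Rinv).trans mk_dot_R_Rinv).trans (e _ _)⟩⟩
  | twoB => exact ⟨_, _, _, _, .symm (.law .Rinv_R), fun P => ⟨dia_unitN_two.trans (e _ _),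
      ((dia_dot_mk dia_Rinv dia_R).trans mk_dot_Rinv_R).trans (e _ _)⟩⟩
  | twoC => exact ⟨_, _, _, _, .law .xc2c, fun P =>
      ⟨((dia_tensor_mk dia_unit_eq dia_kappaInv).trans (mk_tensor_strands 0 1)).trans (e _ _),
        dia_anti_c.trans (e _ _)⟩⟩
  | twoD => exact ⟨_, _, _, _, .law .xc2d, fun P =>
      ⟨((dia_tensor_mk dia_kappa dia_unit_eq).trans (mk_tensor_strands (-1) 0)).trans (e _ _),
        dia_anti_d.trans (e _ _)⟩⟩
  | three => exact ⟨_, _, _, _, .law .xc3, fun P =>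
      ⟨dia_triple_left.trans (e _ _), dia_triple_right.trans (e _ _)⟩⟩

end XCTerm

theorem Tg.val_nil : (Tg.nil False).val = SElts.ofElt Elts.one (.refl _) := by
  rw [← Tg.triv_empty, ← Tg.triv_rl (Equiv.equivOfIsEmpty (Fin 0) Empty), ← Tg.mk_strands_one,
    Tg.val_rl, Tg.val_mk, XCGraph.value_strands, SElts.rl_ofElt]
  congr 1
  · rw [Elts.edges, Elts.prod_of_isEmpty, Elts.map_map, Elts.map_map]
    exact (Elts.map_congr (fun z => z.elim) _).trans (Elts.map_refl _)
  · ext z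
    exact z.elim

namespace XCTerm

theorem val_dia {k : ℕ} (t : XCTerm 0 k) :
    (dia False t).val = SElts.ofElt (Elts.elt (XCHom.mk t)) (.refl _) := by
  have h0 : (Tg.rl (Equiv.sumEmpty Empty (Fin 0)).symm (Equiv.sumEmpty Empty (Fin 0)).symm
      (Tg.nil False)).val = SElts.ofElt (Elts.map (Equiv.sumEmpty Empty (Fin 0)).symm Elts.one)
        (.refl _) := by
    rw [Tg.val_rl, Tg.val_nil, SElts.rl_ofElt]
    congr 1
    ext z
    simp
  have h := act_acts t _ _ h0
  rw [dia, Fam.dia, Tg.val_rl, h, SElts.rl_ofElt, Elts.op_unit, ← Elts.tensor_comm, Elts.map_map]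
  congr 1
  · exact (Elts.map_congr (by rintro (z | z); exacts [rfl, z.elim]) _).trans (Elts.tensor_one _)

end XCTerm

namespace XCGraph

variable {O I : Type}

theorem Move.value_eq {k : ℕ} {l r : XCGraph (Fin k) (Fin k)} (m : Move l r) :
    l.value = r.value := by
  obtain ⟨s, t, o, i, h, hP⟩ := XCTerm.exists_rel_of_move m
  have e : XCHom.mk s = XCHom.mk t := Quot.sound h
  have h1 := XCTerm.val_dia s
  rw [e, ← XCTerm.val_dia t, (hP False).1, (hP False).2, Tg.val_mk, Tg.val_mk, value_relabel,
    value_relabel] at h1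
  have h2 := congrArg (SElts.rl o.symm i.symm) h1
  rwa [SElts.rl_rl, SElts.rl_rl, SElts.rl_id, SElts.rl_id] at h2 <;> simp

theorem finite_of_plug {k : ℕ} {Oc Ic K : Type} (l : XCGraph (Fin k) (Fin k)) (c : XCGraph Oc Ic)
    (o : Fin k ⊕ Oc ≃ O ⊕ K) (i : Fin k ⊕ Ic ≃ I ⊕ K) : Finite K := by
  let D := plug l c o i
  have : Finite D.E := D.finite_edges
  have : Finite (O ⊕ D.B ⊕ D.X × Bool) := Finite.of_equiv _ D.src
  exact Finite.of_injective (fun x : K => (.inr (.inl (.inr x)) : O ⊕ D.B ⊕ D.X × Bool))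
    fun x y h => Sum.inr_injective (Sum.inl_injective (Sum.inr_injective h))

theorem Step.value_eq {D D' : XCGraph O I} (h : D.Step D') : D.value = D'.value := by
  cases h with
  | iso f => exact f.value_eq.symm
  | zeroR e i j h f => exact (f.value_eq.trans (value_subdivide D e i j h)).symm
  | @move k l r m Oc Ic K c o i _ _ f g =>
    have := finite_of_plug l c o i
    rw [f.value_eq, g.value_eq, plug, plug, value_glue, value_glue, value_relabel, value_relabel,
      value_union, value_union, m.value_eq]

theorem Step.isOpen_iff {D D' : XCGraph O I} (h : D.Step D') : D.IsOpen ↔ D'.IsOpen := by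
  rw [← value_isSome, ← value_isSome, h.value_eq]

end XCGraph

namespace Tg

variable {O I : Type}

theorem sound_step {D D' : XCGraph O I} (h : D.Step D') : mk True D = mk True D' :=
  Quot.sound (.step trivial h)

theorem sound_move {k : ℕ} {l r : XCGraph (Fin k) (Fin k)} (m : XCGraph.Move l r) :
    mk True l = mk True r := by
  have e : ∀ l : XCGraph (Fin k) (Fin k), mk True (XCGraph.plug l .nil (.refl _) (.refl _))
      = mk True l := fun l => by
    refine (gl_of_isEmpty (rl _ _ (un (mk True l) (nil True)))).trans ?_
    rw [rl_rl]
    exact (rl_congr (fun _ => rfl) (fun _ => rfl) _).trans (un_nil (mk True l))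
  rw [← e l, ← e r]
  exact sound_step (.move m .nil _ _ (.refl _) (.refl _))

/-- The value of a graph up to all moves. -/
noncomputable def value : Tg True O I → SElts O I :=
  Quot.lift XCGraph.value fun _ _ h => by
    cases h with
    | iso f => exact f.value_eq.symm
    | zeroR e i j h f => exact (f.value_eq.trans (XCGraph.value_subdivide _ e i j h)).symm
    | step _ h => exact h.value_eq

variable {O' I' K : Type}

theorem value_rl (o : O ≃ O') (i : I ≃ I') (x : Tg True O I) :
    value (rl o i x) = SElts.rl o i (value x) := by
  obtain ⟨D, rfl⟩ := x.exists_rep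
  exact D.value_relabel o i

theorem value_gl [Finite K] (x : Tg True (O ⊕ K) (I ⊕ K)) :
    value (gl K x) = SElts.glue K (value x) := by
  obtain ⟨D, rfl⟩ := x.exists_rep
  exact D.value_glue

end Tg

namespace XCTerm

open XCGraph

theorem dia_eq_of_move {k : ℕ} {l r : XCGraph (Fin k) (Fin k)} (m : Move l r) (o i : Equiv.Perm (Fin k))
    {s t : XCTerm 0 k} (hs : dia True s = .mk True (l.relabel o i))
    (ht : dia True t = .mk True (r.relabel o i)) : act True s = act True t :=
  Fam.eq_of_dia_eq (hs.trans ((congrArg (Tg.rl o i) (Tg.sound_move m)).trans ht.symm))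

theorem dia_eq_of_move' {k : ℕ} {l r : XCGraph (Fin k) (Fin k)} (m : Move l r)
    {s t : XCTerm 0 k} (hs : dia True s = .mk True l)
    (ht : dia True t = .mk True r) : act True s = act True t :=
  Fam.eq_of_dia_eq (hs.trans ((Tg.sound_move m).trans ht.symm))

theorem act_mul_unit {P : Prop} :
    act P (comp (tensor (id 1) unit : XCTerm (1 + 0) (1 + 1)) mul) = act P (id 1) := by
  let q : Fin (1 + 1) ≃ Fin (1 + 0) ⊕ Unit := (Equiv.swap 0 1).trans mulE
  have h : act P (tensor (id 1) unit : XCTerm (1 + 0) (1 + 1)) = Fam.pad q :=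
    (isPad_tensor (isPad_cast rfl) isPad_unit).eq_pad q (by decide +kernel)
  refine (congrArg (fun f => Fam.comp f _) h).trans ?_
  refine Eq.trans ?_ (act_id 1).symm
  ext O I x
  show Tg.gl Unit (Tg.rl _ _ ((Fam.pad q).app x)) = Tg.rl _ _ x
  let e : Fin 1 ≃ Unit := Equiv.ofUnique _ _
  have hx := congrArg (Tg.rl (.sumCongr (.refl O) e.symm) (.refl _))
    (Tg.gl_triv_start (Tg.rl (.sumCongr (.refl O) e) (.refl _) x))
  rw [Tg.gl_rl, Tg.rl_un, Tg.rl_rl, Tg.rl_rl, Tg.rl_rl] at hx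
  rw [Fam.pad_app, Tg.rl_rl]
  refine Eq.trans (congrArg _ (Tg.rl_congr ?_ ?_ _)) (hx.trans (Tg.rl_congr ?_ ?_ x))
  on_goal 1 => rintro ((z | z) | z)
  on_goal 4 => rintro ((z | z) | z)
  on_goal 7 => rintro (z | z)
  on_goal 9 => rintro (z | z)
  all_goals first | rfl | (obtain rfl := Subsingleton.elim (α := Fin 1) z (0 : Fin 1); rfl)

theorem act_unit_mul {P : Prop} :
    act P (comp (tensor unit (id 1) : XCTerm (0 + 1) (1 + 1)) mul) = act P (id 1) := by
  let q : Fin (1 + 1) ≃ Fin (0 + 1) ⊕ Unit := mulE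
  have h : act P (tensor unit (id 1) : XCTerm (0 + 1) (1 + 1)) = Fam.pad q :=
    (isPad_tensor isPad_unit (isPad_cast rfl)).eq_pad q (by decide +kernel)
  refine (congrArg (fun f => Fam.comp f _) h).trans ?_
  refine Eq.trans ?_ (act_id 1).symm
  ext O I x
  show Tg.gl Unit (Tg.rl _ _ ((Fam.pad q).app x)) = Tg.rl _ _ x
  let e : Fin 1 ≃ Unit := Equiv.ofUnique _ _
  have hx := congrArg (Tg.rl (.refl _) (.sumCongr (.refl I) e.symm))
    (Tg.gl_triv_end (Tg.rl (.refl _) (.sumCongr (.refl I) e) x))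
  rw [Tg.gl_rl, Tg.rl_un, Tg.rl_rl, Tg.rl_rl, Tg.rl_rl] at hx
  rw [Fam.pad_app, Tg.rl_rl]
  refine Eq.trans (congrArg _ (Tg.rl_congr ?_ ?_ _)) (hx.trans (Tg.rl_congr ?_ ?_ x))
  on_goal 1 => rintro ((z | z) | z)
  on_goal 4 => rintro ((z | z) | z)
  on_goal 7 => rintro (z | z)
  on_goal 9 => rintro (z | z)
  all_goals first | rfl | (obtain rfl := Subsingleton.elim (α := Fin 1) z (0 : Fin 1); rfl)

theorem act_law {a b : ℕ} {s t : XCTerm a b} (h : Law s t) : act True s = act True t := by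
  cases h with
  | assoc => exact act_assoc
  | mul_unit => exact act_mul_unit
  | unit_mul => exact act_unit_mul
  | R_Rinv =>
    exact (dia_eq_of_move' .twoA dia_unitN_two ((dia_dot_mk dia_R dia_Rinv).trans mk_dot_R_Rinv)).symm
  | Rinv_R =>
    exact (dia_eq_of_move' .twoB dia_unitN_two ((dia_dot_mk dia_Rinv dia_R).trans mk_dot_Rinv_R)).symm
  | kappa_kappaInv =>
    exact Fam.eq_of_dia_eq ((dia_dot_mk dia_kappa dia_kappaInv).trans
      ((mk_dot_strands 1 (-1) 0 rfl).trans dia_unitN_one.symm))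
  | kappaInv_kappa =>
    exact Fam.eq_of_dia_eq ((dia_dot_mk dia_kappaInv dia_kappa).trans
      ((mk_dot_strands (-1) 1 0 rfl).trans dia_unitN_one.symm))
  | xc0 => exact dia_eq_of_move .zeroA _ _ dia_R dia_conj_R
  | xc0_inv => exact dia_eq_of_move .zeroB _ _ dia_Rinv dia_conj_Rinv
  | xc1f => exact dia_eq_of_move' .oneF dia_kink_over dia_kink_under
  | xc2c => exact dia_eq_of_move' .twoC ((dia_tensor_mk dia_unit_eq dia_kappaInv).trans
      (mk_tensor_strands 0 1)) dia_anti_c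
  | xc2d => exact dia_eq_of_move' .twoD ((dia_tensor_mk dia_kappa dia_unit_eq).trans
      (mk_tensor_strands (-1) 0)) dia_anti_d
  | xc3 => exact dia_eq_of_move' .three dia_triple_left dia_triple_right

theorem act_eq_of_rel {a b : ℕ} {s t : XCTerm a b} (h : Rel s t) : act True s = act True t :=
  act_sound act_law h

end XCTerm

namespace XCTerm

variable {P : Prop}

open StrandPerm

theorem act_perm : ∀ {n : ℕ} (σ : Equiv.Perm (Fin n)), act P (perm σ) = Fam.perm σ
  | 0, σ => Fam.perm_congr fun i => i.elim0
  | n + 1, σ => by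
    have e₁ : n + 1 = (σ (Fin.last n) : ℕ) + ((n - (σ (Fin.last n) : ℕ)) + 1) := by omega
    have e₂ : (σ (Fin.last n) : ℕ) + (1 + (n - (σ (Fin.last n) : ℕ))) = n + 1 := by omega
    have h : act P (perm σ) = (act P (tensor (perm (removeLast σ)) (id 1))).comp
        ((Fam.perm (finCongr e₁)).comp ((act P (tensor (id _)
          (braid (n - (σ (Fin.last n) : ℕ)) 1))).comp (Fam.perm (finCongr e₂)))) := rfl
    rw [h, act_tensor_perm (act_perm _) (act_id 1), act_tensor_perm (act_id _) rfl, Fam.perm_comp,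
      Fam.perm_comp, Fam.perm_comp]
    refine Fam.perm_congr fun i => Fin.ext ?_
    simp only [Equiv.trans_apply, finCongr_apply, Fin.val_cast, sumE_val, brE_val, finCongr_refl,
      Equiv.refl_apply]
    induction i using Fin.lastCases with
    | last => simp; omega
    | cast i =>
      have h := congrArg Fin.val (removeLast_spec σ i)
      have hi := i.2
      have hp := (σ (Fin.last n)).2
      have hr := (XCTerm.removeLast σ i).2
      simp only [Fin.succAbove, Fin.lt_def] at h
      simp only [Fin.val_castSucc, hi, dite_true, Fin.eta]
      split_ifs at h <;> simp at h <;> grind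

theorem dia_comp_perm {n : ℕ} (t : XCTerm 0 n) (σ : Equiv.Perm (Fin n)) :
    dia P (.comp t (perm σ)) = Tg.rl σ σ (dia P t) := by
  have h : act P (.comp t (perm σ)) = (act P t).comp (act P (perm σ)) := rfl
  rw [dia, h, act_perm, Fam.dia_comp_perm]
  rfl

/-- Which starts of strands are glued by `Id_n ⊗ μ`. -/
def mulLastStart (n : ℕ) : Fin (n + 2) ≃ Fin (n + 1) ⊕ Unit :=
  (finSumFinEquiv.symm.trans ((Equiv.sumCongr (.refl _) mulE).trans (Equiv.sumAssoc _ _ _).symm)).trans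
    (Equiv.sumCongr finSumFinEquiv (.refl _))

/-- Which ends of strands are glued by `Id_n ⊗ μ`. -/
def mulLastEnd (n : ℕ) : Fin (n + 2) ≃ Fin (n + 1) ⊕ Unit :=
  (finSumFinEquiv.symm.trans ((Equiv.sumCongr (.refl _) ((Equiv.swap 0 1).trans mulE)).trans
    (Equiv.sumAssoc _ _ _).symm)).trans (Equiv.sumCongr finSumFinEquiv (.refl _))

theorem act_mul_last (n : ℕ) :
    act P (tensor (id n) mul) = Fam.fuse (mulLastStart n) (mulLastEnd n) := by
  have h : act P (tensor (id n) mul) = (Fam.amb finSumFinEquiv.symm finSumFinEquiv.symm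
    (act P mul)).comp (Fam.amb (finSumFinEquiv.symm.trans (Equiv.sumComm _ _))
        (finSumFinEquiv.symm.trans (Equiv.sumComm _ _)) (act P (id n))) := rfl
  rw [h, act_id, act, Fam.amb_fuse, Fam.amb_of_perm, Fam.perm_eq_fuse, Fam.fuse_comp_fuse]
  refine Fam.fuse_ext (Equiv.emptySum _ _) (fun i => ?_) fun i => ?_
  · obtain ⟨z | z, rfl⟩ := finSumFinEquiv.surjective i
    · simp [mulLastStart, -finSumFinEquiv_apply_left, -finSumFinEquiv_apply_right]
    · fin_cases z <;> simp [mulLastStart, mulE, -finSumFinEquiv_apply_left, -finSumFinEquiv_apply_right]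
  · obtain ⟨z | z, rfl⟩ := finSumFinEquiv.surjective i
    · simp [mulLastEnd, -finSumFinEquiv_apply_left, -finSumFinEquiv_apply_right]
    · fin_cases z <;> simp [mulLastEnd, mulE, -finSumFinEquiv_apply_left, -finSumFinEquiv_apply_right]

theorem dia_mul_last {n : ℕ} (t : XCTerm 0 (n + 2)) :
    dia P (.comp t (tensor (id n) mul))
      = Tg.gl Unit (Tg.rl (mulLastStart n) (mulLastEnd n) (dia P t)) := by
  have h : act P (.comp t (tensor (id n) mul)) = (act P t).comp (act P (tensor (id n) mul)) := rfl
  rw [dia, h, act_mul_last, Fam.dia_comp_fuse]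
  rfl

@[simp] theorem mulLastStart_last (n : ℕ) : mulLastStart n (Fin.last (n + 1)) = .inl (Fin.last n) := by
  have h : Fin.last (n + 1) = finSumFinEquiv (.inr (1 : Fin 2) : Fin n ⊕ Fin 2) := by
    ext; simp
  rw [h, mulLastStart]
  simp only [Equiv.trans_apply, Equiv.symm_apply_apply]
  rfl

@[simp] theorem mulLastStart_castSucc_last (n : ℕ) :
    mulLastStart n (Fin.last n).castSucc = .inr () := by
  have h : (Fin.last n).castSucc = finSumFinEquiv (.inr (0 : Fin 2) : Fin n ⊕ Fin 2) := by
    ext; simp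
  rw [h, mulLastStart]
  simp only [Equiv.trans_apply, Equiv.symm_apply_apply]
  rfl

@[simp] theorem mulLastStart_castSucc_castSucc {n : ℕ} (i : Fin n) :
    mulLastStart n i.castSucc.castSucc = .inl i.castSucc := by
  have h : i.castSucc.castSucc = finSumFinEquiv (.inl i : Fin n ⊕ Fin 2) := by
    ext; simp
  rw [h, mulLastStart]
  simp only [Equiv.trans_apply, Equiv.symm_apply_apply]
  rfl

@[simp] theorem mulLastEnd_last (n : ℕ) : mulLastEnd n (Fin.last (n + 1)) = .inr () := by
  have h : Fin.last (n + 1) = finSumFinEquiv (.inr (1 : Fin 2) : Fin n ⊕ Fin 2) := by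
    ext; simp
  rw [h, mulLastEnd]
  simp only [Equiv.trans_apply, Equiv.symm_apply_apply]
  rfl

@[simp] theorem mulLastEnd_castSucc_last (n : ℕ) :
    mulLastEnd n (Fin.last n).castSucc = .inl (Fin.last n) := by
  have h : (Fin.last n).castSucc = finSumFinEquiv (.inr (0 : Fin 2) : Fin n ⊕ Fin 2) := by
    ext; simp
  rw [h, mulLastEnd]
  simp only [Equiv.trans_apply, Equiv.symm_apply_apply]
  rfl

@[simp] theorem mulLastEnd_castSucc_castSucc {n : ℕ} (i : Fin n) :
    mulLastEnd n i.castSucc.castSucc = .inl i.castSucc := by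
  have h : i.castSucc.castSucc = finSumFinEquiv (.inl i : Fin n ⊕ Fin 2) := by
    ext; simp
  rw [h, mulLastEnd]
  simp only [Equiv.trans_apply, Equiv.symm_apply_apply]
  rfl

end XCTerm

namespace Tg

variable {O I O' I' K : Type}

/-- The moves are imposed. -/
def up : Tg False O I → Tg True O I :=
  Quot.map _root_.id fun _ _ h => by
    cases h with
    | iso f => exact .iso f
    | zeroR e i j h f => exact .zeroR e i j h f
    | step p _ => exact p.elim

theorem up_rl (o : O ≃ O') (i : I ≃ I') (x : Tg False O I) : (rl o i x).up = rl o i x.up := by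
  obtain ⟨D, rfl⟩ := x.exists_rep
  rfl

theorem up_un (x : Tg False O I) (y : Tg False O' I') : (un x y).up = un x.up y.up := by
  obtain ⟨D, rfl⟩ := x.exists_rep
  obtain ⟨T, rfl⟩ := y.exists_rep
  rfl

theorem up_gl (x : Tg False (O ⊕ K) (I ⊕ K)) : (gl K x).up = gl K x.up := by
  obtain ⟨D, rfl⟩ := x.exists_rep
  rfl

theorem value_up (x : Tg False O I) : x.up.value = x.val := by
  obtain ⟨D, rfl⟩ := x.exists_rep
  rfl

end Tg

namespace XCTerm

theorem up_act {a b : ℕ} (t : XCTerm a b) : ∀ {O I : Type} (x : Tg False (O ⊕ Fin a) (I ⊕ Fin a)),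
    ((act False t).app x).up = (act True t).app x.up := by
  have perm : ∀ {A B : Type} (e : A ≃ B) {O I : Type} (x : Tg False (O ⊕ A) (I ⊕ A)),
      ((Fam.perm e).app x).up = (Fam.perm e).app x.up := fun e _ _ x => Tg.up_rl _ _ x
  have add : ∀ {k : ℕ} (e : Fin 0 ≃ Empty) (D : XCGraph (Fin k) (Fin k)) {O I : Type}
      (x : Tg False (O ⊕ Fin 0) (I ⊕ Fin 0)),
      (((Fam.perm e).comp (Fam.add (.mk False D))).app x).up
        = ((Fam.perm e).comp (Fam.add (.mk True D))).app x.up := fun e D O I x => by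
    refine (Tg.up_un _ _).trans ?_
    rw [Tg.up_rl]
    exact congrArg (fun y => Tg.un (Tg.rl _ _ y) _) (perm e x)
  have amb : ∀ {A B X Y K : Type} (p : X ≃ K ⊕ A) (q : Y ≃ K ⊕ B) (f : Fam False A B)
      (g : Fam True A B), (∀ {O I : Type} (x : Tg False (O ⊕ A) (I ⊕ A)),
        (f.app x).up = g.app x.up) → ∀ {O I : Type} (x : Tg False (O ⊕ X) (I ⊕ X)),
        ((Fam.amb p q f).app x).up = (Fam.amb p q g).app x.up := fun p q f g h O I x => by
    refine (Tg.up_rl _ _ _).trans (congrArg _ ((h _).trans (congrArg _ (Tg.up_rl _ _ _))))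
  induction t with
  | cast h => exact perm _
  | comp f g hf hg => exact fun x => (hg _).trans (congrArg _ (hf x))
  | tensor f g hf hg => exact fun x => (amb _ _ _ _ hf _).trans (congrArg _ (amb _ _ _ _ hg x))
  | braid a b => exact perm _
  | mul => exact fun x => (Tg.up_gl _).trans (congrArg _ (Tg.up_rl _ _ x))
  | unit => exact add _ _
  | R => exact add _ _
  | Rinv => exact add _ _
  | kappa => exact add _ _
  | kappaInv => exact add _ _

theorem up_dia {k : ℕ} (t : XCTerm 0 k) : (dia False t).up = dia True t := by
  refine (Tg.up_rl _ _ _).trans (congrArg _ ((up_act t _).trans (congrArg _ (Tg.up_rl _ _ _))))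

theorem value_dia {k : ℕ} (t : XCTerm 0 k) :
    (dia True t).value = SElts.ofElt (Elts.elt (XCHom.mk t)) (.refl _) := by
  rw [← up_dia, Tg.value_up, val_dia]

end XCTerm

namespace XCGraph

variable {O I : Type}

/-- Edges with the given rotation numbers and no vertices in between. -/
def lines {E : Type} [Finite E] (rot : E → SignType) : XCGraph E E where
  E := E
  B := Empty
  X := Empty
  finite_edges := inferInstance
  pos := Empty.elim
  rot := rot
  src := (Equiv.sumEmpty _ _).symm
  tgt := (Equiv.sumEmpty _ _).symm

/-- Disjoint tetravalent vertices with the given signs; the strands are named after their incoming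
half-edges. -/
def crosses {X : Type} [Finite X] (pos : X → Bool) : XCGraph (X × Bool) (X × Bool) where
  E := X × Bool ⊕ X × Bool
  B := Empty
  X := X
  finite_edges := inferInstance
  pos := pos
  rot _ := 0
  src := Equiv.sumCongr (.refl _) (Equiv.emptySum _ _).symm
  tgt := (Equiv.sumComm _ _).trans (Equiv.sumCongr (acrossE X) (Equiv.emptySum _ _).symm)

end XCGraph

namespace Tg

open XCGraph

variable {P : Prop} {O I : Type}

theorem mk_lines_equiv {E F : Type} [Finite E] [Finite F] (e : E ≃ F) (rot : F → SignType) :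
    mk P (lines rot) = rl e e (mk P (lines fun z => rot (e z))) :=
  Eq.symm <| sound_iso
    { e := e
      b := .refl _
      x := .refl _
      pos_eq := fun y => y.elim
      rot_eq := fun _ => rfl
      src_eq := fun _ => rfl
      tgt_eq := fun _ => rfl }

theorem mk_lines_sum {E F : Type} [Finite E] [Finite F] (rot : E ⊕ F → SignType) :
    mk P (lines rot) = un (mk P (lines fun z => rot (.inl z))) (mk P (lines fun z => rot (.inr z))) :=
  Eq.symm <| sound_iso
    { e := Equiv.refl _
      b := Equiv.equivOfIsEmpty (Empty ⊕ Empty) Empty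
      x := Equiv.equivOfIsEmpty (Empty ⊕ Empty) Empty
      pos_eq := by rintro (y | y) <;> exact y.elim
      rot_eq := by rintro (y | y) <;> rfl
      src_eq := by rintro (y | y) <;> rfl
      tgt_eq := by rintro (y | y) <;> rfl }

theorem mk_lines_empty (rot : Empty → SignType) : mk P (lines rot) = nil P :=
  sound_iso
    { e := Equiv.refl _
      b := Equiv.refl _
      x := Equiv.refl _
      pos_eq := fun y => y.elim
      rot_eq := fun y => y.elim
      src_eq := fun y => y.elim
      tgt_eq := fun y => y.elim }

theorem mk_lines_unit (rot : Unit → SignType) : mk P (lines rot)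
    = rl (Equiv.ofUnique (Fin 1) Unit) (Equiv.ofUnique (Fin 1) Unit)
      (mk P (strands 1 fun _ => rot ())) :=
  Eq.symm <| sound_iso
    { e := Equiv.ofUnique (Fin 1) Unit
      b := Equiv.equivOfIsEmpty (Fin 0) Empty
      x := Equiv.equivOfIsEmpty (Fin 0) Empty
      pos_eq := fun y => y.elim0
      rot_eq := fun _ => rfl
      src_eq := fun _ => rfl
      tgt_eq := fun _ => rfl }

theorem mk_crosses_equiv {X Y : Type} [Finite X] [Finite Y] (e : X ≃ Y) (pos : Y → Bool) :
    mk P (crosses pos) = rl (Equiv.prodCongr e (.refl _)) (Equiv.prodCongr e (.refl _))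
      (mk P (crosses fun z => pos (e z))) :=
  Eq.symm <| sound_iso
    { e := Equiv.sumCongr (Equiv.prodCongr e (.refl _)) (Equiv.prodCongr e (.refl _))
      b := .refl _
      x := e
      pos_eq := fun _ => rfl
      rot_eq := fun _ => rfl
      src_eq := by rintro (y | y) <;> rfl
      tgt_eq := by rintro (y | y) <;> rfl }

theorem mk_crosses_sum {X Y : Type} [Finite X] [Finite Y] (pos : X ⊕ Y → Bool) :
    mk P (crosses pos)
      = rl (Equiv.sumProdDistrib _ _ _).symm (Equiv.sumProdDistrib _ _ _).symm
        (un (mk P (crosses fun z => pos (.inl z))) (mk P (crosses fun z => pos (.inr z)))) :=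
  Eq.symm <| sound_iso
    { e := (Equiv.sumSumSumComm _ _ _ _).trans (Equiv.sumCongr (Equiv.sumProdDistrib _ _ _).symm
        (Equiv.sumProdDistrib _ _ _).symm)
      b := Equiv.equivOfIsEmpty (Empty ⊕ Empty) Empty
      x := .refl _
      pos_eq := by rintro (y | y) <;> rfl
      rot_eq := by rintro ((y | y) | (y | y)) <;> rfl
      src_eq := by rintro ((y | y) | (y | y)) <;> rfl
      tgt_eq := by rintro ((y | y) | (y | y)) <;> rfl }

theorem mk_crosses_empty (pos : Empty → Bool) : mk P (crosses pos)
    = rl (Equiv.emptyProd Bool).symm (Equiv.emptyProd Bool).symm (nil P) :=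
  Eq.symm <| sound_iso
    { e := Equiv.equivOfIsEmpty Empty (Empty × Bool ⊕ Empty × Bool)
      b := .refl _
      x := .refl _
      pos_eq := fun y => y.elim
      rot_eq := fun y => y.elim
      src_eq := fun y => y.elim
      tgt_eq := fun y => y.elim }

/-- The two incoming half-edges of one tetravalent vertex. -/
def sides : Fin 2 ≃ Unit × Bool := finTwoEquiv.trans (Equiv.punitProd Bool).symm

theorem mk_crosses_unit (pos : Unit → Bool) : mk P (crosses pos)
    = rl sides (sides.trans (acrossE _)) (mk P (crossing (pos ()) 0 0)) :=
  Eq.symm <| sound_iso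
    { e := (finSumFinEquiv (m := 2) (n := 2)).symm.trans (Equiv.sumCongr sides sides)
      b := Equiv.equivOfIsEmpty (Fin 0) Empty
      x := Equiv.ofUnique (Fin 1) Unit
      pos_eq := fun y => by
        obtain rfl := Subsingleton.elim (α := Fin 1) y (0 : Fin 1)
        rfl
      rot_eq := fun y => by
        change Fin 4 at y
        fin_cases y <;> rfl
      src_eq := fun y => by
        change Fin 4 at y
        fin_cases y <;> rfl
      tgt_eq := fun y => by
        change Fin 4 at y
        fin_cases y <;> rfl }

open Classical in
/-- A graph is glued from its edges and its tetravalent vertices. -/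
theorem mk_eq_gl (D : XCGraph O I) : mk P D
    = gl D.Ports (rl D.starts D.ends (un (mk P (lines D.rot)) (mk P (crosses D.pos)))) := by
  let G : XCGraph O I := (((lines D.rot).union (crosses D.pos)).relabel D.starts D.ends).glue
  let Y := D.X × Bool
  let b := (Equiv.emptySum (Empty ⊕ Empty) (D.B ⊕ Y ⊕ Y)).symm
  let x := (Equiv.emptySum Empty D.X).symm
  have src_eq {e z} (h : D.src e = z) :
      G.src (.inl e) = gluePorts _ _ _ _ (.inl (startE _ _ _ (.inl z))) :=
    congrArg (fun z => gluePorts _ _ _ _ (.inl (startE _ _ _ (.inl z)))) h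
  have tgt_eq {e z} (h : D.tgt e = z) :
      G.tgt (.inl e) = gluePorts _ _ _ _ (.inl (endE _ _ _ (.inl z))) :=
    congrArg (fun z => gluePorts _ _ _ _ (.inl (endE _ _ _ (.inl z)))) h
  refine Eq.symm (XCGraph.mk_eq_of_contraction (G := G) (N := Y ⊕ Y)
    (Sum.elim _root_.id (Sum.elim (fun p => D.tgt.symm (.inr (.inr p)))
      fun p => D.src.symm (.inr (.inr p))))
    (Sum.elim (fun e => if (∃ p, D.src e = .inr (.inr p)) then 1 else 0)
      (Sum.elim (fun p => (if (∃ q, D.src (D.tgt.symm (.inr (.inr p))) = .inr (.inr q))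
        then 1 else 0) + 1) fun _ => 0))
    b x (fun e => .inl e)
    (fun _ => rfl) ?_ ?_ ?_ (fun _ => rfl) (fun _ => rfl) ?_)
  · rintro (e | p | p)
    · rcases h : D.src e with o | c | p
      · exact .inr ⟨(src_eq h).trans (congrArg (oldPort b x) h).symm, if_neg (by simp [h])⟩
      · exact .inr ⟨(src_eq h).trans (congrArg (oldPort b x) h).symm, if_neg (by simp [h])⟩
      · exact .inl ⟨.inr p, src_eq h⟩
    · exact .inl ⟨.inl p, rfl⟩
    · exact .inr ⟨(congrArg (oldPort b x) (D.src.apply_symm_apply (.inr (.inr p)))).symm, rfl⟩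
  · rintro (e | p | p)
    · rcases h : D.tgt e with o | c | p
      · exact .inr ((tgt_eq h).trans (congrArg (oldPort b x) h).symm)
      · exact .inr ((tgt_eq h).trans (congrArg (oldPort b x) h).symm)
      · exact .inl ⟨.inl p, tgt_eq h⟩
    · exact .inr (congrArg (oldPort b x) (D.tgt.apply_symm_apply (.inr (.inr p)))).symm
    · refine .inl ⟨.inr p, ?_⟩
      rcases p with ⟨x, s⟩
      cases s <;> rfl
  · rintro g g' (p | p) h h'
    · obtain rfl : g = .inl (D.tgt.symm (.inr (.inr p))) :=
        G.tgt.injective (h.trans (tgt_eq (D.tgt.apply_symm_apply (.inr (.inr p)))).symm)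
      obtain rfl : g' = .inr (.inl p) := G.src.injective h'
      exact ⟨rfl, rfl⟩
    · obtain rfl : g = .inr (.inr p) := G.tgt.injective (h.trans (by
        rcases p with ⟨x, s⟩
        cases s <;> rfl))
      obtain rfl : g' = .inl (D.src.symm (.inr (.inr p))) :=
        G.src.injective (h'.trans (src_eq (D.src.apply_symm_apply (.inr (.inr p)))).symm)
      exact ⟨rfl, if_pos ⟨p, D.src.apply_symm_apply _⟩⟩
  · rintro (e | p | p) h
    · exact (h rfl).elim
    · rfl
    · rfl

end Tg

namespace Tg

variable {P : Prop} {O I O' I' O'' I'' K K' L : Type}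

theorem un_gl_gl (x : Tg P (O ⊕ K) (I ⊕ K)) (y : Tg P (O' ⊕ K') (I' ⊕ K')) :
    un (gl K x) (gl K' y)
      = gl (K ⊕ K') (rl (Equiv.sumSumSumComm _ _ _ _) (Equiv.sumSumSumComm _ _ _ _) (un x y)) := by
  rw [un_gl, ← un_comm, un_gl, gl_rl, gl_rl, gl_gl, ← un_comm x y, rl_rl, rl_rl, rl_rl, rl_rl]
  refine congrArg _ (rl_congr (fun z => ?_) (fun z => ?_) _) <;>
    rcases z with (z | z) | (z | z) <;> rfl

/-- The ends of the strands of the first graph are glued to the starts of those of the second. -/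
def seq (x : Tg P O K) (y : Tg P K I) : Tg P O I := gl K (rl (.refl _) (Equiv.sumComm _ _) (un x y))

theorem seq_rl (o : O ≃ O') (k : K ≃ K') (i : I ≃ I') (x : Tg P O K) (y : Tg P K I) :
    seq (rl o k x) (rl k i y) = rl o i (seq x y) := by
  rw [seq, seq, un_rl, ← gl_rl' o i k, rl_rl, rl_rl]
  refine congrArg _ (rl_congr (fun z => ?_) (fun z => ?_) _) <;> rcases z with z | z <;> rfl

theorem seq_triv [Finite K] (x : Tg P O K) : seq x (triv P K) = x := by
  refine rl_injective (.refl _) (Equiv.emptySum Empty K).symm ?_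
  rw [← gl_triv_end (rl (.refl _) (Equiv.emptySum Empty K).symm x), rl_un, rl_rl, seq, gl_rl, rl_rl]
  refine congrArg _ (rl_congr (fun z => ?_) (fun z => ?_) _) <;> rcases z with z | z <;> rfl

theorem triv_seq [Finite K] (y : Tg P K I) : seq (triv P K) y = y := by
  refine rl_injective (Equiv.emptySum Empty K).symm (.refl _) ?_
  rw [← gl_triv_start (rl (Equiv.emptySum Empty K).symm (.refl _) y), rl_un, rl_rl, seq, gl_rl,
    ← un_comm y, rl_rl, rl_rl]
  refine congrArg _ (rl_congr (fun z => ?_) (fun z => ?_) _) <;> rcases z with z | z <;> rfl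

theorem seq_assoc (x : Tg P O K) (y : Tg P K L) (z : Tg P L I) :
    seq (seq x y) z = seq x (seq y z) := by
  rw [seq, seq, seq, seq, un_gl, gl_rl, gl_gl, rl_rl, rl_rl, ← un_comm (gl L _) x, un_gl, gl_rl, gl_rl,
    gl_gl, ← gl_reindex (Equiv.sumComm L K)]
  simp only [rl_rl, rl_un, un_rl_right, ← un_assoc]
  rw [← un_comm x (un y z), ← un_assoc, rl_rl, rl_rl]
  refine congrArg _ (rl_congr (fun z => ?_) (fun z => ?_) _) <;>
    rcases z with (z | z) | z <;> rfl

theorem un_seq (x : Tg P O K) (y : Tg P K I) (x' : Tg P O' K') (y' : Tg P K' I') :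
    un (seq x y) (seq x' y') = seq (un x x') (un y y') := by
  have h : rl (Equiv.sumSumSumComm _ _ _ _) (Equiv.sumSumSumComm _ _ _ _) (un (un x y) (un x' y'))
      = un (un x x') (un y y') := by
    rw [← un_assoc (un x y), ← un_assoc (un x x'), ← un_right_comm x y x', rl_un, rl_rl, rl_rl]
    refine rl_congr (fun z => ?_) (fun z => ?_) _ <;> rcases z with ((z | z) | z) | z <;> rfl
  rw [seq, seq, seq, un_gl_gl, un_rl, rl_rl, ← h, rl_rl]
  refine congrArg _ (rl_congr (fun z => ?_) (fun z => ?_) _) <;>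
    rcases z with (z | z) | (z | z) <;> rfl

end Tg

namespace XCHom

variable {n m : ℕ}

/-- The graph of an arrow `0 ⟶ n`, up to all moves. -/
noncomputable def dia : XCHom 0 n → Tg True (Fin n) (Fin n) :=
  Quot.lift (XCTerm.dia True) fun s t h => by rw [XCTerm.dia, XCTerm.dia, XCTerm.act_eq_of_rel h]

theorem exists_rep {a b : ℕ} (u : XCHom a b) : ∃ t, mk t = u := Quot.exists_rep u

theorem value_dia (u : XCHom 0 n) : u.dia.value = SElts.ofElt (Elts.elt u) (.refl _) := by
  obtain ⟨t, rfl⟩ := u.exists_rep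
  exact XCTerm.value_dia t

theorem dia_tensor (u : XCHom 0 n) (v : XCHom 0 m) :
    (u.tensor v : XCHom 0 (n + m)).dia
      = Tg.rl finSumFinEquiv finSumFinEquiv (Tg.un u.dia v.dia) := by
  obtain ⟨s, rfl⟩ := u.exists_rep
  obtain ⟨t, rfl⟩ := v.exists_rep
  exact XCTerm.dia_tensor s t

theorem dia_perm (u : XCHom 0 n) (σ : Equiv.Perm (Fin n)) :
    (u.comp (mk (.perm σ))).dia = Tg.rl σ σ u.dia := by
  obtain ⟨s, rfl⟩ := u.exists_rep
  exact XCTerm.dia_comp_perm s σ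

theorem dia_dot (u v : XCHom 0 n) : (universalElements.dot u v).dia = Tg.seq v.dia u.dia := by
  obtain ⟨s, rfl⟩ := u.exists_rep
  obtain ⟨t, rfl⟩ := v.exists_rep
  refine (XCTerm.dia_dot s t).trans (congrArg (Tg.gl _) ?_)
  rw [← Tg.un_comm (XCTerm.dia True t), Tg.rl_rl]
  refine Tg.rl_congr (fun z => ?_) (fun z => ?_) _ <;> rcases z with z | z <;> rfl

theorem dia_merge (u : XCHom 0 (n + 2)) :
    (u.comp (mk (.tensor (.id n) .mul)) : XCHom 0 (n + 1)).dia
      = Tg.gl Unit (Tg.rl (XCTerm.mulLastStart n) (XCTerm.mulLastEnd n) u.dia) := by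
  obtain ⟨s, rfl⟩ := u.exists_rep
  exact XCTerm.dia_mul_last s

/-- The graph of an element of the virtual category of elements. -/
noncomputable def graph (f : vEXC.Hom n) : Tg True (Fin n) (Fin n) := Tg.rl (.refl _) f.2 (dia f.1)

theorem value_graph (f : vEXC.Hom n) : (graph f).value = SElts.ofElt (Elts.elt f.1) f.2 := by
  refine (Tg.value_rl _ _ _).trans ((congrArg _ (value_dia f.1)).trans ?_)
  rw [SElts.rl_ofElt, Elts.map_refl]
  rfl

theorem graph_injective : Function.Injective (graph (n := n)) := fun f g h => by
  have h := congrArg Tg.value h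
  rw [value_graph, value_graph] at h
  have h := Prod.ext_iff.1 (Option.some.inj h)
  exact Prod.ext (Elts.mk_inj h.1) h.2

theorem graph_one : graph (vEXC.one n) = Tg.triv True (Fin n) :=
  (Tg.rl_refl _).trans (XCTerm.dia_unitN n)

theorem graph_comp (f g : vEXC.Hom n) : graph (vEXC.comp f g) = Tg.seq (graph g) (graph f) := by
  have h : graph f = Tg.rl g.2 (g.2.trans f.2) (Tg.rl g.2.symm g.2.symm f.1.dia) := by
    rw [Tg.rl_rl]
    exact Tg.rl_congr (fun _ => by simp) (fun _ => by simp) _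
  rw [h, graph, graph, Tg.seq_rl]
  refine congrArg _ ((dia_dot _ _).trans (congrArg _ (dia_perm _ _)))

theorem graph_tensor (f : vEXC.Hom n) (g : vEXC.Hom m) : graph (vEXC.tensor f g)
    = Tg.rl finSumFinEquiv finSumFinEquiv (Tg.un (graph f) (graph g)) := by
  rw [graph, graph, graph, Tg.un_rl, Tg.rl_rl]
  refine (congrArg _ (dia_tensor _ _)).trans ((Tg.rl_rl _ _ _ _ _).trans
    (Tg.rl_congr (fun z => ?_) (fun z => ?_) _))
  · rcases z with z | z <;> rfl
  · show blockSum f.2 g.2 (finSumFinEquiv z) = finSumFinEquiv (Sum.map f.2 g.2 z)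
    rw [blockSum, Equiv.trans_apply, Equiv.trans_apply, Equiv.symm_apply_apply]
    rfl

theorem graph_braid (n m : ℕ) : graph (vEXC.braid n m)
    = Tg.rl (.refl _) (blockSwap n m) (Tg.triv True (Fin (n + m))) :=
  congrArg _ (XCTerm.dia_unitN (n + m))

theorem graph_reorder (τ : Equiv.Perm (Fin n)) (f : vEXC.Hom n) :
    graph (universalElements.reorder τ f) = Tg.rl τ (.refl _) (graph f) := by
  rw [graph, graph, Tg.rl_rl]
  refine (congrArg _ (dia_perm _ _)).trans ((Tg.rl_rl _ _ _ _ _).trans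
    (Tg.rl_congr (fun z => rfl) (fun z => ?_) _))
  simp [XCElements.reorder]

theorem insertUnit_eq (f : vEXC.Hom n) :
    universalElements.insertUnit f = vEXC.tensor f (vEXC.one 1) := by
  refine Prod.ext ?_ rfl
  have h : mk (XCTerm.unitN 1) = mk .unit := by
    have h := unit_tensor (mk .unit)
    exact (comp_id _).symm.trans (h.trans (id_comp _))
  have h' : f.1.comp (wl n (mk .unit)) = _ := (congrArg (fun v => comp v (wl n (mk .unit)))
    (tensor_unit f.1)).symm.trans (wr_wl f.1 (mk .unit))
  exact h'.trans (congrArg (tensor f.1) h.symm)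

end XCHom

namespace XCTangle

variable {n m : ℕ}

/-- The class of a tangle among all graphs. -/
def toTg : XCTangle n → Tg True (Fin n) (Fin n) :=
  Quot.lift (fun D => .mk True D.graph) fun _ _ h => Tg.sound_step h

theorem exists_rep (T : XCTangle n) : ∃ D, mk D = T := Quot.exists_rep T

open Classical in
theorem toTg_injective : Function.Injective (toTg (n := n)) := by
  let f : Tg True (Fin n) (Fin n) → Option (XCTangle n) :=
    Quot.lift (fun G => if h : G.IsOpen then some (mk ⟨G, h⟩) else none) fun G G' h => by
      have h : G.Step G' := by
        cases h with
        | iso f => exact .iso f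
        | zeroR e i j h f => exact .zeroR e i j h f
        | step _ h => exact h
      by_cases h1 : G.IsOpen
      · have h2 := h.isOpen_iff.1 h1
        simp only [h1, h2, dif_pos]
        exact congrArg some (Quot.sound h)
      · have h2 := mt h.isOpen_iff.2 h1
        simp only [h1, h2, dif_neg, not_false_eq_true]
  have hf : ∀ T : XCTangle n, f T.toTg = some T := fun T => by
    obtain ⟨D, rfl⟩ := T.exists_rep
    exact dif_pos D.isOpen
  intro T T' h
  have := congrArg f h
  rw [hf, hf] at this
  exact Option.some.inj this

theorem toTg_comp (T₂ T₁ : XCTangle n) : (comp T₂ T₁).toTg = Tg.seq T₁.toTg T₂.toTg := by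
  obtain ⟨D, rfl⟩ := T₁.exists_rep
  obtain ⟨E, rfl⟩ := T₂.exists_rep
  rfl

theorem toTg_tensor (T : XCTangle n) (T' : XCTangle m) :
    (tensor T T').toTg = Tg.rl finSumFinEquiv finSumFinEquiv (Tg.un T.toTg T'.toTg) := by
  obtain ⟨D, rfl⟩ := T.exists_rep
  obtain ⟨E, rfl⟩ := T'.exists_rep
  rfl

theorem toTg_reorder (τ : Equiv.Perm (Fin n)) (T : XCTangle n) :
    (reorder τ T).toTg = Tg.rl τ (.refl _) T.toTg := by
  obtain ⟨D, rfl⟩ := T.exists_rep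
  rfl

theorem toTg_ofPerm (σ : Equiv.Perm (Fin n)) :
    (ofPerm σ).toTg = Tg.rl (.refl _) σ (Tg.triv True (Fin n)) := by
  rw [← Tg.mk_strands_one]
  exact Tg.sound_iso
    { e := .refl _
      b := .refl _
      x := .refl _
      pos_eq := fun y => y.elim0
      rot_eq := fun _ => rfl
      src_eq := fun _ => rfl
      tgt_eq := fun _ => rfl }

theorem toTg_one : (ofPerm (1 : Equiv.Perm (Fin n))).toTg = Tg.triv True (Fin n) :=
  (toTg_ofPerm 1).trans (Tg.rl_refl _)

theorem toTg_tr (h : n = m) (T : txc.Hom n) :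
    toTg (txc.tr h T) = Tg.rl (finCongr h) (finCongr h) (toTg T) := by
  subst h
  exact (Tg.rl_refl _).symm

theorem exists_toTg (f : vEXC.Hom n) : ∃ T : XCTangle n, T.toTg = XCHom.graph f := by
  obtain ⟨D, hD⟩ := (XCHom.graph f).exists_rep
  refine ⟨mk ⟨D, D.value_isSome.1 ⟨Elts.elt f.1, f.2, ?_⟩⟩, hD⟩
  rw [← XCHom.value_graph, ← hD]
  rfl

end XCTangle

namespace Tg

variable {P : Prop} {O I K L : Type}

theorem seq_rl_triv [Finite K] (i : K ≃ I) (x : Tg P O K) :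
    seq x (rl (.refl _) i (triv P K)) = rl (.refl _) i x := by
  have h := seq_rl (.refl _) (.refl _) i x (triv P K)
  rwa [rl_refl, seq_triv] at h

theorem rl_triv_seq [Finite K] (k : K ≃ L) (y : Tg P L I) :
    seq (rl (.refl _) k (triv P K)) y = rl k.symm (.refl _) y := by
  have h := seq_rl (.refl _) k (.refl _) (triv P K) (rl k.symm (.refl _) y)
  rwa [triv_seq, rl_refl, rl_rl, rl_id (by simp) (by simp)] at h

theorem un_triv_fin_zero (x : Tg P O I) :
    rl (Equiv.sumEmpty _ _) (Equiv.sumEmpty _ _) (un x (triv P (Fin 0))) = x := by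
  rw [← triv_rl (Equiv.equivOfIsEmpty Empty (Fin 0)), triv_empty, un_rl_right, rl_rl]
  refine (rl_congr (fun z => ?_) (fun z => ?_) _).trans (un_nil x) <;>
    rcases z with z | z <;> first | rfl | exact z.elim

end Tg

namespace XCTangle

variable {n m k : ℕ}

theorem toTg_txc_comp (f g : txc.Hom n) : toTg (txc.comp f g) = Tg.seq (toTg g) (toTg f) :=
  toTg_comp f g

theorem toTg_txc_tensor (f : txc.Hom n) (g : txc.Hom m) :
    toTg (txc.tensor f g) = Tg.rl finSumFinEquiv finSumFinEquiv (Tg.un (toTg f) (toTg g)) :=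
  toTg_tensor f g

theorem toTg_txc_one (n : ℕ) : toTg (txc.one n) = Tg.triv True (Fin n) := toTg_one

theorem toTg_txc_braid (n m : ℕ) :
    toTg (txc.braid n m) = Tg.rl (.refl _) (blockSwap n m) (Tg.triv True (Fin (n + m))) :=
  toTg_ofPerm _

theorem comp_ofPerm (σ τ : Equiv.Perm (Fin n)) :
    comp (ofPerm σ) (ofPerm τ) = ofPerm (σ * τ) := toTg_injective (by
  rw [toTg_comp, toTg_ofPerm, toTg_ofPerm, toTg_ofPerm, Tg.seq_rl_triv, Tg.rl_rl]
  rfl)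

theorem tensor_ofPerm (σ : Equiv.Perm (Fin n)) (τ : Equiv.Perm (Fin m)) :
    tensor (ofPerm σ) (ofPerm τ) = ofPerm (blockSum σ τ) := toTg_injective (by
  rw [toTg_tensor, toTg_ofPerm, toTg_ofPerm, toTg_ofPerm, Tg.un_rl, Tg.rl_rl, Tg.triv_sum,
    ← Tg.triv_rl finSumFinEquiv, Tg.rl_rl]
  refine Tg.rl_congr (fun z => by rcases z with z | z <;> rfl) (fun z => ?_) _
  rw [Equiv.trans_apply, Equiv.trans_apply, blockSum, Equiv.trans_apply, Equiv.trans_apply,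
    Equiv.symm_apply_apply])

theorem tr_ofPerm (h : n = m) (σ : Equiv.Perm (Fin n)) :
    txc.tr h (ofPerm σ) = ofPerm ((finCongr h).symm.trans (σ.trans (finCongr h))) := by
  subst h
  rfl

theorem blockSwap_finSumFinEquiv (z : Fin n ⊕ Fin m) : blockSwap n m (finSumFinEquiv z)
    = finCongr (Nat.add_comm m n) (finSumFinEquiv z.swap) := by
  simp [blockSwap, finAddFlip, -finSumFinEquiv_apply_left, -finSumFinEquiv_apply_right]

theorem blockSwap_mul (n m : ℕ) :
    (finCongr (Nat.add_comm m n)).symm.trans ((blockSwap m n).trans (finCongr (Nat.add_comm m n)))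
      * blockSwap n m = 1 := by
  refine Equiv.ext fun z => ?_
  obtain ⟨z, rfl⟩ := finSumFinEquiv.surjective z
  rw [Equiv.Perm.mul_apply, blockSwap_finSumFinEquiv]
  refine (congrArg (finCongr (Nat.add_comm m n)) (blockSwap_finSumFinEquiv z.swap)).trans ?_
  rw [Sum.swap_swap]
  rfl

theorem blockSwap_hexagon (n m k : ℕ) (h : m + (n + k) = n + m + k) :
    (finCongr (Nat.add_assoc n m k).symm).symm.trans
        ((blockSwap n (m + k)).trans (finCongr (Nat.add_assoc n m k).symm))
      = (finCongr h).symm.trans ((blockSum 1 (blockSwap n k)).trans (finCongr h))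
        * blockSum (blockSwap n m) 1 := by
  have swap : ∀ (a b : ℕ) (i : Fin (a + b)),
      (blockSwap a b i : ℕ) = if (i : ℕ) < a then b + i else i - a := fun a b => StrandPerm.brE_val
  have sum : ∀ {a b : ℕ} (σ : Equiv.Perm (Fin a)) (τ : Equiv.Perm (Fin b)) (i : Fin (a + b)),
      (blockSum σ τ i : ℕ) = if h : (i : ℕ) < a then (σ ⟨i, h⟩ : ℕ)
        else a + (τ ⟨i - a, by omega⟩ : ℕ) := fun σ τ => StrandPerm.sumE_val σ τ
  refine Equiv.ext fun z => Fin.ext ?_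
  show (blockSwap n (m + k) (Fin.cast (Nat.add_assoc n m k) z) : ℕ)
    = (blockSum 1 (blockSwap n k) (Fin.cast h.symm (blockSum (blockSwap n m) 1 z)) : ℕ)
  simp only [swap, sum, Fin.val_cast, Equiv.Perm.one_apply]
  split_ifs <;> omega

theorem txc_isStrictSymmetricMonoidal : txc.IsStrictSymmetricMonoidal where
  one_comp f := toTg_injective (by rw [toTg_txc_comp, toTg_txc_one, Tg.seq_triv])
  comp_one f := toTg_injective (by rw [toTg_txc_comp, toTg_txc_one, Tg.triv_seq])
  comp_assoc f g h := toTg_injective (by simp only [toTg_txc_comp, Tg.seq_assoc])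
  tensor_one n m := (tensor_ofPerm 1 1).trans (congrArg ofPerm (Equiv.ext fun z => by simp [blockSum]))
  tensor_comp f f' g g' := toTg_injective (by
    simp only [toTg_txc_comp, toTg_txc_tensor, Tg.seq_rl, Tg.un_seq])
  tensor_assoc f g h := toTg_injective (by
    rw [toTg_tr, toTg_txc_tensor, toTg_txc_tensor, toTg_txc_tensor, toTg_txc_tensor, Tg.rl_un,
      Tg.un_rl_right, ← Tg.un_assoc, Tg.rl_rl, Tg.rl_rl, Tg.rl_rl, Tg.rl_rl]
    refine Tg.rl_congr (fun z => ?_) (fun z => ?_) _ <;> rcases z with (z | z) | z <;>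
      exact Fin.ext (by simp [Nat.add_assoc]))
  unit_tensor f := toTg_injective (by
    rw [toTg_tr, toTg_txc_tensor, toTg_txc_one, ← Tg.un_comm, Tg.rl_rl, Tg.rl_rl]
    refine (Tg.rl_congr (fun z => ?_) (fun z => ?_) _).trans (Tg.un_triv_fin_zero _) <;>
    · rcases z with z | z
      · exact Fin.ext (by simp)
      · exact z.elim0)
  tensor_unit f := toTg_injective (by
    rw [toTg_tr, toTg_txc_tensor, toTg_txc_one, Tg.rl_rl]
    refine (Tg.rl_congr (fun z => ?_) (fun z => ?_) _).trans (Tg.un_triv_fin_zero _) <;>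
    · rcases z with z | z
      · rfl
      · exact z.elim0)
  braid_natural f g := toTg_injective (by
    rw [toTg_txc_comp, toTg_txc_comp, toTg_tr, toTg_txc_tensor, toTg_txc_tensor, toTg_txc_braid,
      Tg.seq_rl_triv, Tg.rl_triv_seq, ← Tg.un_comm (toTg f), Tg.rl_rl, Tg.rl_rl, Tg.rl_rl, Tg.rl_rl]
    refine Tg.rl_congr (fun z => ?_) (fun z => ?_) _
    · exact (Equiv.symm_apply_eq _).2 (blockSwap_finSumFinEquiv z).symm |>.symm
    · exact blockSwap_finSumFinEquiv z)
  braid_braid n m := by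
    show txc.comp (txc.tr _ (ofPerm _)) (ofPerm _) = ofPerm 1
    exact (congrArg (fun T => comp T _) (tr_ofPerm _ _)).trans ((comp_ofPerm _ _).trans
      (congrArg ofPerm (blockSwap_mul n m)))
  hexagon n m k := by
    show txc.tr _ (ofPerm _) = txc.comp (txc.tr _ (txc.tensor (ofPerm 1) (ofPerm _)))
      (txc.tensor (ofPerm _) (ofPerm 1))
    refine (tr_ofPerm _ _).trans ((congrArg ofPerm (blockSwap_hexagon n m k (by omega))).trans ?_)
    exact (comp_ofPerm _ _).symm.trans (congrArg₂ comp ((tr_ofPerm _ _).symm.trans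
      (congrArg (txc.tr _) (tensor_ofPerm _ _).symm)) (tensor_ofPerm _ _).symm)

end XCTangle

namespace XCGraph

variable {O I : Type}

theorem exists_strandEndsAt {D : XCGraph O I} (h : D.IsOpen) (o : O) : ∃ i, D.StrandEndsAt o i := by
  obtain ⟨e, he⟩ := D.src.surjective (.inl o)
  have irr : Std.Irrefl (flip (Relation.TransGen D.Next)) := ⟨h⟩
  have tr : IsTrans D.E (flip (Relation.TransGen D.Next)) := ⟨fun _ _ _ h h' => h'.trans h⟩
  have wf : WellFounded (flip (Relation.TransGen D.Next)) :=
    Finite.wellFounded_of_trans_of_irrefl _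
  have key : ∀ f, ∃ g i, Relation.ReflTransGen D.Next f g ∧ D.tgt g = .inl i := by
    intro f
    induction f using wf.induction with
    | _ f ih =>
      have step : ∀ g, D.Next f g → ∃ g i, Relation.ReflTransGen D.Next f g ∧ D.tgt g = .inl i := by
        intro g hg
        obtain ⟨g', i, h1, h2⟩ := ih g (.single hg)
        exact ⟨g', i, .head hg h1, h2⟩
      rcases ht : D.tgt f with i | b | ⟨x, s⟩
      · exact ⟨f, i, .refl, ht⟩
      · exact step (D.src.symm (.inr (.inl b))) (.inl ⟨b, ht, D.src.apply_symm_apply _⟩)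
      · exact step (D.src.symm (.inr (.inr (x, !s)))) (.inr ⟨x, s, ht, D.src.apply_symm_apply _⟩)
  obtain ⟨g, i, h1, h2⟩ := key e
  exact ⟨i, e, g, he, h1, h2⟩

/-- Closing a strand gives a graph which is not open. -/
theorem not_isOpen_of_strandEndsAt {D : XCGraph (O ⊕ Unit) (I ⊕ Unit)}
    (h : D.StrandEndsAt (.inr ()) (.inr ())) : ¬ D.glue.IsOpen := by
  obtain ⟨e, f, he, hf, ht⟩ := h
  have lift : ∀ y z : D.E, D.Next y z → D.glue.Next y z := by
    rintro y z (⟨b, h1, h2⟩ | ⟨x, s, h1, h2⟩)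
    · exact .inl ⟨.inl b, congrArg (gluePorts _ _ _ _) h1, congrArg (gluePorts _ _ _ _) h2⟩
    · exact .inr ⟨x, s, congrArg (gluePorts _ _ _ _) h1, congrArg (gluePorts _ _ _ _) h2⟩
  have last : D.glue.Next f e :=
    .inl ⟨.inr (), congrArg (gluePorts _ _ _ _) ht, congrArg (gluePorts _ _ _ _) he⟩
  exact fun ho => ho e (Relation.TransGen.tail' (Relation.ReflTransGen.mono lift _ _ hf) last)

theorem strandEndsAt_relabel {D : XCGraph O I} {o : O} {i : I} (h : D.StrandEndsAt o i)
    {O' I' : Type} (a : O ≃ O') (b : I ≃ I') : (D.relabel a b).StrandEndsAt (a o) (b i) := by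
  obtain ⟨e, f, he, hf, ht⟩ := h
  refine ⟨e, f, congrArg (Sum.map a _root_.id) he, Relation.ReflTransGen.mono ?_ _ _ hf,
    congrArg (Sum.map b _root_.id) ht⟩
  rintro y z (⟨c, h1, h2⟩ | ⟨x, s, h1, h2⟩)
  · exact .inl ⟨c, congrArg (Sum.map b _root_.id) h1, congrArg (Sum.map a _root_.id) h2⟩
  · exact .inr ⟨x, s, congrArg (Sum.map b _root_.id) h1, congrArg (Sum.map a _root_.id) h2⟩

/-- The permutation in the value of a graph says where the strands end. -/
theorem value_strandEndsAt {n : ℕ} {D : XCGraph (Fin (n + 1)) (Fin (n + 1))} {u : Elts (Fin (n + 1))}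
    {σ : Fin (n + 1) ≃ Fin (n + 1)} (hD : D.value = SElts.ofElt u σ) {o i : Fin (n + 1)}
    (h : D.StrandEndsAt o i) : σ o = i := by
  by_contra hne
  have hr : ∀ p : Fin (n + 1), XCTangle.removeIndex p p = .inr () := fun p => by
    simp [XCTangle.removeIndex]
  let a := XCTangle.removeIndex o
  let b := XCTangle.removeIndex i
  have h' := strandEndsAt_relabel h a b
  rw [hr, hr] at h'
  refine not_isOpen_of_strandEndsAt h' ((value_isSome _).1 ?_)
  rw [value_glue, value_relabel, hD, SElts.rl_ofElt, SElts.glue_unit]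
  let τ : Fin n ⊕ Unit ≃ Fin n ⊕ Unit := a.symm.trans (σ.trans b)
  rcases hz : τ.symm (.inr ()) with z | z
  · exact ⟨_, _, SElts.glue1_ofElt _ (a := z) (by rw [← hz]; exact τ.apply_symm_apply _)⟩
  · refine (hne (b.injective ?_)).elim
    rw [hr, ← τ.apply_symm_apply (.inr ()), hz, ← hr o]
    simp [τ, a]

end XCGraph

namespace XCTangle

variable {n : ℕ}

theorem removeIndex_of_eq_some {p x : Fin (n + 1)} {j : Fin n} (h : finSuccEquiv' p x = some j) :
    removeIndex p x = .inl j := by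
  simp [removeIndex, h]

theorem succAbove_castSucc_last (n : ℕ) :
    (Fin.last n).castSucc.succAbove (Fin.last n) = Fin.last (n + 1) := by
  ext
  simp [Fin.succAbove]

theorem succAbove_castSucc_castSucc (i : Fin n) :
    (Fin.last n).castSucc.succAbove i.castSucc = i.castSucc.castSucc := by
  ext
  simp [Fin.succAbove]

theorem removeIndex_castSucc_last (n : ℕ) :
    removeIndex (Fin.last n).castSucc = XCTerm.mulLastStart n := by
  refine Equiv.ext fun z => ?_
  induction z using Fin.lastCases with
  | last =>
    rw [XCTerm.mulLastStart_last]
    refine removeIndex_of_eq_some ?_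
    rw [← succAbove_castSucc_last, finSuccEquiv'_succAbove]
  | cast z =>
    induction z using Fin.lastCases with
    | last =>
      rw [XCTerm.mulLastStart_castSucc_last]
      simp [removeIndex]
    | cast z =>
      rw [XCTerm.mulLastStart_castSucc_castSucc]
      refine removeIndex_of_eq_some ?_
      rw [← succAbove_castSucc_castSucc, finSuccEquiv'_succAbove]

theorem removeIndex_apply_last (σ : Equiv.Perm (Fin (n + 2))) (z : Fin (n + 2)) :
    removeIndex (σ (Fin.last (n + 1))) (σ z) = Sum.map
      (Equiv.removeNone (((finSuccEquiv' (Fin.last n).castSucc).symm.trans σ).trans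
        (finSuccEquiv' (σ (Fin.last (n + 1)))))) _root_.id (XCTerm.mulLastEnd n z) := by
  induction z using Fin.lastCases with
  | last =>
    rw [XCTerm.mulLastEnd_last]
    simp [removeIndex]
  | cast z =>
    induction z using Fin.lastCases with
    | last =>
      rw [XCTerm.mulLastEnd_castSucc_last]
      refine removeIndex_of_eq_some ((Equiv.removeNone_none _ ?_).trans (by simp)).symm
      rw [Equiv.trans_apply, Equiv.trans_apply, finSuccEquiv'_symm_some, succAbove_castSucc_last,
        finSuccEquiv'_at]
    | cast z =>
      rw [XCTerm.mulLastEnd_castSucc_castSucc]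
      have h : (((finSuccEquiv' (Fin.last n).castSucc).symm.trans σ).trans
          (finSuccEquiv' (σ (Fin.last (n + 1))))) (some z.castSucc)
            = finSuccEquiv' (σ (Fin.last (n + 1))) (σ z.castSucc.castSucc) := by
        rw [Equiv.trans_apply, Equiv.trans_apply, finSuccEquiv'_symm_some,
          succAbove_castSucc_castSucc]
      refine removeIndex_of_eq_some ((Equiv.removeNone_some _ ?_).trans h).symm
      rw [h]
      refine Option.ne_none_iff_exists'.1 fun hn => ?_
      have := σ.injective (finSuccEquiv'_eq_none.1 hn)
      exact absurd this (Fin.castSucc_lt_last _).ne'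

theorem graph_merge (f : vEXC.Hom (n + 2)) : XCHom.graph (universalElements.merge f)
    = Tg.gl Unit (Tg.rl (removeIndex (Fin.last n).castSucc) (removeIndex (f.2 (Fin.last (n + 1))))
        (XCHom.graph f)) := by
  obtain ⟨u, σ⟩ := f
  refine (congrArg _ (XCHom.dia_merge u)).trans ((Tg.gl_rl _ _ _).trans ?_)
  refine (congrArg _ ((Tg.rl_rl _ _ _ _ _).trans (Tg.rl_congr (fun z => ?_) (fun z => ?_) _))).trans
    (congrArg _ (Tg.rl_rl _ _ _ _ _).symm)
  · rw [removeIndex_castSucc_last]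
    rcases h : XCTerm.mulLastStart n z with y | y <;> simp [h]
  · exact (removeIndex_apply_last σ z).symm

end XCTangle

namespace XCGraph

theorem strandEndsAt_of_value {n : ℕ} {D : XCGraph (Fin (n + 1)) (Fin (n + 1))}
    {u : Elts (Fin (n + 1))} {σ : Fin (n + 1) ≃ Fin (n + 1)} (hD : D.value = SElts.ofElt u σ)
    (o : Fin (n + 1)) : D.StrandEndsAt o (σ o) := by
  obtain ⟨i, hi⟩ := exists_strandEndsAt (D.value_isSome.1 ⟨u, σ, hD⟩) o
  rwa [value_strandEndsAt hD hi]

end XCGraph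

theorem SElts.exists_ofElt {O I : Type} {x : SElts O I} (h : x ≠ none) : ∃ u σ, x = ofElt u σ := by
  obtain ⟨⟨u, σ⟩, rfl⟩ := Option.ne_none_iff_exists'.1 h
  exact ⟨u, σ, rfl⟩

namespace XCTangle

/-- The property holds for the generators and is preserved by the operations on XC-tangles. -/
structure IsClosed (p : ∀ {n : ℕ}, XCTangle n → Prop) : Prop where
  ofPerm : ∀ {n : ℕ} (σ : Equiv.Perm (Fin n)), p (.ofPerm σ)
  X : ∀ s, p (.X s)
  C : ∀ r, p (.C r)
  comp : ∀ {n : ℕ} {T T' : XCTangle n}, p T → p T' → p (T.comp T')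
  tensor : ∀ {n m : ℕ} {T : XCTangle n} {T' : XCTangle m}, p T → p T' → p (T.tensor T')
  reorder : ∀ {n : ℕ} (τ : Equiv.Perm (Fin n)) {T : XCTangle n}, p T → p (T.reorder τ)
  merge : ∀ {n : ℕ} {T : XCTangle (n + 2)} {T' : XCTangle (n + 1)}, T.IsMerge T' → p T → p T'

end XCTangle

namespace Tg

open XCGraph

variable {O I O' I' K : Type} {p : ∀ {n : ℕ}, XCTangle n → Prop}

/-- The graph is, up to renaming, an XC-tangle with the property `p`. -/
def Named (p : ∀ {n : ℕ}, XCTangle n → Prop) (x : Tg True O I) : Prop :=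
  ∃ (n : ℕ) (e : O ≃ Fin n) (f : I ≃ Fin n) (T : XCTangle n), T.toTg = rl e f x ∧ p T

theorem Named.rl {x : Tg True O I} (h : Named p x) (o : O ≃ O') (i : I ≃ I') :
    Named p (Tg.rl o i x) := by
  obtain ⟨n, e, f, T, h, hT⟩ := h
  refine ⟨n, o.symm.trans e, i.symm.trans f, T, ?_, hT⟩
  rw [h, rl_rl]
  exact rl_congr (fun _ => by simp) (fun _ => by simp) _

theorem named_toTg {n : ℕ} {T : XCTangle n} (h : p T) : Named p T.toTg :=
  ⟨n, .refl _, .refl _, T, (rl_refl _).symm, h⟩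

theorem exists_sumCongr {A B : Type} (g : A ⊕ Unit ≃ B ⊕ Unit) (h : g (.inr ()) = .inr ()) :
    ∃ e : A ≃ B, ∀ z, g z = Equiv.sumCongr e (.refl _) z := by
  refine ⟨SElts.ctr g, ?_⟩
  rintro (z | z)
  · rcases hz : g (.inl z) with y | y
    · exact congrArg Sum.inl (SElts.ctr_of_inl hz).symm
    · exact absurd (g.injective (hz.trans h.symm)) (by simp)
  · exact h

theorem Named.un (hp : XCTangle.IsClosed p) {x : Tg True O I} {y : Tg True O' I'} (h : Named p x)
    (h' : Named p y) : Named p (Tg.un x y) := by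
  obtain ⟨n, e, f, T, h, hT⟩ := h
  obtain ⟨n', e', f', T', h', hT'⟩ := h'
  refine ⟨n + n', (Equiv.sumCongr e e').trans finSumFinEquiv,
    (Equiv.sumCongr f f').trans finSumFinEquiv, T.tensor T', ?_, hp.tensor hT hT'⟩
  rw [XCTangle.toTg_tensor, h, h', un_rl, rl_rl]

theorem named_nil (hp : XCTangle.IsClosed p) : Named p (nil True) := by
  refine ⟨0, Equiv.equivOfIsEmpty _ _, Equiv.equivOfIsEmpty _ _, .ofPerm 1, ?_, hp.ofPerm 1⟩
  rw [XCTangle.toTg_one, ← triv_empty, triv_rl]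

theorem Named.gl_unit (hp : XCTangle.IsClosed p) {x : Tg True (O ⊕ Unit) (I ⊕ Unit)}
    (h : Named p x) (hx : (gl Unit x).value ≠ none) : Named p (gl Unit x) := by
  obtain ⟨n, e, f, T, h, hT⟩ := h
  obtain ⟨D, rfl⟩ := T.exists_rep
  obtain ⟨u, σ, hσ⟩ := D.graph.value_isSome.2 D.isOpen
  have hv : SElts.ofElt u σ = SElts.rl e f x.value := by
    rw [← hσ, ← value_rl, ← h]
    rfl
  have ne : e (.inr ()) ≠ σ.symm (f (.inr ())) := fun h => hx (by
    have hv := congrArg (SElts.rl e.symm f.symm) hv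
    rw [SElts.rl_rl, SElts.rl_id (by simp) (by simp), SElts.rl_ofElt] at hv
    rw [value_gl, ← hv, SElts.glue_unit]
    exact SElts.glue1_loop _ (by simp [h]))
  rcases n with _ | _ | m
  · exact (e (.inr ())).elim0
  · exact (ne (Subsingleton.elim (α := Fin 1) _ _)).elim
  · obtain ⟨τ, hτ, hτ'⟩ : ∃ τ : Equiv.Perm (Fin (m + 2)), τ (e (.inr ())) = (Fin.last m).castSucc ∧
        τ (σ.symm (f (.inr ()))) = Fin.last (m + 1) := by
      have h1 : (Fin.last m).castSucc ≠ Fin.last (m + 1) := (Fin.castSucc_lt_last _).ne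
      obtain ⟨τ, hτ⟩ := Equiv.Perm.exists_extending_pair
        ![e (.inr ()), σ.symm (f (.inr ()))] ![(Fin.last m).castSucc, Fin.last (m + 1)]
        (by simpa [Function.Injective, Fin.forall_fin_two, eq_comm] using ne)
        (by simpa [Function.Injective, Fin.forall_fin_two, eq_comm] using h1)
      exact ⟨τ, hτ 0, hτ 1⟩
    have hr : ∀ q : Fin (m + 2), XCTangle.removeIndex q q = .inr () := fun q => by
      simp [XCTangle.removeIndex]
    let q := f (.inr ())
    obtain ⟨e', he⟩ := exists_sumCongr (e.trans (τ.trans (XCTangle.removeIndex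
      (Fin.last m).castSucc))) (by rw [Equiv.trans_apply, Equiv.trans_apply, hτ, hr])
    obtain ⟨f', hf⟩ := exists_sumCongr (f.trans (XCTangle.removeIndex q)) (hr q)
    let D' := D.graph.relabel τ (.refl _)
    let G := (D'.relabel (XCTangle.removeIndex (Fin.last m).castSucc) (XCTangle.removeIndex q)).glue
    have hG : mk True G = Tg.rl e' f' (gl Unit x) := by
      have h : mk True D.graph = Tg.rl e f x := h
      show gl Unit (Tg.rl _ _ (Tg.rl _ _ (mk True D.graph))) = _
      rw [h, rl_rl, rl_rl, gl_rl]
      exact congrArg _ (rl_congr he hf _)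
    have hq : D'.StrandEndsAt (Fin.last (m + 1)) q := by
      have h := strandEndsAt_relabel (strandEndsAt_of_value hσ (σ.symm q)) τ (.refl _)
      rw [hτ', Equiv.apply_symm_apply] at h
      exact h
    have hopen : G.IsOpen := by
      obtain ⟨v, ρ, hv⟩ := SElts.exists_ofElt hx
      refine G.value_isSome.1 ⟨v.map e', e'.symm.trans (ρ.trans f'), ?_⟩
      rw [← SElts.rl_ofElt, ← hv, ← value_rl, ← hG]
      rfl
    refine ⟨m + 1, e', f', .mk ⟨G, hopen⟩, hG, hp.merge ?_ (hp.reorder τ hT)⟩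
    exact ⟨⟨D', relabel_isOpen D.isOpen _ _⟩, ⟨G, hopen⟩, rfl, rfl, q, hq, ⟨.refl G⟩⟩

theorem Named.gl (hp : XCTangle.IsClosed p) (K : Type) [Finite K] :
    ∀ {O I : Type} {x : Tg True (O ⊕ K) (I ⊕ K)}, Named p x → (Tg.gl K x).value ≠ none →
      Named p (Tg.gl K x) := by
  refine SElts.finite_sum_induction (p := fun K => ∀ {O I : Type} {x : Tg True (O ⊕ K) (I ⊕ K)},
    Named p x → (Tg.gl K x).value ≠ none → Named p (Tg.gl K x)) (fun {K K'} k ih O I x h h' => ?_)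
    (fun {O I x} h _ => ?_) (fun K _ ih O I x h h' => ?_) K
  · rw [← gl_reindex k.symm] at h' ⊢
    exact ih (h.rl _ _) h'
  · rw [gl_of_isEmpty]
    exact h.rl _ _
  · obtain ⟨x, rfl⟩ : ∃ y, x = Tg.rl (Equiv.sumAssoc _ _ _) (Equiv.sumAssoc _ _ _) y :=
      ⟨Tg.rl (Equiv.sumAssoc _ _ _).symm (Equiv.sumAssoc _ _ _).symm x, by
        rw [rl_rl, rl_id] <;> simp⟩
    have h0 := h.rl (Equiv.sumAssoc O K Unit).symm (Equiv.sumAssoc I K Unit).symm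
    rw [rl_rl, rl_id (by simp) (by simp)] at h0
    rw [← gl_gl] at h' ⊢
    have h1 : (Tg.gl Unit x).value ≠ none := fun e => h' (by rw [value_gl, e, SElts.glue_none])
    exact ih (h0.gl_unit hp h1) h'

theorem named_lines (hp : XCTangle.IsClosed p) {E : Type} [Finite E] (rot : E → SignType) :
    Named p (mk True (lines rot)) := by
  have h : ∀ h : Finite E, ∀ rot : E → SignType, Named p (mk True (lines rot)) := by
    refine SElts.finite_sum_induction (p := fun E => ∀ h : Finite E, ∀ rot : E → SignType,
      Named p (mk True (lines rot))) (fun {K K'} k ih h rot => ?_) (fun _ rot => ?_)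
      (fun K _ ih h rot => ?_) E
    · have := Finite.of_equiv _ k.symm
      rw [mk_lines_equiv k]
      exact (ih this _).rl _ _
    · rw [mk_lines_empty]
      exact named_nil hp
    · rw [mk_lines_sum, mk_lines_unit]
      exact (ih inferInstance _).un hp ((named_toTg (hp.C _)).rl _ _)
  exact h inferInstance rot

theorem named_crosses (hp : XCTangle.IsClosed p) {X : Type} [Finite X] (pos : X → Bool) :
    Named p (mk True (crosses pos)) := by
  have h : ∀ h : Finite X, ∀ pos : X → Bool, Named p (mk True (crosses pos)) := by
    refine SElts.finite_sum_induction (p := fun X => ∀ h : Finite X, ∀ pos : X → Bool,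
      Named p (mk True (crosses pos))) (fun {K K'} k ih h pos => ?_) (fun _ pos => ?_)
      (fun K _ ih h pos => ?_) X
    · have := Finite.of_equiv _ k.symm
      rw [mk_crosses_equiv k]
      exact (ih this _).rl _ _
    · rw [mk_crosses_empty]
      exact (named_nil hp).rl _ _
    · rw [mk_crosses_sum, mk_crosses_unit]
      exact ((ih inferInstance _).un hp ((named_toTg (hp.X _)).rl _ _)).rl _ _
  exact h inferInstance pos

end Tg

namespace XCTangle

variable {n m : ℕ}

/-- XC-tangles are generated by crossings and single edges. -/
theorem IsClosed.all {p : ∀ {n : ℕ}, XCTangle n → Prop} (hp : IsClosed p) (T : XCTangle n) : p T := by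
  have h : Tg.Named p T.toTg := by
    obtain ⟨D, rfl⟩ := T.exists_rep
    obtain ⟨u, σ, hv⟩ := D.graph.value_isSome.2 D.isOpen
    have hv : (Tg.mk True D.graph).value = SElts.ofElt u σ := hv
    show Tg.Named p (Tg.mk True D.graph)
    rw [Tg.mk_eq_gl] at hv ⊢
    exact (((Tg.named_lines hp _).un hp (Tg.named_crosses hp _)).rl _ _).gl hp _
      (by rw [hv]; exact nofun)
  obtain ⟨k, e, f, T', h, hT⟩ := h
  obtain rfl : n = k := by simpa using Fintype.card_congr e
  have h' : T = XCTangle.comp (.ofPerm f.symm) (.reorder e.symm T') := toTg_injective (by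
    rw [toTg_comp, toTg_ofPerm, Tg.seq_rl_triv, toTg_reorder, h, Tg.rl_rl, Tg.rl_rl, Tg.rl_id] <;>
      simp)
  rw [h']
  exact hp.comp (hp.ofPerm _) (hp.reorder _ hT)

theorem graph_X : XCHom.graph (XCHom.mk .R, Equiv.swap 0 1) = (X true).toTg := by
  have h : XCTerm.dia True .R = Tg.rl (.refl _) (.swap 0 1) (X true).toTg := XCTerm.dia_R
  show Tg.rl (.refl _) (.swap 0 1) (XCTerm.dia True .R) = _
  rw [h, Tg.rl_rl]
  exact Tg.rl_id (fun _ => rfl) (by decide) _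

theorem graph_X_neg : XCHom.graph (XCHom.mk (.comp .Rinv (.braid 1 1)), Equiv.swap 0 1)
    = (X false).toTg := by
  have h : XCTerm.dia True (.comp .Rinv (.braid 1 1)) = Tg.rl (StrandPerm.brE 1 1)
      (StrandPerm.brE 1 1) (Tg.rl (.swap 0 1) (.refl _) (X false).toTg) :=
    XCTerm.dia_braid_mk XCTerm.dia_Rinv
  show Tg.rl (.refl _) (.swap 0 1) (XCTerm.dia True (.comp .Rinv (.braid 1 1))) = _
  rw [h, Tg.rl_rl, Tg.rl_rl]
  exact Tg.rl_id (by decide) (by decide) _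

theorem graph_C : XCHom.graph (XCHom.mk .kappaInv, 1) = (C 1).toTg :=
  (Tg.rl_refl _).trans XCTerm.dia_kappaInv

theorem graph_C_neg : XCHom.graph (XCHom.mk .kappa, 1) = (C (-1)).toTg :=
  (Tg.rl_refl _).trans XCTerm.dia_kappa

theorem graph_merge_of_isMerge {T : XCTangle (n + 2)} {T' : XCTangle (n + 1)} (h : T.IsMerge T')
    {f : vEXC.Hom (n + 2)} (hf : XCHom.graph f = T.toTg) :
    XCHom.graph (universalElements.merge f) = T'.toTg := by
  obtain ⟨D, D', rfl, rfl, q, hq, ⟨i⟩⟩ := h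
  have hv : D.graph.value = _ := (congrArg Tg.value hf).symm.trans (XCHom.value_graph f)
  have hq : f.2 (Fin.last (n + 1)) = q := XCGraph.value_strandEndsAt hv hq
  rw [graph_merge, hf, hq]
  exact Tg.sound_iso i

theorem exists_graph (T : XCTangle n) : ∃ f, XCHom.graph f = T.toTg :=
  IsClosed.all (p := fun {n} T => ∃ f : vEXC.Hom n, XCHom.graph f = T.toTg)
    { ofPerm := fun {n} σ => ⟨(XCHom.mk (XCTerm.unitN n), σ),
        (congrArg _ (XCTerm.dia_unitN n)).trans (toTg_ofPerm σ).symm⟩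
      X := fun s => by
        cases s
        exacts [⟨_, graph_X_neg⟩, ⟨_, graph_X⟩]
      C := fun r => by
        rcases r with _ | _ | _
        exacts [⟨(XCHom.mk .unit, 1), (Tg.rl_refl _).trans XCTerm.dia_unit_eq⟩, ⟨_, graph_C_neg⟩,
          ⟨_, graph_C⟩]
      comp := by
        rintro n T T' ⟨f, hf⟩ ⟨g, hg⟩
        exact ⟨vEXC.comp f g, by rw [XCHom.graph_comp, hf, hg, toTg_comp]⟩
      tensor := by
        rintro n m T T' ⟨f, hf⟩ ⟨g, hg⟩
        exact ⟨vEXC.tensor f g, by rw [XCHom.graph_tensor, hf, hg, toTg_tensor]⟩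
      reorder := by
        rintro n τ T ⟨f, hf⟩
        exact ⟨universalElements.reorder τ f, by rw [XCHom.graph_reorder, hf, toTg_reorder]⟩
      merge := by
        rintro n T T' h ⟨f, hf⟩
        exact ⟨_, graph_merge_of_isMerge h hf⟩ } T

/-- The element represented by a tangle. -/
noncomputable def invariant (T : XCTangle n) : vEXC.Hom n := T.exists_graph.choose

theorem graph_invariant (T : XCTangle n) : XCHom.graph T.invariant = T.toTg := T.exists_graph.choose_spec

theorem invariant_eq_iff {T : XCTangle n} {f : vEXC.Hom n} :
    T.invariant = f ↔ T.toTg = XCHom.graph f := by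
  rw [← graph_invariant]
  exact XCHom.graph_injective.eq_iff.symm

theorem invariant_injective : Function.Injective (invariant (n := n)) := fun T T' h =>
  toTg_injective (by rw [← graph_invariant, h, graph_invariant])

theorem invariant_surjective : Function.Surjective (invariant (n := n)) := fun f => by
  obtain ⟨T, h⟩ := exists_toTg f
  exact ⟨T, invariant_eq_iff.2 h⟩

theorem invariant_one : invariant (txc.one n) = vEXC.one n :=
  invariant_eq_iff.2 (toTg_one.trans XCHom.graph_one.symm)

theorem invariant_comp (T T' : XCTangle n) :
    invariant (txc.comp T T') = vEXC.comp T.invariant T'.invariant :=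
  invariant_eq_iff.2 (by rw [XCHom.graph_comp, graph_invariant, graph_invariant]; exact toTg_comp T T')

theorem invariant_tensor (T : XCTangle n) (T' : XCTangle m) :
    invariant (txc.tensor T T') = vEXC.tensor T.invariant T'.invariant :=
  invariant_eq_iff.2 (by
    rw [XCHom.graph_tensor, graph_invariant, graph_invariant]; exact toTg_tensor T T')

theorem invariant_braid (n m : ℕ) : invariant (txc.braid n m) = vEXC.braid n m :=
  invariant_eq_iff.2 ((toTg_ofPerm _).trans (XCHom.graph_braid n m).symm)

theorem invariant_reorder (τ : Equiv.Perm (Fin n)) (T : XCTangle n) :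
    invariant (T.reorder τ) = universalElements.reorder τ T.invariant :=
  invariant_eq_iff.2 (by rw [XCHom.graph_reorder, graph_invariant, toTg_reorder])

theorem invariant_insertEdge (T : XCTangle n) :
    invariant T.insertEdge = universalElements.insertUnit (invariant T) := by
  rw [XCHom.insertUnit_eq]
  refine (invariant_tensor T (C 0)).trans (congrArg _ ?_)
  exact invariant_one (n := 1)

/-- The universal invariant. -/
noncomputable def Z : EndoCat.Functor txc vEXC where
  map := invariant
  map_one _ := invariant_one
  map_comp := invariant_comp
  map_tensor := invariant_tensor
  map_braid := invariant_braid

theorem isUniversalInvariant_Z : universalElements.IsUniversalInvariant Z where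
  map_X := invariant_eq_iff.2 graph_X.symm
  map_X_neg := invariant_eq_iff.2 graph_X_neg.symm
  map_C := invariant_eq_iff.2 graph_C.symm
  map_C_neg := invariant_eq_iff.2 graph_C_neg.symm
  map_reorder := invariant_reorder
  map_merge T _ h := invariant_eq_iff.2 (graph_merge_of_isMerge h (graph_invariant T)).symm
  map_insert := invariant_insertEdge

theorem isIso_Z : Z.IsIso := by
  have h : ∀ (n : ℕ) (f : vEXC.Hom n), ∃ T : XCTangle n, T.invariant = f := fun _ f =>
    invariant_surjective f
  choose g hg using h
  have hg' : ∀ {n : ℕ} (T : XCTangle n) (f : vEXC.Hom n), T.invariant = f → g n f = T := by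
    intro n T f h
    exact invariant_injective ((hg n f).trans h.symm)
  exact ⟨
    { map := fun {n} => g n
      map_one := fun n => hg' (txc.one n) _ invariant_one
      map_comp := fun {n} f f' => hg' (txc.comp (g n f) (g n f')) _ (by rw [invariant_comp, hg, hg])
      map_tensor := fun {n m} f f' => hg' (txc.tensor (g n f) (g m f')) _ (by rw [invariant_tensor, hg, hg])
      map_braid := fun n m => hg' (txc.braid n m) _ (invariant_braid n m) },
    fun T => hg' T _ rfl, fun {n} f => hg n f⟩

end XCTangle

namespace EndoCat.Functor

theorem ext {M : EndoCat.{w}} {N : EndoCat.{v}} {F G : Functor M N}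
    (h : ∀ {n} (f : M.Hom n), F.map f = G.map f) : F = G := by
  cases F
  cases G
  congr
  funext n f
  exact h f

theorem map_tr {M : EndoCat.{w}} {N : EndoCat.{v}} (F : Functor M N) {n m : ℕ} (h : n = m)
    (f : M.Hom n) : F.map (M.tr h f) = N.tr h (F.map f) := by
  subst h
  rfl

/-- The axioms carry over along functors that are surjective on arrows. -/
theorem isStrictSymmetricMonoidal {M : EndoCat.{w}} {N : EndoCat.{v}} (F : Functor M N)
    (hF : ∀ {n} (g : N.Hom n), ∃ f, F.map f = g) (hM : M.IsStrictSymmetricMonoidal) :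
    N.IsStrictSymmetricMonoidal where
  one_comp f := by
    obtain ⟨f, rfl⟩ := hF f
    rw [← F.map_one, ← F.map_comp, hM.one_comp]
  comp_one f := by
    obtain ⟨f, rfl⟩ := hF f
    rw [← F.map_one, ← F.map_comp, hM.comp_one]
  comp_assoc f g h := by
    obtain ⟨f, rfl⟩ := hF f
    obtain ⟨g, rfl⟩ := hF g
    obtain ⟨h, rfl⟩ := hF h
    simp only [← F.map_comp, hM.comp_assoc]
  tensor_one n m := by simp only [← F.map_one, ← F.map_tensor, hM.tensor_one]
  tensor_comp f f' g g' := by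
    obtain ⟨f, rfl⟩ := hF f
    obtain ⟨f', rfl⟩ := hF f'
    obtain ⟨g, rfl⟩ := hF g
    obtain ⟨g', rfl⟩ := hF g'
    simp only [← F.map_comp, ← F.map_tensor, hM.tensor_comp]
  tensor_assoc f g h := by
    obtain ⟨f, rfl⟩ := hF f
    obtain ⟨g, rfl⟩ := hF g
    obtain ⟨h, rfl⟩ := hF h
    simp only [← F.map_tensor, ← F.map_tr, hM.tensor_assoc]
  unit_tensor f := by
    obtain ⟨f, rfl⟩ := hF f
    simp only [← F.map_one, ← F.map_tensor, ← F.map_tr, hM.unit_tensor]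
  tensor_unit f := by
    obtain ⟨f, rfl⟩ := hF f
    rw [← F.map_one, ← F.map_tensor, ← F.map_tr, hM.tensor_unit]
  braid_natural f g := by
    obtain ⟨f, rfl⟩ := hF f
    obtain ⟨g, rfl⟩ := hF g
    simp only [← F.map_braid, ← F.map_tensor, ← F.map_tr, ← F.map_comp, hM.braid_natural]
  braid_braid n m := by
    simp only [← F.map_braid, ← F.map_one, ← F.map_tr, ← F.map_comp, hM.braid_braid]
  hexagon n m k := by
    simp only [← F.map_braid, ← F.map_one, ← F.map_tensor, ← F.map_tr, ← F.map_comp, hM.hexagon]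

end EndoCat.Functor

namespace XCElements

/-- A universal invariant is determined by its properties. -/
theorem IsUniversalInvariant.eq {S : XCElements.{w}} {F G : EndoCat.Functor txc S.vE}
    (hF : S.IsUniversalInvariant F) (hG : S.IsUniversalInvariant G) : F = G := by
  have one : ∀ n : ℕ, F.map (XCTangle.ofPerm (1 : Equiv.Perm (Fin n)))
      = G.map (XCTangle.ofPerm (1 : Equiv.Perm (Fin n))) :=
    fun n => (F.map_one n).trans (G.map_one n).symm
  refine EndoCat.Functor.ext fun {n} T => XCTangle.IsClosed.all
    (p := fun {n} (T : XCTangle n) => F.map T = G.map T) ?_ T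
  exact
    { ofPerm := fun {n} σ => by
        have h : XCTangle.ofPerm σ = XCTangle.reorder σ⁻¹ (.ofPerm 1) := XCTangle.toTg_injective (by
          rw [XCTangle.toTg_ofPerm, XCTangle.toTg_reorder, XCTangle.toTg_one]
          refine (congrArg _ (Tg.triv_rl σ⁻¹).symm).trans ((Tg.rl_rl _ _ _ _ _).trans
            (Tg.rl_congr (fun _ => rfl) (fun _ => by simp) _)))
        rw [h, hF.map_reorder, hG.map_reorder, one]
      X := fun s => by
        cases s
        exacts [hF.map_X_neg.trans hG.map_X_neg.symm, hF.map_X.trans hG.map_X.symm]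
      C := fun r => by
        rcases r with _ | _ | _
        exacts [one 1, hF.map_C_neg.trans hG.map_C_neg.symm, hF.map_C.trans hG.map_C.symm]
      comp := fun {n T T'} h h' => (F.map_comp T T').trans
        ((congrArg₂ _ h h').trans (G.map_comp T T').symm)
      tensor := fun {n m T T'} h h' => (F.map_tensor T T').trans
        ((congrArg₂ _ h h').trans (G.map_tensor T T').symm)
      reorder := fun τ T h => by rw [hF.map_reorder, hG.map_reorder, h]
      merge := fun hm h => by rw [hF.map_merge _ _ hm, hG.map_merge _ _ hm, h] }

end XCElements

namespace XCData

variable {C : Type u} [Category.{v} C] [MonoidalCategory C] [SymmetricCategory C] (D : XCData C)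

/-- The identity of a tensor power, with the exponent rewritten. -/
abbrev castHom {a b : ℕ} (h : a = b) : D.pow a ⟶ D.pow b := eqToHom (congrArg D.pow h)

theorem castHom_whiskerRight {a b : ℕ} (h : a = b) :
    D.castHom h ▷ D.A = D.castHom (congrArg Nat.succ h) := by
  subst h
  exact id_whiskerRight _ _

theorem _root_.CategoryTheory.MonoidalCategory.whiskerRight_associativity
    {X Y Z V W P Q : C} (A : C) (p : X ⊗ Y ⟶ V) (q : V ⊗ Z ⟶ P) (k : P ⟶ Q)
    (r : Y ⊗ Z ⟶ W) (s : X ⊗ W ⟶ Q) (h : p ▷ Z ≫ q ≫ k = (α_ X Y Z).hom ≫ X ◁ r ≫ s) :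
    p ▷ (Z ⊗ A) ≫ ((α_ V Z A).inv ≫ q ▷ A) ≫ k ▷ A
      = (α_ X Y (Z ⊗ A)).hom ≫ X ◁ ((α_ Y Z A).inv ≫ r ▷ A) ≫ (α_ X W A).inv ≫ s ▷ A := by
  have h' := congrArg (fun f => (α_ (X ⊗ Y) Z A).inv ≫ f ▷ A) h
  simp only [comp_whiskerRight] at h'
  rw [Category.assoc, associator_inv_naturality_left_assoc, h']
  simp

theorem powAdd_assoc (a b c : ℕ) :
    (D.powAdd a b).hom ▷ D.pow c ≫ (D.powAdd (a + b) c).hom ≫ D.castHom (Nat.add_assoc a b c)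
      = (α_ _ _ _).hom ≫ D.pow a ◁ (D.powAdd b c).hom ≫ (D.powAdd a (b + c)).hom := by
  induction c with
  | zero => simp [powAdd, pow, castHom]
  | succ c ih =>
    have h : D.castHom (Nat.add_assoc a b (c + 1)) = D.castHom (Nat.add_assoc a b c) ▷ D.A :=
      (D.castHom_whiskerRight _).symm
    rw [h]
    exact whiskerRight_associativity D.A _ _ _ _ _ ih

theorem _root_.CategoryTheory.MonoidalCategory.whiskerRight_leftUnit
    {X Y : C} (A : C) (q : 𝟙_ C ⊗ X ⟶ Y) (k : Y ⟶ X) (h : q ≫ k = (λ_ X).hom) :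
    ((α_ (𝟙_ C) X A).inv ≫ q ▷ A) ≫ k ▷ A = (λ_ (X ⊗ A)).hom := by
  rw [Category.assoc, ← comp_whiskerRight, h, leftUnitor_tensor_hom]

theorem powAdd_zero_left (b : ℕ) :
    (D.powAdd 0 b).hom ≫ D.castHom (Nat.zero_add b) = (λ_ (D.pow b)).hom := by
  induction b with
  | zero => simp [powAdd, pow, castHom, unitors_equal]
  | succ b ih =>
    have h : D.castHom (Nat.zero_add (b + 1)) = D.castHom (Nat.zero_add b) ▷ D.A :=
      (D.castHom_whiskerRight _).symm
    rw [h]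
    exact whiskerRight_leftUnit D.A _ _ ih

theorem powAdd_powTensor {a b c d : ℕ} (f : D.pow a ⟶ D.pow b) (g : D.pow c ⟶ D.pow d) :
    (D.powAdd a c).hom ≫ D.powTensor f g = (f ⊗ₘ g) ≫ (D.powAdd b d).hom := by
  simp [powTensor]

theorem powTensor_id (a b : ℕ) : D.powTensor (𝟙 (D.pow a)) (𝟙 (D.pow b)) = 𝟙 _ := by
  simp [powTensor]

theorem powTensor_comp {a b c a' b' c' : ℕ} (f : D.pow a ⟶ D.pow b) (g : D.pow b ⟶ D.pow c)
    (f' : D.pow a' ⟶ D.pow b') (g' : D.pow b' ⟶ D.pow c') :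
    D.powTensor (f ≫ g) (f' ≫ g') = D.powTensor f f' ≫ D.powTensor g g' := by
  simp [powTensor, tensorHom_comp_tensorHom_assoc]

theorem powTensor_assoc {a b c a' b' c' : ℕ} (f : D.pow a ⟶ D.pow a') (g : D.pow b ⟶ D.pow b')
    (h : D.pow c ⟶ D.pow c') :
    D.powTensor (D.powTensor f g) h ≫ D.castHom (Nat.add_assoc a' b' c')
      = D.castHom (Nat.add_assoc a b c) ≫ D.powTensor f (D.powTensor g h) := by
  rw [← cancel_epi (D.powAdd (a + b) c).hom, ← cancel_epi ((D.powAdd a b).hom ▷ D.pow c)]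
  have h1 := D.powAdd_assoc a b c
  have h2 := D.powAdd_assoc a' b' c'
  have e1 : (D.powAdd a b).hom ▷ D.pow c ≫ (D.powTensor f g ⊗ₘ h)
      = ((f ⊗ₘ g) ⊗ₘ h) ≫ (D.powAdd a' b').hom ▷ D.pow c' := by
    rw [← tensorHom_id, ← tensorHom_id, tensorHom_comp_tensorHom, tensorHom_comp_tensorHom,
      powAdd_powTensor, Category.id_comp, Category.comp_id]
  have e2 : D.pow a ◁ (D.powAdd b c).hom ≫ (f ⊗ₘ D.powTensor g h)
      = (f ⊗ₘ (g ⊗ₘ h)) ≫ D.pow a' ◁ (D.powAdd b' c').hom := by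
    rw [← id_tensorHom, ← id_tensorHom, tensorHom_comp_tensorHom, tensorHom_comp_tensorHom,
      powAdd_powTensor, Category.id_comp, Category.comp_id]
  have e3 := reassoc_of% D.powAdd_powTensor (D.powTensor f g) h
  rw [e3, reassoc_of% e1, h2, reassoc_of% h1, powAdd_powTensor, reassoc_of% e2]
  simp

theorem unit_powTensor {a b : ℕ} (f : D.pow a ⟶ D.pow b) :
    D.powTensor (𝟙 (D.pow 0)) f ≫ D.castHom (Nat.zero_add b) = D.castHom (Nat.zero_add a) ≫ f := by
  rw [← cancel_epi (D.powAdd 0 a).hom, reassoc_of% D.powAdd_powTensor (𝟙 (D.pow 0)) f,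
    powAdd_zero_left, reassoc_of% D.powAdd_zero_left a]
  exact (congrArg (· ≫ _) (id_tensorHom _ f)).trans (leftUnitor_naturality f)

theorem powTensor_unit {a b : ℕ} (f : D.pow a ⟶ D.pow b) : D.powTensor f (𝟙 (D.pow 0)) = f := by
  rw [← cancel_epi (D.powAdd a 0).hom, powAdd_powTensor]
  exact (congrArg (· ≫ _) (tensorHom_id f _)).trans (rightUnitor_naturality f)

/-- The symmetry of tensor powers. -/
abbrev powBraid (a b : ℕ) : D.pow (a + b) ⟶ D.pow (b + a) := D.eval (.braid a b)

theorem powAdd_powBraid (a b : ℕ) :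
    (D.powAdd a b).hom ≫ D.powBraid a b = (β_ _ _).hom ≫ (D.powAdd b a).hom := by
  simp [powBraid, eval]

theorem powBraid_natural {a b c d : ℕ} (f : D.pow a ⟶ D.pow b) (g : D.pow c ⟶ D.pow d) :
    D.powTensor f g ≫ D.powBraid b d = D.powBraid a c ≫ D.powTensor g f := by
  rw [← cancel_epi (D.powAdd a c).hom, reassoc_of% D.powAdd_powTensor f g, powAdd_powBraid,
    reassoc_of% D.powAdd_powBraid a c, powAdd_powTensor, BraidedCategory.braiding_naturality_assoc]

theorem powBraid_powBraid (a b : ℕ) : D.powBraid a b ≫ D.powBraid b a = 𝟙 _ := by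
  rw [← cancel_epi (D.powAdd a b).hom, reassoc_of% D.powAdd_powBraid a b, powAdd_powBraid,
    SymmetricCategory.symmetry_assoc, Category.comp_id]

theorem powBraid_hexagon (a b c : ℕ) : D.powBraid a (b + c)
    = D.castHom (Nat.add_assoc a b c).symm ≫ D.powTensor (D.powBraid a b) (𝟙 (D.pow c)) ≫
      D.castHom (Nat.add_assoc b a c) ≫ D.powTensor (𝟙 (D.pow b)) (D.powBraid a c) ≫
        D.castHom (Nat.add_assoc b c a).symm := by
  rw [← cancel_epi (D.powAdd a (b + c)).hom, ← cancel_epi (D.pow a ◁ (D.powAdd b c).hom),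
    ← cancel_epi (α_ (D.pow a) (D.pow b) (D.pow c)).hom, ← cancel_mono (D.castHom (Nat.add_assoc b c a))]
  have h1 := D.powAdd_assoc a b c
  have h2 := D.powAdd_assoc b a c
  have h3 := D.powAdd_assoc b c a
  have e1 : (D.powAdd a b).hom ▷ D.pow c ≫ (D.powBraid a b ⊗ₘ 𝟙 (D.pow c))
      = (β_ (D.pow a) (D.pow b)).hom ▷ D.pow c ≫ (D.powAdd b a).hom ▷ D.pow c := by
    rw [tensorHom_id, ← comp_whiskerRight, powAdd_powBraid, comp_whiskerRight]
  have e2 : D.pow b ◁ (D.powAdd a c).hom ≫ (𝟙 (D.pow b) ⊗ₘ D.powBraid a c)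
      = D.pow b ◁ (β_ (D.pow a) (D.pow c)).hom ≫ D.pow b ◁ (D.powAdd c a).hom := by
    rw [id_tensorHom, ← whiskerLeft_comp, powAdd_powBraid, whiskerLeft_comp]
  have e3 := reassoc_of% D.powAdd_powTensor (D.powBraid a b) (𝟙 (D.pow c))
  have e4 := reassoc_of% D.powAdd_powTensor (𝟙 (D.pow b)) (D.powBraid a c)
  have e5 := reassoc_of% D.powAdd_powBraid a (b + c)
  simp only [Category.assoc]
  rw [e5, BraidedCategory.braiding_naturality_right_assoc, h3, ← reassoc_of% h1]
  simp only [eqToHom_trans_assoc, eqToHom_refl, Category.id_comp, castHom]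
  rw [e3, reassoc_of% e1, reassoc_of% h2, e4, reassoc_of% e2]
  simp

end XCData

theorem XCTangle.vEXC_isStrictSymmetricMonoidal : vEXC.IsStrictSymmetricMonoidal :=
  XCTangle.Z.isStrictSymmetricMonoidal (fun g => XCTangle.invariant_surjective g)
    XCTangle.txc_isStrictSymmetricMonoidal

namespace XCAlgebra

variable {C : Type u} [Category.{v} C] [MonoidalCategory C] [SymmetricCategory C]
  (A : XCAlgebra C)

theorem eval_rel {a b : ℕ} {s t : XCTerm a b} (h : XCTerm.Rel s t) : A.eval s = A.eval t := by
  induction h with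
  | refl => rfl
  | symm _ ih => exact ih.symm
  | trans _ _ ih ih' => exact ih.trans ih'
  | comp_congr _ _ ih ih' => exact congrArg₂ (· ≫ ·) ih ih'
  | tensor_congr _ _ ih ih' => exact congrArg₂ A.powTensor ih ih'
  | id_comp => exact Category.id_comp _
  | comp_id => exact Category.comp_id _
  | comp_assoc => exact Category.assoc _ _ _
  | tensor_id a b => exact A.powTensor_id a b
  | tensor_comp f g f' g' => exact A.powTensor_comp _ _ _ _
  | tensor_assoc f g h => exact A.powTensor_assoc _ _ _
  | unit_tensor f => exact A.unit_powTensor _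
  | tensor_unit f =>
    exact (Category.comp_id _).trans ((A.powTensor_unit _).trans (Category.id_comp _).symm)
  | braid_natural f g => exact A.powBraid_natural _ _
  | braid_braid a b => exact A.powBraid_powBraid a b
  | hexagon a b c => exact A.powBraid_hexagon a b c
  | law h => exact A.law h

/-- The image of an arrow `0 ⟶ n` of the PROP under an XC-algebra object. -/
def evalHom {n : ℕ} : XCHom 0 n → A.elements.U n :=
  Quot.lift A.elements.elt fun _ _ h => Subtype.ext (A.eval_rel h)

theorem evalHom_push {n m : ℕ} (g : XCTerm n m) (u : XCHom 0 n) :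
    A.evalHom (universalElements.push g u) = A.elements.push g (A.evalHom u) := by
  induction u using Quot.ind
  rfl

theorem evalHom_tensor {n m : ℕ} (u : XCHom 0 n) (u' : XCHom 0 m) :
    A.evalHom (universalElements.tensor u u') = A.elements.tensor (A.evalHom u) (A.evalHom u') := by
  induction u using Quot.ind
  induction u' using Quot.ind
  rfl

theorem evalHom_dot {n : ℕ} (u u' : XCHom 0 n) :
    A.evalHom (universalElements.dot u u') = A.elements.dot (A.evalHom u) (A.evalHom u') :=
  (A.evalHom_push _ _).trans (congrArg _ (A.evalHom_tensor u u'))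

theorem evalHom_surjective {n : ℕ} (u : A.elements.U n) : ∃ f, A.evalHom f = u := by
  obtain ⟨_, t, rfl⟩ := u
  exact ⟨XCHom.mk t, rfl⟩

/-- The canonical functor from the universal virtual category of elements. -/
def canonical : EndoCat.Functor vEXC A.vE where
  map f := (A.evalHom f.1, f.2)
  map_one _ := rfl
  map_comp _ _ := Prod.ext ((A.evalHom_dot _ _).trans
    (congrArg (A.elements.dot · _) (A.evalHom_push _ _))) rfl
  map_tensor _ _ := Prod.ext (A.evalHom_tensor _ _) rfl
  map_braid _ _ := rfl

theorem isCanonical_canonical : A.IsCanonical A.canonical := fun _ _ => rfl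

theorem vE_isStrictSymmetricMonoidal : A.vE.IsStrictSymmetricMonoidal :=
  A.canonical.isStrictSymmetricMonoidal
    (fun g => by
      obtain ⟨f, hf⟩ := A.evalHom_surjective g.1
      exact ⟨(f, g.2), Prod.ext hf rfl⟩)
    XCTangle.vEXC_isStrictSymmetricMonoidal

/-- The universal invariant of XC-tangles associated with an XC-algebra object. -/
noncomputable def Z : EndoCat.Functor txc A.vE where
  map T := A.canonical.map (XCTangle.Z.map T)
  map_one n := congrArg A.canonical.map (XCTangle.Z.map_one n)
  map_comp f g := (congrArg A.canonical.map (XCTangle.Z.map_comp f g)).trans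
    (A.canonical.map_comp _ _)
  map_tensor f g := (congrArg A.canonical.map (XCTangle.Z.map_tensor f g)).trans
    (A.canonical.map_tensor _ _)
  map_braid n m := congrArg A.canonical.map (XCTangle.Z.map_braid n m)

theorem isUniversalInvariant_Z : A.elements.IsUniversalInvariant A.Z where
  map_X := congrArg A.canonical.map XCTangle.isUniversalInvariant_Z.map_X
  map_X_neg := congrArg A.canonical.map XCTangle.isUniversalInvariant_Z.map_X_neg
  map_C := congrArg A.canonical.map XCTangle.isUniversalInvariant_Z.map_C
  map_C_neg := congrArg A.canonical.map XCTangle.isUniversalInvariant_Z.map_C_neg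
  map_reorder τ T :=
    (congrArg A.canonical.map (XCTangle.isUniversalInvariant_Z.map_reorder τ T)).trans
      (Prod.ext (A.evalHom_push _ _) rfl)
  map_merge T T' h :=
    (congrArg A.canonical.map (XCTangle.isUniversalInvariant_Z.map_merge T T' h)).trans
      (Prod.ext (A.evalHom_push _ _) rfl)
  map_insert T :=
    (congrArg A.canonical.map (XCTangle.isUniversalInvariant_Z.map_insert T)).trans
      (Prod.ext (A.evalHom_push _ _) rfl)

end XCAlgebra

theorem theorem4p7 :
    txc.IsStrictSymmetricMonoidal ∧ vEXC.IsStrictSymmetricMonoidal ∧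
    ∃ Z : EndoCat.Functor txc vEXC,
      universalElements.IsUniversalInvariant Z ∧
      (∀ Z' : EndoCat.Functor txc vEXC, universalElements.IsUniversalInvariant Z' → Z' = Z) ∧
      Z.IsIso ∧
      ∀ (C : Type u) [Category.{v} C] [MonoidalCategory C] [SymmetricCategory C]
        (A : XCAlgebra C),
        A.vE.IsStrictSymmetricMonoidal ∧
        ∃ Z_A : EndoCat.Functor txc A.vE,
          A.elements.IsUniversalInvariant Z_A ∧
          (∀ Z' : EndoCat.Functor txc A.vE,
            A.elements.IsUniversalInvariant Z' → Z' = Z_A) ∧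
          ∃ Φ : EndoCat.Functor vEXC A.vE, A.IsCanonical Φ ∧
            ∀ (n : ℕ) (T : XCTangle n), Z_A.map T = Φ.map (Z.map T) :=
  ⟨XCTangle.txc_isStrictSymmetricMonoidal, XCTangle.vEXC_isStrictSymmetricMonoidal, XCTangle.Z,
    XCTangle.isUniversalInvariant_Z, fun _ h => h.eq XCTangle.isUniversalInvariant_Z,
    XCTangle.isIso_Z, fun _ _ _ _ A => ⟨A.vE_isStrictSymmetricMonoidal, A.Z,
      A.isUniversalInvariant_Z, fun _ h => h.eq A.isUniversalInvariant_Z, A.canonical,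
      A.isCanonical_canonical, fun _ _ => rfl⟩⟩
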